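/- Let $\mathfrak g=\mathfrak q_n$ be the complex queer Lie superalgebra of block matrices $T_{A,B}=\begin{pmatrix}A&B\\B&A\end{pmatrix}$, $A,B\in\mathfrak{gl}_n(\mathbb C)$, with $\mathfrak t$ the span of $h_i=T_{E_{ii},0}$, $\mathfrak h=\mathfrak g^{\mathfrak t}$ (the $T_{A,B}$ with $A,B$ diagonal), $\mathfrak n^{\pm}$ the strictly upper/lower triangular parts, $\mathfrak b=\mathfrak h\oplus\mathfrak n^+$, and $\varepsilon_1,\dots,\varepsilon_n\in\mathfrak t^*$ the basis dual to $h_1,\dots,h_n$. The roots are $\alpha=\varepsilon_i-\varepsilon_j$ ($i\ne j$), with support $\{i,j\}$, negative if $i>j$; $\mathfrak g_\alpha$ is the root space. Write $\varepsilon_{i}-\varepsilon_{j}\prec\varepsilon_{i'}-\varepsilon_{j'}$ if $\max(i,j)<\min(i',j')$. Let $\mathrm{Gr}_-(\mathfrak h)$ be the reduced Grothendieck ring of finite-dimensional ($\mathbb Z/2$-graded) $\mathfrak h$-modules: generated by classes $[M]$, with $[E]=[N]+[M]$ for short exact sequences $0\to N\to E\to M\to0$ of even maps, $[\Pi M]=-[M]$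 for the parity shift $\Pi$, and $[M][N]=[M\otimes N]$. For each $\nu\in\mathfrak t^*$ let $C(\nu)$ be a simple $\mathfrak h$-module of weight $\nu$ (unique up to $\Pi$; the parity is chosen arbitrarily), and let $L(\nu)$ be the simple $\mathfrak g$-module of highest weight $\nu$ whose highest weight space is $C(\nu)$. Write $\nu\sim\mu$ if $L(\nu)$ and $L(\mu)$ lie in the same block of the BGG category $\mathcal O$ of $\mathfrak g$ with respect to $\mathfrak b$. For an $\mathfrak h$-module $N$ with diagonal $\mathfrak t$-action and finite-dimensional weight spaces $N_\nu$, let $\mathrm{sch}_{\mathfrak h}N$ be the formal sum of the classes $[N_\nu]\in\mathrm{Gr}_-(\mathfrak h)$. The enveloping algebra $\mathcal U\mathfrak n^-$, with the adjoint action of $\mathfrak h$, has a diagonal $\mathfrak t$-action with finite-dimensional weight spaces, and $$\mathrm{sch}_{\mathfrak h}\,\mathcal U\mathfrak n^-=\sum_{\nu\sim0}m_\nu[C(\nu)],\qquad m_\nu\in\{0,1,-1\}.$$ Moreover, if $m_\nu\neq0$, then $\nu$ can be written in exactly one way (up to the order of the $r$ groups) as $$\nu=k_1(\alpha_{11}+\dots+\alpha_{1j_1})+\dots+k_r(\alpha_{r1}+\dots+\alpha_{rj_r})$$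 with $r\ge0$, all $j_i\ge1$, $k_1,\dots,k_r$ distinct positive integers, and roots $\alpha_{is}$ with pairwise disjoint supports such that $\alpha_{i1}\prec\dots\prec\alpha_{ij_i}$ for each $i$. In this presentation all the $\alpha_{is}$ are negative roots, and $$m_\nu[C(\nu)]=\prod_{i=1}^r[S^{k_i}\mathfrak g_{\alpha_{i1}}]\cdots[S^{k_i}\mathfrak g_{\alpha_{ij_i}}]\quad\text{in }\mathrm{Gr}_-(\mathfrak h),$$ where $S^k$ is the supersymmetric power. -/

import Mathlib

set_option linter.unusedSimpArgs false
set_option linter.style.longLine false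

namespace Queer

noncomputable section

/-- A Lie superalgebra over `ℂ`. The `ℤ/2`-grading is recorded by the parity involution `par`,
which is `+1` on the even part and `-1` on the odd part; thus `x` is homogeneous of parity
`i mod 2` exactly when `par x = (-1) ^ i • x`. -/
class LieSuperalgebra (L : Type) [AddCommGroup L] [Module ℂ L] where
  par : L →ₗ[ℂ] L
  par_par : ∀ x, par (par x) = x
  br : L →ₗ[ℂ] L →ₗ[ℂ] L
  par_br : ∀ x y, par (br x y) = br (par x) (par y)
  br_skew : ∀ (i j : ℕ) (x y : L), par x = (-1 : ℂ) ^ i • x → par y = (-1 : ℂ) ^ j • y →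
    br x y = -((-1 : ℂ) ^ (i * j) • br y x)
  br_jacobi : ∀ (i j : ℕ) (x y z : L), par x = (-1 : ℂ) ^ i • x → par y = (-1 : ℂ) ^ j • y →
    br x (br y z) = br (br x y) z + (-1 : ℂ) ^ (i * j) • br y (br x z)

open LieSuperalgebra

section General

variable {L : Type} [AddCommGroup L] [Module ℂ L] [LieSuperalgebra L]

/-- The even component of an element. -/
def ev : L →ₗ[ℂ] L := (1 / 2 : ℂ) • (LinearMap.id + par)

/-- The odd component of an element. -/
def od : L →ₗ[ℂ] L := (1 / 2 : ℂ) • (LinearMap.id - par)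

lemma par_ev (x : L) : par (ev x) = (-1 : ℂ) ^ 0 • ev x := by
  simp [ev, par_par, add_comm]

lemma par_od (x : L) : par (od x) = (-1 : ℂ) ^ 1 • od x := by
  simp [od, par_par, ← smul_neg]

lemma ev_add_od (x : L) : ev x + od x = x := by
  simp only [ev, od, LinearMap.smul_apply, LinearMap.add_apply, LinearMap.sub_apply,
    LinearMap.id_apply]
  module

lemma ev_of_even {i : ℕ} (hi : Even i) {x : L} (hx : par x = (-1 : ℂ) ^ i • x) : ev x = x := by
  rw [hi.neg_one_pow, one_smul] at hx
  simp only [ev, LinearMap.smul_apply, LinearMap.add_apply, LinearMap.id_apply, hx]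
  module

lemma od_of_even {i : ℕ} (hi : Even i) {x : L} (hx : par x = (-1 : ℂ) ^ i • x) : od x = 0 := by
  rw [hi.neg_one_pow, one_smul] at hx
  simp [od, hx]

lemma ev_of_odd {i : ℕ} (hi : Odd i) {x : L} (hx : par x = (-1 : ℂ) ^ i • x) : ev x = 0 := by
  rw [hi.neg_one_pow] at hx
  simp [ev, hx]

lemma od_of_odd {i : ℕ} (hi : Odd i) {x : L} (hx : par x = (-1 : ℂ) ^ i • x) : od x = x := by
  rw [hi.neg_one_pow] at hx
  simp only [od, LinearMap.smul_apply, LinearMap.sub_apply, LinearMap.id_apply, hx]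
  module

end General

/-- A (`ℤ/2`-graded) module over a Lie superalgebra; `δ` is the parity involution of the
underlying super vector space: `δ v = (-1) ^ p(v) • v` for homogeneous `v`. -/
structure SuperRep (L : Type) [AddCommGroup L] [Module ℂ L] [LieSuperalgebra L] where
  carrier : Type
  [acg : AddCommGroup carrier]
  [mod : Module ℂ carrier]
  δ : Module.End ℂ carrier
  δ_δ : ∀ v, δ (δ v) = v
  ρ : L →ₗ[ℂ] Module.End ℂ carrier
  δ_ρ : ∀ x v, δ (ρ x v) = ρ (par x) (δ v)
  ρ_br : ∀ (i j : ℕ) (x y : L), par x = (-1 : ℂ) ^ i • x → par y = (-1 : ℂ) ^ j • y →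
    ρ (br x y) = ρ x * ρ y - (-1 : ℂ) ^ (i * j) • (ρ y * ρ x)

attribute [instance] SuperRep.acg SuperRep.mod

namespace SuperRep

variable {L : Type} [AddCommGroup L] [Module ℂ L] [LieSuperalgebra L]

/-- Morphisms of modules: parity-preserving equivariant linear maps. -/
def IsHom (M N : SuperRep L) (f : M.carrier →ₗ[ℂ] N.carrier) : Prop :=
  (∀ v, f (M.δ v) = N.δ (f v)) ∧ ∀ x v, f (M.ρ x v) = N.ρ x (f v)

/-- Isomorphism of modules by a parity-preserving map. -/
def Iso (M N : SuperRep L) : Prop :=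
  ∃ f : M.carrier →ₗ[ℂ] N.carrier, IsHom M N f ∧ Function.Bijective f

/-- Graded submodules. -/
def IsSub (M : SuperRep L) (N : Submodule ℂ M.carrier) : Prop :=
  (∀ v ∈ N, M.δ v ∈ N) ∧ ∀ x, ∀ v ∈ N, M.ρ x v ∈ N

/-- A graded submodule, as a module. -/
def sub (M : SuperRep L) (N : Submodule ℂ M.carrier) (h : IsSub M N) : SuperRep L where
  carrier := N
  δ := M.δ.restrict h.1
  δ_δ v := Subtype.ext (M.δ_δ v)
  ρ :=
    { toFun := fun x => (M.ρ x).restrict (h.2 x)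
      map_add' := fun x y => by ext v; simp
      map_smul' := fun c x => by ext v; simp }
  δ_ρ x v := Subtype.ext (M.δ_ρ x v)
  ρ_br i j x y hx hy := by
    ext v
    simpa using congrArg (fun f => f (v : M.carrier)) (M.ρ_br i j x y hx hy)

/-- Simple modules. -/
def IsSimple (M : SuperRep L) : Prop :=
  Nontrivial M.carrier ∧ ∀ N, IsSub M N → N = ⊥ ∨ N = ⊤

/-- Indecomposable modules. -/
def IsIndecomposable (M : SuperRep L) : Prop :=
  Nontrivial M.carrier ∧ ∀ N N', IsSub M N → IsSub M N' → IsCompl N N' → N = ⊥ ∨ N' = ⊥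

/-- `X` is isomorphic to a subquotient of `M`. -/
def IsSubquotient (M X : SuperRep L) : Prop :=
  ∃ (N : Submodule ℂ M.carrier) (h : IsSub M N) (p : (M.sub N h).carrier →ₗ[ℂ] X.carrier),
    IsHom (M.sub N h) X p ∧ Function.Surjective p

/-- The parity shift `Π M`. -/
def shift (M : SuperRep L) : SuperRep L where
  carrier := M.carrier
  δ := -M.δ
  δ_δ v := by simp [M.δ_δ]
  ρ := M.ρ
  δ_ρ x v := by simp [M.δ_ρ]
  ρ_br := M.ρ_br

/-- The trivial module `ℂ`, in even degree. -/
def triv (L : Type) [AddCommGroup L] [Module ℂ L] [LieSuperalgebra L] : SuperRep L where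
  carrier := ℂ
  δ := LinearMap.id
  δ_δ _ := rfl
  ρ := 0
  δ_ρ x v := by simp
  ρ_br i j x y _ _ := by simp

/-- The adjoint module. -/
def adjoint (L : Type) [AddCommGroup L] [Module ℂ L] [LieSuperalgebra L] : SuperRep L where
  carrier := L
  δ := par
  δ_δ := par_par
  ρ := br
  δ_ρ := par_br
  ρ_br i j x y hx hy := by
    ext z
    simp [br_jacobi i j x y z hx hy]

/-- Restriction along a homomorphism of Lie superalgebras. -/
def res {K : Type} [AddCommGroup K] [Module ℂ K] [LieSuperalgebra K] (f : K →ₗ[ℂ] L)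
    (hp : ∀ x, f (par x) = par (f x)) (hb : ∀ x y, f (br x y) = br (f x) (f y))
    (M : SuperRep L) : SuperRep K where
  carrier := M.carrier
  δ := M.δ
  δ_δ := M.δ_δ
  ρ := M.ρ.comp f
  δ_ρ x v := by simp [M.δ_ρ, hp]
  ρ_br i j x y hx hy := by
    simp only [LinearMap.comp_apply, hb]
    exact M.ρ_br i j _ _ (by rw [← hp, hx, map_smul]) (by rw [← hp, hy, map_smul])

open TensorProduct

/-- The operator of `x` on `M ⊗ N`: `x (v ⊗ w) = x v ⊗ w + (-1) ^ (p(x) p(v)) • v ⊗ x w`. -/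
def tensorρ (M N : SuperRep L) : L →ₗ[ℂ] Module.End ℂ (M.carrier ⊗[ℂ] N.carrier) where
  toFun x := TensorProduct.map (M.ρ x) LinearMap.id
    + TensorProduct.map LinearMap.id (N.ρ (ev x)) + TensorProduct.map M.δ (N.ρ (od x))
  map_add' x y := by
    simp only [map_add, TensorProduct.map_add_left, TensorProduct.map_add_right]; abel
  map_smul' c x := by
    simp only [map_smul, TensorProduct.map_smul_left, TensorProduct.map_smul_right,
      RingHom.id_apply, smul_add]

lemma tensorρ_tmul (M N : SuperRep L) (x : L) (v : M.carrier) (w : N.carrier) :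
    tensorρ M N x (v ⊗ₜ w) =
      M.ρ x v ⊗ₜ w + v ⊗ₜ N.ρ (ev x) w + M.δ v ⊗ₜ N.ρ (od x) w := by
  simp [tensorρ]

lemma ev_par (x : L) : ev (par x) = ev x := by
  simp [ev, par_par, add_comm]

lemma od_par (x : L) : od (par x) = -od x := by
  simp [od, par_par, ← smul_neg]

lemma δ_ρ_ev (M : SuperRep L) (x : L) (v : M.carrier) :
    M.δ (M.ρ (ev x) v) = M.ρ (ev x) (M.δ v) := by
  rw [M.δ_ρ, par_ev, pow_zero, one_smul]

lemma δ_ρ_od (M : SuperRep L) (x : L) (v : M.carrier) :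
    M.δ (M.ρ (od x) v) = -M.ρ (od x) (M.δ v) := by
  rw [M.δ_ρ, par_od, pow_one]; simp

lemma ρ_br_apply (M : SuperRep L) {i j : ℕ} {x y : L} (hx : par x = (-1 : ℂ) ^ i • x)
    (hy : par y = (-1 : ℂ) ^ j • y) (v : M.carrier) :
    M.ρ (br x y) v = M.ρ x (M.ρ y v) - (-1 : ℂ) ^ (i * j) • M.ρ y (M.ρ x v) := by
  rw [M.ρ_br i j x y hx hy]; simp

lemma par_br_hom {i j : ℕ} {x y : L} (hx : par x = (-1 : ℂ) ^ i • x)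
    (hy : par y = (-1 : ℂ) ^ j • y) : par (br x y) = (-1 : ℂ) ^ (i + j) • br x y := by
  rw [par_br, hx, hy]; simp [smul_smul, pow_add, mul_comm]

lemma δ_ρ_hom (M : SuperRep L) {i : ℕ} {x : L} (hx : par x = (-1 : ℂ) ^ i • x) (v : M.carrier) :
    M.δ (M.ρ x v) = (-1 : ℂ) ^ i • M.ρ x (M.δ v) := by
  rw [M.δ_ρ, hx]; simp

/-- The tensor product of two modules. -/
def tensor (M N : SuperRep L) : SuperRep L where
  carrier := M.carrier ⊗[ℂ] N.carrier
  δ := TensorProduct.map M.δ N.δ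
  δ_δ v := by
    induction v using TensorProduct.induction_on with
    | zero => simp
    | tmul a b => simp [M.δ_δ, N.δ_δ]
    | add a b ha hb => rw [map_add, map_add, ha, hb]
  ρ := tensorρ M N
  δ_ρ x v := by
    induction v using TensorProduct.induction_on with
    | zero => simp
    | tmul a b =>
      simp only [tensorρ_tmul, map_add, TensorProduct.map_tmul, M.δ_ρ, δ_ρ_ev, δ_ρ_od, M.δ_δ,
        ev_par, od_par, map_neg, LinearMap.neg_apply, M.δ_ρ]
    | add a b ha hb => simp only [map_add, ha, hb]
  ρ_br i j x y hx hy := by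
    apply TensorProduct.ext'
    intro a b
    have hxy := par_br_hom hx hy
    have hM := ρ_br_apply M hx hy a
    have hN := ρ_br_apply N hx hy b
    have hdx := δ_ρ_hom M hx a
    have hdy := δ_ρ_hom M hy a
    rcases Nat.even_or_odd i with hi | hi <;> rcases Nat.even_or_odd j with hj | hj
    all_goals
      first
        | rw [(hi.mul_right j).neg_one_pow] at *
        | rw [(hj.mul_left i).neg_one_pow] at *
        | rw [(hi.mul hj).neg_one_pow] at *
      first
        | rw [hi.neg_one_pow] at hdx
      first
        | rw [hj.neg_one_pow] at hdy
    · have hij := hi.add hj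
      simp only [LinearMap.sub_apply, LinearMap.smul_apply, Module.End.mul_apply, tensorρ_tmul,
        map_add, ev_of_even hi hx, od_of_even hi hx, ev_of_even hj hy, od_of_even hj hy,
        ev_of_even hij hxy, od_of_even hij hxy, map_zero, LinearMap.zero_apply, tmul_zero,
        add_zero, one_smul, hM, hN, sub_tmul, tmul_sub]
      abel
    · have hij := hi.add_odd hj
      simp only [LinearMap.sub_apply, LinearMap.smul_apply, Module.End.mul_apply, tensorρ_tmul,
        map_add, ev_of_even hi hx, od_of_even hi hx, ev_of_odd hj hy, od_of_odd hj hy,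
        ev_of_odd hij hxy, od_of_odd hij hxy, map_zero, LinearMap.zero_apply, tmul_zero,
        add_zero, one_smul, hM, hN, sub_tmul, tmul_sub, hdx, hdy]
      abel
    · have hij := hi.add_even hj
      simp only [LinearMap.sub_apply, LinearMap.smul_apply, Module.End.mul_apply, tensorρ_tmul,
        map_add, ev_of_odd hi hx, od_of_odd hi hx, ev_of_even hj hy, od_of_even hj hy,
        ev_of_odd hij hxy, od_of_odd hij hxy, map_zero, LinearMap.zero_apply, tmul_zero,
        add_zero, one_smul, hM, hN, sub_tmul, tmul_sub, hdx, hdy]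
      abel
    · have hij := hi.add_odd hj
      simp only [LinearMap.sub_apply, LinearMap.smul_apply, Module.End.mul_apply, tensorρ_tmul,
        map_add, ev_of_odd hi hx, od_of_odd hi hx, ev_of_odd hj hy, od_of_odd hj hy,
        ev_of_even hij hxy, od_of_even hij hxy, map_zero, LinearMap.zero_apply, tmul_zero,
        add_zero, neg_smul, one_smul, hM, hN, sub_tmul, tmul_sub, hdx, hdy, M.δ_δ, neg_tmul,
        tmul_neg, tmul_add, add_tmul, sub_neg_eq_add]
      abel

end SuperRep

end

end Queer

namespace Queer

noncomputable section

open LieSuperalgebra SuperRep TensorProduct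

variable {L : Type} [AddCommGroup L] [Module ℂ L] [LieSuperalgebra L]

/-- Finite-dimensional modules. -/
structure FinRep (L : Type) [AddCommGroup L] [Module ℂ L] [LieSuperalgebra L] where
  rep : SuperRep L
  fin : Module.Finite ℂ rep.carrier

attribute [instance] FinRep.fin

namespace FinRep

def shift (M : FinRep L) : FinRep L := ⟨M.rep.shift, M.fin⟩

def triv (L : Type) [AddCommGroup L] [Module ℂ L] [LieSuperalgebra L] : FinRep L :=
  ⟨SuperRep.triv L, inferInstanceAs (Module.Finite ℂ ℂ)⟩

def tensor (M N : FinRep L) : FinRep L :=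
  ⟨M.rep.tensor N.rep, inferInstanceAs (Module.Finite ℂ (M.rep.carrier ⊗[ℂ] N.rep.carrier))⟩

end FinRep

/-- The relations of the reduced Grothendieck group: `[E] = [N] + [M]` for every short exact
sequence `0 → N → E → M → 0`, and `[Π M] = -[M]`. -/
inductive GrRel : FreeAbelianGroup (FinRep L) → Prop
  | exact (N E M : FinRep L) (f : N.rep.carrier →ₗ[ℂ] E.rep.carrier)
      (g : E.rep.carrier →ₗ[ℂ] M.rep.carrier) (hf : IsHom N.rep E.rep f) (hg : IsHom E.rep M.rep g)
      (hfi : Function.Injective f) (hfg : Function.Exact f g) (hgs : Function.Surjective g) :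
      GrRel (FreeAbelianGroup.of E - (FreeAbelianGroup.of N + FreeAbelianGroup.of M))
  | shift (M : FinRep L) : GrRel (FreeAbelianGroup.of M.shift + FreeAbelianGroup.of M)

/-- The reduced Grothendieck group `Gr₋` of the category of finite-dimensional modules. -/
def Gr (L : Type) [AddCommGroup L] [Module ℂ L] [LieSuperalgebra L] : Type 1 :=
  FreeAbelianGroup (FinRep L) ⧸ AddSubgroup.closure {x : FreeAbelianGroup (FinRep L) | GrRel x}

namespace Gr

instance : AddCommGroup (Gr L) :=
  inferInstanceAs (AddCommGroup (FreeAbelianGroup (FinRep L) ⧸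
    AddSubgroup.closure {x : FreeAbelianGroup (FinRep L) | GrRel x}))

/-- The class `[M]` in the reduced Grothendieck group. -/
def cls (M : FinRep L) : Gr L := QuotientAddGroup.mk (FreeAbelianGroup.of M)

lemma cls_exact {N E M : FinRep L} (f : N.rep.carrier →ₗ[ℂ] E.rep.carrier)
    (g : E.rep.carrier →ₗ[ℂ] M.rep.carrier) (hf : IsHom N.rep E.rep f) (hg : IsHom E.rep M.rep g)
    (hfi : Function.Injective f) (hfg : Function.Exact f g) (hgs : Function.Surjective g) :
    cls E = cls N + cls M := by
  have h := (QuotientAddGroup.eq_zero_iff _).2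
    (AddSubgroup.subset_closure (GrRel.exact N E M f g hf hg hfi hfg hgs))
  exact sub_eq_zero.1 h

lemma cls_shift (M : FinRep L) : cls M.shift = -cls M := by
  have h := (QuotientAddGroup.eq_zero_iff _).2 (AddSubgroup.subset_closure (GrRel.shift M))
  exact eq_neg_of_add_eq_zero_left h

/-- A function on modules that respects the relations extends to `Gr`. -/
def lift {A : Type*} [AddCommGroup A] (φ : FinRep L → A)
    (he : ∀ (N E M : FinRep L) (f : N.rep.carrier →ₗ[ℂ] E.rep.carrier)
      (g : E.rep.carrier →ₗ[ℂ] M.rep.carrier), IsHom N.rep E.rep f → IsHom E.rep M.rep g →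
      Function.Injective f → Function.Exact f g → Function.Surjective g → φ E = φ N + φ M)
    (hs : ∀ M, φ M.shift = -φ M) : Gr L →+ A :=
  QuotientAddGroup.lift _ (FreeAbelianGroup.lift φ) <| by
    rw [AddSubgroup.closure_le]
    rintro x (⟨N, E, M, f, g, hf, hg, h1, h2, h3⟩ | ⟨M⟩)
    · simp [AddMonoidHom.mem_ker, he N E M f g hf hg h1 h2 h3]
    · simp [AddMonoidHom.mem_ker, hs M]

@[simp] lemma lift_cls {A : Type*} [AddCommGroup A] (φ : FinRep L → A) (he) (hs) (M : FinRep L) :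
    lift φ he hs (cls M) = φ M := by
  change FreeAbelianGroup.lift φ (FreeAbelianGroup.of M) = φ M
  simp

lemma hom_ext {A : Type*} [AddCommGroup A] {φ ψ : Gr L →+ A} (h : ∀ M, φ (cls M) = ψ (cls M)) :
    φ = ψ := by
  apply QuotientAddGroup.addMonoidHom_ext
  apply FreeAbelianGroup.lift_ext
  exact h

lemma cls_iso {M N : FinRep L} (h : Iso M.rep N.rep) : cls M = cls N := by
  obtain ⟨f, hf, hb⟩ := h
  let Z₀ : SuperRep L :=
    { carrier := PUnit
      δ := 0
      δ_δ := fun _ => rfl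
      ρ := 0
      δ_ρ := fun _ _ => rfl
      ρ_br := fun _ _ _ _ _ _ => rfl }
  let Z : FinRep L := ⟨Z₀, inferInstanceAs (Module.Finite ℂ PUnit)⟩
  have key : ∀ {A B : FinRep L} (f : A.rep.carrier →ₗ[ℂ] B.rep.carrier), IsHom A.rep B.rep f →
      Function.Bijective f → cls B = cls A + cls Z := by
    intro A B f hf hb
    refine cls_exact (M := Z) f 0 hf ⟨fun _ => rfl, fun _ _ => rfl⟩ hb.1 ?_ ?_
    · intro y
      exact ⟨fun _ => hb.2 y, fun _ => rfl⟩
    · intro y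
      exact ⟨0, rfl⟩
  have hZ : cls Z = (0 : Gr L) := by
    have := key (A := Z) (B := Z) LinearMap.id ⟨fun _ => rfl, fun _ _ => rfl⟩ Function.bijective_id
    simpa using this
  rw [key f hf hb, hZ, add_zero]

lemma isHom_of_comp {M N : SuperRep L} {f : M.carrier →ₗ[ℂ] N.carrier}
    (h1 : f ∘ₗ M.δ = N.δ ∘ₗ f) (h2 : ∀ x, f ∘ₗ M.ρ x = N.ρ x ∘ₗ f) : IsHom M N f :=
  ⟨fun v => LinearMap.congr_fun h1 v, fun x v => LinearMap.congr_fun (h2 x) v⟩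

lemma tensor_hom_left {M N P : SuperRep L} {f : M.carrier →ₗ[ℂ] N.carrier} (hf : IsHom M N f) :
    IsHom (P.tensor M) (P.tensor N) (LinearMap.lTensor P.carrier f) := by
  have h1 : LinearMap.lTensor P.carrier f ∘ₗ TensorProduct.map P.δ M.δ =
      TensorProduct.map P.δ N.δ ∘ₗ LinearMap.lTensor P.carrier f :=
    TensorProduct.ext' fun a b => by simp [hf.1]
  have h2 : ∀ x, LinearMap.lTensor P.carrier f ∘ₗ tensorρ P M x =
      tensorρ P N x ∘ₗ LinearMap.lTensor P.carrier f := fun x =>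
    TensorProduct.ext' fun a b => by simp [tensorρ_tmul, hf.2]
  exact isHom_of_comp h1 h2

lemma tensor_hom_right {M N P : SuperRep L} {f : M.carrier →ₗ[ℂ] N.carrier} (hf : IsHom M N f) :
    IsHom (M.tensor P) (N.tensor P) (LinearMap.rTensor P.carrier f) := by
  have h1 : LinearMap.rTensor P.carrier f ∘ₗ TensorProduct.map M.δ P.δ =
      TensorProduct.map N.δ P.δ ∘ₗ LinearMap.rTensor P.carrier f :=
    TensorProduct.ext' fun a b => by simp [hf.1]
  have h2 : ∀ x, LinearMap.rTensor P.carrier f ∘ₗ tensorρ M P x =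
      tensorρ N P x ∘ₗ LinearMap.rTensor P.carrier f := fun x =>
    TensorProduct.ext' fun a b => by simp [tensorρ_tmul, hf.2, hf.1]
  exact isHom_of_comp h1 h2

lemma shift_tensor_iso (M N : SuperRep L) : Iso (M.shift.tensor N) (M.tensor N).shift := by
  have he : ∀ v : M.carrier ⊗[ℂ] N.carrier,
      LinearMap.lTensor M.carrier N.δ (LinearMap.lTensor M.carrier N.δ v) = v := by
    intro v
    rw [← LinearMap.comp_apply, ← LinearMap.lTensor_comp,
      show N.δ ∘ₗ N.δ = LinearMap.id from LinearMap.ext N.δ_δ, LinearMap.lTensor_id,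
      LinearMap.id_apply]
  have h1 : LinearMap.lTensor M.carrier N.δ ∘ₗ TensorProduct.map (-M.δ) N.δ =
      (-TensorProduct.map M.δ N.δ) ∘ₗ LinearMap.lTensor M.carrier N.δ :=
    TensorProduct.ext' fun a b => by simp [neg_tmul]
  have h2 : ∀ x, LinearMap.lTensor M.carrier N.δ ∘ₗ
      (TensorProduct.map (M.ρ x) LinearMap.id + TensorProduct.map LinearMap.id (N.ρ (ev x))
        + TensorProduct.map (-M.δ) (N.ρ (od x))) =
      tensorρ M N x ∘ₗ LinearMap.lTensor M.carrier N.δ := fun x =>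
    TensorProduct.ext' fun a b => by
      simp [tensorρ_tmul, neg_tmul, δ_ρ_ev, δ_ρ_od, tmul_neg]
  exact ⟨LinearMap.lTensor M.carrier N.δ, isHom_of_comp h1 h2, Function.Involutive.bijective he⟩

lemma tensor_shift_iso (M N : SuperRep L) : Iso (M.tensor N.shift) (M.tensor N).shift := by
  have h1 : TensorProduct.map M.δ (-N.δ) = -TensorProduct.map M.δ N.δ :=
    TensorProduct.ext' fun a b => by simp [tmul_neg]
  exact ⟨LinearMap.id, ⟨fun v => LinearMap.congr_fun h1 v, fun _ _ => rfl⟩, Function.bijective_id⟩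

/-- The braiding `v ⊗ w ↦ (-1) ^ (p(v) p(w)) • w ⊗ v`. -/
def braid (M N : SuperRep L) : (M.carrier ⊗[ℂ] N.carrier) →ₗ[ℂ] (N.carrier ⊗[ℂ] M.carrier) :=
  ((1 / 2 : ℂ) • (LinearMap.id + LinearMap.lTensor _ M.δ + LinearMap.rTensor _ N.δ
    - TensorProduct.map N.δ M.δ)) ∘ₗ (TensorProduct.comm ℂ M.carrier N.carrier).toLinearMap

lemma braid_tmul (M N : SuperRep L) (v : M.carrier) (w : N.carrier) :
    braid M N (v ⊗ₜ w) = (1 / 2 : ℂ) • (w ⊗ₜ v + w ⊗ₜ M.δ v + N.δ w ⊗ₜ v - N.δ w ⊗ₜ M.δ v) := by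
  simp [braid]

lemma tensor_comm_iso (M N : SuperRep L) : Iso (M.tensor N) (N.tensor M) := by
  have hinv : ∀ (M N : SuperRep L), braid N M ∘ₗ braid M N = LinearMap.id := fun M N =>
    TensorProduct.ext' fun a b => by
      simp only [LinearMap.comp_apply, LinearMap.id_apply, braid_tmul, map_smul, map_add, map_sub,
        M.δ_δ, N.δ_δ]
      module
  have h1 : braid M N ∘ₗ TensorProduct.map M.δ N.δ = TensorProduct.map N.δ M.δ ∘ₗ braid M N :=
    TensorProduct.ext' fun a b => by
      simp only [LinearMap.comp_apply, TensorProduct.map_tmul, braid_tmul, map_smul, map_add,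
        map_sub, M.δ_δ, N.δ_δ]
  have h2 : ∀ x, braid M N ∘ₗ tensorρ M N x = tensorρ N M x ∘ₗ braid M N := fun x =>
    TensorProduct.ext' fun a b => by
      have hM : M.ρ x = M.ρ (ev x) + M.ρ (od x) := by rw [← map_add, ev_add_od]
      have hN : N.ρ x = N.ρ (ev x) + N.ρ (od x) := by rw [← map_add, ev_add_od]
      simp only [LinearMap.comp_apply, tensorρ_tmul, hM, hN, LinearMap.add_apply, map_add,
        map_smul, map_sub, braid_tmul, δ_ρ_ev, δ_ρ_od, M.δ_δ, N.δ_δ, add_tmul, tmul_add, tmul_neg,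
        neg_tmul]
      module
  exact ⟨braid M N, isHom_of_comp h1 h2, Function.bijective_iff_has_inverse.2
    ⟨braid N M, LinearMap.congr_fun (hinv M N), LinearMap.congr_fun (hinv N M)⟩⟩

lemma tensor_assoc_iso (M N P : SuperRep L) :
    Iso ((M.tensor N).tensor P) (M.tensor (N.tensor P)) := by
  have h1 : (TensorProduct.assoc ℂ M.carrier N.carrier P.carrier).toLinearMap ∘ₗ
      TensorProduct.map (TensorProduct.map M.δ N.δ) P.δ =
      TensorProduct.map M.δ (TensorProduct.map N.δ P.δ) ∘ₗ
        (TensorProduct.assoc ℂ M.carrier N.carrier P.carrier).toLinearMap :=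
    TensorProduct.ext_threefold fun a b c => by simp
  have h2 : ∀ x, (TensorProduct.assoc ℂ M.carrier N.carrier P.carrier).toLinearMap ∘ₗ
      (TensorProduct.map (tensorρ M N x) LinearMap.id
        + TensorProduct.map LinearMap.id (P.ρ (ev x))
        + TensorProduct.map (TensorProduct.map M.δ N.δ) (P.ρ (od x))) =
      (TensorProduct.map (M.ρ x) LinearMap.id + TensorProduct.map LinearMap.id (tensorρ N P (ev x))
        + TensorProduct.map M.δ (tensorρ N P (od x))) ∘ₗ
        (TensorProduct.assoc ℂ M.carrier N.carrier P.carrier).toLinearMap := fun x => by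
    have h1 : ev (ev x) = ev x := ev_of_even (i := 0) (by decide) (par_ev x)
    have h2 : od (ev x) = 0 := od_of_even (i := 0) (by decide) (par_ev x)
    have h3 : ev (od x) = 0 := ev_of_odd (i := 1) (by decide) (par_od x)
    have h4 : od (od x) = od x := od_of_odd (i := 1) (by decide) (par_od x)
    apply TensorProduct.ext_threefold
    intro a b c
    simp only [LinearMap.comp_apply, LinearMap.add_apply, tensorρ_tmul, TensorProduct.map_tmul,
      map_add, add_tmul, LinearEquiv.coe_coe, TensorProduct.assoc_tmul, tmul_add, h1, h2, h3, h4,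
      map_zero, LinearMap.zero_apply, tmul_zero, add_zero, zero_add, LinearMap.id_apply]
    abel
  exact ⟨(TensorProduct.assoc ℂ M.carrier N.carrier P.carrier).toLinearMap, isHom_of_comp h1 h2,
    (TensorProduct.assoc ℂ M.carrier N.carrier P.carrier).bijective⟩

lemma triv_tensor_iso (M : SuperRep L) : Iso ((SuperRep.triv L).tensor M) M := by
  have h1 : (TensorProduct.lid ℂ M.carrier).toLinearMap ∘ₗ TensorProduct.map LinearMap.id M.δ =
      M.δ ∘ₗ (TensorProduct.lid ℂ M.carrier).toLinearMap :=
    TensorProduct.ext' fun a b => by simp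
  have h2 : ∀ x, (TensorProduct.lid ℂ M.carrier).toLinearMap ∘ₗ
      (TensorProduct.map (0 : Module.End ℂ ℂ) LinearMap.id
        + TensorProduct.map LinearMap.id (M.ρ (ev x))
        + TensorProduct.map LinearMap.id (M.ρ (od x))) =
      M.ρ x ∘ₗ (TensorProduct.lid ℂ M.carrier).toLinearMap := fun x =>
    TensorProduct.ext' fun a b => by
      have hM : M.ρ x b = M.ρ (ev x) b + M.ρ (od x) b := by
        rw [← LinearMap.add_apply, ← map_add, ev_add_od]
      simp [hM]
  exact ⟨(TensorProduct.lid ℂ M.carrier).toLinearMap, isHom_of_comp h1 h2,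
    (TensorProduct.lid ℂ M.carrier).bijective⟩

/-- The product of `Gr₋`, determined by `[M] [N] = [M ⊗ N]`. -/
def mulHom : Gr L →+ Gr L →+ Gr L :=
  lift
    (fun M => lift (fun N => cls (M.tensor N))
      (fun N E P f g hf hg h1 h2 h3 =>
        cls_exact (N := M.tensor N) (E := M.tensor E) (M := M.tensor P)
          (LinearMap.lTensor _ f) (LinearMap.lTensor _ g)
          (tensor_hom_left hf) (tensor_hom_left hg)
          (Module.Flat.lTensor_preserves_injective_linearMap _ h1)
          (lTensor_exact _ h2 h3) (LinearMap.lTensor_surjective _ h3))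
      (fun N => by
        rw [← cls_shift]
        exact cls_iso (tensor_shift_iso M.rep N.rep)))
    (fun N E P f g hf hg h1 h2 h3 => hom_ext fun M => by
      simp only [lift_cls, AddMonoidHom.add_apply]
      exact cls_exact (N := N.tensor M) (E := E.tensor M) (M := P.tensor M)
          (LinearMap.rTensor _ f) (LinearMap.rTensor _ g)
          (tensor_hom_right hf) (tensor_hom_right hg)
          (Module.Flat.rTensor_preserves_injective_linearMap _ h1)
          (rTensor_exact _ h2 h3) (LinearMap.rTensor_surjective _ h3))
    (fun N => hom_ext fun M => by
      simp only [lift_cls, AddMonoidHom.neg_apply]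
      rw [← cls_shift]
      exact cls_iso (shift_tensor_iso N.rep M.rep))

lemma mulHom_cls (M N : FinRep L) : mulHom (cls M) (cls N) = cls (M.tensor N) := by
  simp [mulHom]

lemma induction {p : Gr L → Prop} (h1 : ∀ M, p (cls M)) (h2 : ∀ a, p a → p (-a))
    (h3 : ∀ a b, p a → p b → p (a + b)) (h0 : p 0) (a : Gr L) : p a := by
  obtain ⟨a, rfl⟩ := QuotientAddGroup.mk_surjective a
  induction a using FreeAbelianGroup.induction_on with
  | zero => exact h0
  | of M => exact h1 M
  | neg M h => exact h2 _ h
  | add a b ha hb => exact h3 _ _ ha hb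

lemma mul_comm_aux (a b : Gr L) : mulHom a b = mulHom b a := by
  induction a using Gr.induction with
  | h1 M =>
    induction b using Gr.induction with
    | h1 N =>
      rw [mulHom_cls, mulHom_cls]
      exact cls_iso (tensor_comm_iso _ _)
    | h2 b hb => simp [hb]
    | h3 b c hb hc => simp [hb, hc]
    | h0 => simp
  | h2 a ha => simp [ha]
  | h3 a c ha hc => simp [ha, hc]
  | h0 => simp

lemma mul_assoc_aux (a b c : Gr L) : mulHom (mulHom a b) c = mulHom a (mulHom b c) := by
  induction a using Gr.induction with
  | h1 M =>
    induction b using Gr.induction with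
    | h1 N =>
      induction c using Gr.induction with
      | h1 P =>
        simp only [mulHom_cls]
        exact cls_iso (tensor_assoc_iso _ _ _)
      | h2 b hb => simp [hb]
      | h3 b c hb hc => simp [hb, hc]
      | h0 => simp
    | h2 b hb => simp [hb]
    | h3 b c hb hc => simp [hb, hc]
    | h0 => simp
  | h2 a ha => simp [ha]
  | h3 a c ha hc => simp [ha, hc]
  | h0 => simp

lemma one_mul_aux (a : Gr L) : mulHom (cls (FinRep.triv L)) a = a := by
  induction a using Gr.induction with
  | h1 M =>
    rw [mulHom_cls]
    exact cls_iso (triv_tensor_iso _)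
  | h2 a ha => simp [ha]
  | h3 a c ha hc => simp [ha, hc]
  | h0 => simp

/-- The reduced Grothendieck ring. -/
instance : CommRing (Gr L) :=
  { (inferInstance : AddCommGroup (Gr L)) with
    mul := fun a b => mulHom a b
    one := cls (FinRep.triv L)
    left_distrib := fun a b c => map_add (mulHom a) b c
    right_distrib := fun a b c => by
      change mulHom (a + b) c = mulHom a c + mulHom b c
      simp
    zero_mul := fun a => by
      change mulHom 0 a = 0
      simp
    mul_zero := fun a => map_zero (mulHom a)
    mul_assoc := mul_assoc_aux
    one_mul := one_mul_aux
    mul_one := fun a => (mul_comm_aux _ _).trans (one_mul_aux a)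
    mul_comm := mul_comm_aux }

end Gr

end

end Queer

namespace Queer

noncomputable section

open LieSuperalgebra SuperRep

section Envelope

variable {L : Type} [AddCommGroup L] [Module ℂ L] [LieSuperalgebra L]

/-- An even bilinear bracket on a module `M` on which the Lie superalgebra acts by
superderivations. The two cases used below are the Lie superbracket of a Lie superalgebra and
the zero bracket. -/
structure InvBracket (M : SuperRep L) where
  β : M.carrier →ₗ[ℂ] M.carrier →ₗ[ℂ] M.carrier
  δ_β : ∀ v w, M.δ (β v w) = β (M.δ v) (M.δ w)
  ρ_β : ∀ (s i : ℕ) (x : L) (v w : M.carrier), par x = (-1 : ℂ) ^ s • x →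
    M.δ v = (-1 : ℂ) ^ i • v →
    M.ρ x (β v w) = β (M.ρ x v) w + (-1 : ℂ) ^ (s * i) • β v (M.ρ x w)

/-- The zero bracket. -/
def InvBracket.zero (M : SuperRep L) : InvBracket M := ⟨0, by simp, by simp⟩

variable {M : SuperRep L} (B : InvBracket M)

/-- The relations `v w - (-1) ^ (p(v) p(w)) • w v = β(v, w)` for homogeneous `v`, `w`. -/
inductive EnvRel : TensorAlgebra ℂ M.carrier → TensorAlgebra ℂ M.carrier → Prop
  | mk (i j : ℕ) (v w : M.carrier) (hv : M.δ v = (-1 : ℂ) ^ i • v)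
      (hw : M.δ w = (-1 : ℂ) ^ j • w) :
      EnvRel (TensorAlgebra.ι ℂ v * TensorAlgebra.ι ℂ w)
        ((-1 : ℂ) ^ (i * j) • (TensorAlgebra.ι ℂ w * TensorAlgebra.ι ℂ v)
          + TensorAlgebra.ι ℂ (B.β v w))

/-- The quotient of the tensor algebra of `M` by the above relations: the universal enveloping
superalgebra when `β` is a Lie superbracket, the supersymmetric algebra when `β = 0`. -/
abbrev Env : Type := RingQuot (EnvRel B)

namespace Env

/-- The canonical map `M → Env`. -/
def ι : M.carrier →ₗ[ℂ] Env B :=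
  (RingQuot.mkAlgHom ℂ (EnvRel B)).toLinearMap ∘ₗ TensorAlgebra.ι ℂ

lemma ι_mul {i j : ℕ} {v w : M.carrier} (hv : M.δ v = (-1 : ℂ) ^ i • v)
    (hw : M.δ w = (-1 : ℂ) ^ j • w) :
    ι B v * ι B w = (-1 : ℂ) ^ (i * j) • (ι B w * ι B v) + ι B (B.β v w) := by
  have h := RingQuot.mkAlgHom_rel ℂ (EnvRel.mk (B := B) i j v w hv hw)
  simpa [ι] using h

/-- The universal property. -/
def lift {A : Type} [Ring A] [Algebra ℂ A] (f : M.carrier →ₗ[ℂ] A)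
    (hf : ∀ (i j : ℕ) (v w : M.carrier), M.δ v = (-1 : ℂ) ^ i • v → M.δ w = (-1 : ℂ) ^ j • w →
      f v * f w = (-1 : ℂ) ^ (i * j) • (f w * f v) + f (B.β v w)) : Env B →ₐ[ℂ] A :=
  RingQuot.liftAlgHom ℂ ⟨TensorAlgebra.lift ℂ f, by
    rintro _ _ ⟨i, j, v, w, hv, hw⟩
    simpa using hf i j v w hv hw⟩

@[simp] lemma lift_ι {A : Type} [Ring A] [Algebra ℂ A] (f : M.carrier →ₗ[ℂ] A) (hf) (v) :
    lift B f hf (ι B v) = f v := by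
  simp [lift, ι]

@[elab_as_elim]
lemma induction {p : Env B → Prop} (h1 : ∀ r : ℂ, p (algebraMap ℂ _ r)) (h2 : ∀ v, p (ι B v))
    (h3 : ∀ a b, p a → p b → p (a * b)) (h4 : ∀ a b, p a → p b → p (a + b)) (a : Env B) : p a := by
  obtain ⟨a, rfl⟩ := RingQuot.mkAlgHom_surjective ℂ (EnvRel B) a
  induction a using TensorAlgebra.induction with
  | algebraMap r => simpa using h1 r
  | ι v => exact h2 v
  | mul a b ha hb => rw [map_mul]; exact h3 _ _ ha hb
  | add a b ha hb => rw [map_add]; exact h4 _ _ ha hb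

lemma hom_ext {A : Type} [Ring A] [Algebra ℂ A] {f g : Env B →ₐ[ℂ] A}
    (h : ∀ v, f (ι B v) = g (ι B v)) : f = g := by
  refine AlgHom.ext fun a => ?_
  induction a using Env.induction with
  | h1 r => simp
  | h2 v => exact h v
  | h3 a b ha hb => simp [ha, hb]
  | h4 a b ha hb => simp [ha, hb]

/-- The parity automorphism `a ↦ (-1) ^ p(a) • a`. -/
def θ : Env B →ₐ[ℂ] Env B :=
  lift B (ι B ∘ₗ M.δ) fun i j v w hv hw => by
    have hv' : M.δ (M.δ v) = (-1 : ℂ) ^ i • M.δ v := by rw [← map_smul, ← hv]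
    have hw' : M.δ (M.δ w) = (-1 : ℂ) ^ j • M.δ w := by rw [← map_smul, ← hw]
    simpa [B.δ_β] using ι_mul B hv' hw'

@[simp] lemma θ_ι (v : M.carrier) : θ B (ι B v) = ι B (M.δ v) := by simp [θ]

lemma θ_θ (a : Env B) : θ B (θ B a) = a := by
  have : (θ B).comp (θ B) = AlgHom.id ℂ (Env B) := hom_ext B fun v => by simp [M.δ_δ]
  exact DFunLike.congr_fun this a

lemma δ_ρ_deg {s i : ℕ} {x : L} {v : M.carrier} (hx : par x = (-1 : ℂ) ^ s • x)
    (hv : M.δ v = (-1 : ℂ) ^ i • v) : M.δ (M.ρ x v) = (-1 : ℂ) ^ (s + i) • M.ρ x v := by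
  rw [M.δ_ρ, hx, hv]; simp [smul_smul, pow_add, mul_comm]

lemma δ_pow {s i : ℕ} {v : M.carrier} (hv : M.δ v = (-1 : ℂ) ^ i • v) :
    (M.δ ^ s) v = (-1 : ℂ) ^ (s * i) • v := by
  induction s with
  | zero => simp
  | succ s ih => rw [pow_succ', Module.End.mul_apply, ih, map_smul, hv, smul_smul]; ring_nf

/-- Auxiliary: `a ↦ !![θ ^ s a, D a; 0, a]`, which is an algebra homomorphism exactly when `D` is a
superderivation of parity `s`. -/
def derAux (s : ℕ) (x : L) (hx : par x = (-1 : ℂ) ^ s • x) :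
    Env B →ₐ[ℂ] Matrix (Fin 2) (Fin 2) (Env B) :=
  lift B
    { toFun := fun v => !![ι B ((M.δ ^ s) v), ι B (M.ρ x v); 0, ι B v]
      map_add' := fun v w => by
        ext a b; fin_cases a <;> fin_cases b <;> simp
      map_smul' := fun c v => by
        ext a b; fin_cases a <;> fin_cases b <;> simp }
    fun i j v w hv hw => by
      have hβ : M.δ (B.β v w) = (-1 : ℂ) ^ (i + j) • B.β v w := by
        rw [B.δ_β, hv, hw]; simp [smul_smul, pow_add, mul_comm]
      have hsq : ∀ k : ℕ, ((-1 : ℂ) ^ k) * (-1 : ℂ) ^ k = 1 := fun k => by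
        rw [← mul_pow]; simp
      have e1 := ι_mul B hv hw
      have e2 := ι_mul B (δ_ρ_deg hx hv) hw
      have e3 := ι_mul B hv (δ_ρ_deg hx hw)
      have e4 := B.ρ_β s i x v w hx hv
      rw [add_mul, pow_add] at e2
      rw [mul_add, pow_add, mul_comm i s] at e3
      have hp := hsq (s * i)
      have hδ := δ_pow (s := s) hβ
      rw [mul_add, pow_add] at hδ
      ext a b
      fin_cases a <;> fin_cases b
      · simp only [LinearMap.coe_mk, AddHom.coe_mk, Fin.zero_eta, Fin.isValue, Matrix.mul_fin_two,
          Matrix.of_apply, Matrix.cons_val_zero, Matrix.add_apply, Matrix.smul_apply, δ_pow hv,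
          δ_pow hw, hδ, map_smul, smul_mul_smul_comm, e1, mul_zero, add_zero]
        module
      · simp only [LinearMap.coe_mk, AddHom.coe_mk, Fin.zero_eta, Fin.isValue, Matrix.mul_fin_two,
          Matrix.of_apply, Matrix.cons_val_zero, Matrix.cons_val_one, Matrix.cons_val', Fin.mk_one,
          Matrix.cons_val_fin_one, Matrix.add_apply,
          Matrix.smul_apply, δ_pow hv, δ_pow hw, map_smul, map_add, smul_mul_assoc, e2, e3, e4]
        generalize (-1 : ℂ) ^ (s * i) = p at *
        generalize (-1 : ℂ) ^ (s * j) = q at *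
        generalize (-1 : ℂ) ^ (i * j) = r at *
        rw [smul_add, smul_smul, ← mul_assoc, hp, one_mul]
        module
      · simp
      · simp [e1]

lemma θ_pow_ι (s : ℕ) (v : M.carrier) : (θ B ^ s) (ι B v) = ι B ((M.δ ^ s) v) := by
  induction s generalizing v with
  | zero => simp
  | succ s ih => rw [pow_succ, pow_succ, AlgHom.mul_apply, θ_ι, ih, Module.End.mul_apply]

lemma derAux_apply (s : ℕ) (x : L) (hx : par x = (-1 : ℂ) ^ s • x) (a : Env B) :
    derAux B s x hx a 0 0 = (θ B ^ s) a ∧ derAux B s x hx a 1 0 = 0 ∧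
      derAux B s x hx a 1 1 = a := by
  induction a using Env.induction with
  | h1 r => simp [Matrix.algebraMap_matrix_apply]
  | h2 v => simp [derAux, θ_pow_ι]
  | h3 a b ha hb => simp [Matrix.mul_apply, ha, hb]
  | h4 a b ha hb => simp [ha, hb]

/-- The superderivation of `Env` of parity `s` that extends the action of `x` on `M`. -/
def der (s : ℕ) (x : L) (hx : par x = (-1 : ℂ) ^ s • x) : Env B →ₗ[ℂ] Env B where
  toFun a := derAux B s x hx a 0 1
  map_add' a b := by simp
  map_smul' c a := by simp

lemma der_mul (s : ℕ) (x : L) (hx) (a b : Env B) :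
    der B s x hx (a * b) = (θ B ^ s) a * der B s x hx b + der B s x hx a * b := by
  simp [der, Matrix.mul_apply, derAux_apply]

lemma der_algebraMap (s : ℕ) (x : L) (hx) (r : ℂ) : der B s x hx (algebraMap ℂ _ r) = 0 := by
  simp [der, Matrix.algebraMap_matrix_apply]

lemma der_ι (s : ℕ) (x : L) (hx) (v : M.carrier) : der B s x hx (ι B v) = ι B (M.ρ x v) := by
  simp [der, derAux]

/-- The superderivation extending the action of `x` is unique. -/
lemma eq_der {s : ℕ} {x : L} (hx : par x = (-1 : ℂ) ^ s • x) (f : Env B →ₗ[ℂ] Env B)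
    (h1 : ∀ r, f (algebraMap ℂ _ r) = 0) (h2 : ∀ v, f (ι B v) = ι B (M.ρ x v))
    (h3 : ∀ a b, f (a * b) = (θ B ^ s) a * f b + f a * b) : f = der B s x hx := by
  refine LinearMap.ext fun a => ?_
  induction a using Env.induction with
  | h1 r => rw [h1, der_algebraMap]
  | h2 v => rw [h2, der_ι]
  | h3 a b ha hb => rw [h3, der_mul, ha, hb]
  | h4 a b ha hb => rw [map_add, map_add, ha, hb]

lemma θ_der (s : ℕ) (x : L) (hx) (a : Env B) :
    θ B (der B s x hx a) = (-1 : ℂ) ^ s • der B s x hx (θ B a) := by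
  have hsq : ((-1 : ℂ) ^ s) * (-1 : ℂ) ^ s = 1 := by rw [← mul_pow]; simp
  have hc : ∀ a, (θ B ^ s) (θ B a) = θ B ((θ B ^ s) a) := fun a => by
    rw [← AlgHom.mul_apply, ← AlgHom.mul_apply, pow_mul_comm']
  induction a using Env.induction with
  | h1 r => simp [der_algebraMap]
  | h2 v => rw [der_ι, θ_ι, θ_ι, der_ι, M.δ_ρ, hx]; simp
  | h3 a b ha hb =>
    rw [der_mul, map_add, map_mul, map_mul, map_mul, der_mul, ha, hb, hc]
    simp [smul_add]
  | h4 a b ha hb => simp only [map_add, ha, hb, smul_add]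

lemma θ_pow_der (t s : ℕ) (x : L) (hx) (a : Env B) :
    (θ B ^ t) (der B s x hx a) = (-1 : ℂ) ^ (s * t) • der B s x hx ((θ B ^ t) a) := by
  induction t generalizing a with
  | zero => simp
  | succ t ih =>
    rw [pow_succ, AlgHom.mul_apply, AlgHom.mul_apply, θ_der, map_smul, ih, smul_smul]
    congr 1; ring

lemma der_br {s t : ℕ} {x y : L} (hx : par x = (-1 : ℂ) ^ s • x)
    (hy : par y = (-1 : ℂ) ^ t • y) (hxy : par (br x y) = (-1 : ℂ) ^ (s + t) • br x y) :
    der B s x hx ∘ₗ der B t y hy - (-1 : ℂ) ^ (s * t) • (der B t y hy ∘ₗ der B s x hx) =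
      der B (s + t) (br x y) hxy := by
  have hsq : ((-1 : ℂ) ^ (s * t)) * (-1 : ℂ) ^ (s * t) = 1 := by rw [← mul_pow]; simp
  apply eq_der
  · intro r
    simp [der_algebraMap]
  · intro v
    simp [der_ι, ρ_br_apply M hx hy]
  · intro a b
    simp only [LinearMap.sub_apply, LinearMap.comp_apply, LinearMap.smul_apply, der_mul, map_add,
      θ_pow_der, pow_add, AlgHom.mul_apply]
    have hc : (θ B ^ t) ((θ B ^ s) a) = (θ B ^ s) ((θ B ^ t) a) := by
      rw [← AlgHom.mul_apply, ← AlgHom.mul_apply, pow_mul_comm]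
    rw [hc, mul_comm t s]
    generalize (-1 : ℂ) ^ (s * t) = p at *
    simp only [mul_sub, sub_mul, smul_add, smul_mul_assoc, mul_smul_comm, smul_smul, hsq, one_smul]
    abel

/-- The action of the Lie superalgebra on `Env` by superderivations. -/
def act : L →ₗ[ℂ] Module.End ℂ (Env B) where
  toFun x := der B 0 (ev x) (par_ev x) + der B 1 (od x) (par_od x)
  map_add' x y := by
    rw [← eq_der B (par_ev (x + y)) (der B 0 (ev x) (par_ev x) + der B 0 (ev y) (par_ev y)),
      ← eq_der B (par_od (x + y)) (der B 1 (od x) (par_od x) + der B 1 (od y) (par_od y))]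
    · abel
    all_goals
      intros
      simp only [LinearMap.add_apply, der_algebraMap, der_ι, der_mul, map_add, mul_add,
        add_mul, add_zero]
    all_goals abel
  map_smul' c x := by
    rw [← eq_der B (par_ev (c • x)) (c • der B 0 (ev x) (par_ev x)),
      ← eq_der B (par_od (c • x)) (c • der B 1 (od x) (par_od x))]
    · simp
    all_goals
      intros
      simp [der_algebraMap, der_ι, der_mul]

lemma act_apply (x : L) (a : Env B) :
    act B x a = der B 0 (ev x) (par_ev x) a + der B 1 (od x) (par_od x) a := rfl

lemma der_eq_zero {s : ℕ} {x : L} (hx) (h : x = 0) : der B s x hx = 0 := by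
  subst h
  exact (eq_der B hx 0 (by simp) (by simp) (by simp)).symm

lemma act_ι (x : L) (v : M.carrier) : act B x (ι B v) = ι B (M.ρ x v) := by
  rw [act_apply, der_ι, der_ι, ← map_add, ← LinearMap.add_apply, ← map_add, ev_add_od]

lemma act_eq_der {s : ℕ} {x : L} (hx : par x = (-1 : ℂ) ^ s • x) : act B x = der B s x hx := by
  have h2 : θ B ^ 2 = 1 := by
    refine AlgHom.ext fun a => ?_
    rw [pow_two, AlgHom.mul_apply, θ_θ, AlgHom.one_apply]
  apply eq_der
  · intro r
    simp [act_apply, der_algebraMap]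
  · exact act_ι B x
  · intro a b
    rcases Nat.even_or_odd' s with ⟨k, rfl | rfl⟩
    · rw [act_apply, act_apply, act_apply, der_mul, der_eq_zero B _ (od_of_even (by simp) hx),
        pow_mul, h2]
      simp
    · rw [act_apply, act_apply, act_apply, der_mul, der_mul,
        der_eq_zero B (par_ev x) (ev_of_odd (by simp) hx), pow_succ (θ B) (2 * k), pow_mul, h2]
      simp

/-- `Env` as a module over the Lie superalgebra acting on `M`. -/
def rep : SuperRep L where
  carrier := Env B
  δ := (θ B).toLinearMap
  δ_δ := θ_θ B
  ρ := act B
  δ_ρ x a := by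
    have h1 := θ_der B 0 (ev x) (par_ev x) a
    have h2 := θ_der B 1 (od x) (par_od x) a
    have h3 : par x = ev x - od x := by
      conv_lhs => rw [← ev_add_od x, map_add, par_ev, par_od]
      simp [sub_eq_add_neg]
    rw [h3, map_sub, act_eq_der B (par_ev x), act_eq_der B (par_od x)]
    simp only [act_apply, LinearMap.sub_apply, AlgHom.toLinearMap_apply, map_add, h1, h2]
    module
  ρ_br i j x y hx hy := by
    rw [act_eq_der B hx, act_eq_der B hy, act_eq_der B (par_br_hom hx hy),
      ← der_br B hx hy (par_br_hom hx hy)]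
    rfl

end Env

/-- The supersymmetric algebra `S(M)`, with its induced action. -/
abbrev Sym (M : SuperRep L) : SuperRep L := Env.rep (InvBracket.zero M)

/-- The subspace of `S(M)` spanned by the products of `k` elements of `M`. -/
def symSpace (M : SuperRep L) (k : ℕ) : Submodule ℂ (Env (InvBracket.zero M)) :=
  LinearMap.range (Env.ι (InvBracket.zero M)) ^ k

lemma symSpace_isSub (M : SuperRep L) (k : ℕ) : IsSub (Sym M) (symSpace M k) := by
  set B := InvBracket.zero M
  have hθ : ∀ k, ∀ a ∈ symSpace M k, Env.θ B a ∈ symSpace M k := by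
    intro k
    induction k with
    | zero =>
      intro a ha
      rw [symSpace, pow_zero, Submodule.mem_one] at ha ⊢
      obtain ⟨r, rfl⟩ := ha
      exact ⟨r, (AlgHom.commutes _ _).symm⟩
    | succ k ih =>
      intro a ha
      rw [symSpace, pow_succ] at ha ⊢
      refine Submodule.mul_induction_on ha ?_ ?_
      · rintro a ha _ ⟨v, rfl⟩
        rw [map_mul, Env.θ_ι]
        exact Submodule.mul_mem_mul (ih a ha) ⟨_, rfl⟩
      · intro a b ha hb
        rw [map_add]
        exact add_mem ha hb
  have hθp : ∀ s k, ∀ a ∈ symSpace M k, (Env.θ B ^ s) a ∈ symSpace M k := by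
    intro s k
    induction s with
    | zero => intro a ha; simpa using ha
    | succ s ih =>
      intro a ha
      rw [pow_succ, AlgHom.mul_apply]
      exact ih _ (hθ k a ha)
  have hder : ∀ s x hx k, ∀ a ∈ symSpace M k, Env.der B s x hx a ∈ symSpace M k := by
    intro s x hx k
    induction k with
    | zero =>
      intro a ha
      rw [symSpace, pow_zero, Submodule.mem_one] at ha
      obtain ⟨r, rfl⟩ := ha
      rw [Env.der_algebraMap]
      exact zero_mem _
    | succ k ih =>
      intro a ha
      rw [symSpace, pow_succ] at ha ⊢
      refine Submodule.mul_induction_on ha ?_ ?_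
      · rintro a ha _ ⟨v, rfl⟩
        rw [Env.der_mul, Env.der_ι]
        exact add_mem (Submodule.mul_mem_mul (hθp s k a ha) ⟨_, rfl⟩)
          (Submodule.mul_mem_mul (ih a ha) ⟨_, rfl⟩)
      · intro a b ha hb
        rw [map_add]
        exact add_mem ha hb
  have hact : ∀ x, ∀ a ∈ symSpace M k, Env.act B x a ∈ symSpace M k := fun x a ha => by
    rw [Env.act_apply]
    exact add_mem (hder _ _ _ k a ha) (hder _ _ _ k a ha)
  exact ⟨hθ k, hact⟩

/-- The supersymmetric power `S^k M` of a finite-dimensional module. -/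
def symPow (k : ℕ) (M : FinRep L) : FinRep L where
  rep := (Sym M.rep).sub (symSpace M.rep k) (symSpace_isSub M.rep k)
  fin :=
    have h : (symSpace M.rep k).FG := Submodule.FG.pow (Submodule.fg_range _) k
    have h' : Module.Finite ℂ (symSpace M.rep k) := Module.Finite.iff_fg.2 h
    h'

end Envelope
end
end Queer

namespace Queer

noncomputable section

open LieSuperalgebra SuperRep

/-- The underlying space of `𝔮_n`: the pair `(A, B)` stands for the block matrix
`T_{A,B} = !![A, B; B, A]` of `𝔤𝔩(n|n)`. -/
abbrev Q (n : ℕ) : Type := Matrix (Fin n) (Fin n) ℂ × Matrix (Fin n) (Fin n) ℂ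

/-- The bracket of `𝔮_n`: the restriction of the supercommutator of `𝔤𝔩(n|n)`. -/
def qBr (n : ℕ) : Q n →ₗ[ℂ] Q n →ₗ[ℂ] Q n :=
  LinearMap.mk₂ ℂ
    (fun x y => (x.1 * y.1 - y.1 * x.1 + (x.2 * y.2 + y.2 * x.2),
      x.1 * y.2 - y.2 * x.1 + (x.2 * y.1 - y.1 * x.2)))
    (fun x x' y => by ext : 1 <;> simp [add_mul, mul_add] <;> abel)
    (fun c x y => by ext : 1 <;> simp [smul_sub, smul_add])
    (fun x y y' => by ext : 1 <;> simp [add_mul, mul_add] <;> abel)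
    (fun c x y => by ext : 1 <;> simp [smul_sub, smul_add])

lemma qBr_apply {n : ℕ} (x y : Q n) : qBr n x y =
    (x.1 * y.1 - y.1 * x.1 + (x.2 * y.2 + y.2 * x.2),
      x.1 * y.2 - y.2 * x.1 + (x.2 * y.1 - y.1 * x.2)) := rfl

/-- The parity of `𝔮_n`: `(A, 0)` is even and `(0, B)` is odd. -/
def qPar (n : ℕ) : Q n →ₗ[ℂ] Q n := LinearMap.prod (LinearMap.fst ℂ _ _) (-LinearMap.snd ℂ _ _)

lemma qPar_apply {n : ℕ} (x : Q n) : qPar n x = (x.1, -x.2) := rfl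

lemma qPar_even {n i : ℕ} (hi : Even i) {x : Q n} (hx : qPar n x = (-1 : ℂ) ^ i • x) :
    x.2 = 0 := by
  rw [hi.neg_one_pow, one_smul, qPar_apply] at hx
  have h : -x.2 = x.2 := congrArg Prod.snd hx
  ext a b
  have h' := congrFun (congrFun h a) b
  exact self_eq_neg.1 h'.symm

lemma qPar_odd {n i : ℕ} (hi : Odd i) {x : Q n} (hx : qPar n x = (-1 : ℂ) ^ i • x) :
    x.1 = 0 := by
  rw [hi.neg_one_pow, neg_smul, one_smul, qPar_apply] at hx
  have h : x.1 = -x.1 := congrArg Prod.fst hx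
  ext a b
  have h' := congrFun (congrFun h a) b
  exact self_eq_neg.1 h'

/-- The queer Lie superalgebra `𝔮_n`. -/
instance (n : ℕ) : LieSuperalgebra (Q n) where
  par := qPar n
  par_par x := by simp [qPar_apply]
  br := qBr n
  par_br x y := by
    simp only [qPar_apply, qBr_apply]
    ext : 1
    · simp
    · simp; abel
  br_skew i j x y hx hy := by
    obtain ⟨x0, x1⟩ := x
    obtain ⟨y0, y1⟩ := y
    rcases Nat.even_or_odd i with hi | hi <;> rcases Nat.even_or_odd j with hj | hj
    · obtain rfl : x1 = 0 := qPar_even hi hx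
      obtain rfl : y1 = 0 := qPar_even hj hy
      rw [(hi.mul_right j).neg_one_pow]
      ext : 1 <;> simp [qBr_apply]
    · obtain rfl : x1 = 0 := qPar_even hi hx
      obtain rfl : y0 = 0 := qPar_odd hj hy
      rw [(hi.mul_right j).neg_one_pow]
      ext : 1 <;> simp [qBr_apply]
    · obtain rfl : x0 = 0 := qPar_odd hi hx
      obtain rfl : y1 = 0 := qPar_even hj hy
      rw [(hj.mul_left i).neg_one_pow]
      ext : 1 <;> simp [qBr_apply]
    · obtain rfl : x0 = 0 := qPar_odd hi hx
      obtain rfl : y0 = 0 := qPar_odd hj hy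
      rw [(hi.mul hj).neg_one_pow]
      ext : 1 <;> simp [qBr_apply, add_comm]
  br_jacobi i j x y z hx hy := by
    obtain ⟨x0, x1⟩ := x
    obtain ⟨y0, y1⟩ := y
    obtain ⟨z0, z1⟩ := z
    rcases Nat.even_or_odd i with hi | hi <;> rcases Nat.even_or_odd j with hj | hj
    · obtain rfl : x1 = 0 := qPar_even hi hx
      obtain rfl : y1 = 0 := qPar_even hj hy
      rw [(hi.mul_right j).neg_one_pow, one_smul]
      ext : 1 <;> simp only [qBr_apply, Prod.fst_add, Prod.snd_add] <;> noncomm_ring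
    · obtain rfl : x1 = 0 := qPar_even hi hx
      obtain rfl : y0 = 0 := qPar_odd hj hy
      rw [(hi.mul_right j).neg_one_pow, one_smul]
      ext : 1 <;> simp only [qBr_apply, Prod.fst_add, Prod.snd_add] <;> noncomm_ring
    · obtain rfl : x0 = 0 := qPar_odd hi hx
      obtain rfl : y1 = 0 := qPar_even hj hy
      rw [(hj.mul_left i).neg_one_pow, one_smul]
      ext : 1 <;> simp only [qBr_apply, Prod.fst_add, Prod.snd_add] <;> noncomm_ring
    · obtain rfl : x0 = 0 := qPar_odd hi hx
      obtain rfl : y0 = 0 := qPar_odd hj hy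
      rw [(hi.mul hj).neg_one_pow, neg_smul, one_smul]
      ext : 1 <;> simp only [qBr_apply, Prod.fst_add, Prod.snd_add, Prod.fst_neg, Prod.snd_neg] <;>
        noncomm_ring

lemma par_apply {n : ℕ} (x : Q n) : par x = (x.1, -x.2) := rfl

lemma br_apply {n : ℕ} (x y : Q n) : br x y =
    (x.1 * y.1 - y.1 * x.1 + (x.2 * y.2 + y.2 * x.2),
      x.1 * y.2 - y.2 * x.1 + (x.2 * y.1 - y.1 * x.2)) := rfl

/-- The pairs of matrices whose entries vanish at all positions `(i, j)` with `r i j`. -/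
def patternSub (n : ℕ) (r : Fin n → Fin n → Prop) : Submodule ℂ (Q n) where
  carrier := {x | ∀ i j, r i j → x.1 i j = 0 ∧ x.2 i j = 0}
  add_mem' {x y} hx hy i j h := by simp [hx i j h, hy i j h]
  zero_mem' i j _ := by simp
  smul_mem' c x hx i j h := by simp [hx i j h]

lemma patternSub_par {n : ℕ} {r : Fin n → Fin n → Prop} {x : Q n} (hx : x ∈ patternSub n r) :
    par x ∈ patternSub n r := fun i j h => by
  simp [par_apply, hx i j h]

/-- The Cartan subalgebra `𝔥`, the centralizer of `𝔱`: the pairs of diagonal matrices. -/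
def cartan (n : ℕ) : Submodule ℂ (Q n) := patternSub n (fun i j => i ≠ j)

/-- The subalgebra `𝔫⁻`: the pairs of strictly lower triangular matrices. -/
def lower (n : ℕ) : Submodule ℂ (Q n) := patternSub n (fun i j => i ≤ j)

/-- The subalgebra `𝔫⁺`: the pairs of strictly upper triangular matrices. -/
def upper (n : ℕ) : Submodule ℂ (Q n) := patternSub n (fun i j => j ≤ i)

/-- The Borel subalgebra `𝔟 = 𝔥 ⊕ 𝔫⁺`: the pairs of upper triangular matrices. -/
def borel (n : ℕ) : Submodule ℂ (Q n) := patternSub n (fun i j => j < i)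

lemma patternSub_br {n : ℕ} {r r₁ r₂ : Fin n → Fin n → Prop}
    (h : ∀ i j k, r i j → (r₁ i k ∨ r₂ k j) ∧ (r₂ i k ∨ r₁ k j)) {x y : Q n}
    (hx : x ∈ patternSub n r₁) (hy : y ∈ patternSub n r₂) : br x y ∈ patternSub n r := by
  have key : ∀ (A B : Matrix (Fin n) (Fin n) ℂ) (i j : Fin n),
      (∀ k, A i k = 0 ∨ B k j = 0) → (A * B) i j = 0 := by
    intro A B i j h
    rw [Matrix.mul_apply]
    exact Finset.sum_eq_zero fun k _ => mul_eq_zero.2 (h k)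
  intro i j hr
  have hxy : ∀ k, (x.1 i k = 0 ∧ x.2 i k = 0) ∨ (y.1 k j = 0 ∧ y.2 k j = 0) := fun k =>
    (h i j k hr).1.imp (hx i k) (hy k j)
  have hyx : ∀ k, (y.1 i k = 0 ∧ y.2 i k = 0) ∨ (x.1 k j = 0 ∧ x.2 k j = 0) := fun k =>
    (h i j k hr).2.imp (hy i k) (hx k j)
  simp only [br_apply, Matrix.add_apply, Matrix.sub_apply]
  constructor
  · rw [key _ _ i j fun k => (hxy k).imp And.left And.left,
      key _ _ i j fun k => (hyx k).imp And.left And.left,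
      key _ _ i j fun k => (hxy k).imp And.right And.right,
      key _ _ i j fun k => (hyx k).imp And.right And.right]
    simp
  · rw [key _ _ i j fun k => (hxy k).imp And.left And.right,
      key _ _ i j fun k => (hyx k).imp And.right And.left,
      key _ _ i j fun k => (hxy k).imp And.right And.left,
      key _ _ i j fun k => (hyx k).imp And.left And.right]
    simp

/-- `𝔥` is a Lie superalgebra with the bracket of `𝔮_n`. -/
instance (n : ℕ) : LieSuperalgebra (cartan n) where
  par := par.restrict fun _ hx => patternSub_par hx
  par_par x := Subtype.ext (par_par (x : Q n))
  br := LinearMap.mk₂ ℂ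
    (fun x y => ⟨br (x : Q n) (y : Q n), patternSub_br (fun i j k h => by
      constructor <;> (by_contra! hc; exact h (hc.1.trans hc.2))) x.2 y.2⟩)
    (fun x x' y => by ext : 1; simp)
    (fun c x y => by ext : 1; simp)
    (fun x y y' => by ext : 1; simp)
    (fun c x y => by ext : 1; simp)
  par_br x y := Subtype.ext (par_br (x : Q n) y)
  br_skew i j x y hx hy := Subtype.ext
    (br_skew i j (x : Q n) y (congrArg Subtype.val hx) (congrArg Subtype.val hy))
  br_jacobi i j x y z hx hy := Subtype.ext
    (br_jacobi i j (x : Q n) y z (congrArg Subtype.val hx) (congrArg Subtype.val hy))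

/-- The basis `h_1, …, h_n` of `𝔱 = 𝔥_0`; weights are written in the dual basis, as `Fin n → ℂ`. -/
def tor {n : ℕ} (i : Fin n) : cartan n :=
  ⟨(Matrix.diagonal (Pi.single i 1), 0), fun j k hjk => by simp [Matrix.diagonal_apply_ne _ hjk]⟩

lemma par_tor {n : ℕ} (i : Fin n) : par (tor i) = tor i :=
  Subtype.ext (Prod.ext rfl (neg_zero (G := Matrix (Fin n) (Fin n) ℂ)))

lemma br_tor {n : ℕ} (i : Fin n) (x : cartan n) : br (tor i) x = 0 := by
  have hd : ∀ A : Matrix (Fin n) (Fin n) ℂ, (∀ j k, j ≠ k → A j k = 0) →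
      Matrix.diagonal (Pi.single i 1) * A = A * Matrix.diagonal (Pi.single i 1) := by
    intro A hA
    ext j k
    rw [Matrix.diagonal_mul, Matrix.mul_diagonal]
    by_cases h : j = k
    · subst h; ring
    · rw [hA j k h]; ring
  have h1 := hd (x : Q n).1 fun j k h => (x.2 j k h).1
  have h2 := hd (x : Q n).2 fun j k h => (x.2 j k h).2
  refine Subtype.ext ?_
  change br (tor i : Q n) (x : Q n) = 0
  rw [br_apply]
  simp [tor, h1, h2]

/-- The weight space `M_ν`. -/
def wtSpace {n : ℕ} (M : SuperRep (cartan n)) (ν : Fin n → ℂ) : Submodule ℂ M.carrier :=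
  ⨅ i, LinearMap.ker (M.ρ (tor i) - ν i • LinearMap.id)

lemma mem_wtSpace {n : ℕ} {M : SuperRep (cartan n)} {ν : Fin n → ℂ} {v : M.carrier} :
    v ∈ wtSpace M ν ↔ ∀ i, M.ρ (tor i) v = ν i • v := by
  simp [wtSpace, sub_eq_zero]

lemma wtSpace_isSub {n : ℕ} (M : SuperRep (cartan n)) (ν : Fin n → ℂ) : IsSub M (wtSpace M ν) := by
  have hhom : ∀ (i : Fin n) (s : ℕ) (x : cartan n) (_ : par x = (-1 : ℂ) ^ s • x) (v : M.carrier),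
      M.ρ (tor i) (M.ρ x v) = M.ρ x (M.ρ (tor i) v) := by
    intro i s x hx v
    have h := ρ_br_apply M (i := 0) (x := tor i) (by simp [par_tor i]) hx v
    rw [br_tor] at h
    simp only [map_zero, LinearMap.zero_apply, zero_mul, pow_zero, one_smul] at h
    exact (sub_eq_zero.1 h.symm)
  constructor
  · intro v hv
    rw [mem_wtSpace] at hv ⊢
    intro i
    have h := M.δ_ρ (tor i) v
    rw [par_tor, hv i, map_smul] at h
    exact h.symm
  · intro x v hv
    rw [mem_wtSpace] at hv ⊢
    intro i
    rw [← ev_add_od x, map_add, LinearMap.add_apply, map_add, hhom i 0 _ (par_ev x),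
      hhom i 1 _ (par_od x), hv i, map_smul, map_smul, smul_add]

/-- The weight space `M_ν`, as an `𝔥`-module. -/
def wtRep {n : ℕ} (M : SuperRep (cartan n)) (ν : Fin n → ℂ) : SuperRep (cartan n) :=
  M.sub (wtSpace M ν) (wtSpace_isSub M ν)

/-- The restriction to `𝔥` of a `𝔮_n`-module. -/
def resCartan {n : ℕ} (M : SuperRep (Q n)) : SuperRep (cartan n) :=
  res (cartan n).subtype (fun _ => rfl) (fun _ _ => rfl) M

/-- `𝔤 = 𝔮_n` as an `𝔥`-module under the adjoint action. -/
def adCartan (n : ℕ) : SuperRep (cartan n) := resCartan (SuperRep.adjoint (Q n))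

/-- `𝔫⁻` as an `𝔥`-module under the adjoint action. -/
def nMinus (n : ℕ) : SuperRep (cartan n) :=
  (adCartan n).sub (lower n)
    ⟨fun _ hx => patternSub_par hx, fun x _ hy => patternSub_br (r₁ := fun i j => i ≠ j)
      (r₂ := fun i j => i ≤ j) (fun i j k h => by
        constructor <;> (by_contra! hc; omega)) x.2 hy⟩

/-- The bracket of `𝔮_n`, restricted to `𝔫⁻`. -/
def lowerBr (n : ℕ) : lower n →ₗ[ℂ] lower n →ₗ[ℂ] lower n :=
  LinearMap.mk₂ ℂ
    (fun x y => ⟨br (x : Q n) (y : Q n), patternSub_br (r₁ := fun i j => i ≤ j)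
      (r₂ := fun i j => i ≤ j) (fun i j k h => by
        constructor <;> (by_contra! hc; omega)) x.2 y.2⟩)
    (fun x x' y => by ext : 1; simp)
    (fun c x y => by ext : 1; simp)
    (fun x y y' => by ext : 1; simp)
    (fun c x y => by ext : 1; simp)

/-- The Lie superbracket of `𝔫⁻`. -/
def nMinusBr (n : ℕ) : InvBracket (nMinus n) where
  β := lowerBr n
  δ_β v w := Subtype.ext (par_br (L := Q n) (Subtype.val v) (Subtype.val w))
  ρ_β s i x v w hx hv := Subtype.ext
    (br_jacobi (L := Q n) s i (Subtype.val x) (Subtype.val v) (Subtype.val w)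
      (congrArg Subtype.val hx) (congrArg Subtype.val hv))

/-- The enveloping algebra `𝒰(𝔫⁻)`, as an `𝔥`-module under the adjoint action. -/
def UnMinus (n : ℕ) : SuperRep (cartan n) := Env.rep (nMinusBr n)

/-- The category `ℳ(𝔥)`: `𝔱` acts diagonally and the weight spaces are finite-dimensional. -/
def InCatM {n : ℕ} (M : SuperRep (cartan n)) : Prop :=
  (⨆ ν, wtSpace M ν) = ⊤ ∧ ∀ ν, Module.Finite ℂ (wtRep M ν).carrier

open Classical in
/-- The supercharacter `sch_𝔥 M` of a module `M` in `ℳ(𝔥)`, given by its components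
`[M_ν] ∈ Gr₋(𝔥)`; the formal sum `∑_ν m_ν [C(ν)]` has the components `m_ν [C(ν)]`. -/
def sch {n : ℕ} (M : SuperRep (cartan n)) (ν : Fin n → ℂ) : Gr (cartan n) :=
  if h : Module.Finite ℂ (wtRep M ν).carrier then Gr.cls ⟨wtRep M ν, h⟩ else 0

/-- `C` is a simple `𝔥`-module of weight `ν`, i.e. `C(ν)` or its parity shift. -/
def IsSimpleOfWeight {n : ℕ} (ν : Fin n → ℂ) (C : FinRep (cartan n)) : Prop :=
  C.rep.IsSimple ∧ wtSpace C.rep ν = ⊤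

/-- The BGG category `𝒪` of `𝔮_n`: finitely generated modules with a diagonal action of `𝔱` that
are locally finite over `𝔟`. -/
def InCatO {n : ℕ} (M : SuperRep (Q n)) : Prop :=
  (∃ S : Finset M.carrier, ∀ N : Submodule ℂ M.carrier,
    (∀ x, ∀ v ∈ N, M.ρ x v ∈ N) → (∀ v ∈ S, v ∈ N) → N = ⊤) ∧
  (⨆ ν, wtSpace (resCartan M) ν) = ⊤ ∧
  ∀ v, ∃ N : Submodule ℂ M.carrier, v ∈ N ∧ Module.Finite ℂ N ∧
    ∀ x ∈ borel n, ∀ w ∈ N, M.ρ x w ∈ N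

/-- Two simple modules that occur as subquotients of one indecomposable module of `𝒪`. -/
def Linked {n : ℕ} (X Y : SuperRep (Q n)) : Prop :=
  X.IsSimple ∧ Y.IsSimple ∧ ∃ E : SuperRep (Q n), InCatO E ∧ E.IsIndecomposable ∧
    E.IsSubquotient X ∧ E.IsSubquotient Y

/-- Two simple modules lie in the same block of `𝒪`. -/
def SameBlock {n : ℕ} (X Y : SuperRep (Q n)) : Prop := Relation.EqvGen Linked X Y

/-- `X` is the simple module `L(μ)` of highest weight `μ` whose highest weight space is `C`,
the simple quotient of `Ind_𝔟^𝔤 C`. -/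
def IsSimpleHighestWeight {n : ℕ} (μ : Fin n → ℂ) (C : FinRep (cartan n)) (X : SuperRep (Q n)) :
    Prop :=
  X.IsSimple ∧ (∀ x ∈ upper n, ∀ v ∈ wtSpace (resCartan X) μ, X.ρ x v = 0) ∧
    Iso (wtRep (resCartan X) μ) C.rep

/-- The relation `μ ∼ ν`: `L(μ)` and `L(ν)` lie in the same block of `𝒪`, where the highest weight
space of `L(μ)` is `C μ`. -/
def BlockEquiv {n : ℕ} (C : (Fin n → ℂ) → FinRep (cartan n)) (μ ν : Fin n → ℂ) : Prop :=
  ∃ X Y : SuperRep (Q n), IsSimpleHighestWeight μ (C μ) X ∧ IsSimpleHighestWeight ν (C ν) Y ∧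
    SameBlock X Y

/-- The root `ε_i - ε_j`. -/
structure Root (n : ℕ) where
  i : Fin n
  j : Fin n
  ne : i ≠ j

namespace Root

variable {n : ℕ}

/-- The root as a weight. -/
def wt (α : Root n) : Fin n → ℂ := Pi.single α.i 1 - Pi.single α.j 1

/-- The support `{i, j}` of `ε_i - ε_j`. -/
def supp (α : Root n) : Finset (Fin n) := {α.i, α.j}

/-- The negative roots, i.e. the roots of `𝔫⁻`. -/
def IsNeg (α : Root n) : Prop := α.j < α.i

/-- The relation `α ≺ β`. -/
def Prec (α β : Root n) : Prop := max α.i α.j < min β.i β.j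

/-- The root space `𝔤_α`, as an `𝔥`-module. -/
def space (α : Root n) : FinRep (cartan n) where
  rep := wtRep (adCartan n) α.wt
  fin :=
    have _h : Module.Finite ℂ (adCartan n).carrier := inferInstanceAs (Module.Finite ℂ (Q n))
    inferInstanceAs (Module.Finite ℂ (wtSpace (adCartan n) α.wt))

end Root

/-- A presentation `ν = k_1 (α_{11} + ⋯ + α_{1 j_1}) + ⋯ + k_r (α_{r1} + ⋯ + α_{r j_r})`, recorded as
the set of the pairs `(k_i, [α_{i1}, …, α_{i j_i}])`, with distinct positive `k_i`, pairwise
disjoint supports of all the roots, and `α_{i1} ≺ ⋯ ≺ α_{i j_i}` for all `i`. -/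
structure IsPresentation {n : ℕ} (ν : Fin n → ℂ) (D : Finset (ℕ × List (Root n))) : Prop where
  sum_eq : ν = ∑ b ∈ D, b.1 • (b.2.map Root.wt).sum
  pos : ∀ b ∈ D, 0 < b.1
  nonempty : ∀ b ∈ D, b.2 ≠ []
  distinct : ∀ b ∈ D, ∀ c ∈ D, b.1 = c.1 → b = c
  chain : ∀ b ∈ D, b.2.Pairwise Root.Prec
  disjoint_within : ∀ b ∈ D, b.2.Pairwise fun α β => Disjoint α.supp β.supp
  disjoint : ∀ b ∈ D, ∀ c ∈ D, b ≠ c → ∀ α ∈ b.2, ∀ β ∈ c.2, Disjoint α.supp β.supp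

end

end Queer

open Queer

/-! The enveloping algebra of `𝔫⁻` is built up by adding one negative root at a time. Each step is a
Poincaré–Birkhoff–Witt isomorphism `Env n ⊗ Env a ≅ Env (n ⊕ a)` of `𝔥`-modules (`Decomp.iso`). Its
injectivity is read off from an action on the module induced from the regular module of `a`. Hence
the component of the supercharacter at `ν` is the sum, over all Kostant partitions `k` of `ν` into
negative roots, of the products of the classes `[S^{k α} 𝔤_α]` (`sch_UnMinus`).

Simple `𝔥`-modules of weight `ν` are irreducible graded Clifford modules. They are unique up to
parity and have dimension `2 ^ ((s + 1) / 2)`, where `s` is the size of the support of `ν`. So every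
term is an integral multiple of `[C(ν)]`, and the dimension controls the size and the parity of the
multiple (`cls_of_wt`). The coefficient is computed differently for even and odd `s`.

For even `s`, the supertrace of the product of the odd generators over the support is a functional
on the Grothendieck group that does not vanish on `[C(ν)]`. On the term of `k` it vanishes unless
the roots that occur in `k`, seen as edges, form a perfect matching of the support
(`perm_vertices_of_chr_ne_zero`). On a matching, exchanging two vertices of the support reverses its
sign. Suppose that two positions carry the same nonzero value and that no position between them
carries the opposite value. Then the exchange of these positions is a sign-reversing involution on
the matchings, and the coefficient is zero (`sum_chr_eq_zero_of_bad`). If there is no such pair of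
positions, there is at most one matching (`IsMatching.unique`). Its term has the dimension of
`C(ν)`, so it is `±[C(ν)]`.

For odd `s`, `C(ν)` is isomorphic to its parity shift, so `2 [C(ν)] = 0`. Only the number, modulo
two, of Kostant partitions with `(s + 1) / 2` edges matters. In such a partition exactly one vertex
has two edges. These are two sides of a triangle of roots `γ = α + β`, and transferring multiplicity
between `γ` and the pair `α`, `β` is an involution without fixed points (`even_card_nearMatching`).
So the coefficient vanishes.

If the coefficient is nonzero, sorting the edges of the unique matching by multiplicity gives the
presentation: edges with equal multiplicities do not interlock, because there are no bad pairs. A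
presentation is determined by `ν`. Its groups consist of the positions with a given absolute value,
and the relation `≺` forces these positions to be paired off in increasing order.

For the blocks, explicit singular vectors in Verma modules, found inside the copy of `𝔮₂` of a
simple root, connect a weight with its reflection if the difference of the two entries is a positive
integer, and with its shift by the root if the two entries have sum zero. Therefore an integral
weight is connected with all its permutations and with its shifts by all atypical roots, and a
weight with a matching can be reduced to zero edge by edge (`Conn.of_isMatching`). Since the
parities of the `C(ν)` are arbitrary, it is also needed that the trivial module and its parity shift
lie in one block; for `n > 0` a nonsplit extension given by the odd trace shows this. -/

namespace Queer

noncomputable section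

open LieSuperalgebra SuperRep TensorProduct

/-! ### Homogeneous components and induction in enveloping algebras -/

namespace SuperRep

variable {L : Type} [AddCommGroup L] [Module ℂ L] [LieSuperalgebra L]

/-- The even component of a vector. -/
def evM (M : SuperRep L) : M.carrier →ₗ[ℂ] M.carrier := (1 / 2 : ℂ) • (LinearMap.id + M.δ)

/-- The odd component of a vector. -/
def odM (M : SuperRep L) : M.carrier →ₗ[ℂ] M.carrier := (1 / 2 : ℂ) • (LinearMap.id - M.δ)

lemma δ_evM (M : SuperRep L) (v : M.carrier) : M.δ (M.evM v) = M.evM v := by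
  simp [evM, M.δ_δ, add_comm]

lemma δ_odM (M : SuperRep L) (v : M.carrier) : M.δ (M.odM v) = -M.odM v := by
  simp [odM, M.δ_δ, ← smul_neg]

lemma δ_evM' (M : SuperRep L) (v : M.carrier) : M.δ (M.evM v) = (-1 : ℂ) ^ 0 • M.evM v := by
  simp [δ_evM]

lemma δ_odM' (M : SuperRep L) (v : M.carrier) : M.δ (M.odM v) = (-1 : ℂ) ^ 1 • M.odM v := by
  simp [δ_odM]

lemma evM_add_odM (M : SuperRep L) (v : M.carrier) : M.evM v + M.odM v = v := by
  simp only [evM, odM, LinearMap.smul_apply, LinearMap.add_apply, LinearMap.sub_apply,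
    LinearMap.id_apply]
  module

lemma evM_δ (M : SuperRep L) (v : M.carrier) : M.evM (M.δ v) = M.evM v := by
  simp [evM, M.δ_δ, add_comm]

lemma odM_δ (M : SuperRep L) (v : M.carrier) : M.odM (M.δ v) = -M.odM v := by
  simp [odM, M.δ_δ, ← smul_neg]

/-- A property of vectors that is additive holds if it holds for homogeneous vectors. -/
lemma hom_induction (M : SuperRep L) {P : M.carrier → Prop}
    (h : ∀ (i : ℕ) v, M.δ v = (-1 : ℂ) ^ i • v → P v) (ha : ∀ v w, P v → P w → P (v + w))
    (v : M.carrier) : P v := by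
  rw [← M.evM_add_odM v]
  exact ha _ _ (h 0 _ (M.δ_evM' v)) (h 1 _ (M.δ_odM' v))

end SuperRep

lemma par_hom_induction {g : Type} [AddCommGroup g] [Module ℂ g] [LieSuperalgebra g] {P : g → Prop}
    (h : ∀ (i : ℕ) v, par v = (-1 : ℂ) ^ i • v → P v) (ha : ∀ v w, P v → P w → P (v + w))
    (v : g) : P v := by
  rw [← ev_add_od v]
  exact ha _ _ (h 0 _ (par_ev v)) (h 1 _ (par_od v))

lemma neg_one_pow_mul_self (k : ℕ) : ((-1 : ℂ) ^ k) * (-1 : ℂ) ^ k = 1 := by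
  rw [← mul_pow]; simp

namespace Env

variable {L : Type} [AddCommGroup L] [Module ℂ L] [LieSuperalgebra L] {M : SuperRep L}
  (B : InvBracket M)

/-- The defining relation of `Env` in a form that is linear in both vectors. -/
lemma ι_mul_linear (v w : M.carrier) : ι B v * ι B w =
    ι B (M.evM w) * ι B v + ι B (M.odM w) * ι B (M.δ v) + ι B (B.β v w) := by
  induction v using M.hom_induction with
  | ha v v' h h' => simp only [map_add, add_mul, mul_add, h, h', LinearMap.add_apply]; abel
  | h i v hv =>
    have h0 := ι_mul B hv (M.δ_evM' w)
    have h1 := ι_mul B hv (M.δ_odM' w)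
    have h2 : ι B (B.β v w) = ι B (B.β v (M.evM w)) + ι B (B.β v (M.odM w)) := by
      rw [← map_add, ← map_add, M.evM_add_odM]
    conv_lhs => rw [← M.evM_add_odM w, map_add, mul_add, h0, h1]
    rw [hv, h2]
    simp only [mul_zero, pow_zero, one_smul, mul_one, map_smul, mul_smul_comm]
    abel

variable {B} in
/-- Induction on `Env` by left multiplication with generators. -/
lemma induction_left {p : Env B → Prop} (h1 : p 1) (hs : ∀ (r : ℂ) a, p a → p (r • a))
    (ha : ∀ a b, p a → p b → p (a + b)) (hm : ∀ v a, p a → p (ι B v * a)) (a : Env B) : p a := by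
  have key : ∀ a b, p b → p (a * b) := by
    intro a
    induction a using Env.induction with
    | h1 r => intro b hb; rw [← Algebra.smul_def]; exact hs r b hb
    | h2 v => exact hm v
    | h3 a b iha ihb => intro c hc; rw [mul_assoc]; exact iha _ (ihb _ hc)
    | h4 a b iha ihb => intro c hc; rw [add_mul]; exact ha _ _ (iha c hc) (ihb c hc)
  simpa using key a 1 h1

end Env

/-! ### Induced modules for a decomposition into two subalgebras -/

/-- A Lie superalgebra `g = n ⊕ b` that is the direct sum of two subalgebras, where `n` is given as
a module `M` with a bracket; `p` is the projection to `n` with kernel `b`. -/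
structure Splitting {L : Type} [AddCommGroup L] [Module ℂ L] [LieSuperalgebra L] {M : SuperRep L}
    (B : InvBracket M) (g : Type) [AddCommGroup g] [Module ℂ g] [LieSuperalgebra g] where
  j : M.carrier →ₗ[ℂ] g
  p : g →ₗ[ℂ] M.carrier
  p_j : ∀ v, p (j v) = v
  j_δ : ∀ v, j (M.δ v) = par (j v)
  p_par : ∀ x, p (par x) = M.δ (p x)
  j_β : ∀ v w, j (B.β v w) = br (j v) (j w)
  p_br : ∀ x y, p x = 0 → p y = 0 → p (br x y) = 0

namespace Splitting

variable {L : Type} [AddCommGroup L] [Module ℂ L] [LieSuperalgebra L] {M : SuperRep L}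
  {B : InvBracket M} {g : Type} [AddCommGroup g] [Module ℂ g] [LieSuperalgebra g]
  (S : Splitting B g)

/-- The projection to `b` with kernel `n`. -/
def q : g →ₗ[ℂ] g := LinearMap.id - S.j ∘ₗ S.p

lemma q_apply (x : g) : S.q x = x - S.j (S.p x) := rfl

lemma p_q (x : g) : S.p (S.q x) = 0 := by simp [q_apply, S.p_j]

lemma q_j (v : M.carrier) : S.q (S.j v) = 0 := by simp [q_apply, S.p_j]

lemma q_of_p {x : g} (h : S.p x = 0) : S.q x = x := by simp [q_apply, h]

lemma j_p_add_q (x : g) : S.j (S.p x) + S.q x = x := by simp [q_apply]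

lemma q_par (x : g) : S.q (par x) = par (S.q x) := by
  simp [q_apply, S.p_par, S.j_δ]

lemma par_j {i : ℕ} {v : M.carrier} (hv : M.δ v = (-1 : ℂ) ^ i • v) :
    par (S.j v) = (-1 : ℂ) ^ i • S.j v := by rw [← S.j_δ, hv, map_smul]

lemma δ_p {i : ℕ} {x : g} (hx : par x = (-1 : ℂ) ^ i • x) :
    M.δ (S.p x) = (-1 : ℂ) ^ i • S.p x := by rw [← S.p_par, hx, map_smul]

lemma par_q {i : ℕ} {x : g} (hx : par x = (-1 : ℂ) ^ i • x) :
    par (S.q x) = (-1 : ℂ) ^ i • S.q x := by rw [← S.q_par, hx, map_smul]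

lemma p_br_j (y : g) (v : M.carrier) :
    S.p (br y (S.j v)) = S.p (br (S.q y) (S.j v)) + B.β (S.p y) v := by
  conv_lhs => rw [← S.j_p_add_q y, map_add, LinearMap.add_apply, ← S.j_β, map_add, S.p_j]
  rw [add_comm]

lemma q_br_j (y : g) (v : M.carrier) :
    S.q (br y (S.j v)) = S.q (br (S.q y) (S.j v)) := by
  conv_lhs => rw [← S.j_p_add_q y, map_add, LinearMap.add_apply, ← S.j_β, map_add, S.q_j, zero_add]

/-- The space `Env n ⊕ Env n ⊗ g`, whose element `u + ∑ uᵢ ⊗ yᵢ` stands for `u + ∑ uᵢ yᵢ`. -/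
abbrev K (B : InvBracket M) (g : Type) [AddCommGroup g] [Module ℂ g] : Type :=
  Env B × (Env B ⊗[ℂ] g)

/-- Right multiplication by an element of `n`. -/
def rmul : M.carrier →ₗ[ℂ] Module.End ℂ (K B g) where
  -- The rule is `u y x = ± u x y + u [y, x]`. The component of `[y, x]` in `n` is absorbed into
  -- `Env n`, the other one stays in the second factor. The sign is produced by pairing the odd
  -- component of `x` with `par y`.
  toFun x := LinearMap.prod
    (LinearMap.coprod (LinearMap.mulRight ℂ (Env.ι B x))
      (LinearMap.mul' ℂ (Env B) ∘ₗ
        TensorProduct.map LinearMap.id (Env.ι B ∘ₗ S.p ∘ₗ br.flip (S.j x))))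
    (LinearMap.coprod 0
      (TensorProduct.map (LinearMap.mulRight ℂ (Env.ι B (M.evM x))) LinearMap.id
        + TensorProduct.map (LinearMap.mulRight ℂ (Env.ι B (M.odM x))) par
        + TensorProduct.map LinearMap.id (S.q ∘ₗ br.flip (S.j x))))
  map_add' x y := by
    refine LinearMap.prod_ext ?_ (TensorProduct.ext' fun u z => ?_)
    · ext u <;> simp [mul_add]
    · simp only [LinearMap.comp_apply, LinearMap.inr_apply, LinearMap.prod_apply, Function.prod,
        LinearMap.coprod_apply, map_zero, zero_add, TensorProduct.map_tmul, LinearMap.id_apply,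
        LinearMap.mul'_apply, LinearMap.flip_apply, map_add, mul_add, LinearMap.add_apply,
        LinearMap.mulRight_apply, tmul_add, add_tmul, LinearMap.zero_apply, Prod.mk_add_mk]
      refine Prod.ext ?_ ?_ <;> dsimp only
      abel
  map_smul' c x := by
    refine LinearMap.prod_ext ?_ (TensorProduct.ext' fun u z => ?_)
    · ext u <;> simp
    · simp [TensorProduct.smul_tmul', smul_add, mul_smul_comm]

lemma rmul_inl (x : M.carrier) (u : Env B) : S.rmul x (u, 0) = (u * Env.ι B x, 0) := by
  simp [rmul]

lemma rmul_inr (x : M.carrier) (u : Env B) (y : g) : S.rmul x (0, u ⊗ₜ y) =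
    (u * Env.ι B (S.p (br y (S.j x))), (u * Env.ι B (M.evM x)) ⊗ₜ y
      + (u * Env.ι B (M.odM x)) ⊗ₜ par y + u ⊗ₜ S.q (br y (S.j x))) := by
  simp [rmul]

lemma rmul_inr_hom {i t : ℕ} {x : M.carrier} {y : g} (hy : par y = (-1 : ℂ) ^ t • y)
    (hx : M.δ x = (-1 : ℂ) ^ i • x) (u : Env B) : S.rmul x (0, u ⊗ₜ y) =
    (u * Env.ι B (S.p (br y (S.j x))), 0) +
      ((-1 : ℂ) ^ (i * t) • (0, (u * Env.ι B x) ⊗ₜ y) + (0, u ⊗ₜ S.q (br y (S.j x)))) := by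
  rw [rmul_inr, Prod.smul_mk, smul_zero, Prod.mk_add_mk, Prod.mk_add_mk, add_zero, add_zero,
    zero_add]
  congr 2
  rcases Nat.even_or_odd i with hi | hi
  · have h1 : M.evM x = x := by
      simp only [evM, LinearMap.smul_apply, LinearMap.add_apply, LinearMap.id_apply, hx,
        hi.neg_one_pow]
      module
    have h2 : M.odM x = 0 := by simp [odM, hx, hi.neg_one_pow]
    simp [h1, h2, (hi.mul_right t).neg_one_pow]
  · have h1 : M.odM x = x := by
      simp only [odM, LinearMap.smul_apply, LinearMap.sub_apply, LinearMap.id_apply, hx,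
        hi.neg_one_pow]
      module
    have h2 : M.evM x = 0 := by simp [evM, hx, hi.neg_one_pow]
    simp [h1, h2, hy, pow_mul, hi.neg_one_pow, TensorProduct.tmul_smul]

/-- On `Env n` this is the defining relation, and on `u ⊗ y` it is the Jacobi identity for `y`, `v`,
`w`. The factors appear in reversed order because right multiplication by `v w` applies `v` first;
thus `Env n` acts from the right. -/
lemma rmul_rel (i k : ℕ) (v w : M.carrier) (hv : M.δ v = (-1 : ℂ) ^ i • v)
    (hw : M.δ w = (-1 : ℂ) ^ k • w) :
    S.rmul w * S.rmul v = (-1 : ℂ) ^ (i * k) • (S.rmul v * S.rmul w) + S.rmul (B.β v w) := by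
  have hβ : M.δ (B.β v w) = (-1 : ℂ) ^ (i + k) • B.β v w := by
    rw [B.δ_β, hv, hw]; simp [smul_smul, pow_add, mul_comm]
  refine LinearMap.prod_ext (LinearMap.ext fun u => ?_) (TensorProduct.ext' fun u y => ?_)
  · simp only [LinearMap.comp_apply, LinearMap.inl_apply, Module.End.mul_apply, rmul_inl,
      LinearMap.add_apply, LinearMap.smul_apply, Prod.smul_mk, smul_zero, Prod.mk_add_mk, add_zero,
      mul_assoc]
    rw [Env.ι_mul B hv hw, mul_add, mul_smul_comm]
  · induction y using par_hom_induction with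
    | ha y z hy hz => simp only [tmul_add, map_add, hy, hz]
    | h t y hy =>
      have hyv := par_br_hom hy (S.par_j hv)
      have hyw := par_br_hom hy (S.par_j hw)
      have hJ := br_jacobi t i y (S.j v) (S.j w) hy (S.par_j hv)
      have hs := br_skew i (t + k) (S.j v) (br y (S.j w)) (S.par_j hv) hyw
      have hp := S.p_br_j (br y (S.j v)) w
      have hp' := S.p_br_j (br y (S.j w)) v
      have hq := S.q_br_j (br y (S.j v)) w
      have hq' := S.q_br_j (br y (S.j w)) v
      have h1 := Env.ι_mul B (S.δ_p hyv) hw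
      have h2 := Env.ι_mul B (S.δ_p hyw) hv
      have h3 := Env.ι_mul B hv hw
      have es : (-1 : ℂ) ^ (t * i) * (-1 : ℂ) ^ (i * (t + k)) = (-1 : ℂ) ^ (i * k) := by
        rw [mul_add, pow_add, ← mul_assoc, mul_comm t i, neg_one_pow_mul_self, one_mul]
      -- The Jacobi identity is brought to the form in which `v` and `w` only stand on the right of
      -- brackets, the only form that `rmul` produces.
      rw [hs, smul_neg, smul_smul, es, ← neg_smul, ← S.j_β] at hJ
      simp only [LinearMap.comp_apply, LinearMap.inr_apply, Module.End.mul_apply,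
        LinearMap.add_apply, LinearMap.smul_apply]
      rw [S.rmul_inr_hom hy hv, S.rmul_inr_hom hy hw, S.rmul_inr_hom hy hβ]
      simp only [map_add, map_smul]
      rw [rmul_inl, rmul_inl, S.rmul_inr_hom hy hw, S.rmul_inr_hom hy hv,
        S.rmul_inr_hom (S.par_q hyv) hw,
        S.rmul_inr_hom (S.par_q hyw) hv, hJ]
      simp only [map_sub, map_add, map_neg, map_smul, hp, hp', hq, hq', mul_assoc, h1, h2, h3, mul_add,
        tmul_add, add_tmul, tmul_sub, tmul_neg, tmul_smul, mul_smul_comm,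
        ← TensorProduct.smul_tmul']
      have n1 := neg_one_pow_mul_self (t * i)
      have n2 := neg_one_pow_mul_self (t * k)
      have n3 := neg_one_pow_mul_self (i * k)
      simp only [add_mul, mul_add, pow_add, mul_comm i t, mul_comm k t, mul_comm k i]
      generalize (-1 : ℂ) ^ (t * i) = a at *
      generalize (-1 : ℂ) ^ (t * k) = b at *
      generalize (-1 : ℂ) ^ (i * k) = c at *
      have n4 : ∀ x : ℂ, c * (x * c) = x := fun x => by rw [mul_comm x c, ← mul_assoc, n3, one_mul]
      ext : 1
      · simp only [Prod.fst_add, Prod.smul_fst, smul_add, mul_smul_comm, mul_add, smul_smul, n4, Prod.fst_zero, smul_zero]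
        module
      · simp only [Prod.snd_add, Prod.smul_snd, smul_add, smul_smul, n4, Prod.snd_zero, smul_zero]
        module

end Splitting

end

end Queer

namespace Queer

noncomputable section

open LieSuperalgebra SuperRep TensorProduct

namespace Splitting

variable {L : Type} [AddCommGroup L] [Module ℂ L] [LieSuperalgebra L] {M : SuperRep L}
  {B : InvBracket M} {g : Type} [AddCommGroup g] [Module ℂ g] [LieSuperalgebra g]
  (S : Splitting B g)

/-- Right multiplication by an element of `n`, in the opposite algebra. -/
def rmulOp : M.carrier →ₗ[ℂ] (Module.End ℂ (K B g))ᵐᵒᵖ where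
  toFun x := MulOpposite.op (S.rmul x)
  map_add' x y := by rw [map_add, MulOpposite.op_add]
  map_smul' c x := by rw [map_smul, MulOpposite.op_smul, RingHom.id_apply]

/-- The right action of `Env n` on `Env n ⊕ Env n ⊗ g`. -/
def rhom : Env B →ₐ[ℂ] (Module.End ℂ (K B g))ᵐᵒᵖ :=
  RingQuot.liftAlgHom ℂ ⟨TensorAlgebra.lift ℂ S.rmulOp, by
    rintro _ _ ⟨i, k, v, w, hv, hw⟩
    simp only [map_mul, map_add, map_smul, TensorAlgebra.lift_ι_apply]
    change MulOpposite.op (S.rmul v) * MulOpposite.op (S.rmul w) = (-1 : ℂ) ^ (i * k) •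
      (MulOpposite.op (S.rmul w) * MulOpposite.op (S.rmul v)) + MulOpposite.op (S.rmul (B.β v w))
    rw [← MulOpposite.op_mul, S.rmul_rel i k v w hv hw, MulOpposite.op_add, MulOpposite.op_smul,
      MulOpposite.op_mul]⟩

/-- The right action of an element of `Env n`. -/
def ract (u : Env B) : Module.End ℂ (K B g) := (S.rhom u).unop

lemma ract_ι (x : M.carrier) : S.ract (Env.ι B x) = S.rmul x := by
  simp [ract, rhom, rmulOp, Env.ι]

lemma ract_mul (u v : Env B) : S.ract (u * v) = S.ract v * S.ract u := by
  simp [ract]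

lemma ract_one : S.ract 1 = 1 := by simp [ract]

lemma ract_add (u v : Env B) : S.ract (u + v) = S.ract u + S.ract v := by simp [ract]

lemma ract_smul (c : ℂ) (u : Env B) : S.ract (c • u) = c • S.ract u := by simp [ract]

/-- Left multiplication on `Env n ⊕ Env n ⊗ g`. -/
def lmul (u : Env B) : Module.End ℂ (K B g) :=
  LinearMap.prodMap (LinearMap.mulLeft ℂ u) (TensorProduct.map (LinearMap.mulLeft ℂ u) LinearMap.id)

lemma lmul_rmul (u : Env B) (x : M.carrier) : lmul u * S.rmul x = S.rmul x * lmul u := by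
  refine LinearMap.prod_ext (LinearMap.ext fun a => ?_) (TensorProduct.ext' fun a y => ?_)
  · simp [lmul, rmul_inl, mul_assoc]
  · simp [lmul, rmul_inr, mul_assoc]

/-- This allows a generator to be pulled out on the left before the rest of a product has been
rewritten. -/
lemma lmul_ract (u v : Env B) : lmul u * S.ract v = S.ract v * lmul u := by
  induction v using Env.induction_left with
  | h1 => rw [ract_one, mul_one, one_mul]
  | hs r a h => rw [ract_smul, mul_smul_comm, smul_mul_assoc, h]
  | ha a b h h' => rw [ract_add, mul_add, add_mul, h, h']
  | hm x a h => rw [ract_mul, ract_ι, ← mul_assoc, h, mul_assoc, lmul_rmul, mul_assoc]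

/-- The element `1 ⊗ z`, with the component of `z` in `n` moved to `Env n`. -/
def κ : g →ₗ[ℂ] K B g :=
  LinearMap.prod (Env.ι B ∘ₗ S.p) (TensorProduct.mk ℂ (Env B) g 1 ∘ₗ S.q)

lemma κ_apply (z : g) : S.κ z = (Env.ι B (S.p z), 1 ⊗ₜ S.q z) := rfl

/-- In `K` this is the identity `z x = ± x z + [z, x]`. It holds for every `z`, also with a
component in `n`, where the bracket of `n` enters through the relation of `Env`. It becomes the
commutation rule on the induced module. -/
lemma rmul_κ (z : g) (x : M.carrier) : S.rmul x (S.κ z) =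
    lmul (Env.ι B (M.evM x)) (S.κ z) + lmul (Env.ι B (M.odM x)) (S.κ (par z))
      + S.κ (br z (S.j x)) := by
  have e0 : S.κ z = (Env.ι B (S.p z), 0) + (0, 1 ⊗ₜ S.q z) := by simp [κ_apply]
  conv_lhs => rw [e0, map_add, rmul_inl, rmul_inr, Env.ι_mul_linear]
  simp only [κ_apply, lmul, LinearMap.prodMap_apply, LinearMap.mulLeft_apply, TensorProduct.map_tmul,
    LinearMap.id_apply, Prod.mk_add_mk, S.p_br_j z x, S.q_br_j z x, S.p_par, S.q_par, one_mul, mul_one,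
    map_add, zero_add]
  congr 1
  abel

/-- A module over the subalgebra `b`, given by operators for all of `g` that are only used on `b`. -/
structure BMod where
  carrier : Type
  [acg : AddCommGroup carrier]
  [mod : Module ℂ carrier]
  δ : Module.End ℂ carrier
  δ_δ : ∀ v, δ (δ v) = v
  σ : g →ₗ[ℂ] Module.End ℂ carrier
  δ_σ : ∀ x v, S.p x = 0 → δ (σ x v) = σ (par x) (δ v)
  σ_br : ∀ (i k : ℕ) (x y : g), S.p x = 0 → S.p y = 0 → par x = (-1 : ℂ) ^ i • x →
    par y = (-1 : ℂ) ^ k • y → σ (br x y) = σ x * σ y - (-1 : ℂ) ^ (i * k) • (σ y * σ x)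

attribute [instance] BMod.acg BMod.mod

variable {S} (C : S.BMod)

/-- The carrier `Env n ⊗ C` of the induced module. -/
abbrev Ind : Type := Env B ⊗[ℂ] C.carrier

/-- The evaluation `u + ∑ uᵢ ⊗ yᵢ ↦ u ⊗ c + ∑ uᵢ ⊗ yᵢ c`. -/
def evalC : C.carrier →ₗ[ℂ] K B g →ₗ[ℂ] Ind C where
  toFun c := LinearMap.coprod ((TensorProduct.mk ℂ (Env B) C.carrier).flip c)
    (TensorProduct.map LinearMap.id (C.σ.flip c))
  map_add' c d := by
    refine LinearMap.prod_ext (LinearMap.ext fun a => ?_) (TensorProduct.ext' fun a y => ?_) <;>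
      simp [tmul_add]
  map_smul' c d := by
    refine LinearMap.prod_ext (LinearMap.ext fun a => ?_) (TensorProduct.ext' fun a y => ?_) <;>
      simp

lemma evalC_mk (c : C.carrier) (u a : Env B) (y : g) :
    evalC C c (u, a ⊗ₜ y) = u ⊗ₜ c + a ⊗ₜ C.σ y c := by simp [evalC]

/-- Left multiplication on the induced module. -/
def lact (u : Env B) : Module.End ℂ (Ind C) :=
  TensorProduct.map (LinearMap.mulLeft ℂ u) LinearMap.id

lemma lact_tmul (u a : Env B) (c : C.carrier) : lact C u (a ⊗ₜ c) = (u * a) ⊗ₜ c := by simp [lact]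

lemma lact_add (u v : Env B) : lact C (u + v) = lact C u + lact C v := by
  refine TensorProduct.ext' fun a c => ?_
  simp [lact_tmul, add_mul, add_tmul]

lemma lact_smul (r : ℂ) (v : Env B) : lact C (r • v) = r • lact C v := by
  refine TensorProduct.ext' fun a c => ?_
  simp [lact_tmul, TensorProduct.smul_tmul']

lemma evalC_lmul (c : C.carrier) (u : Env B) (k : K B g) :
    evalC C c (lmul u k) = lact C u (evalC C c k) := by
  have : evalC C c ∘ₗ lmul u = lact C u ∘ₗ evalC C c := by
    refine LinearMap.prod_ext (LinearMap.ext fun a => ?_) (TensorProduct.ext' fun a y => ?_) <;>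
      simp [lmul, evalC, lact]
  exact LinearMap.congr_fun this k

/-- The action of `g` on the induced module. -/
def gact : g →ₗ[ℂ] Module.End ℂ (Ind C) where
  -- To compute `z (u ⊗ c)`, the product `z u` is rewritten by letting `u` act from the right on
  -- `z`. Afterwards elements of `b` stand next to `c` and can be evaluated.
  toFun z := TensorProduct.lift (LinearMap.mk₂ ℂ (fun u c => evalC C c (S.ract u (S.κ z)))
    (by intros; simp [ract_add]) (by intros; simp [ract_smul]) (by intros; simp) (by intros; simp))
  map_add' x y := TensorProduct.ext' fun a c => by simp
  map_smul' r y := TensorProduct.ext' fun a c => by simp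

lemma gact_tmul (z : g) (u : Env B) (c : C.carrier) :
    gact C z (u ⊗ₜ c) = evalC C c (S.ract u (S.κ z)) := by simp [gact]

lemma gact_one_tmul (z : g) (c : C.carrier) :
    gact C z (1 ⊗ₜ c) = Env.ι B (S.p z) ⊗ₜ c + 1 ⊗ₜ C.σ (S.q z) c := by
  rw [gact_tmul, ract_one, Module.End.one_apply, κ_apply, evalC_mk]

/-- `z (x w) = ± x (z w) + [z, x] w`. -/
lemma gact_lact (z : g) (x : M.carrier) (w : Ind C) : gact C z (lact C (Env.ι B x) w) =
    lact C (Env.ι B (M.evM x)) (gact C z w) + lact C (Env.ι B (M.odM x)) (gact C (par z) w)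
      + gact C (br z (S.j x)) w := by
  induction w using TensorProduct.induction_on with
  | zero => simp
  | add a b ha hb => simp only [map_add, ha, hb]; abel
  | tmul u c =>
    rw [lact_tmul]
    simp only [gact_tmul]
    rw [ract_mul, ract_ι, Module.End.mul_apply, rmul_κ, map_add, map_add, map_add, map_add,
      ← evalC_lmul, ← evalC_lmul, ← Module.End.mul_apply, ← lmul_ract, ← Module.End.mul_apply (S.ract u),
      ← lmul_ract]
    rfl

lemma gact_lact_hom {s i : ℕ} {z : g} {x : M.carrier} (hz : par z = (-1 : ℂ) ^ s • z)
    (hx : M.δ x = (-1 : ℂ) ^ i • x) (w : Ind C) : gact C z (lact C (Env.ι B x) w) =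
    (-1 : ℂ) ^ (s * i) • lact C (Env.ι B x) (gact C z w) + gact C (br z (S.j x)) w := by
  rw [gact_lact, hz, map_smul]
  congr 1
  rcases Nat.even_or_odd i with hi | hi
  · have h1 : M.evM x = x := by
      simp only [evM, LinearMap.smul_apply, LinearMap.add_apply, LinearMap.id_apply, hx,
        hi.neg_one_pow]
      module
    have h2 : M.odM x = 0 := by simp [odM, hx, hi.neg_one_pow]
    have h3 : lact C (0 : Env B) = 0 := by simpa using lact_smul C 0 0
    simp [h1, h2, h3, (hi.mul_left s).neg_one_pow]
  · have h1 : M.odM x = x := by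
      simp only [odM, LinearMap.smul_apply, LinearMap.sub_apply, LinearMap.id_apply, hx,
        hi.neg_one_pow]
      module
    have h2 : M.evM x = 0 := by simp [evM, hx, hi.neg_one_pow]
    have h3 : lact C (0 : Env B) = 0 := by simpa using lact_smul C 0 0
    rw [mul_comm s i, pow_mul, hi.neg_one_pow]
    simp [h1, h2, h3]

/-- Elements of `n` act by left multiplication. -/
lemma gact_j (x : M.carrier) : gact C (S.j x) = lact C (Env.ι B x) := by
  refine TensorProduct.ext' fun u c => ?_
  induction u using Env.induction_left generalizing x with
  | h1 => simp [gact_one_tmul, lact_tmul, S.p_j, S.q_j]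
  | hs r a h => rw [← TensorProduct.smul_tmul', map_smul, h, map_smul]
  | ha a b h h' => rw [add_tmul, map_add, h, h', map_add]
  | hm v a h =>
    rw [← lact_tmul, gact_lact, ← S.j_δ, ← S.j_β, h, h, h]
    simp only [lact_tmul, ← mul_assoc, ← add_tmul, ← add_mul, Env.ι_mul_linear B x v]

/-- Induction on the induced module. -/
lemma Ind.induction {P : Ind C → Prop} (h1 : ∀ c, P (1 ⊗ₜ c)) (ha : ∀ v w, P v → P w → P (v + w))
    (hm : ∀ (i : ℕ) x w, M.δ x = (-1 : ℂ) ^ i • x → P w → P (lact C (Env.ι B x) w)) (w : Ind C) :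
    P w := by
  induction w using TensorProduct.induction_on with
  | zero => simpa using h1 0
  | add a b h h' => exact ha _ _ h h'
  | tmul u c =>
    have hm' : ∀ x w, P w → P (lact C (Env.ι B x) w) := by
      intro x w hw
      rw [← M.evM_add_odM x, map_add, lact_add]
      exact ha _ _ (hm 0 _ _ (M.δ_evM' x) hw) (hm 1 _ _ (M.δ_odM' x) hw)
    induction u using Env.induction_left generalizing c with
    | h1 => exact h1 c
    | hs r a h => rw [TensorProduct.smul_tmul]; exact h _
    | ha a b h h' => rw [add_tmul]; exact ha _ _ (h c) (h' c)
    | hm v a h => rw [← lact_tmul]; exact hm' _ _ (h c)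

lemma gact_neg (x : g) (w : Ind C) : gact C (-x) w = -gact C x w := by
  rw [← neg_one_smul ℂ, map_smul, LinearMap.smul_apply]
  exact neg_one_smul ℂ (gact C x w)

lemma gact_sub (x y : g) (w : Ind C) : gact C (x - y) w = gact C x w - gact C y w := by
  rw [sub_eq_add_neg, map_add, LinearMap.add_apply, gact_neg, sub_eq_add_neg]

/-- Induction on the vector. On `1 ⊗ c` both elements are split along `n ⊕ b`: two elements of `b`
use the module structure of `C`, an element of `n` on the right uses the commutation rule, and skew
symmetry covers the remaining case. Passing to `x w` is the Jacobi identity for `z`, `z'`, `x`,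
applied to brackets for which the claim on `w` is already known. -/
lemma gact_br (s t : ℕ) (z z' : g) (hz : par z = (-1 : ℂ) ^ s • z)
    (hz' : par z' = (-1 : ℂ) ^ t • z') (w : Ind C) : gact C (br z z') w =
      gact C z (gact C z' w) - (-1 : ℂ) ^ (s * t) • gact C z' (gact C z w) := by
  have hn : ∀ (s t : ℕ) (z : g) (x : M.carrier) (w : Ind C) (hz : par z = (-1 : ℂ) ^ s • z)
      (hx : M.δ x = (-1 : ℂ) ^ t • x), gact C (br z (S.j x)) w =
      gact C z (gact C (S.j x) w) - (-1 : ℂ) ^ (s * t) • gact C (S.j x) (gact C z w) := by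
    intro s t z x w hz hx
    rw [gact_j, gact_lact_hom C hz hx]
    abel
  induction w using Ind.induction generalizing s t z z' with
  | ha v w h h' => simp only [map_add, h s t z z' hz hz', h' s t z z' hz hz', smul_add]; abel
  | h1 c =>
    have hb : gact C (br (S.q z) (S.q z')) (1 ⊗ₜ c) = gact C (S.q z) (gact C (S.q z') (1 ⊗ₜ c))
        - (-1 : ℂ) ^ (s * t) • gact C (S.q z') (gact C (S.q z) (1 ⊗ₜ c)) := by
      have hbr := C.σ_br s t (S.q z) (S.q z') (S.p_q z) (S.p_q z') (S.par_q hz) (S.par_q hz')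
      have hp := S.p_br _ _ (S.p_q z) (S.p_q z')
      simp only [gact_one_tmul, S.p_q, hp, S.q_of_p hp, S.q_of_p (S.p_q z), S.q_of_p (S.p_q z'),
        map_zero, zero_tmul, zero_add, hbr, LinearMap.sub_apply, LinearMap.smul_apply,
        Module.End.mul_apply, tmul_sub, tmul_smul]
    have h1 := hn s t (S.q z) (S.p z') (1 ⊗ₜ c) (S.par_q hz) (S.δ_p hz')
    have h2 := hn s t (S.j (S.p z)) (S.p z') (1 ⊗ₜ c) (S.par_j (S.δ_p hz)) (S.δ_p hz')
    have h3 := hn t s (S.q z') (S.p z) (1 ⊗ₜ c) (S.par_q hz') (S.δ_p hz)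
    have h4 : br (S.j (S.p z)) (S.q z') = -((-1 : ℂ) ^ (s * t) • br (S.q z') (S.j (S.p z))) :=
      br_skew s t _ _ (S.par_j (S.δ_p hz)) (S.par_q hz')
    have e := neg_one_pow_mul_self (s * t)
    rw [mul_comm t s] at h3
    generalize (-1 : ℂ) ^ (s * t) = r at *
    conv_lhs => rw [← S.j_p_add_q z, ← S.j_p_add_q z']
    conv_rhs => rw [← S.j_p_add_q z, ← S.j_p_add_q z']
    simp only [map_add, LinearMap.add_apply, hb, h1, h2, h4, gact_neg, map_smul,
      LinearMap.smul_apply, h3, smul_sub, smul_smul, e, one_smul, smul_add]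
    abel
  | hm i x w hx h =>
    have hzx := par_br_hom hz (S.par_j hx)
    have hzx' := par_br_hom hz' (S.par_j hx)
    have hJ := br_jacobi s t z z' (S.j x) hz hz'
    have e1 := h s t z z' hz hz'
    have e2 := h s (t + i) z _ hz hzx'
    have e3 := h t (s + i) z' _ hz' hzx
    rw [gact_lact_hom C (par_br_hom hz hz') hx, gact_lact_hom C hz' hx, gact_lact_hom C hz hx,
      eq_sub_of_add_eq hJ.symm, gact_sub, map_smul, LinearMap.smul_apply, e1, e2, e3]
    simp only [map_add, map_sub, map_smul, gact_lact_hom C hz' hx, gact_lact_hom C hz hx]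
    have n1 := neg_one_pow_mul_self (s * t)
    simp only [add_mul, mul_add, pow_add, mul_comm t s]
    generalize (-1 : ℂ) ^ (s * t) = a at *
    generalize (-1 : ℂ) ^ (s * i) = b at *
    generalize (-1 : ℂ) ^ (t * i) = c at *
    have n4 : ∀ x : ℂ, a * (a * x) = x := fun x => by rw [← mul_assoc, n1, one_mul]
    simp only [smul_sub, smul_add, smul_smul, n4]
    rw [mul_comm c b, mul_comm a (b * c)]
    abel

/-- The parity involution of the induced module. -/
def indδ : Module.End ℂ (Ind C) := TensorProduct.map (Env.θ B).toLinearMap C.δ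

lemma indδ_lact (x : M.carrier) (w : Ind C) :
    indδ C (lact C (Env.ι B x) w) = lact C (Env.ι B (M.δ x)) (indδ C w) := by
  induction w using TensorProduct.induction_on with
  | zero => simp
  | add a b h h' => simp only [map_add, h, h']
  | tmul u c => simp [lact_tmul, indδ]

lemma indδ_gact (z : g) (w : Ind C) : indδ C (gact C z w) = gact C (par z) (indδ C w) := by
  induction w using Ind.induction generalizing z with
  | h1 c =>
    rw [gact_one_tmul]
    simp only [indδ, map_add, TensorProduct.map_tmul, AlgHom.toLinearMap_apply, Env.θ_ι, map_one,
      gact_one_tmul, S.p_par, S.q_par, C.δ_σ _ _ (S.p_q z)]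
  | ha v w h h' => simp only [map_add, h, h']
  | hm i x w hx h =>
    rw [gact_lact, indδ_lact, gact_lact, map_add, map_add, indδ_lact, indδ_lact, h, h, h,
      M.evM_δ, M.odM_δ, M.δ_evM, M.δ_odM, par_par, par_br, S.j_δ]

/-- The induced module `Ind_b^g C = Env n ⊗ C`. -/
def ind : SuperRep g where
  carrier := Ind C
  δ := indδ C
  δ_δ w := by
    induction w using TensorProduct.induction_on with
    | zero => simp
    | add a b h h' => simp only [map_add, h, h']
    | tmul u c => simp [indδ, C.δ_δ, Env.θ_θ]
  ρ := gact C
  δ_ρ := indδ_gact C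
  ρ_br i k x y hx hy := LinearMap.ext fun w => gact_br C i k x y hx hy w

end Splitting

end

end Queer

namespace Queer

noncomputable section

open LieSuperalgebra SuperRep TensorProduct

/-! ### The Poincaré–Birkhoff–Witt isomorphism for a decomposition -/

namespace Env

variable {L : Type} [AddCommGroup L] [Module ℂ L] [LieSuperalgebra L] {M N : SuperRep L}

lemma act_mul (B : InvBracket M) (x : L) (a b : Env B) :
    act B x (a * b) = act B x a * b + a * act B (ev x) b + θ B a * act B (od x) b := by
  rw [act_eq_der B (par_ev x), act_eq_der B (par_od x), act_apply, act_apply, der_mul, der_mul]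
  simp only [pow_zero, pow_one, AlgHom.one_apply, add_mul]
  abel

lemma act_one (B : InvBracket M) (x : L) : act B x 1 = 0 := by
  rw [act_apply, ← map_one (algebraMap ℂ (Env B)), der_algebraMap, der_algebraMap, add_zero]

/-- Functoriality of `Env`. -/
def map (B : InvBracket M) (B' : InvBracket N) (f : M.carrier →ₗ[ℂ] N.carrier)
    (hδ : ∀ v, f (M.δ v) = N.δ (f v)) (hβ : ∀ v w, f (B.β v w) = B'.β (f v) (f w)) :
    Env B →ₐ[ℂ] Env B' :=
  lift B (ι B' ∘ₗ f) fun i j v w hv hw => by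
    have h := ι_mul B' (v := f v) (w := f w) (i := i) (j := j) (by rw [← hδ, hv, map_smul])
      (by rw [← hδ, hw, map_smul])
    simpa [hβ] using h

section

variable (B : InvBracket M) (B' : InvBracket N) (f : M.carrier →ₗ[ℂ] N.carrier)
    (hδ : ∀ v, f (M.δ v) = N.δ (f v)) (hβ : ∀ v w, f (B.β v w) = B'.β (f v) (f w))

lemma map_ι (v : M.carrier) : map B B' f hδ hβ (ι B v) = ι B' (f v) := by simp [map]

lemma map_θ (a : Env B) : map B B' f hδ hβ (θ B a) = θ B' (map B B' f hδ hβ a) := by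
  have : (map B B' f hδ hβ).comp (θ B) = (θ B').comp (map B B' f hδ hβ) :=
    hom_ext B fun v => by simp [map_ι, hδ]
  exact DFunLike.congr_fun this a

lemma map_act (hρ : ∀ x v, f (M.ρ x v) = N.ρ x (f v)) (x : L) (a : Env B) :
    map B B' f hδ hβ (act B x a) = act B' x (map B B' f hδ hβ a) := by
  induction a using Env.induction generalizing x with
  | h1 r =>
    rw [AlgHom.commutes, Algebra.algebraMap_eq_smul_one, Algebra.algebraMap_eq_smul_one, (act B x).map_smul,
      (act B' x).map_smul, act_one, act_one, smul_zero, smul_zero, map_zero]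
  | h2 v => rw [act_ι, map_ι, map_ι, act_ι, hρ]
  | h3 a b ha hb =>
    rw [act_mul, map_mul, act_mul, map_add, map_add, map_mul, map_mul, map_mul, ha, hb, hb, map_θ]
  | h4 a b ha hb => simp only [map_add, ha, hb]

lemma map_isHom (hf : IsHom M N f) : IsHom (rep B) (rep B') (map B B' f hf.1 hβ).toLinearMap :=
  ⟨map_θ B B' f hf.1 hβ, map_act B B' f hf.1 hβ hf.2⟩

end

end Env

/-- A Lie superalgebra `g` in the category of `L`-modules that is the direct sum of two invariant
subalgebras `n` and `a`. -/
structure Decomp {L : Type} [AddCommGroup L] [Module ℂ L] [LieSuperalgebra L] {M N A : SuperRep L}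
    (Bg : InvBracket M) (B : InvBracket N) (Ba : InvBracket A) [LieSuperalgebra M.carrier] where
  S : Splitting B M.carrier
  par_eq : ∀ v : M.carrier, par v = M.δ v
  br_eq : ∀ v w : M.carrier, br v w = Bg.β v w
  j_hom : IsHom N M S.j
  ja : A.carrier →ₗ[ℂ] M.carrier
  pa : M.carrier →ₗ[ℂ] A.carrier
  ja_hom : IsHom A M ja
  pa_ja : ∀ v, pa (ja v) = v
  p_ja : ∀ v, S.p (ja v) = 0
  ja_pa : ∀ v, ja (pa v) = S.q v
  ja_β : ∀ v w, ja (Ba.β v w) = Bg.β (ja v) (ja w)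

namespace Decomp

variable {L : Type} [AddCommGroup L] [Module ℂ L] [LieSuperalgebra L] {M N A : SuperRep L}
  {Bg : InvBracket M} {B : InvBracket N} {Ba : InvBracket A} [LieSuperalgebra M.carrier]
  (D : Decomp Bg B Ba)

/-- The regular module of the complement `a`. -/
abbrev regular : D.S.BMod where
  carrier := Env Ba
  δ := (Env.θ Ba).toLinearMap
  δ_δ := Env.θ_θ Ba
  σ := LinearMap.mul ℂ (Env Ba) ∘ₗ Env.ι Ba ∘ₗ D.pa
  δ_σ x v hx := by
    have h : D.pa (par x) = A.δ (D.pa x) := by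
      rw [← D.S.q_of_p hx, ← D.ja_pa, D.par_eq, ← D.ja_hom.1, D.pa_ja, D.pa_ja]
    simp [h]
  σ_br i k x y hx hy hpx hpy := by
    have hx' := D.ja_pa x
    have hy' := D.ja_pa y
    rw [D.S.q_of_p hx] at hx'
    rw [D.S.q_of_p hy] at hy'
    have e : ∀ i v, par (D.ja v) = (-1 : ℂ) ^ i • D.ja v → A.δ v = (-1 : ℂ) ^ i • v := by
      intro i v hv
      rw [D.par_eq, ← D.ja_hom.1, ← map_smul] at hv
      simpa [D.pa_ja] using congrArg D.pa hv
    have h := Env.ι_mul Ba (e i (D.pa x) (by rw [hx', hpx])) (e k (D.pa y) (by rw [hy', hpy]))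
    have hb : D.pa (br x y) = Ba.β (D.pa x) (D.pa y) := by
      conv_lhs => rw [← hx', ← hy', D.br_eq, ← D.ja_β, D.pa_ja]
    refine LinearMap.ext fun u => ?_
    simp only [LinearMap.comp_apply, LinearMap.mul_apply', hb, LinearMap.sub_apply, LinearMap.smul_apply,
      Module.End.mul_apply, ← mul_assoc, h, add_mul, smul_mul_assoc, add_sub_cancel_left]

/-- The map `Env n → Env g`. -/
def incl : Env B →ₐ[ℂ] Env Bg :=
  Env.map B Bg D.S.j D.j_hom.1 fun v w => by rw [D.S.j_β, D.br_eq]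

/-- The map `Env a → Env g`. -/
def incla : Env Ba →ₐ[ℂ] Env Bg := Env.map Ba Bg D.ja D.ja_hom.1 D.ja_β

/-- The multiplication map `Env n ⊗ Env a → Env g`. -/
def mulMap : Env B ⊗[ℂ] Env Ba →ₗ[ℂ] Env Bg :=
  LinearMap.mul' ℂ (Env Bg) ∘ₗ TensorProduct.map D.incl.toLinearMap D.incla.toLinearMap

lemma mulMap_tmul (u : Env B) (s : Env Ba) : D.mulMap (u ⊗ₜ s) = D.incl u * D.incla s := by
  simp [mulMap]

lemma mulMap_isHom : IsHom ((Env.rep B).tensor (Env.rep Ba)) (Env.rep Bg) D.mulMap := by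
  have h1 := Env.map_isHom B Bg D.S.j (fun v w => by rw [D.S.j_β, D.br_eq]) D.j_hom
  have h2 := Env.map_isHom Ba Bg D.ja D.ja_β D.ja_hom
  have a1 : ∀ (u : Env B) (s : Env Ba),
      D.mulMap (Env.θ B u ⊗ₜ Env.θ Ba s) = Env.θ Bg (D.mulMap (u ⊗ₜ s)) := by
    intro u s
    rw [mulMap_tmul, mulMap_tmul, map_mul]
    exact congrArg₂ _ (h1.1 u) (h2.1 s)
  have a2 : ∀ (x : L) (u : Env B) (s : Env Ba),
      D.mulMap (Env.act B x u ⊗ₜ s + u ⊗ₜ Env.act Ba (ev x) s + Env.θ B u ⊗ₜ Env.act Ba (od x) s) =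
        Env.act Bg x (D.mulMap (u ⊗ₜ s)) := by
    intro x u s
    rw [map_add, map_add, mulMap_tmul, mulMap_tmul, mulMap_tmul, mulMap_tmul, Env.act_mul]
    exact congrArg₂ _ (congrArg₂ _ (congrArg (· * D.incla s) (h1.2 x u))
      (congrArg (D.incl u * ·) (h2.2 (ev x) s))) (congrArg₂ _ (h1.1 u) (h2.2 (od x) s))
  exact Gr.isHom_of_comp (TensorProduct.ext' fun u s => a1 u s) fun x =>
    TensorProduct.ext' fun u s => (congrArg D.mulMap (tensorρ_tmul _ _ x u s)).trans (a2 x u s)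

/-- The action of `Env g` on the module induced from the regular module of `a`. -/
def gHom : Env Bg →ₐ[ℂ] Module.End ℂ (Splitting.Ind D.regular) :=
  RingQuot.liftAlgHom ℂ ⟨TensorAlgebra.lift ℂ (Splitting.gact D.regular), by
    rintro _ _ ⟨i, k, v, w, hv, hw⟩
    simp only [map_mul, map_add, map_smul, TensorAlgebra.lift_ι_apply]
    refine LinearMap.ext fun x => ?_
    have h := Splitting.gact_br D.regular i k v w (by rw [D.par_eq, hv]) (by rw [D.par_eq, hw]) x
    rw [D.br_eq] at h
    simp only [LinearMap.add_apply, LinearMap.smul_apply, Module.End.mul_apply, h]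
    exact (add_sub_cancel _ _).symm⟩

lemma gHom_ι (v : M.carrier) : D.gHom (Env.ι Bg v) = Splitting.gact D.regular v := by
  simp [gHom, Env.ι]

/-- Acting on `1 ⊗ 1` is a left inverse of the multiplication map: the factor from `a` acts first,
by multiplication in the second tensor factor, and the one from `n` then multiplies in the first.
Hence `mulMap` is injective. -/
lemma gHom_mulMap (w : Splitting.Ind D.regular) :
    D.gHom (D.mulMap w) ((1 : Env B) ⊗ₜ[ℂ] (1 : Env Ba)) = w := by
  have h1 : ∀ s : Env Ba, D.gHom (D.incla s) ((1 : Env B) ⊗ₜ[ℂ] (1 : Env Ba)) = 1 ⊗ₜ s := by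
    intro s
    induction s using Env.induction_left with
    | h1 => rw [map_one, map_one, Module.End.one_apply]
    | hs r a h =>
      rw [map_smul, map_smul, LinearMap.smul_apply, h]
      exact (TensorProduct.tmul_smul r (1 : Env B) a).symm
    | ha a b h h' =>
      rw [map_add, map_add, LinearMap.add_apply, h, h']
      exact (TensorProduct.tmul_add (1 : Env B) a b).symm
    | hm v a h =>
      rw [map_mul, map_mul, Module.End.mul_apply, h, incla, Env.map_ι, gHom_ι]
      have e0 := Splitting.gact_one_tmul D.regular (D.ja v) a
      rw [D.p_ja, D.S.q_of_p (D.p_ja v), map_zero, zero_tmul, zero_add] at e0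
      have e1 : D.regular.σ (D.ja v) a = Env.ι Ba v * a :=
        congrArg (fun y => Env.ι Ba y * a) (D.pa_ja v)
      exact e0.trans (congrArg (fun y => (1 : Env B) ⊗ₜ[ℂ] y) e1)
  induction w using TensorProduct.induction_on with
  | zero => rw [map_zero, map_zero, LinearMap.zero_apply]
  | add a b h h' => rw [map_add, map_add, LinearMap.add_apply, h, h']
  | tmul u s =>
    induction u using Env.induction_left with
    | h1 => rw [mulMap_tmul, map_one, one_mul]; exact h1 s
    | hs r a h =>
      rw [← TensorProduct.smul_tmul', map_smul, map_smul, LinearMap.smul_apply, h]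
    | ha a b h h' => rw [add_tmul, map_add, map_add, LinearMap.add_apply, h, h']
    | hm v a h =>
      rw [mulMap_tmul] at h ⊢
      rw [map_mul D.incl, mul_assoc, map_mul D.gHom, Module.End.mul_apply, h, incl, Env.map_ι, gHom_ι,
        Splitting.gact_j, Splitting.lact_tmul]

/-- Makes the range of `mulMap` stable under left multiplication by generators; as it contains `1`,
`mulMap` is surjective. -/
lemma mulMap_gact (z : M.carrier) (w : Splitting.Ind D.regular) :
    D.mulMap (Splitting.gact D.regular z w) = Env.ι Bg z * D.mulMap w := by
  have hl : ∀ v w, D.mulMap (Splitting.lact D.regular (Env.ι B v) w) =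
      Env.ι Bg (D.S.j v) * D.mulMap w := by
    intro v w
    induction w using TensorProduct.induction_on with
    | zero => rw [map_zero, map_zero, mul_zero]
    | add a b h h' => rw [map_add, map_add, map_add, mul_add, h, h']
    | tmul u s =>
      rw [Splitting.lact_tmul]
      refine (D.mulMap_tmul _ _).trans ?_
      rw [map_mul, mul_assoc, incl, Env.map_ι]
      exact congrArg _ (D.mulMap_tmul u s).symm
  induction w using Splitting.Ind.induction generalizing z with
  | h1 s =>
    rw [Splitting.gact_one_tmul, map_add]
    have e1 := D.mulMap_tmul (Env.ι B (D.S.p z)) s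
    have e2 := D.mulMap_tmul 1 (Env.ι Ba (D.pa (D.S.q z)) * s)
    have e3 := D.mulMap_tmul 1 s
    refine (congrArg₂ _ e1 e2).trans (Eq.trans ?_ (congrArg _ e3.symm))
    rw [map_one, one_mul, one_mul, map_mul, ← add_mul, incl, incla, Env.map_ι, Env.map_ι, ← map_add,
      D.ja_pa, D.S.q_of_p (D.S.p_q z), D.S.j_p_add_q]
  | ha v w h h' => rw [map_add, map_add, h, h', map_add, mul_add]
  | hm i x w hx h =>
    have e1 : M.evM (D.S.j x) = D.S.j (N.evM x) := by
      simp [evM, D.j_hom.1]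
    have e2 : M.odM (D.S.j x) = D.S.j (N.odM x) := by
      simp [odM, D.j_hom.1]
    rw [Splitting.gact_lact, map_add, map_add, hl, hl, hl, h, h, h, ← mul_assoc, ← mul_assoc, ← mul_assoc,
      ← add_mul, ← add_mul, Env.ι_mul_linear Bg z, e1, e2, D.par_eq, D.br_eq]

/-- The Poincaré–Birkhoff–Witt theorem for a decomposition `g = n ⊕ a`. -/
theorem iso (D : Decomp Bg B Ba) : Iso ((Env.rep B).tensor (Env.rep Ba)) (Env.rep Bg) := by
  have hs : Function.Surjective D.mulMap := by
    intro u
    induction u using Env.induction_left with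
    | h1 => exact ⟨(1 : Env B) ⊗ₜ[ℂ] (1 : Env Ba), by rw [mulMap_tmul, map_one, map_one, mul_one]⟩
    | hs r a h => obtain ⟨w, rfl⟩ := h; exact ⟨r • w, map_smul _ _ _⟩
    | ha a b h h' => obtain ⟨w, rfl⟩ := h; obtain ⟨w', rfl⟩ := h'; exact ⟨w + w', map_add _ _ _⟩
    | hm v a h => obtain ⟨w, rfl⟩ := h; exact ⟨_, D.mulMap_gact v w⟩
  exact ⟨D.mulMap, D.mulMap_isHom, Function.LeftInverse.injective
    (g := fun u => D.gHom u ((1 : Env B) ⊗ₜ[ℂ] (1 : Env Ba))) D.gHom_mulMap, hs⟩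

end Decomp

end

end Queer

namespace Queer

noncomputable section

open LieSuperalgebra SuperRep TensorProduct

/-! ### Isomorphisms, submodules, quotients and sums of modules -/

namespace SuperRep

variable {L : Type} [AddCommGroup L] [Module ℂ L] [LieSuperalgebra L]

lemma Iso.symm {M N : SuperRep L} (h : Iso M N) : Iso N M := by
  obtain ⟨f, hf, hb⟩ := h
  let e := LinearEquiv.ofBijective f hb
  have he : ∀ v, f (e.symm v) = v := e.apply_symm_apply
  refine ⟨e.symm.toLinearMap, ⟨fun v => ?_, fun x v => ?_⟩, e.symm.bijective⟩
  · apply hb.1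
    change f (e.symm _) = f (M.δ (e.symm v))
    rw [he, hf.1, he]
  · apply hb.1
    change f (e.symm _) = f (M.ρ x (e.symm v))
    rw [he, hf.2, he]

lemma IsHom.comp {M N P : SuperRep L} {g : N.carrier →ₗ[ℂ] P.carrier}
    {f : M.carrier →ₗ[ℂ] N.carrier} (hg : IsHom N P g) (hf : IsHom M N f) : IsHom M P (g ∘ₗ f) :=
  ⟨fun v => by rw [LinearMap.comp_apply, hf.1, hg.1]; rfl,
    fun x v => by rw [LinearMap.comp_apply, hf.2, hg.2]; rfl⟩

lemma Iso.trans {M N P : SuperRep L} (h : Iso M N) (h' : Iso N P) : Iso M P := by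
  obtain ⟨f, hf, hb⟩ := h
  obtain ⟨g, hg, hb'⟩ := h'
  exact ⟨g ∘ₗ f, hg.comp hf, hb'.comp hb⟩

/-- The quotient by a graded submodule. -/
def quot (M : SuperRep L) (N : Submodule ℂ M.carrier) (h : IsSub M N) : SuperRep L where
  carrier := M.carrier ⧸ N
  δ := N.mapQ N M.δ h.1
  δ_δ v := by
    induction v using Submodule.Quotient.induction_on with
    | H v => simp [M.δ_δ]
  ρ :=
    { toFun := fun x => N.mapQ N (M.ρ x) (h.2 x)
      map_add' := fun x y => by ext v; simp
      map_smul' := fun c x => by ext v; simp }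
  δ_ρ x v := by
    induction v using Submodule.Quotient.induction_on with
    | H v => simp [M.δ_ρ]
  ρ_br i j x y hx hy := by
    ext v
    simp [M.ρ_br i j x y hx hy]

lemma quot_mkQ_isHom (M : SuperRep L) (N : Submodule ℂ M.carrier) (h : IsSub M N) :
    IsHom M (M.quot N h) N.mkQ := ⟨fun _ => rfl, fun _ _ => rfl⟩

lemma sub_subtype_isHom (M : SuperRep L) (N : Submodule ℂ M.carrier) (h : IsSub M N) :
    IsHom (M.sub N h) M N.subtype := ⟨fun _ => rfl, fun _ _ => rfl⟩

lemma IsHom.ker {M N : SuperRep L} {f : M.carrier →ₗ[ℂ] N.carrier} (hf : IsHom M N f) :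
    IsSub M (LinearMap.ker f) :=
  ⟨fun v hv => by rw [LinearMap.mem_ker] at *; rw [hf.1, hv, map_zero],
    fun x v hv => by rw [LinearMap.mem_ker] at *; rw [hf.2, hv, map_zero]⟩

lemma IsHom.map {M N : SuperRep L} {f : M.carrier →ₗ[ℂ] N.carrier} (hf : IsHom M N f)
    {X : Submodule ℂ M.carrier} (hX : IsSub M X) : IsSub N (X.map f) := by
  constructor
  · rintro _ ⟨v, hv, rfl⟩
    exact ⟨_, hX.1 v hv, hf.1 v⟩
  · rintro x _ ⟨v, hv, rfl⟩
    exact ⟨_, hX.2 x v hv, hf.2 x v⟩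

lemma IsHom.comap {M N : SuperRep L} {f : M.carrier →ₗ[ℂ] N.carrier} (hf : IsHom M N f)
    {X : Submodule ℂ N.carrier} (hX : IsSub N X) : IsSub M (X.comap f) := by
  constructor
  · intro v hv
    rw [Submodule.mem_comap] at *
    rw [hf.1]
    exact hX.1 _ hv
  · intro x v hv
    rw [Submodule.mem_comap] at *
    rw [hf.2]
    exact hX.2 x _ hv

lemma isSub_top (M : SuperRep L) : IsSub M ⊤ := ⟨fun _ _ => trivial, fun _ _ _ => trivial⟩

lemma isSub_bot (M : SuperRep L) : IsSub M ⊥ := by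
  constructor
  · intro v hv
    rw [Submodule.mem_bot] at *
    rw [hv, map_zero]
  · intro x v hv
    rw [Submodule.mem_bot] at *
    rw [hv, map_zero]

lemma IsHom.range {M N : SuperRep L} {f : M.carrier →ₗ[ℂ] N.carrier} (hf : IsHom M N f) :
    IsSub N (LinearMap.range f) := by
  rw [LinearMap.range_eq_map]
  exact hf.map M.isSub_top

lemma IsSub.sup {M : SuperRep L} {X Y : Submodule ℂ M.carrier} (hX : IsSub M X) (hY : IsSub M Y) :
    IsSub M (X ⊔ Y) := by
  constructor
  · intro v hv
    obtain ⟨a, ha, b, hb, rfl⟩ := Submodule.mem_sup.1 hv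
    rw [map_add]
    exact Submodule.add_mem_sup (hX.1 a ha) (hY.1 b hb)
  · intro x v hv
    obtain ⟨a, ha, b, hb, rfl⟩ := Submodule.mem_sup.1 hv
    rw [map_add]
    exact Submodule.add_mem_sup (hX.2 x a ha) (hY.2 x b hb)

lemma IsSub.inf {M : SuperRep L} {X Y : Submodule ℂ M.carrier} (hX : IsSub M X) (hY : IsSub M Y) :
    IsSub M (X ⊓ Y) :=
  ⟨fun v hv => ⟨hX.1 v hv.1, hY.1 v hv.2⟩, fun x v hv => ⟨hX.2 x v hv.1, hY.2 x v hv.2⟩⟩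

lemma isSub_sSup {M : SuperRep L} {S : Set (Submodule ℂ M.carrier)} (h : ∀ X ∈ S, IsSub M X) :
    IsSub M (sSup S) := by
  constructor
  · have : sSup S ≤ (sSup S).comap M.δ :=
      sSup_le fun X hX v hv => (le_sSup hX : X ≤ _) ((h X hX).1 v hv)
    exact this
  · intro x
    have : sSup S ≤ (sSup S).comap (M.ρ x) :=
      sSup_le fun X hX v hv => (le_sSup hX : X ≤ _) ((h X hX).2 x v hv)
    exact this

/-- The direct sum of two modules. -/
def prod (M N : SuperRep L) : SuperRep L where
  carrier := M.carrier × N.carrier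
  δ := M.δ.prodMap N.δ
  δ_δ v := Prod.ext (M.δ_δ _) (N.δ_δ _)
  ρ :=
    { toFun := fun x => (M.ρ x).prodMap (N.ρ x)
      map_add' := fun x y => by ext v <;> simp
      map_smul' := fun c x => by ext v <;> simp }
  δ_ρ x v := Prod.ext (M.δ_ρ _ _) (N.δ_ρ _ _)
  ρ_br i j x y hx hy := LinearMap.ext fun v =>
    Prod.ext (ρ_br_apply M hx hy v.1) (ρ_br_apply N hx hy v.2)

end SuperRep

/-- The direct sum of two modules. -/
def FinRep.prod {L : Type} [AddCommGroup L] [Module ℂ L] [LieSuperalgebra L] (M N : FinRep L) :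
    FinRep L :=
  ⟨M.rep.prod N.rep, inferInstanceAs (Module.Finite ℂ (M.rep.carrier × N.rep.carrier))⟩

/-! ### Additivity of classes -/

namespace Gr

variable {L : Type} [AddCommGroup L] [Module ℂ L] [LieSuperalgebra L]

lemma cls_sub_quot (M : FinRep L) (N : Submodule ℂ M.rep.carrier) (h : IsSub M.rep N)
    (h1 : Module.Finite ℂ (M.rep.sub N h).carrier) (h2 : Module.Finite ℂ (M.rep.quot N h).carrier) :
    cls M = cls ⟨M.rep.sub N h, h1⟩ + cls ⟨M.rep.quot N h, h2⟩ :=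
  cls_exact (N := ⟨M.rep.sub N h, h1⟩) (E := M) (M := ⟨M.rep.quot N h, h2⟩) N.subtype N.mkQ
    (sub_subtype_isHom M.rep N h) (quot_mkQ_isHom M.rep N h) N.subtype_injective
    (LinearMap.exact_subtype_mkQ N) N.mkQ_surjective

/-- For `M = 0` the identity maps form a short exact sequence `0 → M → M → M → 0`, so `[M] = [M] +
[M]`. -/
lemma cls_of_subsingleton (M : FinRep L) [Subsingleton M.rep.carrier] : cls M = 0 := by
  have h := cls_exact (N := M) (E := M) (M := M) LinearMap.id LinearMap.id
    ⟨fun _ => rfl, fun _ _ => rfl⟩ ⟨fun _ => rfl, fun _ _ => rfl⟩ Function.injective_id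
    (fun y => ⟨fun _ => ⟨y, rfl⟩, fun _ => Subsingleton.elim _ _⟩) Function.surjective_id
  simpa using h

lemma cls_prod (A B : FinRep L) : cls (A.prod B) = cls A + cls B :=
  cls_exact (N := A) (E := A.prod B) (M := B) (LinearMap.inl ℂ _ _) (LinearMap.snd ℂ _ _)
    ⟨fun _ => Prod.ext rfl (map_zero B.rep.δ).symm,
      fun x _ => Prod.ext rfl (map_zero (B.rep.ρ x)).symm⟩
    ⟨fun _ => rfl, fun _ _ => rfl⟩ LinearMap.inl_injective Function.Exact.inl_snd
    LinearMap.snd_surjective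

/-- Here `Y` is the direct sum of a copy of `A` and `X`. This splits one summand off an internal
direct sum. -/
lemma cls_sub_sup {A E : FinRep L} {f : A.rep.carrier →ₗ[ℂ] E.rep.carrier}
    (hf : IsHom A.rep E.rep f) (hi : Function.Injective f) {X Y : Submodule ℂ E.rep.carrier}
    (hX : IsSub E.rep X) (hY : IsSub E.rep Y) (hXY : Y = LinearMap.range f ⊔ X)
    (hd : Disjoint (LinearMap.range f) X) (h1 : Module.Finite ℂ (E.rep.sub X hX).carrier)
    (h2 : Module.Finite ℂ (E.rep.sub Y hY).carrier) :
    cls ⟨E.rep.sub Y hY, h2⟩ = cls A + cls ⟨E.rep.sub X hX, h1⟩ := by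
  rw [← cls_prod]
  have hle : ∀ p : A.rep.carrier × X, (f.coprod X.subtype) p ∈ Y := fun p => by
    rw [hXY]
    exact Submodule.add_mem_sup ⟨p.1, rfl⟩ p.2.2
  have hinj : Function.Injective (f.coprod X.subtype) := by
    rw [← LinearMap.ker_eq_bot, LinearMap.ker_coprod_of_disjoint_range _ _
      (by rwa [Submodule.range_subtype]), LinearMap.ker_eq_bot.2 hi, Submodule.ker_subtype,
      Submodule.prod_bot]
  refine cls_iso (Iso.symm ⟨(f.coprod X.subtype).codRestrict Y hle, ⟨fun p => ?_, fun x p => ?_⟩,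
    ?_, ?_⟩)
  · refine Subtype.ext ?_
    change f (A.rep.δ p.1) + E.rep.δ p.2.1 = E.rep.δ (f p.1 + p.2.1)
    rw [hf.1, map_add]
  · refine Subtype.ext ?_
    change f (A.rep.ρ x p.1) + E.rep.ρ x p.2.1 = E.rep.ρ x (f p.1 + p.2.1)
    rw [hf.2, map_add]
  · exact fun p q h => hinj (congrArg Subtype.val h)
  · intro y
    obtain ⟨y, hy⟩ : Y := y
    have hy' := hy
    rw [hXY] at hy'
    obtain ⟨_, ⟨v, rfl⟩, x, hx, rfl⟩ := Submodule.mem_sup.1 hy'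
    exact ⟨(v, ⟨x, hx⟩), Subtype.ext rfl⟩

/-- The class of a module that is the direct sum of the images of the modules `A i`, `i ∈ s`. -/
lemma cls_eq_sum {ι : Type*} (s : Finset ι) (E : FinRep L) (A : ι → FinRep L)
    (f : ∀ i, (A i).rep.carrier →ₗ[ℂ] E.rep.carrier) (hf : ∀ i, IsHom (A i).rep E.rep (f i))
    (hi : ∀ i, Function.Injective (f i))
    (hind : iSupIndep fun i => LinearMap.range (f i))
    (hsup : ⨆ i ∈ s, LinearMap.range (f i) = ⊤) : cls E = ∑ i ∈ s, cls (A i) := by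
  classical
  have hX : ∀ t : Finset ι, IsSub E.rep (⨆ i ∈ t, LinearMap.range (f i)) := fun t => by
    induction t using Finset.induction_on with
    | empty => simpa using E.rep.isSub_bot
    | insert a t ha ih =>
      rw [Finset.iSup_insert]
      exact (hf a).range.sup ih
  have hfin : ∀ t : Finset ι,
      Module.Finite ℂ (E.rep.sub (⨆ i ∈ t, LinearMap.range (f i)) (hX t)).carrier := fun t =>
    inferInstanceAs (Module.Finite ℂ (⨆ i ∈ t, LinearMap.range (f i) : Submodule ℂ E.rep.carrier))
  have key : ∀ t : Finset ι, cls ⟨E.rep.sub (⨆ i ∈ t, LinearMap.range (f i)) (hX t), hfin t⟩ =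
      ∑ i ∈ t, cls (A i) := by
    intro t
    induction t using Finset.induction_on with
    | empty =>
      rw [Finset.sum_empty]
      have : Subsingleton (E.rep.sub (⨆ i ∈ (∅ : Finset ι), LinearMap.range (f i)) (hX ∅)).carrier := by
        change Subsingleton (⨆ i ∈ (∅ : Finset ι), LinearMap.range (f i) : Submodule ℂ E.rep.carrier)
        rw [Submodule.subsingleton_iff_eq_bot]
        simp
      exact cls_of_subsingleton (L := L) ⟨_, _⟩
    | insert a t ha ih =>
      rw [Finset.sum_insert ha, ← ih]
      have hd : Disjoint (LinearMap.range (f a)) (⨆ i ∈ t, LinearMap.range (f i)) := by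
        simpa using hind.disjoint_biSup (x := a) (y := (t : Set ι)) (by simpa using ha)
      exact cls_sub_sup (A := A a) (E := E) (f := f a) (hf a) (hi a) (hX t) (hX (insert a t))
        (Finset.iSup_insert a t fun i => LinearMap.range (f i)) hd (hfin t) (hfin (insert a t))
  rw [← key s]
  refine cls_iso (Iso.symm ⟨Submodule.subtype _, sub_subtype_isHom E.rep _ (hX s), ?_⟩)
  exact ⟨Submodule.subtype_injective _, fun v => ⟨⟨v, by rw [hsup]; trivial⟩, rfl⟩⟩

end Gr

/-! ### Weight spaces -/

section Weights

variable {n : ℕ}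

lemma ρ_tor_comm (M : SuperRep (cartan n)) (i : Fin n) (x : cartan n) (v : M.carrier) :
    M.ρ (tor i) (M.ρ x v) = M.ρ x (M.ρ (tor i) v) := by
  induction x using par_hom_induction with
  | ha x y hx hy => simp only [map_add, LinearMap.add_apply, hx, hy]
  | h s x hx =>
    have h := ρ_br_apply M (i := 0) (x := tor i) (by simp [par_tor i]) hx v
    rw [br_tor] at h
    simp only [map_zero, LinearMap.zero_apply, zero_mul, pow_zero, one_smul] at h
    exact sub_eq_zero.1 h.symm

/-- Weight spaces are contained in the joint generalized eigenspaces of the commuting operators of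
the `tor i`, which are independent. -/
lemma wtSpace_iSupIndep (M : SuperRep (cartan n)) : iSupIndep (wtSpace M) := by
  refine (Module.End.independent_iInf_maxGenEigenspace_of_forall_mapsTo (fun i => M.ρ (tor i))
    fun i j φ => Module.End.mapsTo_maxGenEigenspace_of_comm
      (LinearMap.ext fun v => ρ_tor_comm M _ _ v) φ).mono fun ν => ?_
  refine iInf_mono fun i => ?_
  refine le_trans (le_of_eq ?_) ((M.ρ (tor i)).genEigenspace (ν i) |>.monotone (le_top (a := (1 : ℕ∞))))
  rw [Module.End.genEigenspace_one]
  rfl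

/-- The weight spaces of a module spanned by subspaces of weight vectors. -/
lemma wtSpace_eq_iSup {ι : Type*} (M : SuperRep (cartan n)) (N : ι → Submodule ℂ M.carrier)
    (μ : ι → Fin n → ℂ) (hN : ∀ a, N a ≤ wtSpace M (μ a)) (htop : ⨆ a, N a = ⊤) (ν : Fin n → ℂ) :
    wtSpace M ν = ⨆ a, ⨆ (_ : μ a = ν), N a := by
  apply le_antisymm
  · intro x hx
    have h1 : (⊤ : Submodule ℂ M.carrier) ≤
        (⨆ a, ⨆ (_ : μ a = ν), N a) ⊔ ⨆ χ, ⨆ (_ : χ ≠ ν), wtSpace M χ := by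
      rw [← htop]
      refine iSup_le fun a => ?_
      by_cases h : μ a = ν
      · exact le_sup_of_le_left (le_iSup₂_of_le a h le_rfl)
      · exact le_sup_of_le_right (le_iSup₂_of_le (μ a) h (hN a))
    obtain ⟨y, hy, z, hz, rfl⟩ := Submodule.mem_sup.1 (h1 (Submodule.mem_top (x := x)))
    have hy' : y ∈ wtSpace M ν :=
      (iSup₂_le fun a h => h ▸ hN a : (⨆ a, ⨆ (_ : μ a = ν), N a) ≤ wtSpace M ν) hy
    have hz' : z ∈ wtSpace M ν := by simpa using (wtSpace M ν).sub_mem hx hy'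
    have := Submodule.disjoint_def.1 (wtSpace_iSupIndep M ν) z hz' hz
    rw [this, add_zero]
    exact hy
  · exact iSup₂_le fun a h => h ▸ hN a

lemma wtSpace_map {M N : SuperRep (cartan n)} {f : M.carrier →ₗ[ℂ] N.carrier} (hf : IsHom M N f)
    {ν : Fin n → ℂ} {v : M.carrier} (hv : v ∈ wtSpace M ν) : f v ∈ wtSpace N ν := by
  rw [mem_wtSpace] at *
  intro i
  rw [← hf.2, hv, map_smul]

end Weights

end

end Queer

namespace Queer

noncomputable section

open LieSuperalgebra SuperRep TensorProduct DirectSum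

variable {n : ℕ}

/-! ### Decompositions into pieces of known weight and class -/

section InternalSum

variable {I V : Type} [DecidableEq I] [AddCommGroup V] [Module ℂ V] {A : I → Type}
  [∀ a, AddCommGroup (A a)] [∀ a, Module ℂ (A a)] {f : ∀ a, A a →ₗ[ℂ] V}

/-- This and the converse below translate between internal and external direct sums; tensor products
distribute over the latter. -/
lemma bijective_toModule (hi : ∀ a, Function.Injective (f a))
    (hind : iSupIndep fun a => LinearMap.range (f a)) (htop : ⨆ a, LinearMap.range (f a) = ⊤) :
    Function.Bijective (DirectSum.toModule ℂ I V f) := by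
  have h1 := DirectSum.isInternal_submodule_of_iSupIndep_of_iSup_eq_top hind htop
  have h2 : DirectSum.toModule ℂ I V f = DirectSum.coeLinearMap (fun a => LinearMap.range (f a)) ∘ₗ
      (DFinsupp.mapRange.linearEquiv fun a => LinearEquiv.ofInjective (f a) (hi a)).toLinearMap := by
    ext a v
    simp only [LinearMap.comp_apply, toModule_lof, LinearEquiv.coe_coe]
    erw [DFinsupp.mapRange.linearEquiv_apply, DFinsupp.mapRange_single]
    erw [DirectSum.coeLinearMap_lof]
    rfl
  rw [h2]
  exact h1.comp (LinearEquiv.bijective _)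

lemma of_bijective_toModule (h : Function.Bijective (DirectSum.toModule ℂ I V f)) :
    (∀ a, Function.Injective (f a)) ∧ (iSupIndep fun a => LinearMap.range (f a)) ∧
      ⨆ a, LinearMap.range (f a) = ⊤ := by
  let e := LinearEquiv.ofBijective _ h
  let π : ∀ a, V →ₗ[ℂ] A a := fun a => DirectSum.component ℂ I A a ∘ₗ e.symm.toLinearMap
  have hef : ∀ a v, e.symm (f a v) = DirectSum.lof ℂ I A a v := fun a v => by
    rw [LinearEquiv.symm_apply_eq]
    exact (DirectSum.toModule_lof ℂ a v).symm
  have hπ : ∀ a v, π a (f a v) = v := fun a v => by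
    simp only [π, LinearMap.comp_apply, LinearEquiv.coe_coe, hef, DirectSum.component.lof_self]
  have hπ' : ∀ a b v, b ≠ a → π a (f b v) = 0 := fun a b v hb => by
    simp only [π, LinearMap.comp_apply, LinearEquiv.coe_coe, hef, DirectSum.component.of, hb]
    simp
  refine ⟨fun a => Function.LeftInverse.injective (hπ a), fun a => ?_, ?_⟩
  · rw [Submodule.disjoint_def]
    rintro _ ⟨v, rfl⟩ hv
    have hle : ⨆ b, ⨆ (_ : b ≠ a), LinearMap.range (f b) ≤ LinearMap.ker (π a) :=
      iSup₂_le fun b hb => by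
        rintro _ ⟨w, rfl⟩
        exact hπ' a b w hb
    have h0 := hle hv
    rw [LinearMap.mem_ker, hπ] at h0
    rw [h0, map_zero]
  · rw [eq_top_iff]
    intro v _
    obtain ⟨w, rfl⟩ := h.2 v
    induction w using DirectSum.induction_on with
    | zero => rw [map_zero]; exact Submodule.zero_mem _
    | of a v =>
      erw [DirectSum.toModule_lof ℂ a v]
      exact Submodule.mem_iSup_of_mem a ⟨v, rfl⟩
    | add v w hv hw => rw [map_add]; exact Submodule.add_mem _ (hv trivial) (hw trivial)

end InternalSum

/-- A decomposition of an `𝔥`-module into finite-dimensional submodules of weights `μ a` and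
classes `c a`, `a : I`. -/
def HasPieces (M : SuperRep (cartan n)) {I : Type} (μ : I → Fin n → ℂ) (c : I → Gr (cartan n)) :
    Prop :=
  ∃ (A : I → FinRep (cartan n)) (f : ∀ a, (A a).rep.carrier →ₗ[ℂ] M.carrier),
    (∀ a, IsHom (A a).rep M (f a)) ∧ (∀ a, LinearMap.range (f a) ≤ wtSpace M (μ a)) ∧
    (∀ a, Gr.cls (A a) = c a) ∧ (∀ a, Function.Injective (f a)) ∧
    (iSupIndep fun a => LinearMap.range (f a)) ∧ ⨆ a, LinearMap.range (f a) = ⊤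

namespace HasPieces

variable {M N : SuperRep (cartan n)} {I J : Type} {μ : I → Fin n → ℂ} {c : I → Gr (cartan n)}
  {μ' : J → Fin n → ℂ} {c' : J → Gr (cartan n)}

lemma of_iso (h : HasPieces M μ c) (e : Iso M N) : HasPieces N μ c := by
  obtain ⟨A, f, h1, h2, h3, h4, h5, h6⟩ := h
  obtain ⟨g, hg, hb⟩ := e
  have hr : ∀ a, LinearMap.range (g ∘ₗ f a) = (LinearMap.range (f a)).map g := fun a =>
    LinearMap.range_comp _ _
  refine ⟨A, fun a => g ∘ₗ f a, fun a => hg.comp (h1 a), fun a => ?_, h3,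
    fun a => hb.1.comp (h4 a), ?_, ?_⟩
  · rintro _ ⟨v, rfl⟩
    exact wtSpace_map hg (h2 a ⟨v, rfl⟩)
  · simp only [hr]
    exact h5.map_orderIso (Submodule.orderIsoMapComap (LinearEquiv.ofBijective g hb))
  · simp only [hr]
    rw [← Submodule.map_iSup, h6, Submodule.map_top, LinearMap.range_eq_top.2 hb.2]

lemma reindex (h : HasPieces M μ c) (e : J ≃ I) (hμ : ∀ b, μ' b = μ (e b))
    (hc : ∀ b, c' b = c (e b)) : HasPieces M μ' c' := by
  obtain ⟨A, f, h1, h2, h3, h4, h5, h6⟩ := h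
  exact ⟨fun b => A (e b), fun b => f (e b), fun b => h1 _, fun b => hμ b ▸ h2 _,
    fun b => (h3 _).trans (hc b).symm, fun b => h4 _, h5.comp e.injective,
    (e.iSup_comp (g := fun a => LinearMap.range (f a))).trans h6⟩

/-- Both decompositions are turned into external direct sums, over which the tensor product
distributes; the result is turned back into an internal one. -/
lemma tensor (h : HasPieces M μ c) (h' : HasPieces N μ' c') :
    HasPieces (M.tensor N) (fun p : I × J => μ p.1 + μ' p.2) (fun p => c p.1 * c' p.2) := by
  classical
  obtain ⟨A, f, h1, h2, h3, h4, h5, h6⟩ := h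
  obtain ⟨A', f', h1', h2', h3', h4', h5', h6'⟩ := h'
  have hb := bijective_toModule h4 h5 h6
  have hb' := bijective_toModule h4' h5' h6'
  let F : ∀ p : I × J, (A p.1).rep.carrier ⊗[ℂ] (A' p.2).rep.carrier →ₗ[ℂ] M.carrier ⊗[ℂ] N.carrier :=
    fun p => TensorProduct.map (f p.1) (f' p.2)
  have hF : Function.Bijective (DirectSum.toModule ℂ (I × J) (M.carrier ⊗[ℂ] N.carrier) F) := by
    have e : DirectSum.toModule ℂ (I × J) (M.carrier ⊗[ℂ] N.carrier) F ∘ₗ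
        (TensorProduct.directSum ℂ ℂ (fun a => (A a).rep.carrier)
          fun a => (A' a).rep.carrier).toLinearMap =
        (TensorProduct.congr (LinearEquiv.ofBijective _ hb)
          (LinearEquiv.ofBijective _ hb')).toLinearMap := by
      apply TensorProduct.ext
      ext a v b w
      simp only [LinearMap.compr₂ₛₗ_apply, LinearMap.comp_apply, TensorProduct.mk_apply,
        LinearMap.compl₁₂_apply, LinearMap.compr₂_apply, LinearEquiv.coe_coe,
        TensorProduct.congr_tmul, LinearEquiv.ofBijective_apply, toModule_lof,
        TensorProduct.directSum_lof_tmul_lof]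
      rfl
    have h7 : Function.Bijective (DirectSum.toModule ℂ (I × J) (M.carrier ⊗[ℂ] N.carrier) F ∘
        (TensorProduct.directSum ℂ ℂ (fun a => (A a).rep.carrier)
          fun a => (A' a).rep.carrier)) := by
      have := LinearEquiv.bijective (TensorProduct.congr (LinearEquiv.ofBijective _ hb)
          (LinearEquiv.ofBijective _ hb'))
      rw [← LinearEquiv.coe_coe, ← e] at this
      exact this
    exact (Function.Bijective.of_comp_iff _ (LinearEquiv.bijective _)).1 h7
  obtain ⟨h7, h8, h9⟩ := of_bijective_toModule hF
  refine ⟨fun p => (A p.1).tensor (A' p.2), F, fun p => ?_, fun p => ?_, fun p => ?_, h7, h8, h9⟩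
  · refine Gr.isHom_of_comp (M := (A p.1).rep.tensor (A' p.2).rep) (N := M.tensor N)
      (TensorProduct.ext' fun a b => ?_) fun x => TensorProduct.ext' fun a b => ?_
    · change f p.1 ((A p.1).rep.δ a) ⊗ₜ[ℂ] f' p.2 ((A' p.2).rep.δ b) =
        M.δ (f p.1 a) ⊗ₜ[ℂ] N.δ (f' p.2 b)
      rw [(h1 _).1, (h1' _).1]
    · change F p (tensorρ _ _ x (a ⊗ₜ b)) = tensorρ M N x (f p.1 a ⊗ₜ f' p.2 b)
      simp only [tensorρ_tmul, map_add, F, TensorProduct.map_tmul, (h1 _).2, (h1' _).2, (h1 _).1]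
  · rintro _ ⟨v, rfl⟩
    induction v using TensorProduct.induction_on with
    | zero =>
      exact (congrArg (fun y => y ∈ wtSpace (M.tensor N) (μ p.1 + μ' p.2)) (map_zero (F p))).mpr
        (Submodule.zero_mem _)
    | add a b ha hb =>
      exact (congrArg (fun y => y ∈ wtSpace (M.tensor N) (μ p.1 + μ' p.2)) (map_add (F p) a b)).mpr
        (Submodule.add_mem _ ha hb)
    | tmul a b =>
      rw [mem_wtSpace]
      intro i
      have ha := mem_wtSpace.1 (h2 p.1 ⟨a, rfl⟩) i
      have hb := mem_wtSpace.1 (h2' p.2 ⟨b, rfl⟩) i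
      have he : par (tor i) = (-1 : ℂ) ^ 0 • tor i := by simp [par_tor]
      change tensorρ M N (tor i) (f p.1 a ⊗ₜ f' p.2 b) = _ • (f p.1 a ⊗ₜ[ℂ] f' p.2 b)
      rw [tensorρ_tmul, ev_of_even (by simp) he, od_of_even (by simp) he, ha, hb, map_zero,
        LinearMap.zero_apply, tmul_zero, add_zero, tmul_smul]
      exact (add_smul (μ p.1 i) (μ' p.2 i) (f p.1 a ⊗ₜ[ℂ] f' p.2 b)).symm
  · change _ = c p.1 * c' p.2
    rw [← h3, ← h3']
    exact (Gr.mulHom_cls _ _).symm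

lemma inCatM (h : HasPieces M μ c) (hfin : ∀ ν, {a | μ a = ν}.Finite) : InCatM M := by
  obtain ⟨A, f, h1, h2, h3, h4, h5, h6⟩ := h
  refine ⟨?_, fun ν => ?_⟩
  · rw [eq_top_iff, ← h6]
    exact iSup_le fun a => le_iSup_of_le (μ a) (h2 a)
  · change Module.Finite ℂ (wtSpace M ν)
    rw [wtSpace_eq_iSup M _ μ h2 h6, Module.Finite.iff_fg]
    have : ⨆ a, ⨆ (_ : μ a = ν), LinearMap.range (f a) =
        ⨆ a ∈ (hfin ν).toFinset, LinearMap.range (f a) := by simp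
    rw [this]
    exact Submodule.fg_biSup _ _ fun a _ => Submodule.fg_range _

/-- The weight space at `ν` is the direct sum of exactly the pieces of weight `ν`, by the
independence of weight spaces. -/
lemma sch_eq (h : HasPieces M μ c) (hfin : ∀ ν, {a | μ a = ν}.Finite) (ν : Fin n → ℂ) :
    sch M ν = ∑ a ∈ (hfin ν).toFinset, c a := by
  classical
  have hF := (h.inCatM hfin).2 ν
  obtain ⟨A, f, h1, h2, h3, h4, h5, h6⟩ := h
  rw [sch, dif_pos hF]
  have hw := wtSpace_eq_iSup M _ μ h2 h6 ν
  let s := (hfin ν).toFinset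
  have hs : ∀ a : s, μ a = ν := fun a => (hfin ν).mem_toFinset.1 a.2
  have hm : ∀ (a : s) v, f a v ∈ wtSpace M ν := fun a v => hs a ▸ h2 a ⟨v, rfl⟩
  have hr : ∀ a : s, (LinearMap.range ((f a).codRestrict (wtSpace M ν) (hm a))).map
      (wtSpace M ν).subtype = LinearMap.range (f a) := fun a => by
    rw [← LinearMap.range_comp]
    rfl
  rw [Gr.cls_eq_sum (Finset.univ : Finset s) ⟨wtRep M ν, hF⟩ (fun a => A a)
    (fun a => (f a).codRestrict (wtSpace M ν) (hm a))
    (fun a => ⟨fun v => Subtype.ext ((h1 a).1 v), fun x v => Subtype.ext ((h1 a).2 x v)⟩)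
    (fun a v w hvw => h4 a (congrArg Subtype.val hvw)) ?_ ?_]
  · simp only [h3]
    exact Finset.sum_coe_sort s c
  · have h7 : iSupIndep fun a : s => LinearMap.range (f a) := h5.comp Subtype.val_injective
    intro a
    have h8 := h7 a
    rw [Submodule.disjoint_def] at h8 ⊢
    intro x hx hx'
    refine Subtype.ext (h8 (Subtype.val x) ?_ ?_)
    · exact (hr a).le ⟨x, hx, rfl⟩
    · simp only [← hr, ← Submodule.map_iSup]
      exact ⟨x, hx', rfl⟩
  · apply Submodule.map_injective_of_injective (wtSpace M ν).subtype_injective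
    refine Eq.trans ?_ (Submodule.map_subtype_top _).symm
    refine (Submodule.map_iSup _ _).trans ((iSup_congr fun a => (Submodule.map_iSup _ _).trans
      (iSup_congr fun _ => hr a)).trans (Eq.trans ?_ hw.symm))
    simp [s, iSup_subtype]

end HasPieces
end
end Queer

namespace Queer

noncomputable section

open LieSuperalgebra SuperRep TensorProduct

variable {n : ℕ}

/-! ### Pieces of supersymmetric algebras and of the trivial module -/

section Pieces

lemma Env.act_mul_even {L : Type} [AddCommGroup L] [Module ℂ L] [LieSuperalgebra L] {M : SuperRep L}
    (B : InvBracket M) {x : L} (hx : par x = x) (a b : Env B) :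
    Env.act B x (a * b) = Env.act B x a * b + a * Env.act B x b := by
  have hx' : par x = (-1 : ℂ) ^ 0 • x := by simpa using hx
  rw [Env.act_mul, ev_of_even (by simp) hx', od_of_even (by simp) hx', map_zero,
    LinearMap.zero_apply, mul_zero, add_zero]

/-- Products of weight vectors in an enveloping algebra are weight vectors. -/
lemma mul_mem_wtSpace {M : SuperRep (cartan n)} (B : InvBracket M) {μ ν : Fin n → ℂ} {a b : Env B}
    (ha : a ∈ wtSpace (Env.rep B) μ) (hb : b ∈ wtSpace (Env.rep B) ν) :
    a * b ∈ wtSpace (Env.rep B) (μ + ν) := by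
  refine (mem_wtSpace (M := Env.rep B)).2 fun i => ?_
  have h1 : Env.act B (tor i) a = μ i • a := (mem_wtSpace (M := Env.rep B)).1 ha i
  have h2 : Env.act B (tor i) b = ν i • b := (mem_wtSpace (M := Env.rep B)).1 hb i
  refine (Env.act_mul_even B (par_tor i) a b).trans ?_
  rw [h1, h2, smul_mul_assoc, mul_smul_comm]
  exact (add_smul (μ i) (ν i) (a * b)).symm

lemma one_mem_wtSpace {M : SuperRep (cartan n)} (B : InvBracket M) :
    (1 : Env B) ∈ wtSpace (Env.rep B) 0 := by
  refine (mem_wtSpace (M := Env.rep B)).2 fun i => (Env.act_one B (tor i)).trans ?_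
  exact (zero_smul ℂ (1 : Env B)).symm

lemma ι_mem_wtSpace {M : SuperRep (cartan n)} (B : InvBracket M) {μ : Fin n → ℂ} {v : M.carrier}
    (hv : v ∈ wtSpace M μ) : Env.ι B v ∈ wtSpace (Env.rep B) μ := by
  refine (mem_wtSpace (M := Env.rep B)).2 fun i => (Env.act_ι B (tor i) v).trans ?_
  rw [mem_wtSpace.1 hv i, map_smul]
  rfl

lemma symSpace_le_wtSpace (M : SuperRep (cartan n)) {μ : Fin n → ℂ} (hM : wtSpace M μ = ⊤) (k : ℕ) :
    symSpace M k ≤ wtSpace (Sym M) (k • μ) := by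
  induction k with
  | zero =>
    intro a ha
    rw [symSpace, pow_zero, Submodule.mem_one] at ha
    obtain ⟨r, rfl⟩ := ha
    rw [Algebra.algebraMap_eq_smul_one, zero_smul]
    exact Submodule.smul_mem _ r (one_mem_wtSpace _)
  | succ k ih =>
    intro a ha
    rw [symSpace, pow_succ] at ha
    rw [add_smul, one_smul]
    refine Submodule.mul_induction_on ha ?_ fun _ _ => Submodule.add_mem _
    rintro a ha _ ⟨v, rfl⟩
    exact mul_mem_wtSpace _ (ih ha) (ι_mem_wtSpace _ (hM ▸ Submodule.mem_top))

lemma Root.wtSpace_space (α : Root n) : wtSpace α.space.rep α.wt = ⊤ := by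
  rw [eq_top_iff]
  intro v _
  rw [mem_wtSpace]
  intro i
  exact Subtype.ext (mem_wtSpace.1 v.2 i)

/-- The powers `S^k` have the weights `k α`, which are distinct because `α ≠ 0`, so their sum is
direct without any knowledge of a basis. -/
lemma hasPieces_sym (α : Root n) : HasPieces (Sym α.space.rep) (fun k : ℕ => k • α.wt)
    (fun k => Gr.cls (symPow k α.space)) := by
  have hr : ∀ k, LinearMap.range (symSpace α.space.rep k).subtype = symSpace α.space.rep k :=
    fun k => Submodule.range_subtype _
  have hle := symSpace_le_wtSpace _ α.wtSpace_space
  refine ⟨fun k => symPow k α.space, fun k => (symSpace α.space.rep k).subtype,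
    fun k => ⟨fun _ => rfl, fun _ _ => rfl⟩, fun k => (hr k).le.trans (hle k), fun _ => rfl,
    fun k => Submodule.subtype_injective _, ?_, ?_⟩
  · have hinj : Function.Injective fun k : ℕ => k • α.wt :=
      fun k l h => by simpa [Root.wt, α.ne] using congrFun h α.i
    exact ((wtSpace_iSupIndep _).comp hinj).mono fun k => (hr k).le.trans (hle k)
  · refine (iSup_congr hr).trans ?_
    suffices key : ∀ a : Env (InvBracket.zero α.space.rep), a ∈ ⨆ k, symSpace α.space.rep k from
      Submodule.eq_top_iff'.2 key
    intro a
    induction a using Env.induction_left with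
    | h1 =>
      refine Submodule.mem_iSup_of_mem 0 ?_
      rw [symSpace, pow_zero]
      exact Submodule.mem_one.2 ⟨1, map_one _⟩
    | hs r a h => exact Submodule.smul_mem _ r h
    | ha a b h h' => exact Submodule.add_mem _ h h'
    | hm v a h =>
      refine Submodule.iSup_induction (symSpace α.space.rep)
        (motive := fun a => Env.ι _ v * a ∈ ⨆ k, symSpace α.space.rep k) h
        (fun k a ha => ?_) ?_ fun a b h h' => ?_
      · refine Submodule.mem_iSup_of_mem (k + 1) ?_
        rw [symSpace, pow_succ']
        exact Submodule.mul_mem_mul ⟨v, rfl⟩ ha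
      · rw [mul_zero]
        exact Submodule.zero_mem _
      · rw [mul_add]
        exact Submodule.add_mem _ h h'

lemma cls_symPow_zero {L : Type} [AddCommGroup L] [Module ℂ L] [LieSuperalgebra L] (M : FinRep L) :
    Gr.cls (symPow 0 M) = 1 := by
  have h0 : ∀ i j : ℕ, (0 : ℂ) = (-1) ^ (i * j) • 0 + 0 := fun i j => by simp
  -- The augmentation, which shows that the scalars embed into the algebra.
  let ε : Env (InvBracket.zero M.rep) →ₐ[ℂ] ℂ := Env.lift _ 0 fun i j v w _ _ => by simp
  have h1 : ∀ r : ℂ, algebraMap ℂ (Env (InvBracket.zero M.rep)) r ∈ symSpace M.rep 0 := fun r => by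
    rw [symSpace, pow_zero]
    exact Submodule.mem_one.2 ⟨r, rfl⟩
  have h2 : ∀ x r, Env.act (InvBracket.zero M.rep) x (algebraMap ℂ _ r) = 0 := fun x r => by
    rw [Env.act_apply, Env.der_algebraMap, Env.der_algebraMap, add_zero]
  refine (Gr.cls_iso (M := FinRep.triv L) (N := symPow 0 M)
    ⟨(Algebra.linearMap ℂ (Env (InvBracket.zero M.rep))).codRestrict _ h1, ⟨fun r => ?_,
      fun x r => ?_⟩, fun r s h => ?_, ?_⟩).symm
  · exact Subtype.ext ((Env.θ _).commutes r).symm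
  · exact Subtype.ext ((map_zero (algebraMap ℂ (Env (InvBracket.zero M.rep)))).trans (h2 x r).symm)
  · have := congrArg ε (congrArg Subtype.val h)
    exact ((ε.commutes r).symm.trans this).trans (ε.commutes s)
  · rintro ⟨(a : Env (InvBracket.zero M.rep)), ha⟩
    have ha' : (a : Env (InvBracket.zero M.rep)) ∈ (1 : Submodule ℂ (Env (InvBracket.zero M.rep))) := by
      rw [← pow_zero]
      exact ha
    obtain ⟨r, rfl⟩ := (Submodule.mem_one (A := Env (InvBracket.zero M.rep))).1 ha'
    exact ⟨r, rfl⟩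

/-- The enveloping algebra of the zero module. -/
lemma env_iso_triv {L : Type} [AddCommGroup L] [Module ℂ L] [LieSuperalgebra L] {M : SuperRep L}
    (B : InvBracket M) (hM : ∀ v : M.carrier, v = 0) : Iso (SuperRep.triv L) (Env.rep B) := by
  let ε : Env B →ₐ[ℂ] ℂ := Env.lift _ 0 fun i j v w _ _ => by simp
  have h2 : ∀ x r, Env.act B x (algebraMap ℂ _ r) = 0 := fun x r => by
    rw [Env.act_apply, Env.der_algebraMap, Env.der_algebraMap, add_zero]
  refine ⟨Algebra.linearMap ℂ (Env B), ⟨fun r => ((Env.θ _).commutes r).symm,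
    fun x r => (map_zero (algebraMap ℂ (Env B))).trans (h2 x r).symm⟩, fun r s h => ?_, fun a => ?_⟩
  · exact ((ε.commutes r).symm.trans (congrArg ε h)).trans (ε.commutes s)
  · change ∃ r, algebraMap ℂ (Env B) r = a
    induction a using Env.induction with
    | h1 r => exact ⟨r, rfl⟩
    | h2 v => exact ⟨0, by rw [hM v, map_zero, map_zero]⟩
    | h3 a b ha hb =>
      obtain ⟨r, rfl⟩ := ha
      obtain ⟨s, rfl⟩ := hb
      exact ⟨r * s, map_mul _ _ _⟩
    | h4 a b ha hb =>
      obtain ⟨r, rfl⟩ := ha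
      obtain ⟨s, rfl⟩ := hb
      exact ⟨r + s, map_add _ _ _⟩

lemma hasPieces_triv : HasPieces (SuperRep.triv (cartan n)) (fun _ : Unit => 0) (fun _ => 1) := by
  have hr : LinearMap.range (LinearMap.id : ℂ →ₗ[ℂ] ℂ) = ⊤ := LinearMap.range_id
  refine ⟨fun _ => FinRep.triv _, fun _ => LinearMap.id, fun _ => ⟨fun _ => rfl, fun _ _ => rfl⟩,
    fun _ v _ => ?_, fun _ => rfl, fun _ => Function.injective_id, ?_, ?_⟩
  · rw [mem_wtSpace]
    intro i
    exact (zero_smul ℂ v).symm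
  · intro a
    simp [iSup_unique]
  · rw [iSup_unique]
    exact hr

end Pieces

/-! ### Subalgebras given by patterns of matrix entries -/

section Pattern

variable (r : Fin n → Fin n → Prop)

/-- The pairs of matrices of a given pattern, under the adjoint action of `𝔥`. -/
abbrev patRep : SuperRep (cartan n) :=
  (adCartan n).sub (patternSub n r)
    ⟨fun _ hx => patternSub_par hx, fun x _ hy => patternSub_br (r₁ := fun i j => i ≠ j)
      (r₂ := r) (fun i j k h => by
        constructor
        · by_cases hk : i = k
          · subst hk; exact Or.inr h
          · exact Or.inl hk
        · by_cases hk : k = j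
          · subst hk; exact Or.inl h
          · exact Or.inr hk) x.2 hy⟩

variable {r} (hr : ∀ i j k, r i j → r i k ∨ r k j)

/-- The bracket of `𝔮_n` on the subalgebra of a given pattern. -/
def patMul : patternSub n r →ₗ[ℂ] patternSub n r →ₗ[ℂ] patternSub n r :=
  LinearMap.mk₂ ℂ
    (fun x y => ⟨br (x : Q n) (y : Q n), patternSub_br (r₁ := r)
      (r₂ := r) (fun i j k h => ⟨hr i j k h, hr i j k h⟩) x.2 y.2⟩)
    (fun x x' y => by ext : 1; simp)
    (fun c x y => by ext : 1; simp)
    (fun x y y' => by ext : 1; simp)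
    (fun c x y => by ext : 1; simp)

/-- The bracket of `𝔮_n` on the subalgebra of a given pattern. -/
def patBr : InvBracket (patRep r) where
  β := patMul hr
  δ_β v w := Subtype.ext (par_br (L := Q n) (Subtype.val v) (Subtype.val w))
  ρ_β s i x v w hx hv := Subtype.ext
    (br_jacobi (L := Q n) s i (Subtype.val x) (Subtype.val v) (Subtype.val w)
      (congrArg Subtype.val hx) (congrArg Subtype.val hv))

/-- The subalgebra of `𝔮_n` of a given pattern. -/
abbrev patLie : LieSuperalgebra (patRep r).carrier where
  par := (patRep r).δ
  par_par := (patRep r).δ_δ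
  br := patMul hr
  par_br x y := (patBr hr).δ_β x y
  br_skew i j x y hx hy := Subtype.ext
    (br_skew (L := Q n) i j (Subtype.val x) (Subtype.val y) (congrArg Subtype.val hx)
      (congrArg Subtype.val hy))
  br_jacobi i j x y z hx hy := Subtype.ext
    (br_jacobi (L := Q n) i j (Subtype.val x) (Subtype.val y) (Subtype.val z)
      (congrArg Subtype.val hx) (congrArg Subtype.val hy))

lemma br_tor_apply (t : Fin n) (x : Q n) (i j : Fin n) :
    (br (tor t : Q n) x).1 i j = ((if i = t then 1 else 0) - (if j = t then 1 else 0)) * x.1 i j ∧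
    (br (tor t : Q n) x).2 i j = ((if i = t then 1 else 0) - (if j = t then 1 else 0)) * x.2 i j := by
  rw [br_apply]
  simp [tor, Matrix.diagonal_mul, Matrix.mul_diagonal, Pi.single_apply]
  constructor <;> split_ifs <;> simp

/-- An entry at `(i, j)` has `h_t`-eigenvalue `δ_{it} - δ_{jt}`. The value `1` at `t = α.i` forces
`i = α.i`, and the value `-1` at `t = α.j` forces `j = α.j`. -/
lemma mem_rootSpace (α : Root n) {x : Q n} : x ∈ wtSpace (adCartan n) α.wt ↔
    x ∈ patternSub n fun i j => ¬(i = α.i ∧ j = α.j) := by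
  have hw : ∀ t, α.wt t = (if α.i = t then 1 else 0) - (if α.j = t then 1 else 0) := fun t => by
    simp [Root.wt, Pi.single_apply, eq_comm]
  have h0 : x ∈ wtSpace (adCartan n) α.wt ↔ ∀ t, br (tor t : Q n) x = α.wt t • x := mem_wtSpace
  rw [h0]
  constructor
  · intro h i j hij
    have key : ∀ c : ℂ, (∀ t, ((if i = t then 1 else 0) - (if j = t then 1 else 0)) * c =
        α.wt t * c) → c = 0 := by
      intro c hc
      by_contra hne
      have h1 : ∀ t, ((if i = t then 1 else 0) - (if j = t then 1 else 0) : ℂ) = α.wt t :=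
        fun t => mul_right_cancel₀ hne (hc t)
      simp only [hw] at h1
      have hne' := α.ne
      have h2 := h1 α.i
      have h3 := h1 α.j
      rw [if_pos rfl, if_neg hne'.symm] at h2
      rw [if_pos rfl, if_neg hne'] at h3
      refine hij ⟨?_, ?_⟩
      · by_contra hi
        rw [if_neg hi] at h2
        split_ifs at h2 <;> norm_num at h2
      · by_contra hj
        rw [if_neg hj] at h3
        split_ifs at h3 <;> norm_num at h3
    refine ⟨key _ fun t => ?_, key _ fun t => ?_⟩
    · rw [← (br_tor_apply t x i j).1, h t]; rfl
    · rw [← (br_tor_apply t x i j).2, h t]; rfl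
  · intro h t
    refine Prod.ext (Matrix.ext fun i j => ?_) (Matrix.ext fun i j => ?_)
    · rw [(br_tor_apply t x i j).1]
      by_cases hij : i = α.i ∧ j = α.j
      · rw [hij.1, hij.2, ← hw]; rfl
      · simp [(h i j hij).1]
    · rw [(br_tor_apply t x i j).2]
      by_cases hij : i = α.i ∧ j = α.j
      · rw [hij.1, hij.2, ← hw]; rfl
      · simp [(h i j hij).2]

/-- Deleting a matrix entry. -/
def eraseEntry (a b : Fin n) : Matrix (Fin n) (Fin n) ℂ →ₗ[ℂ] Matrix (Fin n) (Fin n) ℂ where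
  toFun A := Matrix.of fun i j => if i = a ∧ j = b then 0 else A i j
  map_add' A B := by ext i j; by_cases h : i = a ∧ j = b <;> simp [h]
  map_smul' c A := by ext i j; by_cases h : i = a ∧ j = b <;> simp [h]

lemma eraseEntry_apply (a b : Fin n) (A : Matrix (Fin n) (Fin n) ℂ) (i j : Fin n) :
    eraseEntry a b A i j = if i = a ∧ j = b then 0 else A i j := rfl

/-- Deleting an entry in both matrices of a pair. -/
def eraseQ (a b : Fin n) : Q n →ₗ[ℂ] Q n := (eraseEntry a b).prodMap (eraseEntry a b)

lemma eraseQ_apply (a b : Fin n) (x : Q n) : eraseQ a b x = (eraseEntry a b x.1, eraseEntry a b x.2) :=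
  rfl

lemma eraseQ_par (a b : Fin n) (x : Q n) : eraseQ a b (par x) = par (eraseQ a b x) := by
  simp [eraseQ_apply, par_apply]

lemma eraseQ_of_mem {a b : Fin n} (hab : r a b) {x : Q n} (hx : x ∈ patternSub n r) :
    eraseQ a b x = x := by
  refine Prod.ext (Matrix.ext fun i j => ?_) (Matrix.ext fun i j => ?_)
  · change eraseEntry a b x.1 i j = _
    rw [eraseEntry_apply]
    split_ifs with h
    · rw [h.1, h.2, (hx a b hab).1]
    · rfl
  · change eraseEntry a b x.2 i j = _
    rw [eraseEntry_apply]
    split_ifs with h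
    · rw [h.1, h.2, (hx a b hab).2]
    · rfl

lemma mem_of_eraseQ_eq_zero {a b : Fin n} {x : Q n} (hx : eraseQ a b x = 0) :
    x ∈ patternSub n fun i j => ¬(i = a ∧ j = b) := by
  intro i j hij
  have h1 := congrFun (congrFun (congrArg Prod.fst hx) i) j
  have h2 := congrFun (congrFun (congrArg Prod.snd hx) i) j
  change eraseEntry a b x.1 i j = _ at h1
  change eraseEntry a b x.2 i j = _ at h2
  rw [eraseEntry_apply, if_neg hij] at h1 h2
  exact ⟨h1, h2⟩

lemma eraseQ_of_pattern {a b : Fin n} {x : Q n} (hx : x ∈ patternSub n fun i j => ¬(i = a ∧ j = b)) :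
    eraseQ a b x = 0 := by
  refine Prod.ext (Matrix.ext fun i j => ?_) (Matrix.ext fun i j => ?_)
  · change eraseEntry a b x.1 i j = _
    rw [eraseEntry_apply]
    split_ifs with h
    · rfl
    · exact (hx i j h).1
  · change eraseEntry a b x.2 i j = _
    rw [eraseEntry_apply]
    split_ifs with h
    · rfl
    · exact (hx i j h).2

lemma sub_eraseQ_mem (a b : Fin n) (x : Q n) :
    x - eraseQ a b x ∈ patternSub n fun i j => ¬(i = a ∧ j = b) := by
  intro i j hij
  constructor
  · change x.1 i j - eraseEntry a b x.1 i j = 0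
    rw [eraseEntry_apply, if_neg hij, sub_self]
  · change x.2 i j - eraseEntry a b x.2 i j = 0
    rw [eraseEntry_apply, if_neg hij, sub_self]

lemma sub_eraseQ_of_pattern {a b : Fin n} {x : Q n}
    (hx : x ∈ patternSub n fun i j => ¬(i = a ∧ j = b)) : x - eraseQ a b x = x := by
  rw [eraseQ_of_pattern hx, sub_zero]

/-- Since `a ≠ b`, the square of the matrix unit `E_ab` vanishes. So a root space is an abelian
subalgebra, and its enveloping algebra is the supersymmetric algebra. -/
lemma br_eq_zero_of_pattern {a b : Fin n} (hab : a ≠ b) {x y : Q n}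
    (hx : x ∈ patternSub n fun i j => ¬(i = a ∧ j = b))
    (hy : y ∈ patternSub n fun i j => ¬(i = a ∧ j = b)) : br x y = 0 := by
  have h : br x y ∈ patternSub n fun _ _ => True :=
    patternSub_br (fun i j k _ => by
      have : ¬(i = a ∧ k = b) ∨ ¬(k = a ∧ j = b) := by
        by_contra! hc
        exact hab (hc.2.1.symm.trans hc.1.2)
      exact ⟨this, this⟩) hx hy
  exact Prod.ext (Matrix.ext fun i j => (h i j trivial).1) (Matrix.ext fun i j => (h i j trivial).2)

variable {r' : Fin n → Fin n → Prop} (hr' : ∀ i j k, r' i j → r' i k ∨ r' k j)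

/-- Removing one root space from a subalgebra of `𝔮_n`. -/
def rootDecomp (α : Root n) (hα : r α.i α.j)
    (hrr : ∀ i j, r' i j ↔ r i j ∧ ¬(i = α.i ∧ j = α.j)) :
    letI := patLie hr'
    Decomp (patBr hr') (patBr hr) (InvBracket.zero α.space.rep) :=
  letI := patLie hr'
  have hle : patternSub n r ≤ patternSub n r' := fun x hx i j h => hx i j ((hrr i j).1 h).1
  have hleα : wtSpace (adCartan n) α.wt ≤ patternSub n r' := fun x hx i j h =>
    (mem_rootSpace α).1 hx i j ((hrr i j).1 h).2
  let jj : patternSub n r →ₗ[ℂ] patternSub n r' := Submodule.inclusion hle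
  have her : ∀ x : Q n, x ∈ patternSub n r' → eraseQ α.i α.j x ∈ patternSub n r := by
    intro x hx i j hij
    change eraseEntry _ _ _ _ _ = 0 ∧ eraseEntry _ _ _ _ _ = 0
    rw [eraseEntry_apply, eraseEntry_apply]
    split_ifs with h
    · exact ⟨rfl, rfl⟩
    · exact hx i j ((hrr i j).2 ⟨hij, h⟩)
  { S :=
      { j := jj
        p := (eraseQ α.i α.j).restrict her
        p_j := fun v => Subtype.ext (eraseQ_of_mem hα (Subtype.prop v))
        j_δ := fun _ => rfl
        p_par := fun x => Subtype.ext (eraseQ_par _ _ (Subtype.val x))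
        j_β := fun _ _ => rfl
        p_br := fun x y hx hy => Subtype.ext (by
          have h1 := mem_of_eraseQ_eq_zero (congrArg Subtype.val hx)
          have h2 := mem_of_eraseQ_eq_zero (congrArg Subtype.val hy)
          exact (congrArg (eraseQ α.i α.j) (br_eq_zero_of_pattern α.ne h1 h2)).trans (map_zero _)) }
    par_eq := fun _ => rfl
    br_eq := fun _ _ => rfl
    j_hom := ⟨fun _ => rfl, fun _ _ => rfl⟩
    ja := Submodule.inclusion hleα
    pa := (LinearMap.id - eraseQ α.i α.j).restrict fun x _ =>
      (mem_rootSpace α).2 (sub_eraseQ_mem α.i α.j x)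
    ja_hom := ⟨fun _ => rfl, fun _ _ => rfl⟩
    pa_ja := fun v => Subtype.ext
      (sub_eraseQ_of_pattern ((mem_rootSpace α).1 (Subtype.prop v)))
    p_ja := fun v => Subtype.ext (eraseQ_of_pattern ((mem_rootSpace α).1 (Subtype.prop v)))
    ja_pa := fun v => rfl
    ja_β := fun v w => Subtype.ext (br_eq_zero_of_pattern α.ne
      ((mem_rootSpace α).1 (Subtype.prop v)) ((mem_rootSpace α).1 (Subtype.prop w))).symm }

end Pattern

end
end Queer

namespace Queer

noncomputable section

open LieSuperalgebra SuperRep TensorProduct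

variable {n : ℕ}

/-! ### Adding the negative roots one by one; Kostant partitions -/

namespace Root

lemma ext {α β : Root n} (hi : α.i = β.i) (hj : α.j = β.j) : α = β := by
  cases α; cases β; cases hi; cases hj; rfl

instance : DecidableEq (Root n) := Classical.decEq _

instance : Fintype (Root n) :=
  Fintype.ofInjective (fun α : Root n => (α.i, α.j)) fun _ _ h =>
    ext (congrArg Prod.fst h) (congrArg Prod.snd h)

lemma sum_update (k : Root n → ℕ) (α : Root n) (t : ℕ) :
    ∑ β, Function.update k α t β • β.wt = ∑ β, Function.update k α 0 β • β.wt + t • α.wt := by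
  rw [← Finset.add_sum_erase _ _ (Finset.mem_univ α), ← Finset.add_sum_erase _ _ (Finset.mem_univ α),
    Function.update_self, Function.update_self, zero_smul, zero_add, add_comm]
  congr 1
  refine Finset.sum_congr rfl fun β hβ => ?_
  rw [Function.update_of_ne (Finset.ne_of_mem_erase hβ),
    Function.update_of_ne (Finset.ne_of_mem_erase hβ)]

lemma prod_update (k : Root n → ℕ) (α : Root n) (t : ℕ) :
    ∏ β : Root n, Gr.cls (symPow (Function.update k α t β) β.space) =
      (∏ β : Root n, Gr.cls (symPow (Function.update k α 0 β) β.space)) *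
        Gr.cls (symPow t α.space) := by
  rw [← Finset.mul_prod_erase _ _ (Finset.mem_univ α), ← Finset.mul_prod_erase _ _ (Finset.mem_univ α),
    Function.update_self, Function.update_self, cls_symPow_zero, one_mul, mul_comm]
  congr 1
  refine Finset.prod_congr rfl fun β hβ => ?_
  rw [Function.update_of_ne (Finset.ne_of_mem_erase hβ),
    Function.update_of_ne (Finset.ne_of_mem_erase hβ)]

end Root

/-- The families of multiplicities supported on the roots outside the pattern `r`. -/
abbrev RootMult (r : Fin n → Fin n → Prop) : Type := {k : Root n → ℕ // ∀ α, r α.i α.j → k α = 0}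

/-- The decomposition of the enveloping algebra of the subalgebra of pattern `r`. -/
def HasRootPieces {r : Fin n → Fin n → Prop} (hr : ∀ i j k, r i j → r i k ∨ r k j) : Prop :=
  HasPieces (Env.rep (patBr hr)) (fun k : RootMult r => ∑ α, k.1 α • α.wt)
    (fun k => ∏ α, Gr.cls (symPow (k.1 α) α.space))

/-- The pattern `r'` frees one more position than `r`, that of `α`, so the new algebra is the old
one tensored with `S(𝔤_α)`. A new index is an old index together with the multiplicity of `α`. -/
lemma HasRootPieces.step {r r' : Fin n → Fin n → Prop} {hr : ∀ i j k, r i j → r i k ∨ r k j}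
    (h : HasRootPieces hr) (hr' : ∀ i j k, r' i j → r' i k ∨ r' k j) (α : Root n)
    (hα : r α.i α.j) (hrr : ∀ i j, r' i j ↔ r i j ∧ ¬(i = α.i ∧ j = α.j)) : HasRootPieces hr' := by
  let := patLie hr'
  have h1 := (HasPieces.tensor h (hasPieces_sym α)).of_iso (rootDecomp hr hr' α hα hrr).iso
  have hne : ∀ β : Root n, r' β.i β.j → β ≠ α := fun β hβ e => by
    subst e
    exact ((hrr _ _).1 hβ).2 ⟨rfl, rfl⟩
  let e : RootMult r' ≃ RootMult r × ℕ :=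
    { toFun := fun k => (⟨Function.update k.1 α 0, fun β hβ => by
        by_cases hb : β = α
        · subst hb; simp
        · rw [Function.update_of_ne hb]
          exact k.2 β ((hrr _ _).2 ⟨hβ, fun hc => hb (Root.ext hc.1 hc.2)⟩)⟩, k.1 α)
      invFun := fun p => ⟨Function.update p.1.1 α p.2, fun β hβ => by
        rw [Function.update_of_ne (hne β hβ)]
        exact p.1.2 β ((hrr _ _).1 hβ).1⟩
      left_inv := fun k => Subtype.ext (by simp)
      right_inv := fun p => Prod.ext (Subtype.ext (by
        have := p.1.2 α hα
        simp [← this])) (by simp) }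
  refine h1.reindex e (fun k => ?_) fun k => ?_
  · have := Root.sum_update k.1 α (k.1 α)
    rwa [Function.update_eq_self] at this
  · have := Root.prod_update k.1 α (k.1 α)
    rwa [Function.update_eq_self] at this

/-- An exhaustion of the set of negative roots, adding one root at a time. -/
def rootPattern (n m : ℕ) (i j : Fin n) : Prop := ¬(j < i ∧ i * n + j < m)

/-- Positions are added row by row, and from left to right in each row. If `(i, k)` and `(k, j)`
have been added, then `j < k`, so `(i, j)` comes before `(i, k)`; hence every stage is a subalgebra.
-/
lemma rootPattern_closed (m : ℕ) (i j k : Fin n) (h : rootPattern n m i j) :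
    rootPattern n m i k ∨ rootPattern n m k j := by
  unfold rootPattern at *
  by_contra! hc
  refine h ⟨hc.2.1.trans hc.1.1, lt_of_le_of_lt ?_ hc.1.2⟩
  have := hc.2.1
  rw [Fin.lt_def] at this
  omega

lemma hasRootPieces (m : ℕ) : HasRootPieces (rootPattern_closed (n := n) m) := by
  induction m with
  | zero =>
    have h0 : ∀ i j, rootPattern n 0 i j := fun i j => by simp [rootPattern]
    have hz : ∀ v : (patRep (rootPattern n 0)).carrier, v = 0 := fun v => Subtype.ext
      (Prod.ext (Matrix.ext fun i j => (v.2 i j (h0 i j)).1) (Matrix.ext fun i j => (v.2 i j (h0 i j)).2))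
    have hk : ∀ (k : RootMult (rootPattern n 0)) α, k.1 α = 0 := fun k α => k.2 α (h0 _ _)
    refine (hasPieces_triv.of_iso (env_iso_triv (patBr (rootPattern_closed 0)) hz)).reindex
      ⟨fun _ => (), fun _ => ⟨0, fun _ _ => rfl⟩, fun k => Subtype.ext (funext fun α => (hk k α).symm),
        fun _ => rfl⟩ (fun k => ?_) fun k => ?_
    · simp [hk]
    · simp [hk, cls_symPow_zero]
  | succ m ih =>
    by_cases h : ∃ α : Root n, α.j < α.i ∧ (α.i : ℕ) * n + α.j = m
    · obtain ⟨α, h1, h2⟩ := h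
      refine ih.step _ α (fun hc => by omega) fun i j => ?_
      unfold rootPattern
      constructor
      · intro hc
        refine ⟨fun hd => hc ⟨hd.1, by omega⟩, ?_⟩
        rintro ⟨rfl, rfl⟩
        exact hc ⟨h1, by omega⟩
      · rintro ⟨hc, hd⟩ ⟨he, hf⟩
        -- Division with remainder by `n` recovers the position from its number, so only one
        -- position is added at this stage.
        by_cases hg : (i : ℕ) * n + j = m
        · have e1 : (i : ℕ) * n + j = α.i * n + α.j := by omega
          have hn : 0 < n := i.pos
          have e2 : (j : ℕ) = α.j := by
            have := congrArg (· % n) e1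
            simpa [Nat.add_mod, Nat.mod_eq_of_lt j.2, Nat.mod_eq_of_lt α.j.2] using this
          have e3 : (i : ℕ) = α.i := by
            rw [e2] at e1
            exact Nat.eq_of_mul_eq_mul_right hn (by omega)
          exact hd ⟨Fin.ext e3, Fin.ext e2⟩
        · exact hc ⟨he, by omega⟩
    · have : rootPattern n (m + 1) = rootPattern n m := by
        funext i j
        unfold rootPattern
        refine propext (not_congr (and_congr_right fun hij => ⟨fun hm => ?_, fun hm => by omega⟩))
        by_contra hc
        exact h ⟨⟨i, j, hij.ne'⟩, hij, by simp only; omega⟩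
      have h1 : ∀ (r : Fin n → Fin n → Prop) (hr : ∀ i j k, r i j → r i k ∨ r k j),
          r = rootPattern n m → HasRootPieces hr := by
        rintro r hr rfl
        exact ih
      exact h1 _ _ this

lemma hasPieces_UnMinus : HasPieces (UnMinus n)
    (fun k : RootMult (fun i j : Fin n => i ≤ j) => ∑ α, k.1 α • α.wt)
    (fun k => ∏ α, Gr.cls (symPow (k.1 α) α.space)) := by
  have h0 : (fun i j : Fin n => i ≤ j) = rootPattern n (n * n) := by
    funext i j
    unfold rootPattern
    -- At stage `n * n` every position below the diagonal has been added.
    have h1 : (i : ℕ) * n + j < n * n := by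
      have := i.2
      have := j.2
      calc (i : ℕ) * n + j < i * n + n := by omega
        _ = (i + 1) * n := by ring
        _ ≤ n * n := Nat.mul_le_mul_right n (by omega)
    simp [h1]
  have h1 : ∀ (r : Fin n → Fin n → Prop) (hr : ∀ i j k, r i j → r i k ∨ r k j),
      r = rootPattern n (n * n) → HasRootPieces hr := by
    rintro r hr rfl
    exact hasRootPieces _
  exact h1 _ (fun i j k hij => by
    by_contra! hc
    exact absurd (hc.2.trans hc.1) (not_lt.2 hij)) h0

/-- The ways to write `ν` as a sum of negative roots. -/
def kostant (ν : Fin n → ℂ) : Set (Root n → ℕ) :=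
  {k | (∀ α, α.i ≤ α.j → k α = 0) ∧ ∑ α, k α • α.wt = ν}

/-- The linear form `ν ↦ ∑ i ν_i`, positive on the negative roots. -/
def height (ν : Fin n → ℂ) : ℂ := ∑ i : Fin n, ((i : ℕ) : ℂ) * ν i

lemma height_wt (α : Root n) : height α.wt = ((α.i : ℕ) : ℂ) - ((α.j : ℕ) : ℂ) := by
  simp [height, Root.wt, mul_sub, Finset.sum_sub_distrib, Pi.single_apply]

lemma height_kostant {ν : Fin n → ℂ} {k : Root n → ℕ} (hk : k ∈ kostant ν) :
    height ν = ((∑ α, k α * ((α.i : ℕ) - (α.j : ℕ)) : ℕ) : ℂ) := by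
  obtain ⟨h1, rfl⟩ := hk
  have : height (∑ α, k α • α.wt) = ∑ α, (k α : ℂ) * height α.wt := by
    simp only [height, Finset.sum_apply, Finset.mul_sum, Pi.smul_apply]
    rw [Finset.sum_comm]
    refine Finset.sum_congr rfl fun α _ => Finset.sum_congr rfl fun i _ => ?_
    rw [nsmul_eq_mul]
    ring
  rw [this, Nat.cast_sum]
  refine Finset.sum_congr rfl fun α _ => ?_
  rw [height_wt]
  by_cases h : α.i ≤ α.j
  · rw [h1 α h]; simp
  · rw [Nat.cast_mul, Nat.cast_sub (by simpa using (not_le.1 h).le)]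

/-- Every negative root has height at least one, so each multiplicity is bounded by the height of
`ν`, which is a natural number as soon as a partition exists. -/
lemma kostant_finite (ν : Fin n → ℂ) : (kostant ν).Finite := by
  by_cases h : ∃ N : ℕ, height ν = N
  · obtain ⟨N, hN⟩ := h
    refine (Set.finite_Iic (fun _ : Root n => N)).subset fun k hk α => ?_
    have h1 := height_kostant hk
    rw [hN, Nat.cast_inj] at h1
    by_cases h2 : α.i ≤ α.j
    · rw [hk.1 α h2]; exact Nat.zero_le _
    · have h3 : k α * ((α.i : ℕ) - α.j) ≤ N := h1 ▸ Finset.single_le_sum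
        (f := fun α : Root n => k α * ((α.i : ℕ) - (α.j : ℕ))) (fun _ _ => Nat.zero_le _) (Finset.mem_univ α)
      have h4 : 0 < (α.i : ℕ) - α.j := by
        rw [not_le, Fin.lt_def] at h2
        omega
      exact (Nat.le_mul_of_pos_right _ h4).trans h3
  · refine Set.Finite.subset Set.finite_empty fun k hk => (h ⟨_, height_kostant hk⟩).elim

lemma rootMult_finite (ν : Fin n → ℂ) :
    {k : RootMult (fun i j : Fin n => i ≤ j) | ∑ α, k.1 α • α.wt = ν}.Finite := by
  refine Set.Finite.of_finite_image (f := Subtype.val) ((kostant_finite ν).subset ?_)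
    Subtype.val_injective.injOn
  rintro _ ⟨k, hk, rfl⟩
  exact ⟨k.2, hk⟩

theorem inCatM_UnMinus (n : ℕ) : InCatM (UnMinus n) := hasPieces_UnMinus.inCatM rootMult_finite

/-- The contribution of a family of multiplicities to the supercharacter of `𝒰(𝔫⁻)`. -/
def rootTerm (k : Root n → ℕ) : Gr (cartan n) := ∏ α, Gr.cls (symPow (k α) α.space)

theorem sch_UnMinus (ν : Fin n → ℂ) :
    sch (UnMinus n) ν = ∑ k ∈ (kostant_finite ν).toFinset, rootTerm k := by
  rw [hasPieces_UnMinus.sch_eq rootMult_finite]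
  refine Finset.sum_bij (fun k _ => k.1) (fun k hk => ?_) (fun k _ l _ h => Subtype.ext h)
    (fun k hk => ?_) fun _ _ => rfl
  · rw [Set.Finite.mem_toFinset] at *
    exact ⟨k.2, hk⟩
  · rw [Set.Finite.mem_toFinset] at hk
    exact ⟨⟨k, hk.1⟩, (rootMult_finite ν).mem_toFinset.2 hk.2, rfl⟩

end
end Queer

namespace Queer

noncomputable section

open LieSuperalgebra SuperRep TensorProduct

variable {n : ℕ}

/-! ### Simple modules of the Cartan subalgebra as Clifford modules -/

section Clifford

/-- The odd basis elements `T_{0, E_ii}` of `𝔥`. -/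
def clf (i : Fin n) : cartan n :=
  ⟨(0, Matrix.diagonal (Pi.single i 1)), fun j k hjk => by simp [Matrix.diagonal_apply_ne _ hjk]⟩

lemma par_clf (i : Fin n) : par (clf i) = (-1 : ℂ) ^ 1 • clf i :=
  Subtype.ext (Prod.ext (by change (0 : Matrix (Fin n) (Fin n) ℂ) = (-1 : ℂ) ^ 1 • 0; simp) (by
    change -Matrix.diagonal (Pi.single i 1) = (-1 : ℂ) ^ 1 • Matrix.diagonal (Pi.single i 1); simp))

lemma br_clf (i j : Fin n) : br (clf i) (clf j) = if i = j then (2 : ℂ) • tor i else 0 := by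
  have h : br (clf i) (clf j) = (⟨br (clf i : Q n) (clf j : Q n), (br (clf i) (clf j)).2⟩ : cartan n) := rfl
  rw [h]
  refine Subtype.ext ?_
  change br (clf i : Q n) (clf j : Q n) = _
  rw [br_apply]
  simp only [clf, Matrix.zero_mul, Matrix.mul_zero, sub_zero, zero_add, add_zero,
    Matrix.diagonal_mul_diagonal]
  split_ifs with hij
  · subst hij
    refine Prod.ext ?_ (by simp [tor])
    ext a b
    simp only [tor]
    by_cases hab : a = b
    · subst hab
      by_cases ha : a = i
      · subst ha; simp; norm_num
      · simp [ha]
    · simp [hab]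
  · refine Prod.ext ?_ rfl
    ext a b
    by_cases hab : a = b
    · subst hab
      by_cases ha : a = i
      · subst ha; simp [hij]
      · simp [ha]
    · simp [hab]

lemma cartan_eq_sum (x : cartan n) :
    x = ∑ i, (x : Q n).1 i i • tor i + ∑ i, (x : Q n).2 i i • clf i := by
  have hd : ∀ A : Matrix (Fin n) (Fin n) ℂ, (∀ j k, j ≠ k → A j k = 0) →
      A = ∑ i, A i i • Matrix.diagonal (Pi.single i 1) := by
    intro A hA
    ext j k
    rw [Matrix.sum_apply]
    by_cases h : j = k
    · subst h; simp [Pi.single_apply]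
    · simp [hA j k h, h]
  refine Subtype.ext (Prod.ext ?_ ?_)
  · rw [Submodule.coe_add, Submodule.coe_sum, Submodule.coe_sum, Prod.fst_add, Prod.fst_sum, Prod.fst_sum]
    refine (hd _ fun j k h => (x.2 j k h).1).trans ?_
    simp [tor, clf]
  · rw [Submodule.coe_add, Submodule.coe_sum, Submodule.coe_sum, Prod.snd_add, Prod.snd_sum, Prod.snd_sum]
    refine (hd _ fun j k h => (x.2 j k h).2).trans ?_
    simp [tor, clf]

variable (M : SuperRep (cartan n))

lemma clf_anti {i j : Fin n} (h : i ≠ j) (v : M.carrier) :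
    M.ρ (clf i) (M.ρ (clf j) v) = -M.ρ (clf j) (M.ρ (clf i) v) := by
  have := ρ_br_apply M (par_clf i) (par_clf j) v
  rw [br_clf, if_neg h, map_zero, LinearMap.zero_apply] at this
  simp only [mul_one, pow_one, neg_smul, one_smul, sub_neg_eq_add] at this
  exact eq_neg_of_add_eq_zero_left this.symm

lemma clf_sq (i : Fin n) (v : M.carrier) : M.ρ (clf i) (M.ρ (clf i) v) = M.ρ (tor i) v := by
  have := ρ_br_apply M (par_clf i) (par_clf i) v
  rw [br_clf, if_pos rfl, map_smul, LinearMap.smul_apply] at this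
  simp only [mul_one, pow_one, neg_smul, one_smul, sub_neg_eq_add, ← two_smul ℂ] at this
  exact (smul_right_injective _ (two_ne_zero (α := ℂ)) this).symm

lemma δ_clf (i : Fin n) (v : M.carrier) : M.δ (M.ρ (clf i) v) = -M.ρ (clf i) (M.δ v) := by
  rw [δ_ρ_hom M (par_clf i)]; simp

variable {M} {ν : Fin n → ℂ}

lemma tor_of_wt (hM : wtSpace M ν = ⊤) (i : Fin n) (v : M.carrier) : M.ρ (tor i) v = ν i • v :=
  mem_wtSpace.1 (hM ▸ Submodule.mem_top : v ∈ wtSpace M ν) i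

lemma clf_sq_of_wt (hM : wtSpace M ν = ⊤) (i : Fin n) (v : M.carrier) :
    M.ρ (clf i) (M.ρ (clf i) v) = ν i • v := (clf_sq M i v).trans (tor_of_wt hM i v)

lemma ρ_of_wt (hM : wtSpace M ν = ⊤) (x : cartan n) (v : M.carrier) :
    M.ρ x v = (∑ i, (x : Q n).1 i i * ν i) • v + ∑ i, (x : Q n).2 i i • M.ρ (clf i) v := by
  conv_lhs => rw [cartan_eq_sum x]
  simp only [map_add, map_sum, map_smul, LinearMap.add_apply, LinearMap.sum_apply,
    LinearMap.smul_apply, tor_of_wt hM, smul_smul, Finset.sum_smul]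

lemma isHom_of_wt {N : SuperRep (cartan n)} (hM : wtSpace M ν = ⊤) (hN : wtSpace N ν = ⊤)
    {f : M.carrier →ₗ[ℂ] N.carrier} (h1 : ∀ v, f (M.δ v) = N.δ (f v))
    (h2 : ∀ i v, f (M.ρ (clf i) v) = N.ρ (clf i) (f v)) : IsHom M N f := by
  refine ⟨h1, fun x v => ?_⟩
  rw [ρ_of_wt hM, ρ_of_wt hN]
  simp [h2]

lemma isSub_of_wt (hM : wtSpace M ν = ⊤) {X : Submodule ℂ M.carrier} (h1 : ∀ v ∈ X, M.δ v ∈ X)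
    (h2 : ∀ i, ∀ v ∈ X, M.ρ (clf i) v ∈ X) : IsSub M X := by
  refine ⟨h1, fun x v hv => ?_⟩
  rw [ρ_of_wt hM]
  exact X.add_mem (X.smul_mem _ hv) (X.sum_mem fun i _ => X.smul_mem _ (h2 i v hv))

/-- The kernel is a graded submodule, because `clf i` anticommutes with the parity and with the
other generators. It is not zero, because the square of `clf i` is `ν i = 0`. -/
lemma clf_eq_zero (hM : wtSpace M ν = ⊤) (hs : M.IsSimple) {i : Fin n} (hi : ν i = 0) (v : M.carrier) :
    M.ρ (clf i) v = 0 := by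
  have hsub : IsSub M (LinearMap.ker (M.ρ (clf i))) := by
    refine isSub_of_wt hM (fun v hv => ?_) fun j v hv => ?_
    · rw [LinearMap.mem_ker] at *
      have := δ_clf M i v
      rw [hv, map_zero] at this
      exact neg_eq_zero.1 this.symm
    · rw [LinearMap.mem_ker] at *
      by_cases h : i = j
      · subst h; rw [hv, map_zero]
      · rw [clf_anti M h, hv, map_zero, neg_zero]
  rcases hs.2 _ hsub with h | h
  · have := hs.1
    obtain ⟨w, hw⟩ := exists_ne (0 : M.carrier)
    have h1 := LinearMap.ker_eq_bot'.1 h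
    refine absurd (h1 w (h1 _ ?_)) hw
    rw [clf_sq_of_wt hM, hi, zero_smul]
  · exact LinearMap.mem_ker.1 (h ▸ Submodule.mem_top)

/-- Schur's lemma. -/
lemma _root_.Queer.SuperRep.IsSimple.bijective {L : Type} [AddCommGroup L] [Module ℂ L]
    [LieSuperalgebra L] {M N : SuperRep L} (hM : M.IsSimple) (hN : N.IsSimple)
    {f : M.carrier →ₗ[ℂ] N.carrier} (hf : IsHom M N f) (h0 : f ≠ 0) : Function.Bijective f := by
  constructor
  · rw [← LinearMap.ker_eq_bot]
    refine (hM.2 _ hf.ker).resolve_right fun h => h0 (LinearMap.ker_eq_top.1 h)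
  · rw [← LinearMap.range_eq_top]
    refine (hN.2 _ hf.range).resolve_left fun h => h0 (LinearMap.range_eq_bot.1 h)

/-- Any nonzero linear map is corrected one generator at a time. All `ν i` used here are nonzero, so
the squares of the generators are invertible scalars. -/
lemma exists_intertwiner {N : SuperRep (cartan n)} (hM : wtSpace M ν = ⊤) (hN : wtSpace N ν = ⊤)
    (h1 : Nontrivial M.carrier) (h2 : Nontrivial N.carrier) (s : Finset (Fin n))
    (hs : ∀ i ∈ s, ν i ≠ 0) : ∃ f : M.carrier →ₗ[ℂ] N.carrier, f ≠ 0 ∧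
      (∀ i ∈ s, ∀ v, f (M.ρ (clf i) v) = N.ρ (clf i) (f v)) ∧
      ∃ ε : ℂ, (ε = 1 ∨ ε = -1) ∧ ∀ v, N.δ (f v) = ε • f (M.δ v) := by
  induction s using Finset.induction_on with
  | empty =>
    obtain ⟨f, hf⟩ : ∃ f : M.carrier →ₗ[ℂ] N.carrier, f ≠ 0 := exists_ne 0
    -- Either the average over the parity is a nonzero even map, or `f` itself is odd.
    by_cases h : f + N.δ ∘ₗ f ∘ₗ M.δ = 0
    · refine ⟨f, hf, by simp, -1, Or.inr rfl, fun v => ?_⟩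
      have := LinearMap.congr_fun h (M.δ v)
      simp only [LinearMap.add_apply, LinearMap.comp_apply, M.δ_δ, LinearMap.zero_apply] at this
      rw [neg_smul, one_smul]
      exact eq_neg_of_add_eq_zero_right this
    · refine ⟨_, h, by simp, 1, Or.inl rfl, fun v => ?_⟩
      simp [M.δ_δ, N.δ_δ, add_comm]
  | insert a s ha ih =>
    obtain ⟨f, hf, hfs, ε, hε, hδ⟩ := ih fun i hi => hs i (Finset.mem_insert_of_mem hi)
    have hνa : ν a ≠ 0 := hs a (Finset.mem_insert_self a s)
    have hai : ∀ i ∈ s, i ≠ a := fun i hi h => ha (h ▸ hi)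
    have hδ' : ∀ v, f (M.δ v) = ε • N.δ (f v) := fun v => by
      rw [hδ, smul_smul]
      rcases hε with rfl | rfl <;> simp
    -- The average commutes with `clf a`. If it vanishes, `f` anticommutes with `clf a`; then
    -- composing with `clf a` and the parity repairs this, keeps the commutation with the earlier
    -- generators, and changes the parity of the map.
    by_cases h : ν a • f + N.ρ (clf a) ∘ₗ f ∘ₗ M.ρ (clf a) = 0
    · have hfa : ∀ v, f (M.ρ (clf a) v) = -N.ρ (clf a) (f v) := fun v => by
        have := LinearMap.congr_fun h (M.ρ (clf a) v)
        simp only [LinearMap.add_apply, LinearMap.comp_apply, LinearMap.smul_apply,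
          clf_sq_of_wt hM, map_smul, LinearMap.zero_apply, ← smul_add] at this
        exact eq_neg_of_add_eq_zero_left ((smul_eq_zero.1 this).resolve_left hνa)
      refine ⟨f ∘ₗ M.ρ (clf a) ∘ₗ M.δ, fun h0 => hf ?_, fun i hi v => ?_, -ε, ?_, fun v => ?_⟩
      · ext v
        have := LinearMap.congr_fun h0 (M.δ (M.ρ (clf a) v))
        simp only [LinearMap.comp_apply, M.δ_δ, clf_sq_of_wt hM, map_smul, LinearMap.zero_apply] at this
        exact (smul_eq_zero.1 this).resolve_left hνa
      · simp only [LinearMap.comp_apply]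
        rcases Finset.mem_insert.1 hi with rfl | hi
        · rw [δ_clf, map_neg, map_neg, hfa, neg_neg]
        · rw [δ_clf, map_neg, map_neg, clf_anti M (hai i hi).symm, map_neg, neg_neg, hfs i hi]
      · rcases hε with rfl | rfl <;> simp
      · simp only [LinearMap.comp_apply]
        rw [hδ, δ_clf, map_neg, smul_neg, neg_smul]
    · refine ⟨_, h, fun i hi v => ?_, ε, hε, fun v => ?_⟩
      · simp only [LinearMap.add_apply, LinearMap.comp_apply, LinearMap.smul_apply, map_add, map_smul]
        rcases Finset.mem_insert.1 hi with rfl | hi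
        · rw [clf_sq_of_wt hM, clf_sq_of_wt hN, map_smul, map_smul, add_comm]
        · rw [hfs i hi, clf_anti M (hai i hi).symm, map_neg, map_neg, hfs i hi,
            clf_anti N (hai i hi).symm, neg_neg]
      · simp only [LinearMap.add_apply, LinearMap.comp_apply, LinearMap.smul_apply, map_add, map_smul]
        rw [hδ, δ_clf, hδ, δ_clf, map_neg, map_smul, map_neg]
        module

lemma isSimple_shift {L : Type} [AddCommGroup L] [Module ℂ L] [LieSuperalgebra L] {M : SuperRep L}
    (h : M.IsSimple) : M.shift.IsSimple :=
  ⟨h.1, fun N hN => h.2 N ⟨fun v hv => by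
    have : -M.δ v ∈ N := hN.1 v hv
    rw [← neg_neg (M.δ v)]
    exact N.neg_mem this, hN.2⟩⟩

/-- Simple `𝔥`-modules of the same weight are isomorphic up to a parity shift. -/
theorem simple_unique {N : SuperRep (cartan n)} (hM : wtSpace M ν = ⊤) (hN : wtSpace N ν = ⊤)
    (h1 : M.IsSimple) (h2 : N.IsSimple) : Iso M N ∨ Iso M N.shift := by
  classical
  obtain ⟨f, hf, hfs, ε, hε, hδ⟩ := exists_intertwiner hM hN h1.1 h2.1
    (Finset.univ.filter fun i => ν i ≠ 0) (by simp)
  have hH : ∀ i v, f (M.ρ (clf i) v) = N.ρ (clf i) (f v) := fun i v => by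
    by_cases hi : ν i = 0
    · rw [clf_eq_zero hM h1 hi, clf_eq_zero hN h2 hi, map_zero]
    · exact hfs i (by simpa using hi) v
  rcases hε with rfl | rfl
  · have h : IsHom M N f := isHom_of_wt hM hN (fun v => by rw [hδ, one_smul]) hH
    exact Or.inl ⟨f, h, h1.bijective h2 h hf⟩
  · have h : IsHom M N.shift f := isHom_of_wt (N := N.shift) hM hN (fun v => by
      change f (M.δ v) = -N.δ (f v)
      rw [hδ, neg_smul, one_smul, neg_neg]) hH
    exact Or.inr ⟨f, h, h1.bijective (isSimple_shift h2) h hf⟩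

/-- The dimension of an irreducible representation of a Clifford algebra. -/
theorem clifford_finrank (N : ℕ) (V : Type) [AddCommGroup V] [Module ℂ V] [Module.Finite ℂ V]
    [Nontrivial V] (e : Fin N → Module.End ℂ V) (c : Fin N → ℂ) (hc : ∀ i, c i ≠ 0)
    (hsq : ∀ i v, e i (e i v) = c i • v) (hanti : ∀ i j, i ≠ j → ∀ v, e i (e j v) = -e j (e i v))
    (hirr : ∀ W : Submodule ℂ V, (∀ i, ∀ v ∈ W, e i v ∈ W) → W = ⊥ ∨ W = ⊤) :
    Module.finrank ℂ V = 2 ^ (N / 2) := by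
  induction N using Nat.twoStepInduction generalizing V with
  | zero =>
    obtain ⟨v, hv⟩ := exists_ne (0 : V)
    have h := (hirr (ℂ ∙ v) fun i => i.elim0).resolve_left (by simpa using hv)
    have := finrank_span_singleton (K := ℂ) hv
    rwa [h, finrank_top] at this
  | one =>
    obtain ⟨μ, hμ⟩ := Module.End.exists_eigenvalue (e 0)
    obtain ⟨v, hv⟩ := hμ.exists_hasEigenvector
    have h := (hirr (ℂ ∙ v) fun i w hw => by
      obtain ⟨a, rfl⟩ := Submodule.mem_span_singleton.1 hw
      rw [Subsingleton.elim i 0, map_smul, hv.apply_eq_smul]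
      exact Submodule.smul_mem _ _ (Submodule.smul_mem _ _ (Submodule.mem_span_singleton_self v))).resolve_left
        (by simpa using hv.2)
    have := finrank_span_singleton (K := ℂ) hv.2
    rwa [h, finrank_top] at this
  | more N ih _ =>
    -- The eigenspace `E` of `e 0 * e 1` is stable under the other generators, and `e 0` maps it
    -- into the eigenspace of the opposite eigenvalue. It turns out that `V = E ⊕ e 0 E` with `E`
    -- irreducible for the other `N` generators, so two generators double the dimension.
    obtain ⟨l, hl⟩ := Module.End.exists_eigenvalue (e 0 * e 1)
    set E := Module.End.eigenspace (e 0 * e 1) l with hE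
    have h01 : ∀ v, e 1 (e 0 v) = -e 0 (e 1 v) := hanti 1 0 (by simp)
    have hmem : ∀ v, v ∈ E ↔ e 0 (e 1 v) = l • v := fun v => Module.End.mem_eigenspace_iff
    have hl0 : l ≠ 0 := by
      rintro rfl
      obtain ⟨v, hv⟩ := hl.exists_hasEigenvector
      have h1 := (hmem v).1 hv.1
      rw [zero_smul] at h1
      have h2 := congrArg (e 0) h1
      rw [hsq, map_zero] at h2
      have h3 := congrArg (e 1) ((smul_eq_zero.1 h2).resolve_left (hc 0))
      rw [hsq, map_zero] at h3
      exact hv.2 ((smul_eq_zero.1 h3).resolve_left (hc 1))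
    have he1 : ∀ v ∈ E, e 1 v = (l / c 0) • e 0 v := fun v hv => by
      have h1 := congrArg (e 0) ((hmem v).1 hv)
      rw [hsq, map_smul] at h1
      rw [div_eq_inv_mul, mul_smul, ← h1, smul_smul, inv_mul_cancel₀ (hc 0), one_smul]
    have hk : ∀ (i : Fin N) v, v ∈ E → e i.succ.succ v ∈ E := fun i v hv => by
      have a1 : (1 : Fin (N + 2)) ≠ i.succ.succ := by
        intro h
        have := congrArg Fin.val h
        simp at this
      have a0 : (0 : Fin (N + 2)) ≠ i.succ.succ := (Fin.succ_ne_zero _).symm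
      rw [hmem, hanti _ _ a1, map_neg, hanti _ _ a0, neg_neg, (hmem v).1 hv, map_smul]
    have hanti0 : ∀ (i : Fin N) v, e i.succ.succ (e 0 v) = -e 0 (e i.succ.succ v) := fun i v =>
      hanti _ _ (Fin.succ_ne_zero _) v
    -- On `E` the operator `e 1` is a multiple of `e 0`. So for a subspace `X` of `E` stable under
    -- the other generators, `X + e 0 X` is stable under all of them, hence equal to `V`. For `X =
    -- E` this gives the decomposition of `V`, for smaller `X` the irreducibility of `E`.
    have hfull : ∀ X : Submodule ℂ V, X ≤ E → X ≠ ⊥ → (∀ (i : Fin N) v, v ∈ X → e i.succ.succ v ∈ X) →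
        X ⊔ X.map (e 0) = ⊤ := by
      intro X hXE hX0 hX
      refine (hirr _ fun i v hv => ?_).resolve_left fun h => hX0 (eq_bot_iff.2 (h ▸ le_sup_left))
      obtain ⟨x, hx, _, ⟨y, hy, rfl⟩, rfl⟩ := Submodule.mem_sup.1 hv
      rw [map_add]
      refine Fin.cases ?_ (fun i => Fin.cases ?_ (fun i => ?_) i) i
      · rw [hsq, add_comm (e 0 x) (c 0 • y)]
        exact Submodule.add_mem_sup (X.smul_mem _ hy) ⟨x, hx, rfl⟩
      · rw [show (Fin.succ 0 : Fin (N + 2)) = 1 from rfl, h01, (hmem y).1 (hXE hy), he1 x (hXE hx),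
          add_comm ((l / c 0) • e 0 x) (-(l • y))]
        exact Submodule.add_mem_sup (X.neg_mem (X.smul_mem _ hy))
          (Submodule.smul_mem _ _ ⟨x, hx, rfl⟩)
      · rw [hanti0]
        exact Submodule.add_mem_sup (hX i x hx) (Submodule.neg_mem _ ⟨_, hX i y hy, rfl⟩)
    have hdisj : ∀ x ∈ E, ∀ y ∈ E, x = e 0 y → x = 0 := by
      intro x hx y hy h
      have h1 := (hmem x).1 hx
      have h2 : e 0 (e 1 x) = -(l • x) := by
        rw [h, h01, map_neg, (hmem y).1 hy, map_smul]
      rw [h1] at h2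
      have h3 : (2 * l) • x = 0 := by
        rw [mul_smul, two_smul]
        nth_rewrite 1 [h2]
        exact neg_add_cancel _
      exact (smul_eq_zero.1 h3).resolve_left (mul_ne_zero two_ne_zero hl0)
    have hEb : E ≠ ⊥ := hl
    have hnt : Nontrivial E := Submodule.nontrivial_iff_ne_bot.2 hEb
    have hdim := ih E (fun i => (e i.succ.succ).restrict (hk i)) (fun i => c i.succ.succ)
      (fun i => hc _) (fun i v => Subtype.ext (hsq _ _))
      (fun i j hij v => Subtype.ext (hanti _ _ (by simpa using hij) _)) fun W hW => by
        by_cases hb : W = ⊥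
        · exact Or.inl hb
        right
        have h1 := hfull (W.map E.subtype) (Submodule.map_subtype_le _ _)
          (fun h => hb (Submodule.map_injective_of_injective E.subtype_injective
            (h.trans (Submodule.map_bot _).symm)))
          (by rintro i _ ⟨v, hv, rfl⟩; exact ⟨_, hW i v hv, rfl⟩)
        rw [eq_top_iff]
        intro v _
        obtain ⟨_, ⟨x, hx, rfl⟩, _, ⟨_, ⟨y, hy, rfl⟩, rfl⟩, hxy⟩ :=
          Submodule.mem_sup.1 (h1 ▸ Submodule.mem_top : (v : V) ∈ _)
        have h2 := hdisj (v - x : V) (E.sub_mem v.2 x.2) y y.2 (by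
          rw [← hxy]; simp)
        have h3 : v = x := Subtype.ext (sub_eq_zero.1 h2)
        exact h3 ▸ hx
    have hEE := hfull E le_rfl hEb hk
    have h4 : IsCompl E (E.map (e 0)) := by
      refine ⟨Submodule.disjoint_def.2 ?_, codisjoint_iff.2 hEE⟩
      rintro x hx ⟨y, hy, h⟩
      exact hdisj x hx y hy h.symm
    have h5 : Function.Injective (e 0) := by
      refine Function.LeftInverse.injective (g := fun v => (c 0)⁻¹ • e 0 v) fun v => ?_
      simp only
      rw [hsq, smul_smul, inv_mul_cancel₀ (hc 0), one_smul]
    have h6 := Submodule.finrank_add_eq_of_isCompl h4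
    rw [← LinearEquiv.finrank_eq (Submodule.equivMapOfInjective (e 0) h5 E)] at h6
    rw [← h6, hdim, show (N + 2) / 2 = N / 2 + 1 by omega, pow_succ]
    ring

end Clifford
end
end Queer

namespace Queer

noncomputable section

open LieSuperalgebra SuperRep TensorProduct

variable {n : ℕ}

/-! ### Existence of simple submodules -/

section SimpleModules

variable {L : Type} [AddCommGroup L] [Module ℂ L] [LieSuperalgebra L]

/-- A nonzero finite-dimensional module has a simple submodule. -/
lemma exists_simple_sub (M : SuperRep L) (X : Submodule ℂ M.carrier) (hX : IsSub M X) (hX0 : X ≠ ⊥)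
    [hfin : Module.Finite ℂ X] :
    ∃ (Y : Submodule ℂ M.carrier) (h : IsSub M Y), Y ≤ X ∧ (M.sub Y h).IsSimple := by
  induction hd : Module.finrank ℂ X using Nat.strong_induction_on generalizing X with
  | _ d ih =>
    by_cases hs : (M.sub X hX).IsSimple
    · exact ⟨X, hX, le_rfl, hs⟩
    · have hnt : Nontrivial X := Submodule.nontrivial_iff_ne_bot.2 hX0
      obtain ⟨Z, hZ, hZ0, hZ1⟩ : ∃ Z : Submodule ℂ X, IsSub (M.sub X hX) Z ∧ Z ≠ ⊥ ∧ Z ≠ ⊤ := by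
        by_contra! hc
        refine hs ⟨hnt, fun Z hZ => ?_⟩
        by_cases h : Z = ⊥
        · exact Or.inl h
        · exact Or.inr (hc Z hZ h)
      have hZ' : IsSub M (Z.map X.subtype) := (sub_subtype_isHom M X hX).map hZ
      have hlt : Module.finrank ℂ (Z.map X.subtype) < d := by
        rw [← LinearEquiv.finrank_eq (Submodule.equivMapOfInjective X.subtype X.subtype_injective Z), ← hd]
        exact Submodule.finrank_lt hZ1
      obtain ⟨Y, hY, hYZ, hYs⟩ := ih _ hlt (Z.map X.subtype) hZ' (fun h => hZ0
        (Submodule.map_injective_of_injective X.subtype_injective (h.trans (Submodule.map_bot _).symm)))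
        (hfin := Module.Finite.equiv
          (Submodule.equivMapOfInjective X.subtype X.subtype_injective Z)) rfl
      exact ⟨Y, hY, hYZ.trans (Submodule.map_subtype_le _ _), hYs⟩

end SimpleModules

/-! ### Classes of modules of a single weight -/

section Classes

variable {ν : Fin n → ℂ}

lemma wtSpace_sub {M : SuperRep (cartan n)} (hM : wtSpace M ν = ⊤) {X : Submodule ℂ M.carrier}
    (hX : IsSub M X) : wtSpace (M.sub X hX) ν = ⊤ := by
  refine (Submodule.eq_top_iff').2 fun v => mem_wtSpace.2 fun i => Subtype.ext ?_
  exact tor_of_wt hM i v.1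

lemma wtSpace_quot {M : SuperRep (cartan n)} (hM : wtSpace M ν = ⊤) {X : Submodule ℂ M.carrier}
    (hX : IsSub M X) : wtSpace (M.quot X hX) ν = ⊤ := by
  refine (Submodule.eq_top_iff').2 fun v => mem_wtSpace.2 fun i => ?_
  obtain ⟨v, rfl⟩ := X.mkQ_surjective v
  exact congrArg X.mkQ (tor_of_wt hM i v)

open Classical in
/-- The support of a weight. -/
def wtSupp (ν : Fin n → ℂ) : Finset (Fin n) := Finset.univ.filter fun i => ν i ≠ 0

lemma mem_wtSupp {i : Fin n} : i ∈ wtSupp ν ↔ ν i ≠ 0 := by simp [wtSupp]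

/-- The generators outside the support act by zero. The parity `δ` serves as one more Clifford
generator, of square one, and turns simplicity as a graded module into irreducibility. So there are
`(wtSupp ν).card + 1` generators in total. -/
theorem finrank_simple {M : SuperRep (cartan n)} [Module.Finite ℂ M.carrier] (hM : wtSpace M ν = ⊤)
    (hs : M.IsSimple) : Module.finrank ℂ M.carrier = 2 ^ (((wtSupp ν).card + 1) / 2) := by
  have := hs.1
  let o := (wtSupp ν).orderEmbOfFin rfl
  have ho : ∀ k, ν (o k) ≠ 0 := fun k => mem_wtSupp.1 (Finset.orderEmbOfFin_mem _ rfl k)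
  refine clifford_finrank _ M.carrier (Fin.cons M.δ fun k => M.ρ (clf (o k)))
    (Fin.cons 1 fun k => ν (o k)) ?_ ?_ ?_ ?_
  · intro k
    refine Fin.cases ?_ (fun k => ?_) k
    · simp
    · simpa using ho k
  · intro k v
    refine Fin.cases ?_ (fun k => ?_) k
    · simp [M.δ_δ]
    · simpa using clf_sq_of_wt hM _ v
  · intro k l
    refine Fin.cases ?_ (fun k => ?_) k <;> refine Fin.cases ?_ (fun l => ?_) l
    · exact fun h => absurd rfl h
    · intro _ v
      simpa using δ_clf M _ v
    · intro _ v
      simp [δ_clf]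
    · intro h v
      have : o k ≠ o l := fun e => h (congrArg Fin.succ (o.injective e))
      simpa using clf_anti M this v
  · intro W hW
    refine hs.2 W (isSub_of_wt hM (fun v hv => hW 0 v hv) fun i v hv => ?_)
    by_cases hi : ν i = 0
    · rw [clf_eq_zero hM hs hi]
      exact W.zero_mem
    · have h1 : i ∈ Set.range o := by
        rw [Finset.range_orderEmbOfFin]
        exact mem_wtSupp.2 hi
      obtain ⟨k, rfl⟩ := h1
      exact hW k.succ v hv

/-- The class of a module of weight `ν` is a multiple of that of the simple module. -/
theorem cls_of_wt {C : FinRep (cartan n)} (hC : IsSimpleOfWeight ν C) (M : FinRep (cartan n))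
    (hM : wtSpace M.rep ν = ⊤) : ∃ (a : ℤ) (m : ℕ), Gr.cls M = a • Gr.cls C ∧
      Module.finrank ℂ M.rep.carrier = m * Module.finrank ℂ C.rep.carrier ∧ Even (a - m) ∧
      a.natAbs ≤ m := by
  induction hd : Module.finrank ℂ M.rep.carrier using Nat.strong_induction_on generalizing M with
  | _ d ih =>
    by_cases h0 : d = 0
    · subst h0
      have : Subsingleton M.rep.carrier := Module.finrank_zero_iff.1 hd
      exact ⟨0, 0, by rw [Gr.cls_of_subsingleton, zero_smul], by simp, by simp, by simp⟩
    have hnt : Nontrivial M.rep.carrier := Module.nontrivial_of_finrank_pos (R := ℂ) (by omega)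
    obtain ⟨Y, hY, -, hYs⟩ := exists_simple_sub M.rep ⊤ M.rep.isSub_top top_ne_bot
    have h1 : Module.Finite ℂ (M.rep.sub Y hY).carrier := inferInstanceAs (Module.Finite ℂ Y)
    have h2 : Module.Finite ℂ (M.rep.quot Y hY).carrier :=
      inferInstanceAs (Module.Finite ℂ (M.rep.carrier ⧸ Y))
    have hYr : Module.finrank ℂ Y = Module.finrank ℂ C.rep.carrier :=
      (finrank_simple (wtSpace_sub hM hY) hYs).trans (finrank_simple hC.2 hC.1).symm
    have hq : Module.finrank ℂ (M.rep.carrier ⧸ Y) + Module.finrank ℂ Y = d :=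
      hd ▸ Submodule.finrank_quotient_add_finrank Y
    have hpos : 0 < Module.finrank ℂ Y := by
      have : Nontrivial Y := hYs.1
      exact Module.finrank_pos
    obtain ⟨a, m, ha, hm, he, h3⟩ := ih (Module.finrank ℂ (M.rep.carrier ⧸ Y)) (by omega)
      ⟨M.rep.quot Y hY, h2⟩ (wtSpace_quot hM hY) rfl
    obtain ⟨ε, hε, hε'⟩ : ∃ ε : ℤ, (ε = 1 ∨ ε = -1) ∧
        Gr.cls ⟨M.rep.sub Y hY, h1⟩ = ε • Gr.cls C := by
      rcases simple_unique (wtSpace_sub hM hY) hC.2 hYs hC.1 with h | h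
      · exact ⟨1, Or.inl rfl, by rw [one_smul]; exact Gr.cls_iso h⟩
      · refine ⟨-1, Or.inr rfl, ?_⟩
        rw [neg_smul, one_smul, ← Gr.cls_shift]
        exact Gr.cls_iso h
    -- The multiple `a` is a sum of `m` signs, one for each composition factor, whence its parity
    -- and its bound. The parity decides the case of odd support; for `m = 1` both together give `a
    -- = ±1`.
    refine ⟨ε + a, m + 1, ?_, ?_, ?_, ?_⟩
    · rw [Gr.cls_sub_quot M Y hY h1 h2, hε', ha, add_smul]
    · rw [add_mul, one_mul, ← hm, ← hYr, ← hq]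
    · have : Even (ε - 1) := by rcases hε with rfl | rfl <;> decide
      have h4 : ε + a - ((m + 1 : ℕ) : ℤ) = (ε - 1) + (a - m) := by push_cast; ring
      rw [h4]
      exact this.add he
    · rcases hε with rfl | rfl <;> omega

end Classes

/-! ### Supertraces as functionals on the Grothendieck group -/

section Characters

variable (M : SuperRep (cartan n))

/-- The product of the operators of odd basis elements of `𝔥`. -/
def clfProd (l : List (Fin n)) : Module.End ℂ M.carrier := (l.map fun i => M.ρ (clf i)).prod

@[simp] lemma clfProd_nil : clfProd M [] = 1 := rfl

@[simp] lemma clfProd_cons (i : Fin n) (l : List (Fin n)) :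
    clfProd M (i :: l) = M.ρ (clf i) * clfProd M l := by simp [clfProd]

lemma clfProd_append (l l' : List (Fin n)) : clfProd M (l ++ l') = clfProd M l * clfProd M l' := by
  simp [clfProd]

lemma clf_mul_clfProd {i : Fin n} {l : List (Fin n)} (hi : i ∉ l) :
    M.ρ (clf i) * clfProd M l = (-1 : ℂ) ^ l.length • (clfProd M l * M.ρ (clf i)) := by
  induction l with
  | nil => simp
  | cons j l ih =>
    rw [List.mem_cons, not_or] at hi
    have h : M.ρ (clf i) * M.ρ (clf j) = -(M.ρ (clf j) * M.ρ (clf i)) :=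
      LinearMap.ext fun v => clf_anti M hi.1 v
    rw [clfProd_cons, ← mul_assoc, h, neg_mul, mul_assoc, ih hi.2, List.length_cons, mul_smul_comm,
      mul_assoc, pow_succ, mul_neg_one, neg_smul]

/-- Passing `clf i` through the product costs one sign for each factor except `clf i` itself. -/
lemma clf_mul_clfProd_of_mem {i : Fin n} {l : List (Fin n)} (hl : l.Nodup) (hi : i ∈ l) :
    M.ρ (clf i) * clfProd M l = (-1 : ℂ) ^ (l.length + 1) • (clfProd M l * M.ρ (clf i)) := by
  induction l with
  | nil => simp at hi
  | cons j l ih =>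
    rw [List.nodup_cons] at hl
    by_cases hij : i = j
    · subst hij
      have h1 := clf_mul_clfProd M hl.1
      rw [clfProd_cons]
      conv_lhs => rw [h1, mul_smul_comm, ← mul_assoc]
      rw [List.length_cons, pow_succ, pow_succ, mul_assoc]
      simp
    · have h : M.ρ (clf i) * M.ρ (clf j) = -(M.ρ (clf j) * M.ρ (clf i)) :=
        LinearMap.ext fun v => clf_anti M hij v
      rw [clfProd_cons, ← mul_assoc, h, neg_mul, mul_assoc,
        ih hl.2 ((List.mem_cons.1 hi).resolve_left hij), List.length_cons, mul_smul_comm,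
        mul_assoc, pow_succ _ (l.length + 1), mul_neg_one, neg_smul]

lemma δ_mul_clfProd (l : List (Fin n)) :
    M.δ * clfProd M l = (-1 : ℂ) ^ l.length • (clfProd M l * M.δ) := by
  induction l with
  | nil => simp
  | cons j l ih =>
    have h : M.δ * M.ρ (clf j) = -(M.ρ (clf j) * M.δ) := LinearMap.ext fun v => δ_clf M j v
    rw [clfProd_cons, ← mul_assoc, h, neg_mul, mul_assoc, ih, List.length_cons, mul_smul_comm,
      mul_assoc, pow_succ, mul_neg_one, neg_smul]

lemma clfProd_injective {ν : Fin n → ℂ} (hM : wtSpace M ν = ⊤) {l : List (Fin n)}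
    (hl : ∀ i ∈ l, ν i ≠ 0) : Function.Injective (clfProd M l) := by
  induction l with
  | nil => exact fun _ _ h => h
  | cons j l ih =>
    rw [clfProd_cons]
    have h1 : Function.Injective (M.ρ (clf j)) := Function.LeftInverse.injective
      (g := fun v => (ν j)⁻¹ • M.ρ (clf j) v) fun v => by
        simp only
        rw [clf_sq_of_wt hM, smul_smul, inv_mul_cancel₀ (hl j List.mem_cons_self), one_smul]
    exact h1.comp (ih fun i hi => hl i (List.mem_cons_of_mem _ hi))

/-- Reordering changes the product of the Clifford generators by a sign. -/
lemma clfProd_perm {l l' : List (Fin n)} (h : l.Perm l') (hl : l.Nodup) :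
    ∃ ε : ℂ, (ε = 1 ∨ ε = -1) ∧ ∀ M : SuperRep (cartan n), clfProd M l = ε • clfProd M l' := by
  induction h with
  | nil => exact ⟨1, Or.inl rfl, fun M => by simp⟩
  | cons a h ih =>
    obtain ⟨ε, hε, h1⟩ := ih (List.nodup_cons.1 hl).2
    exact ⟨ε, hε, fun M => by rw [clfProd_cons, h1, clfProd_cons, mul_smul_comm]⟩
  | swap a b l =>
    refine ⟨-1, Or.inr rfl, fun M => ?_⟩
    have hab : b ≠ a := by
      simp only [List.nodup_cons, List.mem_cons, not_or] at hl
      exact hl.1.1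
    have h : M.ρ (clf b) * M.ρ (clf a) = -(M.ρ (clf a) * M.ρ (clf b)) :=
      LinearMap.ext fun v => clf_anti M hab v
    rw [clfProd_cons, clfProd_cons, clfProd_cons, clfProd_cons, ← mul_assoc, h, neg_mul, mul_assoc,
      neg_smul, one_smul]
  | trans h1 h2 ih1 ih2 =>
    obtain ⟨ε, hε, h3⟩ := ih1 hl
    obtain ⟨ε', hε', h4⟩ := ih2 (h1.nodup_iff.1 hl)
    refine ⟨ε * ε', ?_, fun M => by rw [h3, h4, smul_smul]⟩
    rcases hε with rfl | rfl <;> rcases hε' with rfl | rfl <;> simp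

/-- If `l₂` stands between `p` and `q`, both generators pass it with the same sign `(-1) ^
l₂.length`, so what remains is the sign of their own anticommutation. -/
lemma clfProd_swap {p q : Fin n} (hpq : p ≠ q) {l : List (Fin n)} (hl : l.Nodup) (hp : p ∈ l)
    (hq : q ∈ l) : clfProd M (l.map (Equiv.swap p q)) = -clfProd M l := by
  have key : ∀ (p q : Fin n) (l₁ l₂ l₃ : List (Fin n)), (l₁ ++ p :: (l₂ ++ q :: l₃)).Nodup →
      clfProd M ((l₁ ++ p :: (l₂ ++ q :: l₃)).map (Equiv.swap p q)) =
        -clfProd M (l₁ ++ p :: (l₂ ++ q :: l₃)) := by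
    intro p q l₁ l₂ l₃ h
    have hfix : ∀ l : List (Fin n), p ∉ l → q ∉ l → l.map (Equiv.swap p q) = l := fun l h1 h2 => by
      conv_rhs => rw [← List.map_id l]
      refine List.map_congr_left fun x hx => Equiv.swap_apply_of_ne_of_ne ?_ ?_
      · rintro rfl; exact h1 hx
      · rintro rfl; exact h2 hx
    simp only [List.nodup_append, List.nodup_cons, List.mem_append, List.mem_cons, not_or] at h
    obtain ⟨-, ⟨⟨p2, pq, p3⟩, -, ⟨q3, -⟩, h23⟩, h1⟩ := h
    have p1 : p ∉ l₁ := fun h => h1 p h p (Or.inl rfl) rfl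
    have q1 : q ∉ l₁ := fun h => h1 q h q (Or.inr (Or.inr (Or.inl rfl))) rfl
    have q2 : q ∉ l₂ := fun h => h23 q h q (Or.inl rfl) rfl
    have hanti : M.ρ (clf q) * M.ρ (clf p) = -(M.ρ (clf p) * M.ρ (clf q)) :=
      LinearMap.ext fun v => clf_anti M (Ne.symm pq) v
    have e1 := clf_mul_clfProd M p2
    have e2 := clf_mul_clfProd M q2
    have main : M.ρ (clf q) * (clfProd M l₂ * (M.ρ (clf p) * clfProd M l₃)) =
        -(M.ρ (clf p) * (clfProd M l₂ * (M.ρ (clf q) * clfProd M l₃))) := by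
      rw [← mul_assoc, e2, ← mul_assoc (M.ρ (clf p)), e1, smul_mul_assoc, smul_mul_assoc, mul_assoc,
        mul_assoc, ← mul_assoc (M.ρ (clf q)), hanti, ← mul_assoc (M.ρ (clf p)) (M.ρ (clf q)), neg_mul,
        mul_neg, smul_neg]
    simp only [List.map_append, List.map_cons, hfix l₁ p1 q1, hfix l₂ p2 q2, hfix l₃ p3 q3,
      Equiv.swap_apply_left, Equiv.swap_apply_right, clfProd_append, clfProd_cons, main, mul_neg]
  obtain ⟨s, t, rfl⟩ := List.append_of_mem hp
  rw [List.mem_append, List.mem_cons] at hq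
  rcases hq with hq | hq | hq
  · obtain ⟨s, u, rfl⟩ := List.append_of_mem hq
    rw [Equiv.swap_comm]
    rw [List.append_assoc, List.cons_append] at hl ⊢
    exact key _ _ _ _ _ hl
  · exact absurd hq.symm hpq
  · obtain ⟨t, u, rfl⟩ := List.append_of_mem hq
    exact key _ _ _ _ _ hl

variable {M}

/-- If the support of the weight has an odd number of elements, a simple module is isomorphic to
its parity shift. -/
theorem iso_shift_of_odd {ν : Fin n → ℂ} (hM : wtSpace M ν = ⊤) (hs : M.IsSimple)
    (hodd : Odd (wtSupp ν).card) : Iso M M.shift := by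
  set l := (wtSupp ν).toList with hl
  have hlen : Odd l.length := by rwa [hl, Finset.length_toList]
  -- A product of an odd number of distinct generators commutes with each of them and anticommutes
  -- with the parity, so it is a morphism to the parity shift.
  have hhom : IsHom M M.shift (clfProd M l) := by
    refine isHom_of_wt (N := M.shift) hM hM (fun v => ?_) fun i v => ?_
    · have h := LinearMap.congr_fun (δ_mul_clfProd M l) v
      rw [hlen.neg_one_pow, neg_smul, one_smul] at h
      change clfProd M l (M.δ v) = -M.δ (clfProd M l v)
      rw [show M.δ (clfProd M l v) = -(clfProd M l (M.δ v)) from h, neg_neg]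
    · change clfProd M l (M.ρ (clf i) v) = M.ρ (clf i) (clfProd M l v)
      by_cases hi : ν i = 0
      · rw [clf_eq_zero hM hs hi, clf_eq_zero hM hs hi, map_zero]
      · have h := LinearMap.congr_fun (clf_mul_clfProd_of_mem M (Finset.nodup_toList _)
          (Finset.mem_toList.2 (mem_wtSupp.2 hi) : i ∈ l)) v
        rw [(hlen.add_odd odd_one).neg_one_pow, one_smul] at h
        exact h.symm
  refine ⟨_, hhom, hs.bijective (isSimple_shift hs) hhom fun h0 => ?_⟩
  have := hs.1
  obtain ⟨v, hv⟩ := exists_ne (0 : M.carrier)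
  refine hv (clfProd_injective M hM (l := l) (fun i hi => ?_) ?_)
  · exact mem_wtSupp.1 (Finset.mem_toList.1 hi)
  · rw [show clfProd M l = 0 from h0]; rfl

/-- Additivity of the trace in short exact sequences. -/
lemma trace_exact {U V W : Type} [AddCommGroup U] [Module ℂ U] [AddCommGroup V] [Module ℂ V]
    [AddCommGroup W] [Module ℂ W] [Module.Finite ℂ U] [Module.Finite ℂ V] [Module.Finite ℂ W]
    {f : U →ₗ[ℂ] V} {g : V →ₗ[ℂ] W} (hf : Function.Injective f) (hfg : Function.Exact f g)
    (hg : Function.Surjective g) {TU : Module.End ℂ U} {TV : Module.End ℂ V} {TW : Module.End ℂ W}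
    (h1 : ∀ u, f (TU u) = TV (f u)) (h2 : ∀ v, g (TV v) = TW (g v)) :
    LinearMap.trace ℂ V TV = LinearMap.trace ℂ U TU + LinearMap.trace ℂ W TW := by
  obtain ⟨s, hs⟩ := g.exists_rightInverse_of_surjective (LinearMap.range_eq_top.2 hg)
  obtain ⟨r, hr⟩ := f.exists_leftInverse_of_injective (LinearMap.ker_eq_bot.2 hf)
  have hs' : ∀ w, g (s w) = w := LinearMap.congr_fun hs
  have hr' : ∀ u, r (f u) = u := LinearMap.congr_fun hr
  let p : V →ₗ[ℂ] U := r ∘ₗ (LinearMap.id - s ∘ₗ g)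
  have hp : ∀ v, f (p v) + s (g v) = v := fun v => by
    obtain ⟨u, hu⟩ := (hfg (v - s (g v))).1 (by rw [map_sub, hs', sub_self])
    simp only [p, LinearMap.comp_apply, LinearMap.sub_apply, LinearMap.id_apply, ← hu, hr']
    rw [hu, sub_add_cancel]
  have hpf : ∀ u, p (f u) = u := fun u => by
    simp only [p, LinearMap.comp_apply, LinearMap.sub_apply, LinearMap.id_apply, (hfg (f u)).2 ⟨u, rfl⟩,
      map_zero, sub_zero, hr']
  -- With respect to a splitting `V = U ⊕ W`, the trace is that of the two diagonal blocks;
  -- cyclicity of the trace isolates them.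
  have e : TV = (f ∘ₗ TU) ∘ₗ p + (TV ∘ₗ s) ∘ₗ g := LinearMap.ext fun v => by
    simp only [LinearMap.add_apply, LinearMap.comp_apply, h1, ← map_add, hp]
  rw [e, map_add, LinearMap.trace_comp_comm', LinearMap.trace_comp_comm' g (TV ∘ₗ s)]
  congr 2
  · ext u; simp [hpf]
  · ext w; simp [h2, hs']

/-- The supertrace of a product of odd basis elements of `𝔥`. -/
def chr (l : List (Fin n)) : Gr (cartan n) →+ ℂ :=
  Gr.lift (fun M => LinearMap.trace ℂ M.rep.carrier (M.rep.δ * clfProd M.rep l))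
    (fun N E M f g hf hg h1 h2 h3 => by
      have key : ∀ {A B : FinRep (cartan n)} {f : A.rep.carrier →ₗ[ℂ] B.rep.carrier},
          IsHom A.rep B.rep f → ∀ v, f ((A.rep.δ * clfProd A.rep l) v) =
            (B.rep.δ * clfProd B.rep l) (f v) := by
        intro A B f hf v
        rw [Module.End.mul_apply, Module.End.mul_apply, hf.1]
        congr 1
        induction l with
        | nil => rfl
        | cons i l ih =>
          rw [clfProd_cons, clfProd_cons, Module.End.mul_apply, Module.End.mul_apply, hf.2, ih]
      exact trace_exact h1 h2 h3 (key hf) (key hg))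
    (fun M => by
      have : M.shift.rep.δ * clfProd M.shift.rep l = -(M.rep.δ * clfProd M.rep l) :=
        neg_mul M.rep.δ (clfProd M.rep l)
      exact (congrArg (LinearMap.trace ℂ M.rep.carrier) this).trans (map_neg _ _))

lemma chr_cls (l : List (Fin n)) (M : FinRep (cartan n)) :
    chr l (Gr.cls M) = LinearMap.trace ℂ M.rep.carrier (M.rep.δ * clfProd M.rep l) :=
  Gr.lift_cls _ _ _ M

lemma chr_congr {l l' : List (Fin n)} {ε : ℂ} (h : ∀ M : SuperRep (cartan n), clfProd M l = ε • clfProd M l')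
    (x : Gr (cartan n)) : chr l x = ε * chr l' x := by
  have : chr l = (AddMonoidHom.mulLeft ε).comp (chr l') := Gr.hom_ext fun M => by
    simp [chr_cls, h]
  rw [this]
  rfl

lemma chr_perm {l l' : List (Fin n)} (h : l.Perm l') (hl : l.Nodup) :
    ∃ ε : ℂ, (ε = 1 ∨ ε = -1) ∧ ∀ x, chr l x = ε * chr l' x := by
  obtain ⟨ε, hε, h1⟩ := clfProd_perm h hl
  exact ⟨ε, hε, chr_congr h1⟩

lemma chr_swap {p q : Fin n} (hpq : p ≠ q) {l : List (Fin n)} (hl : l.Nodup) (hp : p ∈ l)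
    (hq : q ∈ l) (x : Gr (cartan n)) : chr (l.map (Equiv.swap p q)) x = -chr l x := by
  rw [chr_congr (ε := -1) (l' := l) fun M => by rw [clfProd_swap M hpq hl hp hq, neg_smul, one_smul],
    neg_one_mul]

/-- A product of an even number of generators anticommutes with each of them and commutes with `δ`,
so after composition with `δ` it commutes with everything. By Schur's lemma it is a scalar, nonzero
since the operator is injective, and its trace is that scalar times the dimension. -/
theorem chr_simple_ne_zero {ν : Fin n → ℂ} {C : FinRep (cartan n)} (hC : IsSimpleOfWeight ν C)
    (heven : Even (wtSupp ν).card) : chr (wtSupp ν).toList (Gr.cls C) ≠ 0 := by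
  obtain ⟨hs, hM⟩ := hC
  have hnt := hs.1
  set l := (wtSupp ν).toList with hl
  have hlen : Even l.length := by rwa [hl, Finset.length_toList]
  let T := C.rep.δ * clfProd C.rep l
  have hδ : ∀ v, T (C.rep.δ v) = C.rep.δ (T v) := fun v => by
    have h := LinearMap.congr_fun (δ_mul_clfProd C.rep l) v
    rw [hlen.neg_one_pow, one_smul] at h
    exact congrArg C.rep.δ h.symm
  have hH : ∀ i v, T (C.rep.ρ (clf i) v) = C.rep.ρ (clf i) (T v) := fun i v => by
    by_cases hi : ν i = 0
    · rw [clf_eq_zero hM hs hi, clf_eq_zero hM hs hi, map_zero]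
    · have h := LinearMap.congr_fun (clf_mul_clfProd_of_mem C.rep (Finset.nodup_toList _)
        (Finset.mem_toList.2 (mem_wtSupp.2 hi) : i ∈ l)) v
      rw [(hlen.add_odd odd_one).neg_one_pow, neg_smul, one_smul] at h
      have h' : clfProd C.rep l (C.rep.ρ (clf i) v) = -C.rep.ρ (clf i) (clfProd C.rep l v) := by
        rw [show C.rep.ρ (clf i) (clfProd C.rep l v) = -(clfProd C.rep l (C.rep.ρ (clf i) v)) from h,
          neg_neg]
      change C.rep.δ (clfProd C.rep l _) = C.rep.ρ (clf i) (C.rep.δ (clfProd C.rep l v))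
      rw [h', map_neg, δ_clf, neg_neg]
  obtain ⟨μ, hμ⟩ := Module.End.exists_eigenvalue T
  have hsub : IsSub C.rep (Module.End.eigenspace T μ) := by
    refine isSub_of_wt hM (fun v hv => ?_) fun i v hv => ?_
    · rw [Module.End.mem_eigenspace_iff] at *
      rw [hδ, hv, map_smul]
    · rw [Module.End.mem_eigenspace_iff] at *
      rw [hH, hv, map_smul]
  have htop := (hs.2 _ hsub).resolve_left hμ
  have hT : T = μ • LinearMap.id := LinearMap.ext fun v =>
    Module.End.mem_eigenspace_iff.1 (htop ▸ Submodule.mem_top : v ∈ Module.End.eigenspace T μ)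
  have hTi : Function.Injective T := by
    have h1 : Function.Injective C.rep.δ := Function.Involutive.injective C.rep.δ_δ
    exact h1.comp (clfProd_injective C.rep hM fun i hi => mem_wtSupp.1 (Finset.mem_toList.1 hi))
  have hμ0 : μ ≠ 0 := by
    rintro rfl
    obtain ⟨v, hv⟩ := exists_ne (0 : C.rep.carrier)
    exact hv (hTi (by rw [hT]; simp))
  rw [chr_cls]
  change LinearMap.trace ℂ C.rep.carrier T ≠ 0
  rw [hT, map_smul, LinearMap.trace_id]
  exact mul_ne_zero hμ0 (Nat.cast_ne_zero.2 Module.finrank_pos.ne')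

end Characters

end
end Queer

namespace Queer

noncomputable section

open LieSuperalgebra SuperRep TensorProduct

variable {n : ℕ}

/-! ### The supersymmetric powers of a root space -/

section SymPow

variable (α : Root n)

lemma single_mem_rootSpace (a b : ℂ) :
    ((Matrix.single α.i α.j a, Matrix.single α.i α.j b) : Q n) ∈ wtSpace (adCartan n) α.wt := by
  rw [mem_rootSpace]
  intro i j hij
  have : ¬(α.i = i ∧ α.j = j) := fun h => hij ⟨h.1.symm, h.2.symm⟩
  simp [Matrix.single_apply, this]

/-- The even root vector. -/
def evenRoot : α.space.rep.carrier := ⟨(Matrix.single α.i α.j 1, Matrix.single α.i α.j 0),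
  single_mem_rootSpace α 1 0⟩

/-- The odd root vector. -/
def oddRoot : α.space.rep.carrier := ⟨(Matrix.single α.i α.j 0, Matrix.single α.i α.j 1),
  single_mem_rootSpace α 0 1⟩

lemma δ_evenRoot : α.space.rep.δ (evenRoot α) = evenRoot α :=
  Subtype.ext (Prod.ext rfl (by
    change -Matrix.single α.i α.j (0 : ℂ) = Matrix.single α.i α.j 0; simp))

lemma δ_oddRoot : α.space.rep.δ (oddRoot α) = -oddRoot α :=
  Subtype.ext (Prod.ext (by
    change Matrix.single α.i α.j (0 : ℂ) = -Matrix.single α.i α.j 0; simp) rfl)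

lemma rootSpace_eq (v : α.space.rep.carrier) : ∃ a b : ℂ, v = a • evenRoot α + b • oddRoot α := by
  obtain ⟨v, hv⟩ := v
  have hv' := (mem_rootSpace α).1 hv
  refine ⟨Prod.fst v α.i α.j, Prod.snd v α.i α.j, Subtype.ext ?_⟩
  have h : ∀ A : Matrix (Fin n) (Fin n) ℂ, (∀ i j, ¬(i = α.i ∧ j = α.j) → A i j = 0) →
      A = Matrix.single α.i α.j (A α.i α.j) := by
    intro A hA
    ext i j
    by_cases h : i = α.i ∧ j = α.j
    · rw [h.1, h.2, Matrix.single_apply_same]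
    · have h' : ¬(α.i = i ∧ α.j = j) := fun h' => h ⟨h'.1.symm, h'.2.symm⟩
      rw [hA i j h, Matrix.single_apply, if_neg h']
  refine Prod.ext ?_ ?_
  · change Prod.fst v = Prod.fst v α.i α.j • Matrix.single α.i α.j (1 : ℂ) +
      Prod.snd v α.i α.j • Matrix.single α.i α.j 0
    refine (h _ fun i j hij => (hv' i j hij).1).trans ?_
    simp [Matrix.smul_single]
  · change Prod.snd v = Prod.fst v α.i α.j • Matrix.single α.i α.j (0 : ℂ) +
      Prod.snd v α.i α.j • Matrix.single α.i α.j 1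
    refine (h _ fun i j hij => (hv' i j hij).2).trans ?_
    simp [Matrix.smul_single]

lemma diagonal_mul_single (t : Fin n) (i j : Fin n) (c : ℂ) :
    Matrix.diagonal (Pi.single t 1) * Matrix.single i j c = (if t = i then (1 : ℂ) else 0) • Matrix.single i j c := by
  ext a b
  rw [Matrix.diagonal_mul, Matrix.smul_apply, Matrix.single_apply]
  by_cases h : i = a
  · subst h; simp [Pi.single_apply, eq_comm]
  · simp [h]

lemma single_mul_diagonal (t : Fin n) (i j : Fin n) (c : ℂ) :
    Matrix.single i j c * Matrix.diagonal (Pi.single t 1) = (if t = j then (1 : ℂ) else 0) • Matrix.single i j c := by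
  ext a b
  rw [Matrix.mul_diagonal, Matrix.smul_apply, Matrix.single_apply]
  by_cases h : j = b
  · subst h; simp [Pi.single_apply, eq_comm]; split_ifs <;> rfl
  · simp [h]

lemma clf_evenRoot (t : Fin n) : α.space.rep.ρ (clf t) (evenRoot α) =
    ((if t = α.i then (1 : ℂ) else 0) - if t = α.j then 1 else 0) • oddRoot α := by
  refine Subtype.ext ?_
  change br (clf t : Q n) (Matrix.single α.i α.j (1 : ℂ), Matrix.single α.i α.j (0 : ℂ)) =
    (_ : ℂ) • ((Matrix.single α.i α.j (0 : ℂ), Matrix.single α.i α.j (1 : ℂ)) : Q n)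
  rw [br_apply]
  simp [clf, diagonal_mul_single, single_mul_diagonal, sub_smul]
  split_ifs <;> simp

lemma clf_oddRoot (t : Fin n) : α.space.rep.ρ (clf t) (oddRoot α) =
    ((if t = α.i then (1 : ℂ) else 0) + if t = α.j then 1 else 0) • evenRoot α := by
  refine Subtype.ext ?_
  change br (clf t : Q n) (Matrix.single α.i α.j (0 : ℂ), Matrix.single α.i α.j (1 : ℂ)) =
    (_ : ℂ) • ((Matrix.single α.i α.j (1 : ℂ), Matrix.single α.i α.j (0 : ℂ)) : Q n)
  rw [br_apply]
  simp [clf, diagonal_mul_single, single_mul_diagonal, add_smul]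
  split_ifs <;> simp

/-- The structure of the supersymmetric power `S^k 𝔤_α`, `k > 0`. -/
structure IsRootPower (k : ℕ) (N : FinRep (cartan n)) : Prop where
  finrank : Module.finrank ℂ N.rep.carrier = 2
  wt : wtSpace N.rep (k • α.wt) = ⊤
  zero : ∀ t, t ≠ α.i → t ≠ α.j → N.rep.ρ (clf t) = 0
  rel : ∀ v, N.rep.ρ (clf α.j) v = -N.rep.ρ (clf α.i) (N.rep.δ v)

lemma Env.act_mul_odd {L : Type} [AddCommGroup L] [Module ℂ L] [LieSuperalgebra L] {M : SuperRep L}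
    (B : InvBracket M) {x : L} (hx : par x = (-1 : ℂ) ^ 1 • x) (a b : Env B) :
    Env.act B x (a * b) = Env.act B x a * b + Env.θ B a * Env.act B x b := by
  rw [Env.act_mul, ev_of_odd (by simp) hx, od_of_odd (by simp) hx, map_zero,
    LinearMap.zero_apply, mul_zero, add_zero]

lemma wtSpace_symPow (k : ℕ) : wtSpace (symPow k α.space).rep (k • α.wt) = ⊤ := by
  refine Submodule.eq_top_iff'.2 fun v => ?_
  have h := (mem_wtSpace (M := Sym α.space.rep)).1
    (symSpace_le_wtSpace _ α.wtSpace_space k v.2)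
  exact mem_wtSpace.2 fun i => Subtype.ext (h i)

-- Let `E` be the even and `F` the odd root vector. As `F E = E F` and `F F = 0`, the power has the
-- basis `E ^ (k + 1)`, `E ^ k * F`. The generator `clf t` maps the first vector to `(k + 1) c t`
-- times the second, and the second to `d t` times the first. From `α.i` to `α.j` only `c` changes
-- its sign; this is the effect of composing with `-δ`.
set_option maxHeartbeats 1000000 in
theorem isRootPower_symPow (k : ℕ) : IsRootPower α (k + 1) (symPow (k + 1) α.space) := by
  set B := InvBracket.zero α.space.rep with hB
  set E := Env.ι B (evenRoot α) with hE
  set F := Env.ι B (oddRoot α) with hF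
  have hEF : F * E = E * F := by
    have := Env.ι_mul B (i := 1) (j := 0) (v := oddRoot α) (w := evenRoot α)
      (by rw [δ_oddRoot]; simp) (by rw [δ_evenRoot]; simp)
    simpa [hB, InvBracket.zero] using this
  have hFF : F * F = 0 := by
    have := Env.ι_mul B (i := 1) (j := 1) (v := oddRoot α) (w := oddRoot α)
      (by rw [δ_oddRoot]; simp) (by rw [δ_oddRoot]; simp)
    have h2 : F * F = (-1 : ℂ) • (F * F) := by simpa [hB, InvBracket.zero] using this
    have h3 : (2 : ℂ) • (F * F) = 0 := by
      have h4 : (2 : ℂ) • (F * F) = F * F - (-1 : ℂ) • (F * F) := by module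
      rw [h4, ← h2, sub_self]
    exact (smul_eq_zero.1 h3).resolve_left two_ne_zero
  have hFE : ∀ k, F * E ^ k = E ^ k * F := fun k => (Commute.pow_right hEF k).eq
  have hθE : ∀ k, Env.θ B (E ^ k) = E ^ k := fun k => by rw [map_pow, hE, Env.θ_ι, δ_evenRoot]
  have hθF : Env.θ B F = (-1 : ℂ) • F := by
    rw [hF, Env.θ_ι, δ_oddRoot, ← neg_one_smul ℂ, map_smul]
  let c : Fin n → ℂ := fun t => (if t = α.i then (1 : ℂ) else 0) - if t = α.j then 1 else 0
  let d : Fin n → ℂ := fun t => (if t = α.i then (1 : ℂ) else 0) + if t = α.j then 1 else 0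
  have hDE : ∀ t, Env.act B (clf t) E = c t • F := fun t => by
    rw [hE, Env.act_ι, clf_evenRoot, map_smul]
  have hDF : ∀ t, Env.act B (clf t) F = d t • E := fun t => by
    rw [hF, Env.act_ι, clf_oddRoot, map_smul]
  have hDEk : ∀ t (k : ℕ), Env.act B (clf t) (E ^ (k + 1)) = ((k + 1 : ℂ) * c t) • (E ^ k * F) := by
    intro t k
    induction k with
    | zero => simp [hDE]
    | succ k ih =>
      rw [pow_succ, Env.act_mul_odd B (par_clf t), ih, hDE, hθE, smul_mul_assoc, mul_assoc, hEF,
        ← mul_assoc, ← pow_succ, mul_smul_comm, ← add_smul]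
      congr 1
      push_cast
      ring
  have hDEF : ∀ t k, Env.act B (clf t) (E ^ k * F) = d t • E ^ (k + 1) := by
    intro t k
    rw [Env.act_mul_odd B (par_clf t), hDF, hθE, mul_smul_comm, ← pow_succ]
    cases k with
    | zero => rw [pow_zero, Env.act_one, zero_mul, zero_add]
    | succ k => rw [hDEk, smul_mul_assoc, mul_assoc, hFF, mul_zero, smul_zero, zero_add]
  have hspan : ∀ k, ∀ x ∈ symSpace α.space.rep (k + 1), ∃ a b : ℂ, x = a • E ^ (k + 1) + b • (E ^ k * F) := by
    intro k
    induction k with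
    | zero =>
      intro x hx
      rw [symSpace, zero_add, pow_one] at hx
      obtain ⟨v, rfl⟩ := hx
      obtain ⟨a, b, rfl⟩ := rootSpace_eq α v
      exact ⟨a, b, by rw [map_add, map_smul, map_smul, zero_add, pow_one, pow_zero, one_mul]⟩
    | succ k ih =>
      intro x hx
      rw [symSpace, pow_succ] at hx
      refine Submodule.mul_induction_on hx ?_ ?_
      · rintro x hx _ ⟨v, rfl⟩
        obtain ⟨a, b, rfl⟩ := ih x hx
        obtain ⟨a', b', rfl⟩ := rootSpace_eq α v
        refine ⟨a * a', a * b' + b * a', ?_⟩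
        rw [map_add, map_smul, map_smul, ← hE, ← hF]
        simp only [add_mul, mul_add, smul_mul_assoc, mul_smul_comm, mul_assoc, hEF, hFF, mul_zero,
          smul_zero, add_zero]
        rw [← mul_assoc, ← pow_succ, ← pow_succ]
        module
      · rintro x y ⟨a, b, rfl⟩ ⟨a', b', rfl⟩
        exact ⟨a + a', b + b', by module⟩
  have hEmem : ∀ k, E ^ k ∈ symSpace α.space.rep k := fun k =>
    Submodule.pow_mem_pow (LinearMap.range (Env.ι B)) (LinearMap.mem_range_self _ _) k
  have hFmem : ∀ k, E ^ k * F ∈ symSpace α.space.rep (k + 1) := fun k => by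
    rw [symSpace, pow_succ]
    exact Submodule.mul_mem_mul (hEmem k) ⟨_, rfl⟩
  -- The character of the supersymmetric algebra with `E ↦ 1` and `F ↦ 0`; it shows that the powers
  -- of `E` do not vanish.
  let ev1 : α.space.rep.carrier →ₗ[ℂ] ℂ :=
    { toFun := fun v => (Subtype.val v : Q n).1 α.i α.j
      map_add' := fun _ _ => rfl
      map_smul' := fun _ _ => rfl }
  let ε : Env B →ₐ[ℂ] ℂ := Env.lift B ev1 fun i j v w hv hw => by
    have hodd : ∀ (i : ℕ) (v : α.space.rep.carrier), Odd i → α.space.rep.δ v = (-1 : ℂ) ^ i • v →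
        ev1 v = 0 := by
      intro i v hi hv
      rw [hi.neg_one_pow, neg_smul, one_smul] at hv
      have h1 : ev1 v = -ev1 v := by
        rw [← map_neg, ← hv]
        rfl
      exact self_eq_neg.1 h1
    change _ = _ + ev1 0
    rw [map_zero, add_zero, smul_eq_mul]
    rcases Nat.even_or_odd i with hi | hi
    · rw [(hi.mul_right j).neg_one_pow, one_mul, mul_comm]
    · rw [hodd i v hi hv, mul_zero, zero_mul, mul_zero]
  have hεE : ε E = 1 := by
    rw [hE]
    refine (Env.lift_ι B ev1 _ (evenRoot α)).trans ?_
    exact Matrix.single_apply_same α.i α.j (1 : ℂ)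
  have hεF : ε F = 0 := by
    rw [hF]
    refine (Env.lift_ι B ev1 _ (oddRoot α)).trans ?_
    exact Matrix.single_apply_same α.i α.j (0 : ℂ)
  have hci : c α.i = 1 := by simp [c, α.ne]
  have hdi : d α.i = 1 := by simp [d, α.ne]
  have hcj : c α.j = -1 := by simp [c, α.ne.symm]
  have hdj : d α.j = 1 := by simp [d, α.ne.symm]
  have hD : ∀ t (a b : ℂ), Env.act B (clf t) (a • E ^ (k + 1) + b • (E ^ k * F)) =
      (a * ((k + 1 : ℂ) * c t)) • (E ^ k * F) + (b * d t) • E ^ (k + 1) := fun t a b => by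
    rw [map_add, (Env.act B (clf t)).map_smul, (Env.act B (clf t)).map_smul, hDEk, hDEF, smul_smul,
      smul_smul]
  have hθ : ∀ a b : ℂ, Env.θ B (a • E ^ (k + 1) + b • (E ^ k * F)) =
      a • E ^ (k + 1) + (-b) • (E ^ k * F) := fun a b => by
    rw [map_add, map_smul, map_smul, hθE, map_mul, hθE, hθF, mul_smul_comm, smul_smul,
      mul_neg_one]
  refine ⟨?_, ?_, fun t h1 h2 => ?_, fun v => ?_⟩
  · let φ : (ℂ × ℂ) →ₗ[ℂ] symSpace α.space.rep (k + 1) :=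
      { toFun := fun p => ⟨p.1 • E ^ (k + 1) + p.2 • (E ^ k * F),
          Submodule.add_mem _ (Submodule.smul_mem _ _ (hEmem _)) (Submodule.smul_mem _ _ (hFmem _))⟩
        map_add' := fun p q => Subtype.ext (by
          simp only [Prod.fst_add, Prod.snd_add, Submodule.coe_add]; module)
        map_smul' := fun r p => Subtype.ext (by
          simp only [Prod.smul_fst, Prod.smul_snd, Submodule.coe_smul, RingHom.id_apply, smul_eq_mul]
          module) }
    have hφ : Function.Bijective φ := by
      constructor
      · rw [injective_iff_map_eq_zero]
        rintro ⟨a, b⟩ h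
        have h1 : a • E ^ (k + 1) + b • (E ^ k * F) = 0 := congrArg Subtype.val h
        have ha : a = 0 := by
          have := congrArg ε h1
          simpa [hεE, hεF] using this
        subst ha
        -- The character does not see `E ^ k * F`, but `clf α.i` maps this vector to `E ^ (k + 1)`.
        have h2 := (hD α.i 0 b).symm.trans ((congrArg (Env.act B (clf α.i)) h1).trans (map_zero _))
        rw [zero_mul, zero_smul, zero_add, hdi, mul_one] at h2
        have h3 := congrArg ε h2
        have hb : b = 0 := by simpa [hεE] using h3
        rw [hb]
        rfl
      · rintro ⟨x, hx⟩
        obtain ⟨a, b, rfl⟩ := hspan k x hx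
        exact ⟨(a, b), rfl⟩
    have := (LinearEquiv.ofBijective φ hφ).finrank_eq
    rw [Module.finrank_prod, Module.finrank_self] at this
    exact this.symm
  · exact wtSpace_symPow α (k + 1)
  · refine LinearMap.ext fun v => Subtype.ext ?_
    obtain ⟨a, b, hv⟩ := hspan k v.1 v.2
    refine (congrArg (Env.act B (clf t)) hv).trans ((hD t a b).trans ?_)
    have hc : c t = 0 := by simp [c, h1, h2]
    have hd : d t = 0 := by simp [d, h1, h2]
    rw [hc, hd, mul_zero, mul_zero, mul_zero, zero_smul, zero_smul, add_zero]
    rfl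
  · refine Subtype.ext ?_
    obtain ⟨a, b, hv⟩ := hspan k v.1 v.2
    refine (congrArg (Env.act B (clf α.j)) hv).trans ((hD _ a b).trans ?_)
    have h5 : Env.act B (clf α.i) (Env.θ B (v.1 : Env B)) =
        (a * ((k + 1 : ℂ) * c α.i)) • (E ^ k * F) + (-b * d α.i) • E ^ (k + 1) :=
      (congrArg (fun y => Env.act B (clf α.i) (Env.θ B y)) hv).trans
        ((congrArg (Env.act B (clf α.i)) (hθ a b)).trans (hD _ _ _))
    change _ = -(Env.act B (clf α.i) (Env.θ B (v.1 : Env B)))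
    refine Eq.trans ?_ (neg_one_smul ℂ (Env.act B (clf α.i) (Env.θ B (v.1 : Env B))))
    rw [h5, hci, hcj, hdi, hdj]
    module

end SymPow

end
end Queer

namespace Queer

noncomputable section

open LieSuperalgebra SuperRep TensorProduct

variable {n : ℕ}

/-! ### Supertraces of products of root powers -/

section CharacterProducts

/-- An operator anticommuting with an invertible one has trace zero. -/
lemma trace_eq_zero_of_anti {V : Type*} [AddCommGroup V] [Module ℂ V] {X Y : Module.End ℂ V} {c : ℂ}
    (hc : c ≠ 0) (hX : X * X = c • 1) (h : X * Y = -(Y * X)) : LinearMap.trace ℂ V Y = 0 := by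
  have h1 : LinearMap.trace ℂ V (X * (Y * X)) = LinearMap.trace ℂ V ((Y * X) * X) :=
    LinearMap.trace_mul_comm ℂ _ _
  rw [← mul_assoc, h, neg_mul, mul_assoc, hX, mul_smul_comm, mul_one, map_neg, map_smul,
    smul_eq_mul] at h1
  have h2 : c * LinearMap.trace ℂ V Y = 0 := self_eq_neg.1 h1.symm
  exact (mul_eq_zero.1 h2).resolve_left hc

lemma anti_mul_prod {R ι : Type*} [Ring R] {A : R} (T : ι → R) {l : List ι}
    (hA : ∀ s ∈ l, A * T s = -(T s * A)) (hl : Even l.length) :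
    A * (l.map T).prod = (l.map T).prod * A := by
  have key : ∀ l : List ι, (∀ s ∈ l, A * T s = -(T s * A)) →
      A * (l.map T).prod = (-1) ^ l.length * ((l.map T).prod * A) := by
    intro l hl
    induction l with
    | nil => simp
    | cons s l ih =>
      rw [List.map_cons, List.prod_cons, ← mul_assoc, hl s List.mem_cons_self, neg_mul, mul_assoc,
        ih fun t ht => hl t (List.mem_cons_of_mem _ ht), List.length_cons, pow_succ, mul_neg_one,
        neg_mul, ← mul_assoc, ← mul_assoc, ← mul_assoc,
        ← ((Commute.neg_one_left (T s)).pow_left l.length).eq]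
      simp only [mul_assoc]
  rw [key l hA, hl.neg_one_pow, one_mul]

lemma mul_anti_of_anti {R : Type*} [Ring R] {A D P : R} (h1 : A * D = -(D * A)) (h2 : A * P = P * A) :
    A * (D * P) = -(D * P * A) := by
  rw [← mul_assoc, h1, neg_mul, mul_assoc, h2, mul_assoc]

lemma mul_mul_eq_sq {R : Type*} [Ring R] {a d j : R} (hj : j = -(a * d)) (h : d * a = -(a * d))
    (hd : d * d = 1) : d * (j * a) = a * a := by
  rw [hj, neg_mul, mul_neg, ← mul_assoc, ← mul_assoc, h, neg_mul, neg_mul, neg_neg, mul_assoc a d d,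
    hd, mul_one]

/-- The operator of an odd basis element on a tensor product. -/
def tensorClf (N M : SuperRep (cartan n)) (t : Fin n) : Module.End ℂ (N.carrier ⊗[ℂ] M.carrier) :=
  TensorProduct.map (N.ρ (clf t)) LinearMap.id + TensorProduct.map N.δ (M.ρ (clf t))

lemma tensorClf_tmul (N M : SuperRep (cartan n)) (t : Fin n) (v : N.carrier) (w : M.carrier) :
    tensorClf N M t (v ⊗ₜ w) = N.ρ (clf t) v ⊗ₜ w + N.δ v ⊗ₜ M.ρ (clf t) w := by
  simp [tensorClf]

lemma tensorρ_clf (N M : SuperRep (cartan n)) (t : Fin n) : tensorρ N M (clf t) = tensorClf N M t := by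
  refine TensorProduct.ext' fun v w => ?_
  rw [tensorρ_tmul, ev_of_odd (i := 1) (by simp) (par_clf t), od_of_odd (i := 1) (by simp) (par_clf t),
    map_zero, LinearMap.zero_apply, tmul_zero, add_zero, tensorClf_tmul]

lemma chr_mul_cls (l : List (Fin n)) (N M : FinRep (cartan n)) :
    chr l (Gr.cls N * Gr.cls M) = LinearMap.trace ℂ (N.rep.carrier ⊗[ℂ] M.rep.carrier)
      (TensorProduct.map N.rep.δ M.rep.δ * (l.map (tensorClf N.rep M.rep)).prod) := by
  change chr l (Gr.mulHom (Gr.cls N) (Gr.cls M)) = _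
  rw [Gr.mulHom_cls, chr_cls]
  change LinearMap.trace ℂ (N.rep.carrier ⊗[ℂ] M.rep.carrier) (TensorProduct.map N.rep.δ M.rep.δ *
    (l.map fun t => tensorρ N.rep M.rep (clf t)).prod) = _
  congr 4
  exact funext fun t => tensorρ_clf _ _ t

lemma clf_mul_self_of_wt {M : SuperRep (cartan n)} {ν : Fin n → ℂ} (hM : wtSpace M ν = ⊤) (t : Fin n) :
    M.ρ (clf t) * M.ρ (clf t) = ν t • 1 := LinearMap.ext fun v => clf_sq_of_wt hM t v

/-- The operator `clf t ⊗ 1` is invertible because `ν t ≠ 0`. It anticommutes with `δ ⊗ δ` and with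
each of the evenly many factors, which all belong to generators other than `clf t`. So it
anticommutes with the operator whose trace is taken. -/
theorem chr_mul_eq_zero {N : FinRep (cartan n)} {ν : Fin n → ℂ} (hN : wtSpace N.rep ν = ⊤) {t : Fin n}
    (ht : ν t ≠ 0) {l : List (Fin n)} (hl : t ∉ l) (hlen : Even l.length) (x : Gr (cartan n)) :
    chr l (Gr.cls N * x) = 0 := by
  have : (chr l).comp (AddMonoidHom.mulLeft (Gr.cls N)) = 0 := Gr.hom_ext fun M => by
    change chr l (Gr.cls N * Gr.cls M) = 0
    rw [chr_mul_cls]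
    set D : Module.End ℂ (N.rep.carrier ⊗[ℂ] M.rep.carrier) := TensorProduct.map N.rep.δ M.rep.δ with hD
    let A : Module.End ℂ (N.rep.carrier ⊗[ℂ] M.rep.carrier) :=
      TensorProduct.map (N.rep.ρ (clf t)) LinearMap.id
    have hδ : A * D = -(D * A) := by
      refine TensorProduct.ext' fun v w => ?_
      simp [A, hD, δ_clf, neg_tmul]
    have hA : ∀ s, s ≠ t → A * tensorClf N.rep M.rep s = -(tensorClf N.rep M.rep s * A) := by
      intro s hs
      refine TensorProduct.ext' fun v w => ?_
      have h := clf_anti N.rep hs v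
      simp only [A, Module.End.mul_apply, LinearMap.neg_apply, tensorClf_tmul,
        TensorProduct.map_tmul, map_add, LinearMap.id_apply, δ_clf, h, neg_tmul]
      abel
    refine trace_eq_zero_of_anti (X := A) ht ?_ ?_
    · refine TensorProduct.ext' fun v w => ?_
      simp only [A, Module.End.mul_apply, TensorProduct.map_tmul, LinearMap.id_apply,
        clf_sq_of_wt hN, LinearMap.smul_apply, Module.End.one_apply, smul_tmul']
    · exact mul_anti_of_anti hδ
        (anti_mul_prod _ (fun s hs => hA s fun h => hl (h ▸ hs)) hlen)
  exact DFunLike.congr_fun this x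

-- The generators at the ends of `α` act on `N ⊗ M` by sums of two terms. Of the four resulting
-- products only the one with both generators on `N` has nonzero trace on `N`: there the relation
-- between them gives `δ clf_j clf_i = clf_i² = k`, with trace `2 k` on the two-dimensional `N`.
set_option maxHeartbeats 1000000 in
theorem chr_rootPower_mul {α : Root n} {k : ℕ} (hk : 0 < k) {N : FinRep (cartan n)}
    (hN : IsRootPower α k N) {l : List (Fin n)} (hi : α.i ∉ l) (hj : α.j ∉ l) (hlen : Even l.length)
    (x : Gr (cartan n)) : chr (α.j :: α.i :: l) (Gr.cls N * x) = 2 * k * chr l x := by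
  have : (chr (α.j :: α.i :: l)).comp (AddMonoidHom.mulLeft (Gr.cls N)) =
      (AddMonoidHom.mulLeft (2 * k : ℂ)).comp (chr l) := Gr.hom_ext fun M => by
    change chr (α.j :: α.i :: l) (Gr.cls N * Gr.cls M) = 2 * k * chr l (Gr.cls M)
    rw [chr_mul_cls, chr_cls]
    -- The generators in `l` kill `N`, so they act on `M` only. Each brings along the parity of `N`,
    -- which cancels because their number is even.
    have hP : (l.map (tensorClf N.rep M.rep)).prod =
        TensorProduct.map LinearMap.id (clfProd M.rep l) := by
      have key : ∀ l : List (Fin n), α.i ∉ l → α.j ∉ l → (l.map (tensorClf N.rep M.rep)).prod =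
          TensorProduct.map (N.rep.δ ^ l.length) (clfProd M.rep l) := by
        intro l hi hj
        induction l with
        | nil => exact (TensorProduct.map_id (R := ℂ) (M := N.rep.carrier) (N := M.rep.carrier)).symm
        | cons s l ih =>
          rw [List.mem_cons, not_or] at hi hj
          rw [List.map_cons, List.prod_cons, clfProd_cons, ih hi.2 hj.2, tensorClf,
            hN.zero s (Ne.symm hi.1) (Ne.symm hj.1), TensorProduct.map_zero_left, zero_add,
            List.length_cons, pow_succ', TensorProduct.map_mul]
      rw [key l hi hj]
      have h2 : N.rep.δ * N.rep.δ = 1 := LinearMap.ext N.rep.δ_δ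
      obtain ⟨m, hm⟩ := hlen
      rw [hm, ← two_mul, pow_mul, pow_two, h2, one_pow]
      rfl
    have hwi : (k • α.wt) α.i = (k : ℂ) := by simp [Root.wt, α.ne]
    have hk' : (k : ℂ) ≠ 0 := Nat.cast_ne_zero.2 hk.ne'
    have hii : N.rep.ρ (clf α.i) * N.rep.ρ (clf α.i) = (k : ℂ) • 1 := by
      rw [clf_mul_self_of_wt hN.wt, hwi]
    have hδδ : N.rep.δ * N.rep.δ = (1 : ℂ) • 1 := by
      rw [one_smul]; exact LinearMap.ext N.rep.δ_δ
    have hanti : ∀ t, N.rep.δ * N.rep.ρ (clf t) = -(N.rep.ρ (clf t) * N.rep.δ) := fun t =>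
      LinearMap.ext fun v => δ_clf N.rep t v
    have hδ0 : LinearMap.trace ℂ N.rep.carrier N.rep.δ = 0 :=
      trace_eq_zero_of_anti hk' hii (by rw [hanti, neg_neg])
    have hr0 : ∀ t, LinearMap.trace ℂ N.rep.carrier (N.rep.ρ (clf t)) = 0 := fun t =>
      trace_eq_zero_of_anti one_ne_zero hδδ (hanti t)
    have hji : N.rep.ρ (clf α.j) = -(N.rep.ρ (clf α.i) * N.rep.δ) := LinearMap.ext hN.rel
    have e1 : N.rep.δ * (N.rep.ρ (clf α.j) * N.rep.ρ (clf α.i)) = (k : ℂ) • 1 := by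
      rw [mul_mul_eq_sq hji (hanti _) (by rw [hδδ, one_smul]), hii]
    have expand : TensorProduct.map N.rep.δ M.rep.δ *
        ((α.j :: α.i :: l).map (tensorClf N.rep M.rep)).prod =
        TensorProduct.map ((k : ℂ) • 1) (M.rep.δ * clfProd M.rep l)
        + TensorProduct.map (N.rep.δ * (N.rep.ρ (clf α.j) * N.rep.δ))
            (M.rep.δ * (M.rep.ρ (clf α.i) * clfProd M.rep l))
        + TensorProduct.map (N.rep.ρ (clf α.i))
            (M.rep.δ * (M.rep.ρ (clf α.j) * clfProd M.rep l))
        + TensorProduct.map N.rep.δ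
            (M.rep.δ * (M.rep.ρ (clf α.j) * (M.rep.ρ (clf α.i) * clfProd M.rep l))) := by
      rw [List.map_cons, List.map_cons, List.prod_cons, List.prod_cons, hP]
      refine TensorProduct.ext' fun v w => ?_
      have e1' := LinearMap.congr_fun e1 v
      change N.rep.δ (N.rep.ρ (clf α.j) (N.rep.ρ (clf α.i) v)) = (k : ℂ) • v at e1'
      simp only [LinearMap.add_apply, TensorProduct.map_tmul, map_add, LinearMap.id_apply,
        Module.End.mul_apply, tensorClf_tmul, N.rep.δ_δ, e1', LinearMap.smul_apply, Module.End.one_apply]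
      abel
    have e2 : LinearMap.trace ℂ N.rep.carrier (N.rep.δ * (N.rep.ρ (clf α.j) * N.rep.δ)) = 0 := by
      rw [LinearMap.trace_mul_comm, mul_assoc, hδδ, one_smul, mul_one, hr0]
    rw [expand, map_add, map_add, map_add, LinearMap.trace_tensorProduct', LinearMap.trace_tensorProduct',
      LinearMap.trace_tensorProduct', LinearMap.trace_tensorProduct', hδ0, hr0, e2, map_smul,
      LinearMap.trace_one, hN.finrank]
    rw [smul_eq_mul, zero_mul, zero_mul, zero_mul, add_zero, add_zero, add_zero, Nat.cast_ofNat,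
      mul_comm (k : ℂ)]
  exact DFunLike.congr_fun this x

lemma chr_one {l : List (Fin n)} (h : chr l 1 ≠ 0) : l = [] := by
  cases l with
  | nil => rfl
  | cons i l =>
    refine absurd ?_ h
    refine (chr_cls (i :: l) (FinRep.triv (cartan n))).trans ?_
    rw [clfProd_cons]
    have : (FinRep.triv (cartan n)).rep.ρ (clf i) = 0 := rfl
    rw [this, zero_mul, mul_zero, map_zero]

lemma chr_nil_one : chr [] (1 : Gr (cartan n)) = 1 := by
  refine (chr_cls [] (FinRep.triv (cartan n))).trans ?_
  rw [clfProd_nil, mul_one]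
  refine (LinearMap.trace_id ℂ ℂ).trans ?_
  simp

/-- The class of the tensor product of supersymmetric powers of root spaces. -/
def edgeProd (k : Root n → ℕ) (L : List (Root n)) : Gr (cartan n) :=
  (L.map fun α => Gr.cls (symPow (k α) α.space)).prod

/-- The list of the vertices of a list of roots. -/
def vertices (L : List (Root n)) : List (Fin n) := L.flatMap fun α => [α.j, α.i]

@[simp] lemma vertices_nil : vertices ([] : List (Root n)) = [] := rfl

@[simp] lemma vertices_cons (α : Root n) (L : List (Root n)) :
    vertices (α :: L) = α.j :: α.i :: vertices L := rfl

lemma mem_vertices {L : List (Root n)} {v : Fin n} :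
    v ∈ vertices L ↔ ∃ α ∈ L, v = α.j ∨ v = α.i := by
  simp [vertices]

lemma length_vertices (L : List (Root n)) : (vertices L).length = 2 * L.length := by
  induction L with
  | nil => rfl
  | cons α L ih => rw [vertices_cons, List.length_cons, List.length_cons, List.length_cons, ih]; ring

lemma isRootPower_of_pos (α : Root n) {k : ℕ} (hk : 0 < k) : IsRootPower α k (symPow k α.space) := by
  obtain ⟨k, rfl⟩ := Nat.exists_eq_succ_of_ne_zero hk.ne'
  exact isRootPower_symPow α k

theorem chr_edgeProd (k : Root n → ℕ) {L : List (Root n)} (hk : ∀ α ∈ L, 0 < k α)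
    (hL : (vertices L).Nodup) : chr (vertices L) (edgeProd k L) = (L.map fun α => (2 * k α : ℂ)).prod := by
  induction L with
  | nil => exact chr_nil_one
  | cons α L ih =>
    rw [vertices_cons, List.nodup_cons, List.nodup_cons, List.mem_cons, not_or] at hL
    rw [vertices_cons, edgeProd, List.map_cons, List.prod_cons, List.map_cons, List.prod_cons,
      chr_rootPower_mul (hk α List.mem_cons_self) (isRootPower_of_pos α (hk α List.mem_cons_self))
        hL.2.1 hL.1.2 (by rw [length_vertices]; exact even_two_mul _)]
    rw [← ih (fun β hβ => hk β (List.mem_cons_of_mem _ hβ)) hL.2.2]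
    rfl

/-- The roots are removed one at a time. Both ends of a root must occur in `l`, else the supertrace
vanishes. Moved to the front of `l`, they are removed together with the root, at the cost of a
nonzero factor; in the end the supertrace on the trivial module forces the rest of `l` to be empty.
-/
theorem perm_vertices_of_chr_ne_zero (k : Root n → ℕ) {L : List (Root n)} (hk : ∀ α ∈ L, 0 < k α)
    {l : List (Fin n)} (hl : l.Nodup) (hlen : Even l.length) (h : chr l (edgeProd k L) ≠ 0) :
    l.Perm (vertices L) := by
  induction L generalizing l with
  | nil => rw [chr_one h]; rfl
  | cons α L ih =>
    have hα := hk α List.mem_cons_self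
    have hN := isRootPower_of_pos α hα
    have hk' : (k α : ℂ) ≠ 0 := Nat.cast_ne_zero.2 hα.ne'
    rw [edgeProd, List.map_cons, List.prod_cons] at h
    have hi : α.i ∈ l := by
      by_contra hi
      exact h (chr_mul_eq_zero hN.wt (t := α.i) (by simpa [Root.wt, α.ne] using hα.ne') hi hlen _)
    have hj : α.j ∈ l := by
      by_contra hj
      exact h (chr_mul_eq_zero hN.wt (t := α.j) (by simpa [Root.wt, α.ne.symm] using hα.ne') hj hlen _)
    have hp : l.Perm (α.j :: α.i :: (l.erase α.j).erase α.i) :=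
      (List.perm_cons_erase hj).trans
        ((List.perm_cons_erase ((List.mem_erase_of_ne α.ne).2 hi)).cons _)
    have hnd := (hp.nodup_iff).1 hl
    rw [List.nodup_cons, List.nodup_cons, List.mem_cons, not_or] at hnd
    have hlen' : Even ((l.erase α.j).erase α.i).length := by
      have := hp.length_eq
      rw [List.length_cons, List.length_cons] at this
      rw [this] at hlen
      simpa [Nat.even_add_one] using hlen
    obtain ⟨ε, -, hε⟩ := chr_perm hp hl
    rw [hε, chr_rootPower_mul hα hN hnd.2.1 hnd.1.2 hlen'] at h
    have h' := right_ne_zero_of_mul (right_ne_zero_of_mul h)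
    exact hp.trans (((ih (fun β hβ => hk β (List.mem_cons_of_mem _ hβ)) hnd.2.2 hlen' h').cons _).cons _)

lemma wtSpace_tensor {M N : SuperRep (cartan n)} {μ ν : Fin n → ℂ} (hM : wtSpace M μ = ⊤)
    (hN : wtSpace N ν = ⊤) : wtSpace (M.tensor N) (μ + ν) = ⊤ := by
  refine Submodule.eq_top_iff'.2 fun v => mem_wtSpace.2 fun i => ?_
  have hev : ev (tor i : cartan n) = tor i := ev_of_even (i := 0) (by simp) (by simp [par_tor])
  have hod : od (tor i : cartan n) = 0 := od_of_even (i := 0) (by simp) (by simp [par_tor])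
  have : (M.tensor N).ρ (tor i) = (μ + ν) i • LinearMap.id := by
    refine TensorProduct.ext' fun a b => ?_
    refine (tensorρ_tmul M N (tor i) a b).trans ?_
    rw [hev, hod, map_zero, LinearMap.zero_apply, tmul_zero, add_zero, tor_of_wt hM, tor_of_wt hN]
    simp only [Pi.add_apply, LinearMap.smul_apply, LinearMap.id_apply]
    rw [tmul_smul, ← smul_tmul', ← add_smul]
    rfl
  rw [this]
  rfl

lemma exists_rep_edgeProd (k : Root n → ℕ) {L : List (Root n)} (hk : ∀ α ∈ L, 0 < k α) :
    ∃ T : FinRep (cartan n), Gr.cls T = edgeProd k L ∧ Module.finrank ℂ T.rep.carrier = 2 ^ L.length ∧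
      wtSpace T.rep (L.map fun α => k α • α.wt).sum = ⊤ := by
  induction L with
  | nil =>
    refine ⟨FinRep.triv _, rfl, Module.finrank_self ℂ, Submodule.eq_top_iff'.2 fun v => mem_wtSpace.2 fun i => ?_⟩
    exact (zero_smul ℂ v).symm
  | cons α L ih =>
    obtain ⟨T, h1, h2, h3⟩ := ih fun β hβ => hk β (List.mem_cons_of_mem _ hβ)
    have hN := isRootPower_of_pos α (hk α List.mem_cons_self)
    refine ⟨(symPow (k α) α.space).tensor T, ?_, ?_, ?_⟩
    · rw [edgeProd, List.map_cons, List.prod_cons, ← Gr.mulHom_cls, h1]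
      rfl
    · refine (Module.finrank_tensorProduct (R := ℂ) (S := ℂ) (M := (symPow (k α) α.space).rep.carrier) (M' := T.rep.carrier)).trans ?_
      rw [hN.finrank, h2, List.length_cons, pow_succ']
    · exact wtSpace_tensor hN.wt h3

end CharacterProducts

end
end Queer

namespace Queer

noncomputable section

open LieSuperalgebra SuperRep TensorProduct

variable {n : ℕ}

/-! ### Perfect matchings of the support -/

section Matchings

/-- The roots that occur in a family of multiplicities. -/
def edges (k : Root n → ℕ) : Finset (Root n) := Finset.univ.filter fun α => k α ≠ 0

lemma mem_edges {k : Root n → ℕ} {α : Root n} : α ∈ edges k ↔ k α ≠ 0 := by simp [edges]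

lemma rootTerm_eq_edgeProd {k : Root n → ℕ} {L : List (Root n)} (hL : L.Nodup)
    (h : ∀ α, α ∈ L ↔ k α ≠ 0) : rootTerm k = edgeProd k L := by
  have : L.toFinset = edges k := by ext α; rw [List.mem_toFinset, h, mem_edges]
  rw [edgeProd, ← List.prod_toFinset _ hL, this, rootTerm, edges, Finset.prod_filter]
  refine Finset.prod_congr rfl fun α _ => ?_
  split_ifs with hα
  · rfl
  · rw [not_not.1 hα, cls_symPow_zero]

lemma rootTerm_eq (k : Root n → ℕ) : rootTerm k = edgeProd k (edges k).toList :=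
  rootTerm_eq_edgeProd (Finset.nodup_toList _) fun α => by rw [Finset.mem_toList, mem_edges]

lemma pos_of_mem_edges {k : Root n → ℕ} : ∀ α ∈ (edges k).toList, 0 < k α := fun α hα => by
  rw [Finset.mem_toList, mem_edges] at hα
  exact Nat.pos_of_ne_zero hα

lemma neg_of_kostant {ν : Fin n → ℂ} {k : Root n → ℕ} (hk : k ∈ kostant ν) {α : Root n}
    (hα : k α ≠ 0) : α.j < α.i := by
  by_contra h
  exact hα (hk.1 α (not_lt.1 h))

lemma kostant_apply {ν : Fin n → ℂ} {k : Root n → ℕ} (hk : k ∈ kostant ν) (v : Fin n) :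
    ν v = ∑ α, (k α : ℂ) * α.wt v := by
  rw [← hk.2, Finset.sum_apply]
  exact Finset.sum_congr rfl fun α _ => by rw [Pi.smul_apply, nsmul_eq_mul]

lemma Root.wt_i (α : Root n) : α.wt α.i = 1 := by simp [Root.wt, α.ne]

lemma Root.wt_j (α : Root n) : α.wt α.j = -1 := by simp [Root.wt, α.ne.symm]

lemma Root.wt_of_ne {α : Root n} {v : Fin n} (hi : v ≠ α.i) (hj : v ≠ α.j) : α.wt v = 0 := by
  simp [Root.wt, hi, hj]

/-- The roots that occur in `k` form a perfect matching of the support of `ν`. -/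
structure IsMatching (ν : Fin n → ℂ) (k : Root n → ℕ) : Prop where
  mem : k ∈ kostant ν
  perm : (wtSupp ν).toList.Perm (vertices (edges k).toList)

namespace IsMatching

variable {ν : Fin n → ℂ} {k : Root n → ℕ} (h : IsMatching ν k)

lemma nodup (h : IsMatching ν k) : (vertices (edges k).toList).Nodup :=
  h.perm.nodup_iff.1 (Finset.nodup_toList _)

lemma eq_of_vertex (h : IsMatching ν k) {α β : Root n} (hα : k α ≠ 0) (hβ : k β ≠ 0) {v : Fin n}
    (h1 : v = α.j ∨ v = α.i) (h2 : v = β.j ∨ v = β.i) : α = β := by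
  by_contra hne
  have h3 := (List.nodup_flatMap.1 h.nodup).2
  have : Std.Symm (Function.onFun List.Disjoint fun α : Root n => [α.j, α.i]) :=
    ⟨fun _ _ h => h.symm⟩
  have h4 := h3.forall (Finset.mem_toList.2 (mem_edges.2 hα))
    (Finset.mem_toList.2 (mem_edges.2 hβ)) hne
  exact h4 (a := v) (by simpa using h1) (by simpa using h2)

lemma lt (h : IsMatching ν k) {α : Root n} (hα : k α ≠ 0) : α.j < α.i := neg_of_kostant h.mem hα

lemma apply_of_vertex (h : IsMatching ν k) {α : Root n} (hα : k α ≠ 0) {v : Fin n}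
    (hv : v = α.j ∨ v = α.i) : ν v = k α * α.wt v := by
  rw [kostant_apply h.mem, Finset.sum_eq_single α]
  · intro β _ hβ
    by_cases h0 : k β = 0
    · rw [h0, Nat.cast_zero, zero_mul]
    · rw [Root.wt_of_ne (fun e => hβ (h.eq_of_vertex h0 hα (.inr e) hv))
        (fun e => hβ (h.eq_of_vertex h0 hα (.inl e) hv)), mul_zero]
  · simp

lemma apply_i (h : IsMatching ν k) {α : Root n} (hα : k α ≠ 0) : ν α.i = k α := by
  rw [h.apply_of_vertex hα (.inr rfl), Root.wt_i, mul_one]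

lemma apply_j (h : IsMatching ν k) {α : Root n} (hα : k α ≠ 0) : ν α.j = -k α := by
  rw [h.apply_of_vertex hα (.inl rfl), Root.wt_j, mul_neg_one]

lemma exists_edge (h : IsMatching ν k) {v : Fin n} (hv : ν v ≠ 0) :
    ∃ α, k α ≠ 0 ∧ (v = α.j ∨ v = α.i) := by
  have h1 := h.perm.subset (Finset.mem_toList.2 (mem_wtSupp.2 hv))
  obtain ⟨α, hα, h2⟩ := mem_vertices.1 h1
  exact ⟨α, mem_edges.1 (Finset.mem_toList.1 hα), h2⟩

/-- At the lower end of an edge the value of `ν` is a negative integer, and at an upper end it is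
positive. So a position that is a lower end in one matching is one in every matching, and the value
gives the multiplicity. -/
lemma exists_edge_j (h : IsMatching ν k) {α : Root n} {l : Root n → ℕ} (h' : IsMatching ν l)
    (hα : l α ≠ 0) : ∃ β, k β ≠ 0 ∧ β.j = α.j ∧ k β = l α := by
  have h1 := h'.apply_j hα
  have hpos : (0 : ℝ) < l α := Nat.cast_pos.2 (Nat.pos_of_ne_zero hα)
  obtain ⟨β, hβ, e | e⟩ := h.exists_edge (v := α.j) (by rw [h1]; simpa using hα)
  · refine ⟨β, hβ, e.symm, ?_⟩
    rw [e, h.apply_j hβ, neg_inj] at h1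
    exact_mod_cast h1
  · exfalso
    rw [e, h.apply_i hβ] at h1
    have h2 : ((k β + l α : ℕ) : ℂ) = 0 := by push_cast; rw [h1]; ring
    have := Nat.cast_eq_zero.1 h2
    omega

end IsMatching

/-- Two positions with the same nonzero value that no position with the opposite value separates. -/
def IsBadPair (ν : Fin n → ℂ) (p q : Fin n) : Prop :=
  p < q ∧ ν p ≠ 0 ∧ ν q = ν p ∧ ∀ v, p < v → v < q → ν v ≠ -ν p

/-- Without bad pairs, the edges of a matching join neighbours. -/
lemma IsMatching.not_between {ν : Fin n → ℂ} {k : Root n → ℕ} (h : IsMatching ν k)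
    (hb : ∀ p q, ¬IsBadPair ν p q) {α : Root n} (hα : k α ≠ 0) {v : Fin n} (h1 : α.j < v) (h2 : v < α.i) :
    ν v ≠ k α ∧ ν v ≠ -k α := by
  have hk : (k α : ℂ) ≠ 0 := Nat.cast_ne_zero.2 hα
  by_contra hc
  -- A value `k α` strictly inside the edge would form a bad pair with the upper end, unless `-k α`
  -- occurs between them. So `-k α` occurs inside in any case.
  have h3 : ∃ q, α.j < q ∧ q < α.i ∧ ν q = -k α := by
    by_cases hv : ν v = k α
    · by_contra! h4
      exact hb v α.i ⟨h2, by rwa [hv], by rw [hv, h.apply_i hα], fun w hw1 hw2 => by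
        rw [hv]; exact h4 w (h1.trans hw1) hw2⟩
    · exact ⟨v, h1, h2, by by_contra h4; exact hc ⟨hv, h4⟩⟩
  -- The rightmost such position is the lower end of an edge `β` of the same multiplicity. If `β`
  -- ends before `α.i`, its upper end and `α.i` form a bad pair. If it ends after, then `α.i` lies
  -- inside `β`, which is excluded by recursion, as `β` starts further to the right.
  let S := Finset.univ.filter fun q => α.j < q ∧ q < α.i ∧ ν q = -k α
  obtain ⟨q, hq, hmax⟩ := S.exists_max_image id (by
    obtain ⟨q, hq⟩ := h3
    exact ⟨q, by simpa [S] using hq⟩)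
  simp only [S, Finset.mem_filter, Finset.mem_univ, true_and, id] at hq hmax
  obtain ⟨q1, q2, q3⟩ := hq
  obtain ⟨β, hβ, e⟩ := h.exists_edge (v := q) (by rw [q3]; exact neg_ne_zero.2 hk)
  have hβα : k β = k α ∧ q = β.j := by
    rcases e with e | e
    · rw [e, h.apply_j hβ, neg_inj] at q3
      exact ⟨by exact_mod_cast q3, e⟩
    · exfalso
      rw [e, h.apply_i hβ] at q3
      have h2 : ((k β + k α : ℕ) : ℂ) = 0 := by push_cast; rw [q3]; ring
      have := Nat.cast_eq_zero.1 h2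
      omega
  obtain ⟨hβk, rfl⟩ := hβα
  have hne : β.i ≠ α.i := fun e => by
    have := h.eq_of_vertex hα hβ (.inr rfl) (.inr e.symm)
    subst this
    exact lt_irrefl _ q1
  rcases lt_or_gt_of_ne hne with h5 | h5
  · refine hb β.i α.i ⟨h5, by rw [h.apply_i hβ, hβk]; exact hk, by rw [h.apply_i hβ, h.apply_i hα, hβk],
      fun w hw1 hw2 hw => ?_⟩
    rw [h.apply_i hβ, hβk] at hw
    have := hmax w ⟨(q1.trans (h.lt hβ)).trans hw1, hw2, hw⟩
    exact absurd (this.trans_lt (h.lt hβ)) (lt_asymm hw1)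
  · exact (h.not_between hb hβ q2 h5).1 (by rw [hβk, h.apply_i hα])
  termination_by n - α.j
  decreasing_by
    rw [Fin.lt_def] at q1
    omega

/-- Edges of the two matchings with the same lower end have the same multiplicity. If their upper
ends differed, the nearer one would lie strictly inside the longer edge and carry the forbidden
value. -/
lemma IsMatching.subset {ν : Fin n → ℂ} {k l : Root n → ℕ} (h : IsMatching ν k) (h' : IsMatching ν l)
    (hb : ∀ p q, ¬IsBadPair ν p q) {α : Root n} (hα : l α ≠ 0) : k α = l α := by
  obtain ⟨β, hβ, e, e'⟩ := h.exists_edge_j h' hα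
  have hi : β.i = α.i := by
    by_contra hne
    rcases lt_or_gt_of_ne hne with h1 | h1
    · exact (h'.not_between hb hα (e ▸ h.lt hβ) h1).1 (by rw [h.apply_i hβ, e'])
    · exact (h.not_between hb hβ (e ▸ h'.lt hα) h1).1 (by rw [h'.apply_i hα, e'])
  rw [← Root.ext hi e, e', Root.ext hi e]

lemma IsMatching.unique {ν : Fin n → ℂ} {k l : Root n → ℕ} (h : IsMatching ν k) (h' : IsMatching ν l)
    (hb : ∀ p q, ¬IsBadPair ν p q) : k = l := by
  funext α
  by_cases hα : l α = 0
  · by_cases hα' : k α = 0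
    · rw [hα, hα']
    · exact (h'.subset h hb hα').symm
  · exact h.subset h' hb hα

lemma isMatching_of_chr_ne_zero {ν : Fin n → ℂ} (heven : Even (wtSupp ν).card) {k : Root n → ℕ}
    (hk : k ∈ kostant ν) (h : chr (wtSupp ν).toList (rootTerm k) ≠ 0) : IsMatching ν k :=
  ⟨hk, perm_vertices_of_chr_ne_zero k pos_of_mem_edges (Finset.nodup_toList _)
    (by rwa [Finset.length_toList]) (by rwa [← rootTerm_eq])⟩

/-- The action of permutations on roots. -/
def Root.perm (σ : Equiv.Perm (Fin n)) (α : Root n) : Root n := ⟨σ α.i, σ α.j, σ.injective.ne α.ne⟩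

lemma vertices_map (σ : Equiv.Perm (Fin n)) (L : List (Root n)) :
    vertices (L.map (Root.perm σ)) = (vertices L).map σ := by
  induction L with
  | nil => rfl
  | cons α L ih => rw [List.map_cons, vertices_cons, vertices_cons, List.map_cons, List.map_cons, ih]; rfl

lemma Root.perm_swap (p q : Fin n) (α : Root n) :
    (α.perm (Equiv.swap p q)).perm (Equiv.swap p q) = α :=
  Root.ext (Equiv.swap_apply_self _ _ _) (Equiv.swap_apply_self _ _ _)

lemma Root.wt_perm_swap (p q : Fin n) (α : Root n) (v : Fin n) :
    (α.perm (Equiv.swap p q)).wt v = α.wt (Equiv.swap p q v) := by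
  have h : ∀ i, v = Equiv.swap p q i ↔ Equiv.swap p q v = i := fun i =>
    ⟨fun h => by rw [h, Equiv.swap_apply_self], fun h => by rw [← h, Equiv.swap_apply_self]⟩
  simp only [Root.wt, Root.perm, Pi.sub_apply, Pi.single_apply, h]

/-- A matching evaluates to the product of the `2 k α` along its own list of vertices. Relabelling
the roots leaves this product unchanged and exchanges `p` and `q` in the list, which reverses the
sign of the functional. -/
lemma chr_rootTerm_swap {ν : Fin n → ℂ} {k : Root n → ℕ} (h : IsMatching ν k) {p q : Fin n}
    (hpq : p ≠ q) (hp : ν p ≠ 0) (hq : ν q ≠ 0) :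
    chr (wtSupp ν).toList (rootTerm fun α => k (α.perm (Equiv.swap p q))) =
      -chr (wtSupp ν).toList (rootTerm k) := by
  set L := (edges k).toList with hL
  set L' := L.map (Root.perm (Equiv.swap p q)) with hL'
  have hinv : Function.Involutive (Root.perm (Equiv.swap p q)) := Root.perm_swap p q
  have hL1 : L'.Nodup := (Finset.nodup_toList _).map hinv.injective
  have hL2 : ∀ α, α ∈ L' ↔ k (α.perm (Equiv.swap p q)) ≠ 0 := fun α => by
    rw [hL', List.mem_map, hL]
    simp only [Finset.mem_toList, mem_edges]
    constructor
    · rintro ⟨β, hβ, rfl⟩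
      rwa [hinv]
    · exact fun hα => ⟨_, hα, hinv α⟩
  have hV : vertices L' = (vertices L).map (Equiv.swap p q) := by
    exact vertices_map _ L
  have hmem : ∀ v, ν v ≠ 0 → v ∈ vertices L := fun v hv =>
    h.perm.subset (Finset.mem_toList.2 (mem_wtSupp.2 hv))
  obtain ⟨ε, -, hε⟩ := chr_perm h.perm (Finset.nodup_toList _)
  have e1 := chr_edgeProd k pos_of_mem_edges h.nodup
  have e2 := chr_edgeProd (fun α => k (α.perm (Equiv.swap p q))) (L := L')
    (fun α hα => Nat.pos_of_ne_zero ((hL2 α).1 hα))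
    (by rw [hV]; exact h.nodup.map (Equiv.injective _))
  rw [hV, chr_swap hpq h.nodup (hmem p hp) (hmem q hq), ← rootTerm_eq_edgeProd hL1 hL2, hL', List.map_map] at e2
  rw [hε, hε, rootTerm_eq k, e1, eq_neg_iff_add_eq_zero, ← mul_add]
  rw [neg_eq_iff_eq_neg] at e2
  rw [e2]
  have : ((fun α => (2 * (k (α.perm (Equiv.swap p q)) : ℂ))) ∘ Root.perm (Equiv.swap p q)) =
      fun α => (2 * k α : ℂ) := funext fun α => by simp [hinv α]
  rw [this, neg_add_cancel, mul_zero]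

/-- A bad pair makes the supercharacter vanish. -/
lemma sum_chr_eq_zero_of_bad {ν : Fin n → ℂ} (heven : Even (wtSupp ν).card) {p q : Fin n}
    (hb : IsBadPair ν p q) :
    ∑ k ∈ (kostant_finite ν).toFinset, chr (wtSupp ν).toList (rootTerm k) = 0 := by
  classical
  obtain ⟨hpq, hp, hqp, hbet⟩ := hb
  have hq : ν q ≠ 0 := by rwa [hqp]
  set φ : (Root n → ℕ) → ℂ := fun k => chr (wtSupp ν).toList (rootTerm k) with hφ
  let σ : (Root n → ℕ) → (Root n → ℕ) := fun k α => k (α.perm (Equiv.swap p q))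
  have hσσ : ∀ k, σ (σ k) = k := fun k => funext fun α => congrArg k (Root.perm_swap p q α)
  -- The sum stays `ν` because `ν p = ν q`. An edge at `p` or `q` has the opposite value at its
  -- other end; it could become nonnegative under the exchange only if that end lay between `p` and
  -- `q`, which a bad pair excludes.
  have hσ : ∀ k ∈ kostant ν, φ k ≠ 0 → σ k ∈ kostant ν ∧ φ (σ k) = -φ k := by
    intro k hk h0
    have hm := isMatching_of_chr_ne_zero heven hk h0
    refine ⟨⟨fun α hα => ?_, ?_⟩, chr_rootTerm_swap hm hpq.ne hp hq⟩
    · by_contra hne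
      set β := α.perm (Equiv.swap p q) with hβ
      have hα' : α = β.perm (Equiv.swap p q) := (Root.perm_swap p q α).symm
      have h1 := hm.lt hne
      have h2 := hm.apply_i hne
      have h3 := hm.apply_j hne
      have h4 : ∀ v, ν v = -ν p → v ≠ p ∧ v ≠ q ∧ ¬(p < v ∧ v < q) := fun v hv =>
        ⟨fun e => hp (self_eq_neg.1 (by rwa [e] at hv)),
          fun e => hp (self_eq_neg.1 (by rwa [e, hqp] at hv)), fun e => hbet v e.1 e.2 hv⟩
      rw [hα'] at hα
      change Equiv.swap p q β.i ≤ Equiv.swap p q β.j at hα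
      by_cases hi : β.i = p ∨ β.i = q
      · have h5 := h4 β.j (by
          rw [h3, ← h2]
          rcases hi with e | e
          · rw [e]
          · rw [e, hqp])
        rw [Equiv.swap_apply_of_ne_of_ne h5.1 h5.2.1] at hα
        rcases hi with e | e
        · rw [e, Equiv.swap_apply_left] at hα
          rw [e] at h1
          exact lt_asymm (hpq.trans_le hα) h1
        · rw [e, Equiv.swap_apply_right] at hα
          rw [e] at h1
          exact h5.2.2 ⟨lt_of_le_of_ne hα h5.1.symm, h1⟩
      · rw [not_or] at hi
        rw [Equiv.swap_apply_of_ne_of_ne hi.1 hi.2] at hα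
        by_cases hj : β.j = p ∨ β.j = q
        · have h5 := h4 β.i (by
            rw [h2, ← neg_neg (k β : ℂ), ← h3]
            rcases hj with e | e
            · rw [e]
            · rw [e, hqp])
          rcases hj with e | e
          · rw [e, Equiv.swap_apply_left] at hα
            rw [e] at h1
            exact h5.2.2 ⟨h1, lt_of_le_of_ne hα h5.2.1⟩
          · rw [e, Equiv.swap_apply_right] at hα
            rw [e] at h1
            exact lt_asymm (hpq.trans h1) (lt_of_le_of_ne hα h5.1)
        · rw [not_or] at hj
          rw [Equiv.swap_apply_of_ne_of_ne hj.1 hj.2] at hα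
          exact absurd h1 (not_lt.2 hα)
    · funext v
      have hinv : Function.Involutive (Root.perm (Equiv.swap p q)) := Root.perm_swap p q
      rw [← Equiv.sum_comp hinv.toPerm, Finset.sum_apply]
      simp only [Pi.smul_apply, nsmul_eq_mul]
      have e := kostant_apply hk (Equiv.swap p q v)
      have hν : ν (Equiv.swap p q v) = ν v := by
        rw [Equiv.swap_apply_def]
        split_ifs with h1 h1
        · rw [h1, hqp]
        · rw [h1, hqp]
        · rfl
      rw [← hν, e]
      refine Finset.sum_congr rfl fun β _ => ?_
      change ((k ((β.perm (Equiv.swap p q)).perm (Equiv.swap p q)) : ℕ) : ℂ) *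
        (β.perm (Equiv.swap p q)).wt v = _
      rw [Root.perm_swap, Root.wt_perm_swap]
  -- Where the supertrace vanishes the involution is taken to be the identity, since there the
  -- exchanged family need not consist of negative roots.
  refine Finset.sum_involution (fun k _ => if φ k ≠ 0 then σ k else k) ?_ ?_ ?_ ?_
  · intro k hk
    rw [Set.Finite.mem_toFinset] at hk
    split_ifs with h0
    · change φ k + φ (σ k) = 0
      rw [(hσ k hk h0).2, add_neg_cancel]
    · change φ k + φ k = 0
      rw [not_not.1 h0, add_zero]
  · intro k hk h0
    rw [Set.Finite.mem_toFinset] at hk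
    rw [if_pos h0]
    intro e
    have := (hσ k hk h0).2
    rw [e] at this
    exact h0 (self_eq_neg.1 this)
  · intro k hk
    rw [Set.Finite.mem_toFinset] at *
    split_ifs with h0
    · exact (hσ k hk h0).1
    · exact hk
  · intro k hk
    rw [Set.Finite.mem_toFinset] at hk
    by_cases h0 : φ k ≠ 0
    · simp only [if_pos h0]
      rw [if_pos (by rw [(hσ k hk h0).2]; exact neg_ne_zero.2 h0), hσσ]
    · simp only [if_neg h0]

end Matchings

end
end Queer

namespace Queer

noncomputable section

open LieSuperalgebra SuperRep TensorProduct

variable {n : ℕ}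

/-! ### Odd support: the parity of the number of partitions -/

section OddRank

/-- Two functions whose sums differ by one. -/
lemma exists_unique_excess {ι : Type*} [Fintype ι] {f g : ι → ℕ} (hle : ∀ v, g v ≤ f v)
    (hsum : ∑ v, f v = ∑ v, g v + 1) : ∃ v₀, f v₀ = g v₀ + 1 ∧ ∀ v, v ≠ v₀ → f v = g v := by
  classical
  have h0 : ∑ v, (f v - g v) = 1 := by
    have : ∑ v, f v = ∑ v, g v + ∑ v, (f v - g v) := by
      rw [← Finset.sum_add_distrib]
      exact Finset.sum_congr rfl fun v _ => (Nat.add_sub_cancel' (hle v)).symm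
    omega
  obtain ⟨v₀, h1⟩ : ∃ v₀, f v₀ - g v₀ ≠ 0 := by
    by_contra! h
    rw [Finset.sum_eq_zero fun v _ => h v] at h0
    omega
  rw [← Finset.add_sum_erase _ _ (Finset.mem_univ v₀)] at h0
  have h2 : ∑ v ∈ Finset.univ.erase v₀, (f v - g v) = 0 := by omega
  refine ⟨v₀, by have := hle v₀; omega, fun v hv => ?_⟩
  have := Finset.sum_eq_zero_iff.1 h2 v (Finset.mem_erase.2 ⟨hv, Finset.mem_univ v⟩)
  have := hle v
  omega

/-- The edges at a vertex. -/
def edgesAt (k : Root n → ℕ) (v : Fin n) : Finset (Root n) :=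
  (edges k).filter fun α => v = α.j ∨ v = α.i

lemma mem_edgesAt {k : Root n → ℕ} {v : Fin n} {α : Root n} :
    α ∈ edgesAt k v ↔ k α ≠ 0 ∧ (v = α.j ∨ v = α.i) := by
  rw [edgesAt, Finset.mem_filter, mem_edges]

lemma sum_card_edgesAt (k : Root n → ℕ) : ∑ v, (edgesAt k v).card = 2 * (edges k).card := by
  simp only [edgesAt, Finset.card_filter]
  rw [Finset.sum_comm, mul_comm, ← smul_eq_mul, ← Finset.sum_const]
  refine Finset.sum_congr rfl fun α _ => ?_
  rw [← Finset.card_filter, show (Finset.univ.filter fun v => v = α.j ∨ v = α.i) = {α.j, α.i} by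
    ext v; simp, Finset.card_pair α.ne.symm]

variable {ν : Fin n → ℂ} {k : Root n → ℕ}

lemma apply_eq_sum_edgesAt (hk : k ∈ kostant ν) (v : Fin n) :
    ν v = ∑ α ∈ edgesAt k v, (k α : ℂ) * α.wt v := by
  rw [kostant_apply hk]
  refine (Finset.sum_subset (Finset.subset_univ _) fun α _ hα => ?_).symm
  by_cases h0 : k α = 0
  · rw [h0, Nat.cast_zero, zero_mul]
  · rw [Root.wt_of_ne (fun e => hα (mem_edgesAt.2 ⟨h0, .inr e⟩))
      (fun e => hα (mem_edgesAt.2 ⟨h0, .inl e⟩)), mul_zero]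

/-- The edges form a matching apart from two edges with a common vertex. -/
structure IsNearMatching (ν : Fin n → ℂ) (s : ℕ) (k : Root n → ℕ) : Prop where
  mem : k ∈ kostant ν
  card : (edges k).card = s

/-- Every position of the support has degree at least one, and the degrees add up to `2 s`, one more
than the size of the support. So there is a single excess, and its vertex lies in the support,
because `ν` does not vanish at a vertex of degree one. -/
lemma IsNearMatching.exists_vertex {s : ℕ} (hs : (wtSupp ν).card + 1 = 2 * s)
    (h : IsNearMatching ν s k) : ∃ v₀, ν v₀ ≠ 0 ∧ (edgesAt k v₀).card = 2 ∧
      ∀ v α β, v ≠ v₀ → α ∈ edgesAt k v → β ∈ edgesAt k v → α = β := by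
  classical
  have h1 : ∀ v, (if ν v ≠ 0 then 1 else 0) ≤ (edgesAt k v).card := fun v => by
    split_ifs with hv
    · by_contra h0
      have : edgesAt k v = ∅ := by rw [← Finset.card_eq_zero]; omega
      exact hv (by rw [apply_eq_sum_edgesAt h.mem, this, Finset.sum_empty])
    · exact Nat.zero_le _
  obtain ⟨v₀, h2, h3⟩ := exists_unique_excess h1 (by
    rw [sum_card_edgesAt, h.card, ← hs, ← Finset.card_filter]
    rfl)
  have h4 : ν v₀ ≠ 0 := by
    intro h0
    rw [if_neg (not_not.2 h0), zero_add, Finset.card_eq_one] at h2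
    obtain ⟨α, hα⟩ := h2
    have h5 := apply_eq_sum_edgesAt h.mem v₀
    rw [h0, hα, Finset.sum_singleton] at h5
    obtain ⟨h6, h7⟩ := mem_edgesAt.1 (hα ▸ Finset.mem_singleton_self α : α ∈ edgesAt k v₀)
    have h8 : α.wt v₀ ≠ 0 := by
      rcases h7 with e | e
      · rw [e, Root.wt_j]; simp
      · rw [e, Root.wt_i]; simp
    exact mul_ne_zero (Nat.cast_ne_zero.2 h6) h8 h5.symm
  refine ⟨v₀, h4, by rw [h2, if_pos h4], fun v α β hv hα hβ => ?_⟩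
  have h9 : (edgesAt k v).card ≤ 1 := by
    rw [h3 v hv]
    split_ifs <;> simp
  exact Finset.card_le_one.1 h9 α hα β hβ

/-- The three edges of a triangle. -/
structure IsTriangle (α β γ : Root n) : Prop where
  mid : α.i = β.j
  bot : γ.j = α.j
  top : γ.i = β.i
  lt₁ : α.j < α.i
  lt₂ : β.j < β.i

/-- Exactly two edges of the triangle occur in `k`. -/
structure IsCorner (k : Root n → ℕ) (α β γ : Root n) : Prop extends IsTriangle α β γ where
  two : (k α ≠ 0 ∧ k β ≠ 0 ∧ k γ = 0) ∨ (k α ≠ 0 ∧ k β = 0 ∧ k γ ≠ 0) ∨ (k α = 0 ∧ k β ≠ 0 ∧ k γ ≠ 0)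

section Triangle

variable {α β γ : Root n}

lemma IsTriangle.ne₁ (h : IsTriangle α β γ) : α ≠ β := fun e => by
  have h1 := h.mid; have h2 := h.lt₁; subst e; exact absurd h1 h2.ne'

lemma IsTriangle.ne₂ (h : IsTriangle α β γ) : α ≠ γ := fun e => by
  have h1 := h.top; have h2 := h.lt₂; have h3 := h.mid; subst e; exact absurd (h3.symm.trans h1) h2.ne

lemma IsTriangle.ne₃ (h : IsTriangle α β γ) : β ≠ γ := fun e => by
  have h1 := h.bot; have h2 := h.lt₁; have h3 := h.mid; subst e; exact absurd (h3.trans h1) h2.ne'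

lemma IsTriangle.wt (h : IsTriangle α β γ) : γ.wt = α.wt + β.wt := by
  simp only [Root.wt, h.bot, h.top, h.mid]
  abel

/-- The third side joins the two free ends; the order of the three vertices decides which roles the
given roots play. -/
lemma exists_triangle {p q : Root n} (hp : p.j < p.i) (hq : q.j < q.i) (hpq : p ≠ q) {v : Fin n}
    (hvp : v = p.j ∨ v = p.i) (hvq : v = q.j ∨ v = q.i) :
    ∃ α β γ, IsTriangle α β γ ∧ (p = α ∨ p = β ∨ p = γ) ∧ (q = α ∨ q = β ∨ q = γ) := by
  rcases hvp with rfl | rfl <;> rcases hvq with e | e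
  · rcases lt_trichotomy p.i q.i with h | h | h
    · exact ⟨p, ⟨q.i, p.i, h.ne'⟩, q, ⟨rfl, e.symm, rfl, hp, h⟩, by simp, by simp⟩
    · exact absurd (Root.ext h e) hpq
    · exact ⟨q, ⟨p.i, q.i, h.ne'⟩, p, ⟨rfl, e, rfl, hq, h⟩, by simp, by simp⟩
  · have h : q.j < p.i := (hq.trans_eq e.symm).trans hp
    exact ⟨q, p, ⟨p.i, q.j, h.ne'⟩, ⟨e.symm, rfl, rfl, hq, hp⟩, by simp, by simp⟩
  · have h : p.j < q.i := (hp.trans_eq e).trans hq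
    exact ⟨p, q, ⟨q.i, p.j, h.ne'⟩, ⟨e, rfl, rfl, hp, hq⟩, by simp, by simp⟩
  · rcases lt_trichotomy p.j q.j with h | h | h
    · exact ⟨⟨q.j, p.j, h.ne'⟩, q, p, ⟨rfl, rfl, e, h, hq⟩, by simp, by simp⟩
    · exact absurd (Root.ext e h) hpq
    · exact ⟨⟨p.j, q.j, h.ne'⟩, p, q, ⟨rfl, rfl, e.symm, h, hp⟩, by simp, by simp⟩

end Triangle

lemma IsNearMatching.exists_corner {s : ℕ} (hs : (wtSupp ν).card + 1 = 2 * s)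
    (h : IsNearMatching ν s k) : ∃ α β γ, IsCorner k α β γ := by
  obtain ⟨v, hv, h2, h3⟩ := h.exists_vertex hs
  obtain ⟨p, q, hpq, hv'⟩ := Finset.card_eq_two.1 h2
  have hp : p ∈ edgesAt k v := by rw [hv']; simp
  have hq : q ∈ edgesAt k v := by rw [hv']; simp
  obtain ⟨hp0, hp1⟩ := mem_edgesAt.1 hp
  obtain ⟨hq0, hq1⟩ := mem_edgesAt.1 hq
  obtain ⟨α, β, γ, ht, h4, h5⟩ := exists_triangle (neg_of_kostant h.mem hp0) (neg_of_kostant h.mem hq0)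
    hpq hp1 hq1
  refine ⟨α, β, γ, ht, ?_⟩
  -- If all three sides occurred, all three vertices would have degree at least two.
  have h6 : ¬(k α ≠ 0 ∧ k β ≠ 0 ∧ k γ ≠ 0) := fun ⟨hα, hβ, hγ⟩ => by
    have e1 : α.i = v := by
      by_contra hne
      exact ht.ne₁ (h3 α.i α β hne (mem_edgesAt.2 ⟨hα, .inr rfl⟩) (mem_edgesAt.2 ⟨hβ, .inl ht.mid⟩))
    have e2 : α.j = v := by
      by_contra hne
      exact ht.ne₂ (h3 α.j α γ hne (mem_edgesAt.2 ⟨hα, .inl rfl⟩) (mem_edgesAt.2 ⟨hγ, .inl ht.bot.symm⟩))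
    exact α.ne (e1.trans e2.symm)
  rcases h4 with rfl | rfl | rfl <;> rcases h5 with rfl | rfl | rfl <;> tauto

/-- The two occurring sides share a vertex, so they are the two edges at the only vertex of degree
two; and two sides determine the triangle. -/
lemma IsNearMatching.corner_unique {s : ℕ} (hs : (wtSupp ν).card + 1 = 2 * s)
    (h : IsNearMatching ν s k) {α β γ α' β' γ' : Root n} (h1 : IsCorner k α β γ)
    (h2 : IsCorner k α' β' γ') : α = α' ∧ β = β' ∧ γ = γ' := by
  obtain ⟨v, hv, hc, h3⟩ := h.exists_vertex hs
  obtain ⟨p, q, hpq, hv'⟩ := Finset.card_eq_two.1 hc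
  have key : ∀ {a b : Root n} {w : Fin n}, k a ≠ 0 → k b ≠ 0 → a ≠ b → (w = a.j ∨ w = a.i) →
      (w = b.j ∨ w = b.i) → (a = p ∨ a = q) ∧ (b = p ∨ b = q) := by
    intro a b w ha hb hab hwa hwb
    have hw : w = v := by
      by_contra hne
      exact hab (h3 w a b hne (mem_edgesAt.2 ⟨ha, hwa⟩) (mem_edgesAt.2 ⟨hb, hwb⟩))
    subst hw
    have h4 : a ∈ edgesAt k w := mem_edgesAt.2 ⟨ha, hwa⟩
    have h5 : b ∈ edgesAt k w := mem_edgesAt.2 ⟨hb, hwb⟩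
    rw [hv'] at h4 h5
    exact ⟨by simpa using h4, by simpa using h5⟩
  have main : ∀ {α β γ : Root n}, IsCorner k α β γ →
      ∃ a b, ((a = p ∧ b = q) ∨ (a = q ∧ b = p)) ∧
        ((a = α ∧ b = β) ∨ (a = α ∧ b = γ) ∨ (a = β ∧ b = γ)) := by
    intro α β γ h
    rcases h.two with ⟨ha, hb, -⟩ | ⟨ha, -, hb⟩ | ⟨-, ha, hb⟩
    · have := key (w := α.i) ha hb h.ne₁ (.inr rfl) (.inl h.mid)
      have := h.ne₁
      exact ⟨α, β, by grind, by simp⟩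
    · have := key (w := α.j) ha hb h.ne₂ (.inl rfl) (.inl h.bot.symm)
      have := h.ne₂
      exact ⟨α, γ, by grind, by simp⟩
    · have := key (w := β.i) ha hb h.ne₃ (.inr rfl) (.inr h.top.symm)
      have := h.ne₃
      exact ⟨β, γ, by grind, by simp⟩
  obtain ⟨a, b, hab, e⟩ := main h1
  obtain ⟨a', b', hab', e'⟩ := main h2
  have hS : (a = a' ∧ b = b') ∨ (a = b' ∧ b = a') := by grind
  suffices H : (α.j = α'.j ∧ α.i = α'.i) ∧ (β.j = β'.j ∧ β.i = β'.i) ∧ (γ.j = γ'.j ∧ γ.i = γ'.i) from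
    ⟨Root.ext H.1.2 H.1.1, Root.ext H.2.1.2 H.2.1.1, Root.ext H.2.2.2 H.2.2.1⟩
  have hS' : (a.j = a'.j ∧ a.i = a'.i ∧ b.j = b'.j ∧ b.i = b'.i) ∨
      (a.j = b'.j ∧ a.i = b'.i ∧ b.j = a'.j ∧ b.i = a'.i) := by
    rcases hS with ⟨rfl, rfl⟩ | ⟨rfl, rfl⟩ <;> simp
  clear hS main key hab hab'
  obtain ⟨h11, h12, h13, h14, h15⟩ := h1.toIsTriangle
  obtain ⟨h21, h22, h23, h24, h25⟩ := h2.toIsTriangle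
  simp only [Fin.ext_iff, Fin.lt_def] at *
  rcases e with ⟨rfl, rfl⟩ | ⟨rfl, rfl⟩ | ⟨rfl, rfl⟩ <;>
    rcases e' with ⟨rfl, rfl⟩ | ⟨rfl, rfl⟩ | ⟨rfl, rfl⟩ <;> omega

/-- Replacement of the multiplicities of three roots. -/
def updateThree (k : Root n → ℕ) (α β γ : Root n) (a b c : ℕ) : Root n → ℕ :=
  fun δ => if δ = α then a else if δ = β then b else if δ = γ then c else k δ

section UpdateThree

variable {α β γ : Root n} (h : IsTriangle α β γ) (a b c : ℕ)

@[simp] lemma updateThree_fst : updateThree k α β γ a b c α = a := by simp [updateThree]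

lemma updateThree_snd (h : IsTriangle α β γ) : updateThree k α β γ a b c β = b := by
  simp [updateThree, h.ne₁.symm]

lemma updateThree_thd (h : IsTriangle α β γ) : updateThree k α β γ a b c γ = c := by
  simp [updateThree, h.ne₂.symm, h.ne₃.symm]

lemma updateThree_self : updateThree k α β γ (k α) (k β) (k γ) = k := by
  funext δ
  simp only [updateThree]
  split_ifs with h1 h1 h1
  all_goals first | rw [h1] | rfl

lemma updateThree_updateThree (a' b' c' : ℕ) :
    updateThree (updateThree k α β γ a b c) α β γ a' b' c' = updateThree k α β γ a' b' c' := by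
  funext δ
  simp only [updateThree]
  split_ifs <;> rfl

lemma sum_updateThree (h : IsTriangle α β γ) {M : Type*} [AddCommMonoid M] (F : Root n → ℕ → M) :
    ∑ δ, F δ (updateThree k α β γ a b c δ) = F α a + (F β b + (F γ c +
      ∑ δ ∈ ((Finset.univ.erase α).erase β).erase γ, F δ (k δ))) := by
  rw [← Finset.add_sum_erase _ _ (Finset.mem_univ α),
    ← Finset.add_sum_erase _ _ (Finset.mem_erase.2 ⟨h.ne₁.symm, Finset.mem_univ β⟩),
    ← Finset.add_sum_erase _ _ (Finset.mem_erase.2 ⟨h.ne₃.symm, Finset.mem_erase.2 ⟨h.ne₂.symm, Finset.mem_univ γ⟩⟩),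
    updateThree_fst, updateThree_snd _ _ _ h, updateThree_thd _ _ _ h]
  congr 3
  refine Finset.sum_congr rfl fun δ hδ => ?_
  simp only [Finset.mem_erase, Finset.mem_univ, and_true] at hδ
  simp [updateThree, hδ.1, hδ.2.1, hδ.2.2]

lemma card_edges_eq_sum (k : Root n → ℕ) : (edges k).card = ∑ δ, if k δ ≠ 0 then 1 else 0 := by
  rw [edges, Finset.card_filter]

end UpdateThree

/-- The other presentation of the contribution of a triangle. -/
def flipThree (k : Root n → ℕ) (α β γ : Root n) : Root n → ℕ :=
  -- Since `γ = α + β`, multiplicity can be moved between `γ` and the pair `α`, `β`. Moving as much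
  -- as possible exhausts the smaller of `k α` and `k β`, so again two sides occur; in the other
  -- direction all of `k γ` is moved back.
  if k γ = 0 then
    updateThree k α β γ (k α - min (k α) (k β)) (k β - min (k α) (k β)) (min (k α) (k β))
  else updateThree k α β γ (k α + k γ) (k β + k γ) 0

lemma IsNearMatching.flip {s : ℕ} (hs : (wtSupp ν).card + 1 = 2 * s) (h : IsNearMatching ν s k)
    {α β γ : Root n} (hc : IsCorner k α β γ) :
    IsNearMatching ν s (flipThree k α β γ) ∧ IsCorner (flipThree k α β γ) α β γ ∧
      flipThree (flipThree k α β γ) α β γ = k ∧ flipThree k α β γ ≠ k := by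
  have ht := hc.toIsTriangle
  -- The sums `a + c` and `b + c` are the coefficients of `α` and `β` in the contribution of the
  -- triangle. If they are kept and again two of the three multiplicities are nonzero, neither the
  -- weight nor the number of edges changes.
  have general : ∀ a b c : ℕ, a + c = k α + k γ → b + c = k β + k γ →
      ((a ≠ 0 ∧ b ≠ 0 ∧ c = 0) ∨ (a ≠ 0 ∧ b = 0 ∧ c ≠ 0) ∨ (a = 0 ∧ b ≠ 0 ∧ c ≠ 0)) →
      IsNearMatching ν s (updateThree k α β γ a b c) ∧ IsCorner (updateThree k α β γ a b c) α β γ := by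
    intro a b c h1 h2 h3
    refine ⟨⟨⟨fun δ hδ => ?_, ?_⟩, ?_⟩, ⟨ht, ?_⟩⟩
    · have e1 : δ ≠ α := fun e => by subst e; exact absurd ht.lt₁ (not_lt.2 hδ)
      have e2 : δ ≠ β := fun e => by subst e; exact absurd ht.lt₂ (not_lt.2 hδ)
      have e3 : δ ≠ γ := fun e => by
        subst e
        exact absurd (((ht.bot.trans_lt ht.lt₁).trans_eq ht.mid).trans (ht.lt₂.trans_eq ht.top.symm)) (not_lt.2 hδ)
      simp only [updateThree, if_neg e1, if_neg e2, if_neg e3]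
      exact h.mem.1 δ hδ
    · have e := h.mem.2
      rw [← updateThree_self (k := k) (α := α) (β := β) (γ := γ),
        sum_updateThree _ _ _ ht fun δ m => m • δ.wt] at e
      rw [sum_updateThree _ _ _ ht fun δ m => m • δ.wt, ← e, ht.wt]
      simp only [smul_add, ← add_assoc]
      congr 1
      calc a • α.wt + b • β.wt + c • α.wt + c • β.wt = (a + c) • α.wt + (b + c) • β.wt := by
            rw [add_smul, add_smul]; abel
        _ = (k α + k γ) • α.wt + (k β + k γ) • β.wt := by rw [h1, h2]
        _ = _ := by rw [add_smul, add_smul]; abel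
    · have e := h.card
      rw [← updateThree_self (k := k) (α := α) (β := β) (γ := γ), card_edges_eq_sum,
        sum_updateThree _ _ _ ht fun _ m => if m ≠ 0 then 1 else 0] at e
      rw [card_edges_eq_sum, sum_updateThree _ _ _ ht fun _ m => if m ≠ 0 then 1 else 0, ← e]
      have h4 := hc.two
      split_ifs <;> omega
    · rw [updateThree_fst, updateThree_snd _ _ _ ht, updateThree_thd _ _ _ ht]
      exact h3
  by_cases hγ : k γ = 0
  · obtain ⟨hα, hβ, -⟩ : k α ≠ 0 ∧ k β ≠ 0 ∧ k γ = 0 := by have := hc.two; tauto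
    -- With equal multiplicities `ν` would vanish at the common vertex, which lies in the support.
    -- So exactly one of the two sides is exhausted by the flip.
    have hne : k α ≠ k β := by
      intro e
      obtain ⟨v, hv, h2, h3⟩ := h.exists_vertex hs
      have m1 : α ∈ edgesAt k α.i := mem_edgesAt.2 ⟨hα, .inr rfl⟩
      have m2 : β ∈ edgesAt k α.i := mem_edgesAt.2 ⟨hβ, .inl ht.mid⟩
      have hv' : α.i = v := by
        by_contra hne
        exact ht.ne₁ (h3 α.i α β hne m1 m2)
      subst hv'
      have : edgesAt k α.i = {α, β} := by
        refine (Finset.eq_of_subset_of_card_le (fun δ hδ => ?_) (by rw [h2, Finset.card_pair ht.ne₁])).symm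
        rcases Finset.mem_insert.1 hδ with rfl | hδ
        · exact m1
        · rw [Finset.mem_singleton.1 hδ]; exact m2
      refine hv ?_
      rw [apply_eq_sum_edgesAt h.mem, this, Finset.sum_pair ht.ne₁, e, Root.wt_i, ht.mid, Root.wt_j]
      ring
    have hflip : flipThree k α β γ = _ := if_pos hγ
    rw [hflip]
    obtain ⟨g1, g2⟩ := general (k α - min (k α) (k β)) (k β - min (k α) (k β)) (min (k α) (k β))
      (by omega) (by omega) (by omega)
    refine ⟨g1, g2, ?_, ?_⟩
    · rw [flipThree, if_neg (by rw [updateThree_thd _ _ _ ht]; omega), updateThree_updateThree,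
        updateThree_fst, updateThree_snd _ _ _ ht, updateThree_thd _ _ _ ht,
        Nat.sub_add_cancel (min_le_left _ _), Nat.sub_add_cancel (min_le_right _ _)]
      conv_rhs => rw [← updateThree_self (k := k) (α := α) (β := β) (γ := γ), hγ]
    · intro e
      have := congrFun e γ
      rw [updateThree_thd _ _ _ ht] at this
      omega
  · have h2 := hc.two
    have hflip : flipThree k α β γ = _ := if_neg hγ
    rw [hflip]
    obtain ⟨g1, g2⟩ := general (k α + k γ) (k β + k γ) 0 (by omega) (by omega) (by omega)
    refine ⟨g1, g2, ?_, ?_⟩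
    · rw [flipThree, if_pos (by rw [updateThree_thd _ _ _ ht]), updateThree_updateThree,
        updateThree_fst, updateThree_snd _ _ _ ht]
      have hm : min (k α + k γ) (k β + k γ) = k γ := by omega
      rw [hm, Nat.add_sub_cancel, Nat.add_sub_cancel, updateThree_self]
    · intro e
      have := congrFun e γ
      rw [updateThree_thd _ _ _ ht] at this
      exact hγ this.symm

/-- For a weight with a support of `2 s - 1` elements, the number of presentations with `s` roots is
even. -/
theorem even_card_nearMatching {s : ℕ} (hs : (wtSupp ν).card + 1 = 2 * s) :
    Even ((kostant_finite ν).toFinset.filter fun k => (edges k).card = s).card := by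
  classical
  set S := (kostant_finite ν).toFinset.filter fun k => (edges k).card = s with hS
  have hmem : ∀ k, k ∈ S ↔ IsNearMatching ν s k := fun k => by
    rw [hS, Finset.mem_filter, Set.Finite.mem_toFinset]
    exact ⟨fun h => ⟨h.1, h.2⟩, fun h => ⟨h.1, h.2⟩⟩
  -- The corner is chosen arbitrarily; its uniqueness makes the map computable from any corner, also
  -- after the flip.
  let f : (Root n → ℕ) → (Root n → ℕ) := fun k =>
    if h : ∃ t : Root n × Root n × Root n, IsCorner k t.1 t.2.1 t.2.2 then
      flipThree k h.choose.1 h.choose.2.1 h.choose.2.2 else k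
  have hf : ∀ k, IsNearMatching ν s k → ∀ α β γ, IsCorner k α β γ → f k = flipThree k α β γ := by
    intro k hk α β γ hc
    have hex : ∃ t : Root n × Root n × Root n, IsCorner k t.1 t.2.1 t.2.2 := ⟨(α, β, γ), hc⟩
    obtain ⟨e1, e2, e3⟩ := hk.corner_unique hs hc hex.choose_spec
    simp only [f, dif_pos hex]
    rw [← e1, ← e2, ← e3]
  -- Modulo two the cardinality is a sum of ones, cancelled in pairs by the involution, which has no
  -- fixed points.
  have hcard : ((S.card : ℕ) : ZMod 2) = 0 := by
    rw [Finset.cast_card]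
    refine Finset.sum_involution (fun k _ => f k) (fun k hk => ?_) (fun k hk _ => ?_) (fun k hk => ?_)
      fun k hk => ?_
    · decide
    all_goals
      rw [hmem] at hk
      obtain ⟨α, β, γ, hc⟩ := hk.exists_corner hs
      obtain ⟨h1, h2, h3, h4⟩ := hk.flip hs hc
    · rw [hf k hk α β γ hc]
      exact h4
    · rw [hf k hk α β γ hc, hmem]
      exact h1
    · simp only [hf k hk α β γ hc]
      rw [hf _ h1 α β γ h2, h3]
  rwa [ZMod.natCast_eq_zero_iff_even] at hcard

end OddRank

end
end Queer

namespace Queer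

noncomputable section

open LieSuperalgebra SuperRep TensorProduct

variable {n : ℕ}

/-! ### The coefficients of the supercharacter -/

section Coefficients

variable {ν : Fin n → ℂ} {C : FinRep (cartan n)}

lemma sum_edges_wt {k : Root n → ℕ} (hk : k ∈ kostant ν) :
    ((edges k).toList.map fun α => k α • α.wt).sum = ν := by
  rw [Finset.sum_map_toList, ← hk.2, edges, Finset.sum_filter]
  refine Finset.sum_congr rfl fun α _ => ?_
  split_ifs with h
  · rfl
  · rw [not_not.1 h, zero_smul]

lemma rootTerm_of_kostant (hC : IsSimpleOfWeight ν C) {k : Root n → ℕ} (hk : k ∈ kostant ν) :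
    ∃ (a : ℤ) (m : ℕ), rootTerm k = a • Gr.cls C ∧
      2 ^ (edges k).card = m * 2 ^ (((wtSupp ν).card + 1) / 2) ∧ Even (a - m) ∧ a.natAbs ≤ m := by
  obtain ⟨T, h1, h2, h3⟩ := exists_rep_edgeProd k (L := (edges k).toList) pos_of_mem_edges
  rw [sum_edges_wt hk] at h3
  obtain ⟨a, m, e1, e2, e3, e4⟩ := cls_of_wt hC T h3
  refine ⟨a, m, ?_, ?_, e3, e4⟩
  · rw [rootTerm_eq, ← h1, e1]
  · rw [h2, Finset.length_toList, finrank_simple hC.2 hC.1] at e2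
    exact e2

/-- Since `C` is isomorphic to its parity shift, `2 [C] = 0`, and a term is determined by the parity
of its length `m`. By dimensions `m` is a power of two, equal to one exactly for partitions with `s`
edges, and the number of those is even. -/
lemma sch_of_odd (hC : IsSimpleOfWeight ν C) (hodd : Odd (wtSupp ν).card) :
    sch (UnMinus n) ν = 0 := by
  obtain ⟨s', hs'⟩ := hodd
  set s := s' + 1 with hs
  have hcard : (wtSupp ν).card + 1 = 2 * s := by omega
  have h2 : (2 : ℤ) • Gr.cls C = 0 := by
    have := Gr.cls_iso (M := C) (N := C.shift) (iso_shift_of_odd hC.2 hC.1 ⟨s', hs'⟩)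
    rw [Gr.cls_shift] at this
    rw [two_smul]
    nth_rewrite 1 [this]
    exact neg_add_cancel _
  have heven : ∀ a : ℤ, Even a → a • Gr.cls C = 0 := by
    rintro _ ⟨b, rfl⟩
    rw [← mul_two, mul_smul, h2, smul_zero]
  have hterm : ∀ k ∈ kostant ν, rootTerm k = if (edges k).card = s then Gr.cls C else 0 := by
    intro k hk
    obtain ⟨a, m, h3, h4, h5, -⟩ := rootTerm_of_kostant hC hk
    have hdiv : ((wtSupp ν).card + 1) / 2 = s := by omega
    rw [hdiv] at h4
    have ham : rootTerm k = (m : ℤ) • Gr.cls C := by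
      rw [h3, ← sub_eq_zero, ← sub_smul]
      exact heven _ h5
    rw [ham]
    split_ifs with hc
    · rw [hc] at h4
      have : m = 1 := by
        have hp : 0 < 2 ^ s := by positivity
        nlinarith
      rw [this, Nat.cast_one, one_smul]
    · have hlt : s < (edges k).card := by
        by_contra hle
        have h6 : (edges k).card < s := by omega
        have h7 := Nat.pow_lt_pow_right one_lt_two h6
        rcases Nat.eq_zero_or_pos m with h0 | h0
        · rw [h0, zero_mul] at h4
          exact absurd h4 (by positivity)
        · have := Nat.le_mul_of_pos_left (2 ^ s) h0
          omega
      refine heven _ ?_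
      obtain ⟨d, hd⟩ := Nat.exists_eq_add_of_lt hlt
      have : m = 2 ^ (d + 1) := by
        rw [hd, show s + d + 1 = (d + 1) + s by ring, pow_add] at h4
        exact (Nat.eq_of_mul_eq_mul_right (by positivity) h4).symm
      rw [this, pow_succ]
      exact ⟨2 ^ d, by push_cast; ring⟩
  rw [sch_UnMinus, Finset.sum_congr rfl fun k hk => hterm k ((kostant_finite ν).mem_toFinset.1 hk),
    ← Finset.sum_filter, Finset.sum_const, ← natCast_zsmul]
  refine heven _ ?_
  exact_mod_cast even_card_nearMatching hcard

/-- The supercharacter of `𝒰(𝔫⁻)` in terms of matchings. -/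
theorem exists_coeff (hC : IsSimpleOfWeight ν C) : ∃ m : ℤ, (m = 0 ∨ m = 1 ∨ m = -1) ∧
    sch (UnMinus n) ν = m • Gr.cls C ∧
    (m ≠ 0 → ∃ k, IsMatching ν k ∧ (∀ p q, ¬IsBadPair ν p q) ∧ m • Gr.cls C = rootTerm k) := by
  rcases Nat.even_or_odd (wtSupp ν).card with heven | hodd
  swap
  · exact ⟨0, .inl rfl, by rw [sch_of_odd hC hodd, zero_smul], fun h => absurd rfl h⟩
  have hχ := chr_simple_ne_zero hC heven
  choose! a m h1 h2 h3 h4 using fun k (hk : k ∈ kostant ν) => rootTerm_of_kostant hC hk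
  have hsch : sch (UnMinus n) ν = (∑ k ∈ (kostant_finite ν).toFinset, a k) • Gr.cls C := by
    rw [sch_UnMinus, Finset.sum_smul]
    exact Finset.sum_congr rfl fun k hk => h1 k ((kostant_finite ν).mem_toFinset.1 hk)
  have hchr : ∀ b : ℤ, chr (wtSupp ν).toList (b • Gr.cls C) = b * chr (wtSupp ν).toList (Gr.cls C) :=
    fun b => by rw [map_zsmul, zsmul_eq_mul]
  -- The functional is injective on the multiples of `[C]`, so it detects the coefficient. If it
  -- does not vanish, there is no bad pair and there is a matching, which is then unique.
  by_cases h0 : chr (wtSupp ν).toList (sch (UnMinus n) ν) = 0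
  · refine ⟨0, .inl rfl, ?_, fun h => absurd rfl h⟩
    rw [hsch, hchr] at h0
    have := (mul_eq_zero.1 h0).resolve_right hχ
    rw [hsch, Int.cast_eq_zero.1 this]
  have hb : ∀ p q, ¬IsBadPair ν p q := by
    intro p q hpq
    refine h0 ?_
    rw [sch_UnMinus, map_sum]
    exact sum_chr_eq_zero_of_bad heven hpq
  obtain ⟨k, hk, hk0⟩ : ∃ k ∈ kostant ν, chr (wtSupp ν).toList (rootTerm k) ≠ 0 := by
    by_contra! hc
    refine h0 ?_
    rw [sch_UnMinus, map_sum]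
    exact Finset.sum_eq_zero fun k hk => hc k ((kostant_finite ν).mem_toFinset.1 hk)
  have hm := isMatching_of_chr_ne_zero heven hk hk0
  have hzero : ∀ l ∈ kostant ν, l ≠ k → a l = 0 := by
    intro l hl hlk
    have h5 : chr (wtSupp ν).toList (rootTerm l) = 0 := by
      by_contra h6
      exact hlk ((isMatching_of_chr_ne_zero heven hl h6).unique hm hb)
    rw [h1 l hl, hchr] at h5
    exact Int.cast_eq_zero.1 ((mul_eq_zero.1 h5).resolve_right hχ)
  have hsum : ∑ l ∈ (kostant_finite ν).toFinset, a l = a k := by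
    refine Finset.sum_eq_single_of_mem k ((kostant_finite ν).mem_toFinset.2 hk) fun l hl hlk => ?_
    exact hzero l ((kostant_finite ν).mem_toFinset.1 hl) hlk
  have hcard : (wtSupp ν).card = 2 * (edges k).card := by
    have := hm.perm.length_eq
    rwa [length_vertices, Finset.length_toList, Finset.length_toList] at this
  -- A matching has half as many edges as the support has elements, so its term has the dimension of
  -- `C`.
  have hmk : m k = 1 := by
    have h5 := h2 k hk
    rw [hcard, show (2 * (edges k).card + 1) / 2 = (edges k).card by omega] at h5
    have hp : 0 < 2 ^ (edges k).card := by positivity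
    nlinarith
  have ha : a k = 1 ∨ a k = -1 := by
    have h5 := h3 k hk
    have h6 := h4 k hk
    rw [hmk] at h5 h6
    obtain ⟨b, hb⟩ := h5
    omega
  exact ⟨a k, .inr ha, by rw [hsch, hsum], fun _ => ⟨k, hm, hb, (h1 k hk).symm⟩⟩

end Coefficients

end
end Queer

namespace Queer

noncomputable section

open LieSuperalgebra SuperRep TensorProduct

variable {n : ℕ}

/-! ### Presentations and their uniqueness -/

section Presentations

/-- The first key is `α.j`, which for a negative root is its lower end; so sorting lists the edges
of a matching from left to right. -/
instance : LinearOrder (Root n) :=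
  LinearOrder.lift' (fun α : Root n => toLex (α.j, α.i)) fun _ _ h =>
    Root.ext (congrArg Prod.snd (toLex.injective h)) (congrArg Prod.fst (toLex.injective h))

lemma Root.j_le_of_le {α β : Root n} (h : α ≤ β) : α.j ≤ β.j := by
  change toLex (α.j, α.i) ≤ toLex (β.j, β.i) at h
  rcases (Prod.Lex.le_iff).1 h with h | h
  · exact h.le
  · exact h.1.le

/-- The roots of multiplicity `κ`, in increasing order. -/
def edgeGroup (k : Root n → ℕ) (κ : ℕ) : List (Root n) :=
  ((edges k).filter fun α => k α = κ).sort

lemma mem_edgeGroup {k : Root n → ℕ} {κ : ℕ} {α : Root n} :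
    α ∈ edgeGroup k κ ↔ k α ≠ 0 ∧ k α = κ := by
  rw [edgeGroup, Finset.mem_sort, Finset.mem_filter, mem_edges]

/-- The presentation defined by a matching. -/
def toPresentation (k : Root n → ℕ) : Finset (ℕ × List (Root n)) :=
  ((edges k).image k).image fun κ => (κ, edgeGroup k κ)

lemma mem_toPresentation {k : Root n → ℕ} {b : ℕ × List (Root n)} :
    b ∈ toPresentation k ↔ (∃ α, k α ≠ 0 ∧ k α = b.1) ∧ b.2 = edgeGroup k b.1 := by
  simp only [toPresentation, Finset.mem_image, mem_edges]
  constructor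
  · rintro ⟨_, ⟨α, hα, rfl⟩, rfl⟩
    exact ⟨⟨α, hα, rfl⟩, rfl⟩
  · rintro ⟨⟨α, hα, h1⟩, h2⟩
    exact ⟨b.1, ⟨α, hα, h1⟩, Prod.ext rfl h2.symm⟩

lemma prod_edgeGroup {M : Type*} [CommMonoid M] (k : Root n → ℕ) (κ : ℕ) (F : Root n → M) :
    ((edgeGroup k κ).map F).prod = ∏ α ∈ (edges k).filter fun α => k α = κ, F α := by
  rw [edgeGroup, ← List.prod_toFinset _ (Finset.sort_nodup _ _), Finset.sort_toFinset]

lemma prod_toPresentation {M : Type*} [CommMonoid M] (k : Root n → ℕ) (F : ℕ → Root n → M) :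
    ∏ b ∈ toPresentation k, (b.2.map (F b.1)).prod = ∏ α ∈ edges k, F (k α) α := by
  rw [toPresentation, Finset.prod_image fun a _ b _ h => congrArg Prod.fst h,
    ← Finset.prod_fiberwise_of_maps_to (t := (edges k).image k) (g := k)
      fun α hα => Finset.mem_image_of_mem k hα]
  refine Finset.prod_congr rfl fun κ _ => ?_
  rw [prod_edgeGroup]
  exact Finset.prod_congr rfl fun α hα => by rw [(Finset.mem_filter.1 hα).2]

variable {ν : Fin n → ℂ}

theorem isPresentation_toPresentation {k : Root n → ℕ} (h : IsMatching ν k)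
    (hb : ∀ p q, ¬IsBadPair ν p q) : IsPresentation ν (toPresentation k) := by
  have hdisj : ∀ α β, k α ≠ 0 → k β ≠ 0 → α ≠ β → Disjoint α.supp β.supp := by
    intro α β hα hβ hne
    rw [Finset.disjoint_left]
    intro v hv1 hv2
    simp only [Root.supp, Finset.mem_insert, Finset.mem_singleton] at hv1 hv2
    exact hne (h.eq_of_vertex hα hβ hv1.symm hv2.symm)
  have hpair : ∀ κ, (edgeGroup k κ).Pairwise fun α β => (k α ≠ 0 ∧ k α = κ) ∧ (k β ≠ 0 ∧ k β = κ) ∧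
      α < β := fun κ => by
    have h1 := (Finset.sortedLT_sort ((edges k).filter fun α => k α = κ)).pairwise
    refine List.Pairwise.imp_of_mem (fun {a b} ha hb hab => ?_) h1
    exact ⟨mem_edgeGroup.1 ha, mem_edgeGroup.1 hb, hab⟩
  constructor
  · have e1 := prod_toPresentation (M := Multiplicative (Fin n → ℂ)) k
      fun κ α => Multiplicative.ofAdd (κ • α.wt)
    have e2 : ∀ b : ℕ × List (Root n), b.1 • (b.2.map Root.wt).sum = (b.2.map fun α => b.1 • α.wt).sum :=
      fun b => by rw [List.smul_sum, List.map_map]; rfl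
    have e3 := sum_edges_wt h.mem
    rw [Finset.sum_map_toList] at e3
    rw [← e3, Finset.sum_congr rfl fun b _ => e2 b]
    exact e1.symm
  · intro b hb'
    obtain ⟨⟨α, hα, e⟩, -⟩ := mem_toPresentation.1 hb'
    omega
  · intro b hb' h0
    obtain ⟨⟨α, hα, e⟩, e2⟩ := mem_toPresentation.1 hb'
    have : α ∈ edgeGroup k b.1 := mem_edgeGroup.2 ⟨hα, e⟩
    rw [← e2, h0] at this
    exact List.not_mem_nil this
  · intro b hb' c hc e
    exact Prod.ext e (by rw [(mem_toPresentation.1 hb').2, (mem_toPresentation.1 hc).2, e])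
  · intro b hb'
    rw [(mem_toPresentation.1 hb').2]
    refine (hpair b.1).imp fun {α β} hαβ => ?_
    obtain ⟨⟨hα, e1⟩, ⟨hβ, e2⟩, hlt⟩ := hαβ
    have h1 : α.j < β.j := lt_of_le_of_ne (Root.j_le_of_le hlt.le) fun e =>
      hlt.ne (h.eq_of_vertex hα hβ (.inl rfl) (.inl e))
    -- The next edge of the same multiplicity cannot begin inside `α`: it has the value `-k α` at
    -- its lower end, and such a value does not occur inside an edge in the absence of bad pairs.
    have h2 : α.i < β.j := by
      rcases lt_trichotomy α.i β.j with h2 | h2 | h2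
      · exact h2
      · exact absurd (h.eq_of_vertex hα hβ (.inr rfl) (.inl h2)) hlt.ne
      · exact absurd (by rw [h.apply_j hβ, e1, e2]) (h.not_between hb hα h1 h2).2
    rw [Root.Prec, max_eq_left (h.lt hα).le, min_eq_right (h.lt hβ).le]
    exact h2
  · intro b hb'
    rw [(mem_toPresentation.1 hb').2]
    exact (hpair b.1).imp fun {α β} hαβ => hdisj α β hαβ.1.1 hαβ.2.1.1 hαβ.2.2.ne
  · intro b hb' c hc hbc α hα β hβ
    rw [(mem_toPresentation.1 hb').2, mem_edgeGroup] at hα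
    rw [(mem_toPresentation.1 hc).2, mem_edgeGroup] at hβ
    refine hdisj α β hα.1 hβ.1 ?_
    rintro rfl
    exact hbc (Prod.ext (hα.2.symm.trans hβ.2) (by
      rw [(mem_toPresentation.1 hb').2, (mem_toPresentation.1 hc).2, ← hα.2, ← hβ.2]))

namespace IsPresentation

variable {D : Finset (ℕ × List (Root n))}

lemma apply (h : IsPresentation ν D) (v : Fin n) :
    ν v = ∑ b ∈ D, (b.1 : ℂ) * (b.2.map fun α => α.wt v).sum := by
  have e : ν v = (∑ b ∈ D, b.1 • (b.2.map Root.wt).sum) v := congrFun h.sum_eq v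
  rw [e, Finset.sum_apply]
  refine Finset.sum_congr rfl fun b _ => ?_
  rw [Pi.smul_apply, nsmul_eq_mul]
  congr 1
  exact (map_list_sum (Pi.evalAddMonoidHom (fun _ : Fin n => ℂ) v) _).trans (by rw [List.map_map]; rfl)

lemma exists_mem (h : IsPresentation ν D) {v : Fin n} (hv : ν v ≠ 0) :
    ∃ b ∈ D, ∃ α ∈ b.2, v ∈ α.supp := by
  by_contra! hc
  refine hv ?_
  rw [h.apply]
  refine Finset.sum_eq_zero fun b hb => mul_eq_zero_of_right _ (List.sum_eq_zero fun x hx => ?_)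
  obtain ⟨α, hα, rfl⟩ := List.mem_map.1 hx
  have h1 := hc b hb α hα
  simp only [Root.supp, Finset.mem_insert, Finset.mem_singleton, not_or] at h1
  exact Root.wt_of_ne h1.1 h1.2

lemma apply_mem (h : IsPresentation ν D) {b : ℕ × List (Root n)} (hb : b ∈ D) {α : Root n}
    (hα : α ∈ b.2) {v : Fin n} (hv : v ∈ α.supp) : ν v = b.1 * α.wt v := by
  have hzero : ∀ β : Root n, Disjoint α.supp β.supp → β.wt v = 0 := fun β hβ => by
    have h1 := Finset.disjoint_left.1 hβ hv
    simp only [Root.supp, Finset.mem_insert, Finset.mem_singleton, not_or] at h1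
    exact Root.wt_of_ne h1.1 h1.2
  rw [h.apply, Finset.sum_eq_single_of_mem b hb]
  · congr 1
    rw [List.sum_map_eq_nsmul_single α]
    · rw [List.count_eq_one_of_mem ?_ hα, one_smul]
      refine (h.chain b hb).imp fun {a c} hac => ?_
      rintro rfl
      exact absurd hac (not_lt.2 ((min_le_left _ _).trans (le_max_left _ _)))
    · intro β hne hβ
      have : Std.Symm fun α β : Root n => Disjoint α.supp β.supp := ⟨fun _ _ h => h.symm⟩
      exact hzero β ((h.disjoint_within b hb).forall hα hβ hne.symm)
  · intro c hc hcb
    refine mul_eq_zero_of_right _ (List.sum_eq_zero fun x hx => ?_)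
    obtain ⟨β, hβ, rfl⟩ := List.mem_map.1 hx
    exact hzero β (h.disjoint b hb c hc hcb.symm α hα β hβ)

lemma apply_i (h : IsPresentation ν D) {b : ℕ × List (Root n)} (hb : b ∈ D) {α : Root n}
    (hα : α ∈ b.2) : ν α.i = b.1 := by
  rw [h.apply_mem hb hα (by simp [Root.supp]), Root.wt_i, mul_one]

lemma apply_j (h : IsPresentation ν D) {b : ℕ × List (Root n)} (hb : b ∈ D) {α : Root n}
    (hα : α ∈ b.2) : ν α.j = -b.1 := by
  rw [h.apply_mem hb hα (by simp [Root.supp]), Root.wt_j, mul_neg_one]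

lemma eq_of_apply (h : IsPresentation ν D) {b : ℕ × List (Root n)} (hb : b ∈ D) {α : Root n}
    (hα : α ∈ b.2) {v : Fin n} (hv : v ∈ α.supp) {κ : ℕ} (hκ : ν v = κ ∨ ν v = -κ) : b.1 = κ := by
  have h1 : ν v = b.1 ∨ ν v = -b.1 := by
    simp only [Root.supp, Finset.mem_insert, Finset.mem_singleton] at hv
    rcases hv with rfl | rfl
    · exact .inl (h.apply_i hb hα)
    · exact .inr (h.apply_j hb hα)
  have h2 : (b.1 : ℂ) = κ ∨ (b.1 : ℂ) = -κ := by
    rcases h1 with e | e <;> rw [e] at hκ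
    · exact hκ
    · rcases hκ with e | e
      · exact .inr (neg_eq_iff_eq_neg.1 e)
      · exact .inl (neg_inj.1 e)
  rcases h2 with e | e
  · exact_mod_cast e
  · have e' : ((b.1 + κ : ℕ) : ℂ) = 0 := by push_cast; rw [e]; ring
    have := Nat.cast_eq_zero.1 e'
    omega

/-- The vertices of a group are the positions of the corresponding absolute value. -/
lemma mem_supp_iff (h : IsPresentation ν D) {b : ℕ × List (Root n)} (hb : b ∈ D) (v : Fin n) :
    (∃ α ∈ b.2, v ∈ α.supp) ↔ ν v = b.1 ∨ ν v = -b.1 := by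
  constructor
  · rintro ⟨α, hα, hv⟩
    simp only [Root.supp, Finset.mem_insert, Finset.mem_singleton] at hv
    rcases hv with rfl | rfl
    · exact .inl (h.apply_i hb hα)
    · exact .inr (h.apply_j hb hα)
  · intro hv
    have h0 : (b.1 : ℂ) ≠ 0 := Nat.cast_ne_zero.2 (h.pos b hb).ne'
    obtain ⟨c, hc, α, hα, hv'⟩ := h.exists_mem (v := v) (by
      rcases hv with e | e <;> rw [e]
      · exact h0
      · exact neg_ne_zero.2 h0)
    have : c = b := h.distinct c hc b hb (h.eq_of_apply hc hα hv' hv)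
    subst this
    exact ⟨α, hα, hv'⟩

end IsPresentation

/-- The increasing list of all ends cuts into consecutive pairs, one for each root. The values `κ`
and `-κ` of `ν` at the two ends fix the direction of the root. -/
lemma eq_of_sorted_vertices {κ : ℂ} (hκ : κ ≠ 0) {L L' : List (Root n)} (hL : ∀ α ∈ L, ν α.i = κ ∧ ν α.j = -κ)
    (hL' : ∀ α ∈ L', ν α.i = κ ∧ ν α.j = -κ)
    (h : (L.flatMap fun α => [min α.i α.j, max α.i α.j]) =
      L'.flatMap fun α => [min α.i α.j, max α.i α.j]) : L = L' := by
  induction L generalizing L' with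
  | nil =>
    cases L' with
    | nil => rfl
    | cons α' L' => simp at h
  | cons α L ih =>
    cases L' with
    | nil => simp at h
    | cons α' L' =>
      simp only [List.flatMap_cons, List.cons_append, List.nil_append, List.cons.injEq] at h
      have h1 := hL α List.mem_cons_self
      have h2 := hL' α' List.mem_cons_self
      have hne : κ ≠ -κ := fun e => hκ (self_eq_neg.1 e)
      have hαα : α = α' := by
        rcases le_total α.i α.j with e | e <;> rcases le_total α'.i α'.j with e' | e'
        · rw [min_eq_left e, min_eq_left e', max_eq_right e, max_eq_right e'] at h
          exact Root.ext h.1 h.2.1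
        · rw [min_eq_left e, min_eq_right e', max_eq_right e, max_eq_left e'] at h
          exact absurd (h1.1.symm.trans ((congrArg ν h.1).trans h2.2)) hne
        · rw [min_eq_right e, min_eq_left e', max_eq_left e, max_eq_right e'] at h
          exact absurd (h2.1.symm.trans ((congrArg ν h.1.symm).trans h1.2)) hne
        · rw [min_eq_right e, min_eq_right e', max_eq_left e, max_eq_left e'] at h
          exact Root.ext h.2.1 h.1
      rw [hαα, ih (fun β hβ => hL β (List.mem_cons_of_mem _ hβ))
        (fun β hβ => hL' β (List.mem_cons_of_mem _ hβ)) h.2.2]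

lemma sorted_vertices {L : List (Root n)} (h : L.Pairwise Root.Prec) :
    (L.flatMap fun α => [min α.i α.j, max α.i α.j]).Pairwise (· < ·) := by
  rw [List.pairwise_flatMap]
  refine ⟨fun α _ => ?_, h.imp fun {α β} hαβ x hx y hy => ?_⟩
  · simpa using α.ne
  · simp only [List.mem_cons, List.not_mem_nil, or_false] at hx hy
    have h1 : x ≤ max α.i α.j := by
      rcases hx with rfl | rfl
      · exact min_le_max
      · exact le_rfl
    have h2 : min β.i β.j ≤ y := by
      rcases hy with rfl | rfl
      · exact le_rfl
      · exact min_le_max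
    exact (h1.trans_lt hαβ).trans_le h2

lemma mem_flatMap_minMax {L : List (Root n)} {v : Fin n} :
    (v ∈ L.flatMap fun α => [min α.i α.j, max α.i α.j]) ↔ ∃ α ∈ L, v ∈ α.supp := by
  rw [List.mem_flatMap]
  refine exists_congr fun α => and_congr_right fun _ => ?_
  simp only [List.mem_cons, List.not_mem_nil, or_false, Root.supp, Finset.mem_insert,
    Finset.mem_singleton]
  rcases le_total α.i α.j with e | e
  · rw [min_eq_left e, max_eq_right e]
  · rw [min_eq_right e, max_eq_left e, or_comm]

/-- The number of a group of `D'` occurs as a value of `ν`, so it is also the number of a group of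
`D`. In both groups the vertices are the positions where `ν` has this absolute value, and `≺` makes
the list of ends increasing, so the two lists of ends coincide. -/
lemma IsPresentation.subset {D D' : Finset (ℕ × List (Root n))} (h : IsPresentation ν D)
    (h' : IsPresentation ν D') : D' ⊆ D := by
  intro b' hb'
  obtain ⟨α, hα⟩ := List.exists_mem_of_ne_nil _ (h'.nonempty b' hb')
  have h0 : (b'.1 : ℂ) ≠ 0 := Nat.cast_ne_zero.2 (h'.pos b' hb').ne'
  obtain ⟨b, hb, β, hβ, hv⟩ := h.exists_mem (v := α.i) (by rw [h'.apply_i hb' hα]; exact h0)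
  have e : b.1 = b'.1 := h.eq_of_apply hb hβ hv (.inl (h'.apply_i hb' hα))
  have e2 : b.2 = b'.2 := by
    refine eq_of_sorted_vertices (ν := ν) h0 (fun γ hγ => ?_) (fun γ hγ => ?_) ?_
    · rw [← e]; exact ⟨h.apply_i hb hγ, h.apply_j hb hγ⟩
    · exact ⟨h'.apply_i hb' hγ, h'.apply_j hb' hγ⟩
    · have s1 := sorted_vertices (h.chain b hb)
      have s2 := sorted_vertices (h'.chain b' hb')
      refine List.Perm.eq_of_pairwise' s1 s2 ?_
      refine (List.perm_ext_iff_of_nodup (s1.imp fun h => h.ne) (s2.imp fun h => h.ne)).2 fun v => ?_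
      rw [mem_flatMap_minMax, mem_flatMap_minMax, h.mem_supp_iff hb, h'.mem_supp_iff hb', e]
  rwa [show b' = b from Prod.ext e.symm e2.symm]

theorem IsPresentation.unique {D D' : Finset (ℕ × List (Root n))} (h : IsPresentation ν D)
    (h' : IsPresentation ν D') : D' = D :=
  (h.subset h').antisymm (h'.subset h)

theorem exists_presentation {k : Root n → ℕ} (h : IsMatching ν k) (hb : ∀ p q, ¬IsBadPair ν p q) :
    ∃ D : Finset (ℕ × List (Root n)), IsPresentation ν D ∧ (∀ D', IsPresentation ν D' → D' = D) ∧
      (∀ b ∈ D, ∀ α ∈ b.2, α.IsNeg) ∧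
      rootTerm k = ∏ b ∈ D, (b.2.map fun α => Gr.cls (symPow b.1 α.space)).prod := by
  have hD := isPresentation_toPresentation h hb
  refine ⟨toPresentation k, hD, fun D' h' => hD.unique h', fun b hb' α hα => ?_, ?_⟩
  · rw [(mem_toPresentation.1 hb').2, mem_edgeGroup] at hα
    exact h.lt hα.1
  · rw [prod_toPresentation k fun κ α => Gr.cls (symPow κ α.space), rootTerm_eq, edgeProd,
      Finset.prod_map_toList]

end Presentations

end
end Queer

namespace Queer

noncomputable section

open LieSuperalgebra SuperRep TensorProduct

variable {n : ℕ}

/-! ### Verma modules -/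

namespace Splitting

variable {L : Type} [AddCommGroup L] [Module ℂ L] [LieSuperalgebra L] {M : SuperRep L}
  {B : InvBracket M} {g : Type} [AddCommGroup g] [Module ℂ g] [LieSuperalgebra g]
  {S : Splitting B g} (C : S.BMod)

/-- The universal property of the induced module. -/
lemma ind_exists_hom (X : SuperRep g) (f : C.carrier →ₗ[ℂ] X.carrier)
    (hδ : ∀ c, f (C.δ c) = X.δ (f c)) (hσ : ∀ x c, S.p x = 0 → X.ρ x (f c) = f (C.σ x c)) :
    ∃ φ : Ind C →ₗ[ℂ] X.carrier, IsHom (ind C) X φ ∧ ∀ c, φ (1 ⊗ₜ c) = f c := by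
  let U : Env B →ₐ[ℂ] Module.End ℂ X.carrier :=
    Env.lift B (X.ρ ∘ₗ S.j) fun i j v w hv hw => by
      rw [LinearMap.comp_apply, LinearMap.comp_apply, LinearMap.comp_apply, S.j_β,
        X.ρ_br i j _ _ (S.par_j hv) (S.par_j hw)]
      abel
  have hU : ∀ x, U (Env.ι B x) = X.ρ (S.j x) := fun x => Env.lift_ι _ _ _ _
  let φ : Ind C →ₗ[ℂ] X.carrier :=
    TensorProduct.lift (LinearMap.mk₂ ℂ (fun u c => U u (f c)) (by intros; simp) (by intros; simp)
      (by intros; simp) (by intros; simp))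
  have φt : ∀ u c, φ (u ⊗ₜ c) = U u (f c) := fun u c => rfl
  have φ1 : ∀ c, φ (1 ⊗ₜ c) = f c := fun c => by rw [φt, map_one]; rfl
  have φx : ∀ x w, φ (lact C (Env.ι B x) w) = X.ρ (S.j x) (φ w) := by
    intro x w
    induction w using TensorProduct.induction_on with
    | zero => simp only [map_zero]
    | add a b ha hb => simp only [map_add, ha, hb]
    | tmul u c => rw [lact_tmul, φt, map_mul, φt, hU, Module.End.mul_apply]
  have hρ : ∀ (w : Ind C) (z : g), φ (gact C z w) = X.ρ z (φ w) := by
    intro w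
    induction w using Ind.induction with
    | h1 c =>
      intro z
      rw [gact_one_tmul, map_add, φt, hU, φ1, φ1, ← hσ _ _ (S.p_q z), ← LinearMap.add_apply,
        ← map_add, S.j_p_add_q]
    | ha v w h h' => intro z; rw [map_add, map_add, h, h', map_add, map_add]
    | hm i x w hx h =>
      intro z
      induction z using par_hom_induction with
      | ha z z' hz hz' => simp only [map_add, LinearMap.add_apply, hz, hz']
      | h s z hz =>
        rw [gact_lact_hom C hz hx, map_add, map_smul, φx, φx, h, h, ρ_br_apply X hz (S.par_j hx)]
        abel
  suffices h : ∀ w, φ (indδ C w) = X.δ (φ w) from ⟨φ, ⟨h, fun z w => hρ w z⟩, φ1⟩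
  intro w
  induction w using Ind.induction with
  | h1 c =>
    have : indδ C (1 ⊗ₜ c) = 1 ⊗ₜ C.δ c := by simp [indδ]
    rw [this, φ1, φ1, hδ]
  | ha v w h h' => simp only [map_add, h, h']
  | hm i x w hx h => rw [indδ_lact, φx, φx, h, X.δ_ρ, S.j_δ]

end Splitting

/-- The part of a pair of matrices at the positions `(i, j)` with `r i j`. -/
def truncQ (r : Fin n → Fin n → Prop) [∀ i j, Decidable (r i j)] : Q n →ₗ[ℂ] Q n :=
  let t : Matrix (Fin n) (Fin n) ℂ →ₗ[ℂ] Matrix (Fin n) (Fin n) ℂ :=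
    { toFun := fun A => Matrix.of fun i j => if r i j then A i j else 0
      map_add' := fun A B => by ext i j; by_cases h : r i j <;> simp [h]
      map_smul' := fun c A => by ext i j; by_cases h : r i j <;> simp [h] }
  t.prodMap t

section

variable (r : Fin n → Fin n → Prop) [∀ i j, Decidable (r i j)]

lemma truncQ_fst (x : Q n) (i j : Fin n) : (truncQ r x).1 i j = if r i j then x.1 i j else 0 := rfl

lemma truncQ_snd (x : Q n) (i j : Fin n) : (truncQ r x).2 i j = if r i j then x.2 i j else 0 := rfl

lemma Q.ext_entries {x y : Q n} (h : ∀ i j, x.1 i j = y.1 i j ∧ x.2 i j = y.2 i j) : x = y :=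
  Prod.ext (Matrix.ext fun i j => (h i j).1) (Matrix.ext fun i j => (h i j).2)

lemma truncQ_par (x : Q n) : truncQ r (par x) = par (truncQ r x) := by
  refine Q.ext_entries fun i j => ?_
  by_cases h : r i j <;> simp [truncQ_fst, truncQ_snd, par_apply, h]

variable {r} {r' : Fin n → Fin n → Prop}

lemma truncQ_mem (h : ∀ i j, r' i j → ¬r i j) (x : Q n) : truncQ r x ∈ patternSub n r' :=
  fun i j hij => by simp [truncQ_fst, truncQ_snd, h i j hij]

lemma truncQ_of_mem (h : ∀ i j, ¬r i j → r' i j) {x : Q n} (hx : x ∈ patternSub n r') :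
    truncQ r x = x := by
  refine Q.ext_entries fun i j => ?_
  by_cases hr : r i j
  · simp [truncQ_fst, truncQ_snd, hr]
  · simp [truncQ_fst, truncQ_snd, hr, hx i j (h i j hr)]

lemma truncQ_eq_zero (h : ∀ i j, r i j → r' i j) {x : Q n} (hx : x ∈ patternSub n r') :
    truncQ r x = 0 := by
  refine Q.ext_entries fun i j => ?_
  by_cases hr : r i j
  · simp [truncQ_fst, truncQ_snd, hr, hx i j (h i j hr)]
  · simp [truncQ_fst, truncQ_snd, hr]

lemma mem_of_truncQ (h : ∀ i j, r' i j → r i j) {x : Q n} (hx : truncQ r x = 0) :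
    x ∈ patternSub n r' := fun i j hij => by
  have h1 := congrArg (fun y : Q n => y.1 i j) hx
  have h2 := congrArg (fun y : Q n => y.2 i j) hx
  simp only [truncQ_fst, truncQ_snd, h i j hij, if_true] at h1 h2
  exact ⟨h1, h2⟩

end

/-- The projection of `𝔮_n` to `𝔥`. -/
def diagQ : Q n →ₗ[ℂ] cartan n :=
  (truncQ fun i j => i = j).codRestrict (cartan n) fun x => truncQ_mem (fun _ _ h => h) x

lemma diagQ_par (x : Q n) : diagQ (par x) = par (diagQ x) := Subtype.ext (truncQ_par _ x)

lemma diagQ_cartan (x : cartan n) : diagQ (x : Q n) = x :=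
  Subtype.ext (truncQ_of_mem (fun _ _ h => h) x.2)

lemma diagQ_upper {x : Q n} (hx : x ∈ upper n) : diagQ x = 0 :=
  Subtype.ext (truncQ_eq_zero (fun _ _ h => h.ge) hx)

lemma cartan_le_borel : cartan n ≤ borel n := fun _ hx i j h => hx i j h.ne'

lemma upper_le_borel : upper n ≤ borel n := fun _ hx i j h => hx i j h.le

lemma sub_diagQ_mem {x : Q n} (hx : x ∈ borel n) : x - (diagQ x : Q n) ∈ upper n := by
  intro i j hij
  have e1 : (diagQ x : Q n).1 i j = if i = j then x.1 i j else 0 := rfl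
  have e2 : (diagQ x : Q n).2 i j = if i = j then x.2 i j else 0 := rfl
  rcases hij.lt_or_eq with h | h
  · have := hx i j h
    simp [e1, e2, h.ne', this]
  · subst h
    exact ⟨sub_eq_zero.2 (by rw [e1, if_pos rfl]), sub_eq_zero.2 (by rw [e2, if_pos rfl])⟩

lemma br_borel_upper {x y : Q n} (hx : x ∈ borel n) (hy : y ∈ upper n) : br x y ∈ upper n :=
  patternSub_br (r₁ := fun i j => j < i) (r₂ := fun i j => j ≤ i)
    (fun i j k h => by constructor <;> (by_contra! hc; omega)) hx hy

lemma br_upper_borel {x y : Q n} (hx : x ∈ upper n) (hy : y ∈ borel n) : br x y ∈ upper n :=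
  patternSub_br (r₁ := fun i j => j ≤ i) (r₂ := fun i j => j < i)
    (fun i j k h => by constructor <;> (by_contra! hc; omega)) hx hy

lemma br_borel {x y : Q n} (hx : x ∈ borel n) (hy : y ∈ borel n) : br x y ∈ borel n :=
  patternSub_br (r₁ := fun i j => j < i) (r₂ := fun i j => j < i)
    (fun i j k h => by constructor <;> (by_contra! hc; omega)) hx hy

/-- The subalgebra `𝔫⁺` is an ideal of `𝔟`, so the projection to the diagonal is multiplicative on
`𝔟`. This is what makes an `𝔥`-module into a `𝔟`-module. -/
lemma diagQ_br {x y : Q n} (hx : x ∈ borel n) (hy : y ∈ borel n) :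
    diagQ (br x y) = br (diagQ x) (diagQ y) := by
  have e : br x y = br (diagQ x : Q n) (diagQ y : Q n)
      + (br (diagQ x : Q n) (y - (diagQ y : Q n)) + br (x - (diagQ x : Q n)) y) := by
    simp only [map_sub, LinearMap.sub_apply]; abel
  have h1 := br_borel_upper (cartan_le_borel (diagQ x).2) (sub_diagQ_mem hy)
  have h2 := br_upper_borel (sub_diagQ_mem hx) hy
  rw [e, map_add, diagQ_upper (add_mem h1 h2), add_zero]
  exact diagQ_cartan (br (diagQ x) (diagQ y))

/-- The decomposition `𝔮_n = 𝔫⁻ ⊕ 𝔟`. -/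
def triangular (n : ℕ) : Splitting (nMinusBr n) (Q n) where
  j := (lower n).subtype
  p := (truncQ fun i j => j < i).codRestrict (lower n) fun x => truncQ_mem (fun _ _ h => h.not_gt) x
  p_j v := Subtype.ext (truncQ_of_mem (fun _ _ h => not_lt.1 h) v.2)
  j_δ _ := rfl
  p_par x := Subtype.ext (truncQ_par _ x)
  j_β _ _ := rfl
  p_br x y hx hy := Subtype.ext (truncQ_eq_zero (fun _ _ h => h)
    (br_borel (mem_of_truncQ (fun _ _ h => h) (congrArg Subtype.val hx))
      (mem_of_truncQ (fun _ _ h => h) (congrArg Subtype.val hy))))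

lemma triangular_p_eq_zero {x : Q n} : (triangular n).p x = 0 ↔ x ∈ borel n :=
  ⟨fun h => mem_of_truncQ (fun _ _ h => h) (congrArg Subtype.val h),
    fun h => Subtype.ext (truncQ_eq_zero (fun _ _ h => h) h)⟩

/-- An `𝔥`-module as a `𝔟`-module on which `𝔫⁺` acts by zero. -/
def inflate (C : SuperRep (cartan n)) : (triangular n).BMod where
  carrier := C.carrier
  δ := C.δ
  δ_δ := C.δ_δ
  σ := C.ρ ∘ₗ diagQ
  δ_σ x v _ := by
    rw [LinearMap.comp_apply, LinearMap.comp_apply, diagQ_par, C.δ_ρ]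
  σ_br i k x y hx hy hpx hpy := by
    rw [triangular_p_eq_zero] at hx hy
    rw [LinearMap.comp_apply, LinearMap.comp_apply, LinearMap.comp_apply, diagQ_br hx hy]
    exact C.ρ_br i k _ _ (by rw [← diagQ_par, hpx, map_smul]) (by rw [← diagQ_par, hpy, map_smul])

/-- The Verma module `Ind_𝔟^𝔤 C`. -/
def verma (C : SuperRep (cartan n)) : SuperRep (Q n) := Splitting.ind (inflate C)

namespace verma

variable (C : SuperRep (cartan n))

/-- The embedding of the highest weight space. -/
def hw : C.carrier →ₗ[ℂ] (verma C).carrier :=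
  TensorProduct.mk ℂ (Env (nMinusBr n)) C.carrier 1

lemma ρ_borel_hw {x : Q n} (hx : x ∈ borel n) (c : C.carrier) :
    (verma C).ρ x (hw C c) = hw C (C.ρ (diagQ x) c) := by
  have h0 : (triangular n).p x = 0 := triangular_p_eq_zero.2 hx
  have h := Splitting.gact_one_tmul (inflate C) x c
  rw [h0, (triangular n).q_of_p h0, map_zero] at h
  refine h.trans ?_
  have e : (0 : Env (nMinusBr n)) ⊗ₜ[ℂ] c = 0 := zero_tmul _ _
  exact (congrArg (· + hw C (C.ρ (diagQ x) c)) e).trans (zero_add _)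

lemma ρ_upper_hw {x : Q n} (hx : x ∈ upper n) (c : C.carrier) : (verma C).ρ x (hw C c) = 0 := by
  rw [ρ_borel_hw C (upper_le_borel hx), diagQ_upper hx, map_zero, LinearMap.zero_apply, map_zero]

lemma hw_isHom : IsHom C (resCartan (verma C)) (hw C) := by
  refine ⟨fun c => ?_, fun x c => ?_⟩
  · change _ = TensorProduct.map (Env.θ (nMinusBr n)).toLinearMap C.δ ((1 : Env (nMinusBr n)) ⊗ₜ c)
    rw [TensorProduct.map_tmul, AlgHom.toLinearMap_apply, map_one]
    rfl
  · have h := ρ_borel_hw C (cartan_le_borel x.2) c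
    rw [diagQ_cartan] at h
    exact h.symm

/-- The Verma module is generated by its highest weight space under `𝔫⁻`. -/
lemma eq_top {N : Submodule ℂ (verma C).carrier} (h1 : ∀ c, hw C c ∈ N)
    (h2 : ∀ x ∈ lower n, ∀ v ∈ N, (verma C).ρ x v ∈ N) : N = ⊤ := by
  refine (Submodule.eq_top_iff').2 fun w => ?_
  refine Splitting.Ind.induction (inflate C) (P := fun w => w ∈ N) h1 (fun v w hv hw => add_mem hv hw)
    (fun i x w _ hw => ?_) w
  have h := h2 x.1 x.2 w hw
  have e := LinearMap.congr_fun (Splitting.gact_j (inflate C) x) w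
  exact e ▸ h

/-- The augmentation of `𝒰(𝔫⁻)` provides a left inverse. -/
lemma hw_injective : Function.Injective (hw C) := by
  let ε : Env (nMinusBr n) →ₐ[ℂ] ℂ := Env.lift (nMinusBr n) 0 (by intros; simp)
  let g : Env (nMinusBr n) ⊗[ℂ] C.carrier →ₗ[ℂ] C.carrier :=
    (TensorProduct.lid ℂ C.carrier).toLinearMap ∘ₗ TensorProduct.map ε.toLinearMap LinearMap.id
  refine Function.LeftInverse.injective (g := g) fun c => ?_
  change g ((1 : Env (nMinusBr n)) ⊗ₜ c) = c
  simp [g]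

/-- The universal property. -/
lemma exists_hom (X : SuperRep (Q n)) (f : C.carrier →ₗ[ℂ] X.carrier)
    (hf : IsHom C (resCartan X) f) (h0 : ∀ x ∈ upper n, ∀ c, X.ρ x (f c) = 0) :
    ∃ φ : (verma C).carrier →ₗ[ℂ] X.carrier, IsHom (verma C) X φ ∧ ∀ c, φ (hw C c) = f c := by
  refine Splitting.ind_exists_hom (inflate C) X f hf.1 fun x c hx => ?_
  rw [triangular_p_eq_zero] at hx
  have e : x = (x - (diagQ x : Q n)) + (diagQ x : Q n) := by abel
  have e1 : X.ρ x (f c) = X.ρ (diagQ x : Q n) (f c) := by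
    conv_lhs => rw [e, map_add, LinearMap.add_apply]
    exact (congrArg (· + X.ρ (diagQ x : Q n) (f c)) (h0 _ (sub_diagQ_mem hx) c)).trans (zero_add _)
  exact e1.trans (hf.2 (diagQ x) c).symm

end verma

end

end Queer

namespace Queer

noncomputable section

open LieSuperalgebra SuperRep TensorProduct

variable {n : ℕ}

/-! ### Matrix units and weights of modules -/

/-- The even matrix units. -/
def eQ (i j : Fin n) : Q n := (Matrix.single i j 1, 0)

/-- The odd matrix units. -/
def oQ (i j : Fin n) : Q n := (0, Matrix.single i j 1)

lemma par_eQ (i j : Fin n) : par (eQ i j) = (-1 : ℂ) ^ 0 • eQ i j := by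
  simp [par_apply, eQ]

lemma par_oQ (i j : Fin n) : par (oQ i j) = (-1 : ℂ) ^ 1 • oQ i j := by
  simp [par_apply, oQ]

lemma Q_eq_sum (x : Q n) : x = ∑ i, ∑ j, (x.1 i j • eQ i j + x.2 i j • oQ i j) := by
  have h : ∀ A : Matrix (Fin n) (Fin n) ℂ, A = ∑ i, ∑ j, A i j • Matrix.single i j 1 := fun A => by
    conv_lhs => rw [Matrix.matrix_eq_sum_single A]
    simp
  refine Prod.ext ?_ ?_
  · simp only [Prod.fst_sum, Prod.fst_add, Prod.smul_fst, eQ, oQ, smul_zero, add_zero]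
    exact h x.1
  · simp only [Prod.snd_sum, Prod.snd_add, Prod.smul_snd, eQ, oQ, smul_zero, zero_add]
    exact h x.2

lemma tor_eq_eQ (i : Fin n) : (tor i : Q n) = eQ i i := by
  refine Prod.ext ?_ rfl
  exact Matrix.diagonal_single i 1

lemma clf_eq_oQ (i : Fin n) : (clf i : Q n) = oQ i i := by
  refine Prod.ext rfl ?_
  exact Matrix.diagonal_single i 1

lemma single_mul_single_ite (i j k l : Fin n) :
    Matrix.single i j (1 : ℂ) * Matrix.single k l 1 = if j = k then Matrix.single i l 1 else 0 := by
  split_ifs with h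
  · subst h; simp
  · exact Matrix.single_mul_single_of_ne _ _ _ _ h _

lemma br_eQ_eQ (i j k l : Fin n) : br (eQ i j) (eQ k l) =
    (if j = k then eQ i l else 0) - (if l = i then eQ k j else 0) := by
  rw [br_apply]
  simp only [eQ, single_mul_single_ite, mul_zero, zero_mul, add_zero, sub_zero]
  split_ifs <;> simp

lemma br_eQ_oQ (i j k l : Fin n) : br (eQ i j) (oQ k l) =
    (if j = k then oQ i l else 0) - (if l = i then oQ k j else 0) := by
  rw [br_apply]
  simp only [eQ, oQ, single_mul_single_ite, mul_zero, zero_mul, add_zero, sub_zero]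
  split_ifs <;> simp

lemma br_oQ_eQ (i j k l : Fin n) : br (oQ i j) (eQ k l) =
    (if j = k then oQ i l else 0) - (if l = i then oQ k j else 0) := by
  rw [br_apply]
  simp only [eQ, oQ, single_mul_single_ite, mul_zero, zero_mul, add_zero, sub_zero, zero_add]
  split_ifs <;> simp

lemma br_oQ_oQ (i j k l : Fin n) : br (oQ i j) (oQ k l) =
    (if j = k then eQ i l else 0) + (if l = i then eQ k j else 0) := by
  rw [br_apply]
  simp only [eQ, oQ, single_mul_single_ite, mul_zero, zero_mul, add_zero, sub_zero, zero_add]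
  split_ifs <;> simp

lemma single_mem {r : Fin n → Fin n → Prop} {i j : Fin n} (h : ¬r i j) :
    eQ i j ∈ patternSub n r ∧ oQ i j ∈ patternSub n r := by
  have h0 : ∀ k l, r k l → Matrix.single i j (1 : ℂ) k l = 0 := fun k l hkl => by
    refine Matrix.single_apply_of_ne _ _ _ _ _ fun ⟨h1, h2⟩ => h ?_
    subst h1; subst h2; exact hkl
  exact ⟨fun k l hkl => ⟨h0 k l hkl, rfl⟩, fun k l hkl => ⟨rfl, h0 k l hkl⟩⟩

/-- A statement about all elements of a pattern subspace follows from matrix units. -/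
lemma pattern_induction {r : Fin n → Fin n → Prop} {P : Q n → Prop} (h0 : P 0)
    (ha : ∀ x y, P x → P y → P (x + y)) (hs : ∀ (c : ℂ) x, P x → P (c • x))
    (he : ∀ i j, ¬r i j → P (eQ i j)) (ho : ∀ i j, ¬r i j → P (oQ i j)) {x : Q n}
    (hx : x ∈ patternSub n r) : P x := by
  rw [Q_eq_sum x]
  refine Finset.sum_induction _ P ha h0 fun i _ => Finset.sum_induction _ P ha h0 fun j _ => ?_
  by_cases h : r i j
  · rw [(hx i j h).1, (hx i j h).2]
    simpa using h0
  · exact ha _ _ (hs _ _ (he i j h)) (hs _ _ (ho i j h))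

section Weights

variable (M : SuperRep (Q n))

lemma ρ_mem_wtSpace {x : Q n} {ν α : Fin n → ℂ} (hx : ∀ t, br (tor t : Q n) x = α t • x)
    {v : M.carrier} (hv : v ∈ wtSpace (resCartan M) ν) : M.ρ x v ∈ wtSpace (resCartan M) (ν + α) := by
  refine (mem_wtSpace (M := resCartan M)).2 fun t => ?_
  have hv' : M.ρ (tor t : Q n) v = ν t • v := (mem_wtSpace (M := resCartan M)).1 hv t
  have ht : par (tor t : Q n) = (-1 : ℂ) ^ 0 • (tor t : Q n) := by
    rw [tor_eq_eQ]; exact par_eQ t t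
  have key : ∀ y : Q n, ∀ s, par y = (-1 : ℂ) ^ s • y →
      M.ρ (tor t : Q n) (M.ρ y v) = M.ρ (br (tor t : Q n) y) v + ν t • M.ρ y v := by
    intro y s hy
    rw [ρ_br_apply M ht hy, hv', map_smul, zero_mul, pow_zero, one_smul]
    abel
  have h : M.ρ (tor t : Q n) (M.ρ x v) = M.ρ (br (tor t : Q n) x) v + ν t • M.ρ x v := by
    rw [← ev_add_od x]
    simp only [map_add, LinearMap.add_apply, key _ 0 (par_ev x), key _ 1 (par_od x), smul_add]
    abel
  refine h.trans ?_
  rw [hx, map_smul, LinearMap.smul_apply, ← add_smul, Pi.add_apply, add_comm (α t)]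
  rfl

/-- The weight `ε_i - ε_j`, which is zero for `i = j`. -/
def dwt (i j : Fin n) : Fin n → ℂ := Pi.single i 1 - Pi.single j 1

lemma br_tor_eQ (t i j : Fin n) : br (tor t : Q n) (eQ i j) = dwt i j t • eQ i j := by
  rw [tor_eq_eQ, br_eQ_eQ, dwt, Pi.sub_apply, Pi.single_apply, Pi.single_apply, sub_smul]
  congr 1
  · split_ifs with h
    · rw [h, one_smul]
    · rw [zero_smul]
  · by_cases h : j = t
    · rw [if_pos h, if_pos h.symm, h, one_smul]
    · rw [if_neg h, if_neg (Ne.symm h), zero_smul]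

lemma br_tor_oQ (t i j : Fin n) : br (tor t : Q n) (oQ i j) = dwt i j t • oQ i j := by
  rw [tor_eq_eQ, br_eQ_oQ, dwt, Pi.sub_apply, Pi.single_apply, Pi.single_apply, sub_smul]
  congr 1
  · split_ifs with h
    · rw [h, one_smul]
    · rw [zero_smul]
  · by_cases h : j = t
    · rw [if_pos h, if_pos h.symm, h, one_smul]
    · rw [if_neg h, if_neg (Ne.symm h), zero_smul]

variable {M}

lemma eQ_mem_wtSpace (i j : Fin n) {ν : Fin n → ℂ} {v : M.carrier}
    (hv : v ∈ wtSpace (resCartan M) ν) : M.ρ (eQ i j) v ∈ wtSpace (resCartan M) (ν + dwt i j) :=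
  ρ_mem_wtSpace M (br_tor_eQ · i j) hv

lemma oQ_mem_wtSpace (i j : Fin n) {ν : Fin n → ℂ} {v : M.carrier}
    (hv : v ∈ wtSpace (resCartan M) ν) : M.ρ (oQ i j) v ∈ wtSpace (resCartan M) (ν + dwt i j) :=
  ρ_mem_wtSpace M (br_tor_oQ · i j) hv

/-- If the sum of a vector of weight `μ` and of vectors of other weights lies in a submodule, then
so does the vector of weight `μ`. -/
lemma mem_of_add_mem {M : SuperRep (cartan n)} {N : Submodule ℂ M.carrier} (hN : IsSub M N)
    {μ : Fin n → ℂ} {t r : M.carrier} (ht : t ∈ wtSpace M μ)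
    (hr : r ∈ ⨆ ν, ⨆ (_ : ν ≠ μ), wtSpace M ν) (h : t + r ∈ N) : t ∈ N := by
  have hq := quot_mkQ_isHom M N hN
  have h1 : N.mkQ t ∈ wtSpace (M.quot N hN) μ := wtSpace_map hq ht
  have h2 : N.mkQ r ∈ ⨆ ν, ⨆ (_ : ν ≠ μ), wtSpace (M.quot N hN) ν := by
    have : (⨆ ν, ⨆ (_ : ν ≠ μ), wtSpace M ν) ≤
        (⨆ ν, ⨆ (_ : ν ≠ μ), wtSpace (M.quot N hN) ν).comap N.mkQ :=
      iSup₂_le fun ν hν v hv => Submodule.mem_comap.2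
        ((le_iSup₂ (f := fun ν (_ : ν ≠ μ) => wtSpace (M.quot N hN) ν) ν hν) (wtSpace_map hq hv))
    exact this hr
  have h3 : N.mkQ t + N.mkQ r = 0 := by
    rw [← map_add]; exact (Submodule.Quotient.mk_eq_zero N).2 h
  have h4 : N.mkQ t = -N.mkQ r := eq_neg_of_add_eq_zero_left h3
  have h5 := Submodule.disjoint_def.1 (wtSpace_iSupIndep (M.quot N hN) μ) (N.mkQ t) h1
    (h4 ▸ neg_mem h2)
  exact (Submodule.Quotient.mk_eq_zero N).1 h5

end Weights

lemma height_add (μ ν : Fin n → ℂ) : height (μ + ν) = height μ + height ν := by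
  simp [height, mul_add, Finset.sum_add_distrib]

lemma height_dwt {i j : Fin n} : height (dwt i j) = ((i : ℕ) : ℂ) - ((j : ℕ) : ℂ) := by
  simp [height, dwt, mul_sub, Finset.sum_sub_distrib, Pi.single_apply]

/-! ### The simple quotient of a Verma module -/

namespace verma

variable {C : SuperRep (cartan n)} {μ : Fin n → ℂ}

lemma hw_mem_wtSpace (hC : wtSpace C μ = ⊤) (c : C.carrier) :
    hw C c ∈ wtSpace (resCartan (verma C)) μ :=
  wtSpace_map (hw_isHom C) (hC ▸ Submodule.mem_top)

/-- Consider the span of the highest weight space and of all weight spaces whose height exceeds that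
of `μ` by a positive integer. Elements of `𝔫⁻` increase the height, so this span is stable and
therefore everything; and in weight `μ` it only contains the highest weight space. -/
lemma weights (hC : wtSpace C μ = ⊤) : (⨆ ν, wtSpace (resCartan (verma C)) ν) = ⊤ ∧
    wtSpace (resCartan (verma C)) μ = LinearMap.range (hw C) := by
  classical
  obtain ⟨N, hμ, hpos, hbot⟩ : ∃ N : (Fin n → ℂ) → Submodule ℂ (verma C).carrier,
      N μ = LinearMap.range (hw C) ∧
      (∀ a, a ≠ μ → (∃ m : ℕ, height a = height μ + m + 1) →
        N a = wtSpace (resCartan (verma C)) a) ∧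
      (∀ a, a ≠ μ → (¬∃ m : ℕ, height a = height μ + m + 1) → N a = ⊥) := by
    refine ⟨fun a => if a = μ then LinearMap.range (hw C)
      else if ∃ m : ℕ, height a = height μ + m + 1 then wtSpace (resCartan (verma C)) a else ⊥,
      if_pos rfl, fun a h1 h2 => (if_neg h1).trans (if_pos h2),
      fun a h1 h2 => (if_neg h1).trans (if_neg h2)⟩
  have hN : ∀ a, N a ≤ wtSpace (resCartan (verma C)) a := by
    intro a
    by_cases h1 : a = μ
    · rw [h1, hμ]
      rintro _ ⟨c, rfl⟩
      exact hw_mem_wtSpace hC c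
    · by_cases h2 : ∃ m : ℕ, height a = height μ + m + 1
      · exact (hpos a h1 h2).le
      · rw [hbot a h1 h2]
        exact fun v hv => (Submodule.mem_bot ℂ).1 hv ▸ zero_mem _
  have hht : ∀ a, ∀ v ∈ N a, v ≠ 0 → ∃ m : ℕ, height a = height μ + m := by
    intro a v hv h0
    by_cases h1 : a = μ
    · exact ⟨0, by rw [h1, Nat.cast_zero, add_zero]⟩
    · by_cases h2 : ∃ m : ℕ, height a = height μ + m + 1
      · obtain ⟨m, hm⟩ := h2
        exact ⟨m + 1, by rw [hm]; push_cast; ring⟩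
      · rw [hbot a h1 h2] at hv
        exact (h0 ((Submodule.mem_bot ℂ).1 hv)).elim
  have hstep : ∀ (i j : Fin n) a, j < i → ∀ v ∈ N a, v ≠ 0 →
      wtSpace (resCartan (verma C)) (a + dwt i j) ≤ N (a + dwt i j) := by
    intro i j a hij v hv h0
    obtain ⟨m, hm⟩ := hht a v hv h0
    obtain ⟨d, hd⟩ := Nat.exists_eq_add_of_lt (Fin.lt_def.1 hij)
    have e : height (a + dwt i j) = height μ + ((m + d : ℕ) : ℂ) + 1 := by
      rw [height_add, hm, height_dwt, hd]; push_cast; ring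
    have hne : a + dwt i j ≠ μ := by
      intro h
      rw [h, add_assoc, left_eq_add] at e
      exact Nat.cast_add_one_ne_zero _ e
    exact (hpos _ hne ⟨_, e⟩).ge
  have htop : ⨆ a, N a = ⊤ := by
    refine eq_top C (fun c => ?_) fun x hx v hv => ?_
    · exact (le_iSup N μ) (by rw [hμ]; exact ⟨c, rfl⟩)
    · refine Submodule.iSup_induction N (motive := fun v => (verma C).ρ x v ∈ ⨆ a, N a) hv ?_ ?_ ?_
      · intro a v hv
        by_cases h0 : v = 0
        · rw [h0, map_zero]; exact zero_mem _
        refine pattern_induction (P := fun x => (verma C).ρ x v ∈ ⨆ a, N a) ?_ ?_ ?_ ?_ ?_ hx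
        · rw [map_zero]; exact zero_mem _
        · intro x y hx hy; rw [map_add]; exact add_mem hx hy
        · intro c x hx; rw [map_smul]; exact Submodule.smul_mem _ _ hx
        · intro i j hij
          exact (le_iSup N _) (hstep i j a (not_le.1 hij) v hv h0 (eQ_mem_wtSpace i j (hN a hv)))
        · intro i j hij
          exact (le_iSup N _) (hstep i j a (not_le.1 hij) v hv h0 (oQ_mem_wtSpace i j (hN a hv)))
      · rw [map_zero]; exact zero_mem _
      · intro v w hv hw; rw [map_add]; exact add_mem hv hw
  refine ⟨top_le_iff.1 (htop ▸ iSup_mono hN), ?_⟩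
  refine (wtSpace_eq_iSup (resCartan (verma C)) N id hN htop μ).trans (Eq.trans ?_ hμ)
  exact iSup_iSup_eq_left

/-- The sum of the weight spaces of weights other than the highest weight. -/
def rest (C : SuperRep (cartan n)) (μ : Fin n → ℂ) : Submodule ℂ (verma C).carrier :=
  ⨆ ν, ⨆ (_ : ν ≠ μ), wtSpace (resCartan (verma C)) ν

lemma exists_add (hC : wtSpace C μ = ⊤) (v : (verma C).carrier) :
    ∃ c, ∃ r ∈ rest C μ, v = hw C c + r := by
  have h : v ∈ LinearMap.range (hw C) ⊔ rest C μ := by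
    have h1 : (⊤ : Submodule ℂ (verma C).carrier) ≤ LinearMap.range (hw C) ⊔ rest C μ := by
      refine (weights hC).1.ge.trans (iSup_le fun ν => ?_)
      by_cases h : ν = μ
      · rw [h]; exact (weights hC).2.le.trans le_sup_left
      · exact (le_iSup₂ (f := fun ν (_ : ν ≠ μ) => wtSpace (resCartan (verma C)) ν) ν h).trans
          le_sup_right
    exact h1 trivial
  obtain ⟨_, ⟨c, rfl⟩, r, hr, rfl⟩ := Submodule.mem_sup.1 h
  exact ⟨c, r, hr, rfl⟩

lemma isSub_res {M : SuperRep (Q n)} {N : Submodule ℂ M.carrier} (hN : IsSub M N) :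
    IsSub (resCartan M) N := ⟨hN.1, fun x => hN.2 x.1⟩

/-- A proper submodule of a Verma module does not meet the highest weight space. -/
lemma le_rest_or_eq_top (hC : wtSpace C μ = ⊤) (hs : C.IsSimple)
    {N : Submodule ℂ (verma C).carrier} (hN : IsSub (verma C) N) : N ≤ rest C μ ∨ N = ⊤ := by
  have hcomap : IsSub C (N.comap (hw C)) := (hw_isHom C).comap (isSub_res hN)
  rcases hs.2 _ hcomap with h | h
  · left
    intro v hv
    obtain ⟨c, r, hr, rfl⟩ := exists_add hC v
    have h1 : hw C c ∈ N := mem_of_add_mem (isSub_res hN) (hw_mem_wtSpace hC c) hr hv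
    have h2 : c = 0 := (Submodule.mem_bot ℂ).1 (h ▸ h1)
    rw [h2, map_zero, zero_add]
    exact hr
  · right
    exact eq_top C (fun c => (h ▸ Submodule.mem_top : c ∈ N.comap (hw C))) fun x _ v hv => hN.2 x v hv

lemma hw_mem_rest (hC : wtSpace C μ = ⊤) {c : C.carrier} (h : hw C c ∈ rest C μ) : c = 0 := by
  have h5 := Submodule.disjoint_def.1 (wtSpace_iSupIndep (resCartan (verma C)) μ) (hw C c)
    (hw_mem_wtSpace hC c) h
  exact hw_injective C (h5.trans (map_zero _).symm)

lemma rest_ne_top (hC : wtSpace C μ = ⊤) (hs : C.IsSimple) : rest C μ ≠ ⊤ := by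
  intro h
  have := hs.1
  obtain ⟨c, hc⟩ := exists_ne (0 : C.carrier)
  exact hc (hw_mem_rest hC (h ▸ Submodule.mem_top))

/-- The largest proper submodule. -/
def rad (C : SuperRep (cartan n)) (μ : Fin n → ℂ) : Submodule ℂ (verma C).carrier :=
  sSup {N | IsSub (verma C) N ∧ N ≤ rest C μ}

lemma rad_isSub : IsSub (verma C) (rad C μ) := isSub_sSup fun _ h => h.1

lemma rad_le : rad C μ ≤ rest C μ := sSup_le fun _ h => h.2

/-- The simple quotient of the Verma module. -/
def simple (C : SuperRep (cartan n)) (μ : Fin n → ℂ) : SuperRep (Q n) :=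
  (verma C).quot (rad C μ) rad_isSub

lemma exists_proj (C : SuperRep (cartan n)) (μ : Fin n → ℂ) :
    ∃ q : (verma C).carrier →ₗ[ℂ] (simple C μ).carrier, IsHom (verma C) (simple C μ) q ∧
      (∀ v, q v = 0 ↔ v ∈ rad C μ) ∧ Function.Surjective q :=
  ⟨(rad C μ).mkQ, quot_mkQ_isHom _ _ _, fun _ => Submodule.Quotient.mk_eq_zero _,
    (rad C μ).mkQ_surjective⟩

/-- The preimage of a submodule either avoids the highest weight space, and then lies in the radical
by maximality, or is everything. -/
lemma simple_isSimple (hC : wtSpace C μ = ⊤) (hs : C.IsSimple) : (simple C μ).IsSimple := by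
  obtain ⟨q, hq, hq0, hqs⟩ := exists_proj C μ
  refine ⟨?_, fun N hN => ?_⟩
  · exact Submodule.Quotient.nontrivial_iff.2 fun h => rest_ne_top hC hs (top_le_iff.1 (h ▸ rad_le))
  · rcases le_rest_or_eq_top hC hs (hq.comap hN) with h | h
    · left
      rw [eq_bot_iff]
      intro v hv
      obtain ⟨v, rfl⟩ := hqs v
      have h1 : N.comap q ≤ rad C μ := le_sSup ⟨hq.comap hN, h⟩
      exact (Submodule.mem_bot ℂ).2 ((hq0 v).2 (h1 hv))
    · right
      rw [eq_top_iff]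
      intro v _
      obtain ⟨v, rfl⟩ := hqs v
      exact (h ▸ Submodule.mem_top : v ∈ N.comap q)

lemma _root_.Queer.SuperRep.IsHom.res {M N : SuperRep (Q n)} {f : M.carrier →ₗ[ℂ] N.carrier}
    (hf : IsHom M N f) : IsHom (resCartan M) (resCartan N) f := ⟨hf.1, fun x => hf.2 x.1⟩

/-- The radical lies in the sum of the other weight spaces, so the highest weight space survives in
the quotient unchanged. -/
lemma simple_isSimpleHighestWeight {C : FinRep (cartan n)} (hC : IsSimpleOfWeight μ C) :
    IsSimpleHighestWeight μ C (simple C.rep μ) := by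
  obtain ⟨q, hq, hq0, hqs⟩ := exists_proj C.rep μ
  have hf : IsHom C.rep (resCartan (simple C.rep μ)) (q ∘ₗ hw C.rep) := hq.res.comp (hw_isHom C.rep)
  have hfi : ∀ c, q (hw C.rep c) = 0 → c = 0 := fun c hc =>
    hw_mem_rest hC.2 (rad_le ((hq0 _).1 hc))
  have hfw : ∀ c, q (hw C.rep c) ∈ wtSpace (resCartan (simple C.rep μ)) μ := fun c =>
    wtSpace_map hf (hC.2 ▸ Submodule.mem_top)
  have hfs : ∀ v ∈ wtSpace (resCartan (simple C.rep μ)) μ, ∃ c, q (hw C.rep c) = v := by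
    intro v hv
    obtain ⟨w, rfl⟩ := hqs v
    obtain ⟨c, r, hr, rfl⟩ := exists_add hC.2 w
    refine ⟨c, ?_⟩
    have h1 : q r ∈ ⨆ ν, ⨆ (_ : ν ≠ μ), wtSpace (resCartan (simple C.rep μ)) ν := by
      have : rest C.rep μ ≤
          (⨆ ν, ⨆ (_ : ν ≠ μ), wtSpace (resCartan (simple C.rep μ)) ν).comap q :=
        iSup₂_le fun ν hν v hv => Submodule.mem_comap.2
          ((le_iSup₂ (f := fun ν (_ : ν ≠ μ) => wtSpace (resCartan (simple C.rep μ)) ν) ν hν)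
            (wtSpace_map hq.res hv))
      exact this hr
    have h2 : q r ∈ wtSpace (resCartan (simple C.rep μ)) μ := by
      have e : q r = q (hw C.rep c + r) - q (hw C.rep c) := by rw [map_add, add_sub_cancel_left]
      rw [e]; exact sub_mem hv (hfw c)
    have h3 : q r = 0 :=
      Submodule.disjoint_def.1 (wtSpace_iSupIndep (resCartan (simple C.rep μ)) μ) _ h2 h1
    rw [map_add, h3, add_zero]
  refine ⟨simple_isSimple hC.2 hC.1, fun x hx v hv => ?_, ?_⟩
  · obtain ⟨c, rfl⟩ := hfs v hv
    rw [← hq.2 x, ρ_upper_hw C.rep hx, map_zero]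
  · refine Iso.symm ⟨(q ∘ₗ hw C.rep).codRestrict _ hfw, ⟨fun c => Subtype.ext (hf.1 c), fun x c =>
      Subtype.ext (hf.2 x c)⟩, (injective_iff_map_eq_zero _).2 fun a h =>
        hfi a (congrArg Subtype.val h), fun v => ?_⟩
    obtain ⟨c, hc⟩ := hfs v.1 v.2
    exact ⟨c, Subtype.ext hc⟩

end verma

end

end Queer

namespace Queer

noncomputable section

open LieSuperalgebra SuperRep TensorProduct

variable {n : ℕ}

/-! ### Verma modules in category 𝒪 -/

/-- The action of `𝔮_n` maps a finite-dimensional `𝔟`-stable subspace into another one. -/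
lemma locallyFinite_ρ {M : SuperRep (Q n)} {N : Submodule ℂ M.carrier} (hfin : Module.Finite ℂ N)
    (hN : ∀ x ∈ borel n, ∀ w ∈ N, M.ρ x w ∈ N) : ∃ N' : Submodule ℂ M.carrier,
      (∀ x, ∀ v ∈ N, M.ρ x v ∈ N') ∧ Module.Finite ℂ N' ∧ ∀ x ∈ borel n, ∀ w ∈ N', M.ρ x w ∈ N' := by
  let P : Submodule ℂ M.carrier := Submodule.map₂ M.ρ ⊤ N
  have hP : ∀ x, ∀ v ∈ N, M.ρ x v ∈ P := fun x v hv => Submodule.apply_mem_map₂ _ trivial hv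
  have hPfg : P.FG := Submodule.FG.map₂ _ (Module.Finite.fg_top) (Module.Finite.iff_fg.1 hfin)
  refine ⟨P, hP, Module.Finite.iff_fg.2 hPfg, fun x hx w hw => ?_⟩
  -- For `x` in `𝔟`, `x y v = [x, y] v ± y x v`, and `x v` stays in `N`.
  have key : ∀ (s : ℕ) (x : Q n), x ∈ borel n → par x = (-1 : ℂ) ^ s • x → ∀ (t : ℕ) (y : Q n),
      par y = (-1 : ℂ) ^ t • y → ∀ v ∈ N, M.ρ x (M.ρ y v) ∈ P := by
    intro s x hx hs t y ht v hv
    have h := ρ_br_apply M hs ht v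
    rw [eq_sub_iff_add_eq] at h
    rw [← h]
    exact add_mem (hP _ v hv) (Submodule.smul_mem _ _ (hP _ _ (hN x hx v hv)))
  have key2 : ∀ (s : ℕ) (x : Q n), x ∈ borel n → par x = (-1 : ℂ) ^ s • x →
      ∀ w ∈ P, M.ρ x w ∈ P := by
    intro s x hx hs w hw
    have hle : P ≤ P.comap (M.ρ x) := Submodule.map₂_le.2 fun y _ v hv => by
      have h : M.ρ x (M.ρ y v) = M.ρ x (M.ρ (ev y) v) + M.ρ x (M.ρ (od y) v) := by
        rw [← map_add (M.ρ x), ← LinearMap.add_apply, ← map_add, ev_add_od]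
      rw [Submodule.mem_comap, h]
      exact add_mem (key s x hx hs 0 _ (par_ev y) v hv) (key s x hx hs 1 _ (par_od y) v hv)
    exact hle hw
  have hpar : ∀ x ∈ borel n, ev x ∈ borel n ∧ od x ∈ borel n := fun x hx =>
    ⟨Submodule.smul_mem _ _ (add_mem hx (patternSub_par hx)),
      Submodule.smul_mem _ _ (sub_mem hx (patternSub_par hx))⟩
  rw [← ev_add_od x, map_add, LinearMap.add_apply]
  exact add_mem (key2 0 _ (hpar x hx).1 (par_ev x) w hw) (key2 1 _ (hpar x hx).2 (par_od x) w hw)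

namespace verma

variable {C : SuperRep (cartan n)} {μ : Fin n → ℂ}

lemma inCatO (hC : wtSpace C μ = ⊤) (hfin : Module.Finite ℂ C.carrier) : InCatO (verma C) := by
  classical
  refine ⟨?_, (weights hC).1, fun v => ?_⟩
  · obtain ⟨S, hS⟩ := hfin.fg_top
    refine ⟨S.image (hw C), fun N hN hSN => eq_top C (fun c => ?_) fun x _ v hv => hN x v hv⟩
    have h1 : Submodule.span ℂ (S : Set C.carrier) ≤ N.comap (hw C) :=
      Submodule.span_le.2 fun c hc => hSN _ (Finset.mem_image_of_mem _ hc)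
    rw [hS] at h1
    exact h1 trivial
  -- The vectors that lie in finite-dimensional `𝔟`-stable subspaces form a subspace. It contains
  -- the highest weight space and is stable under `𝔤`, so it is the whole module.
  · let W : Submodule ℂ (verma C).carrier :=
      { carrier := {v | ∃ N : Submodule ℂ (verma C).carrier, v ∈ N ∧ Module.Finite ℂ N ∧
          ∀ x ∈ borel n, ∀ w ∈ N, (verma C).ρ x w ∈ N}
        zero_mem' := ⟨⊥, zero_mem _, inferInstance, fun x _ w hw => by
          rw [(Submodule.mem_bot ℂ).1 hw, map_zero]; exact zero_mem _⟩
        add_mem' := by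
          rintro v w ⟨N, hv, h1, h2⟩ ⟨N', hw, h1', h2'⟩
          refine ⟨N ⊔ N', add_mem (Submodule.mem_sup_left hv) (Submodule.mem_sup_right hw),
            inferInstance, fun x hx u hu => ?_⟩
          obtain ⟨a, ha, b, hb, rfl⟩ := Submodule.mem_sup.1 hu
          rw [map_add]
          exact add_mem (Submodule.mem_sup_left (h2 x hx a ha)) (Submodule.mem_sup_right (h2' x hx b hb))
        smul_mem' := fun c v ⟨N, hv, h⟩ => ⟨N, N.smul_mem c hv, h⟩ }
    have hW : W = ⊤ := by
      refine eq_top C (fun c => ?_) fun x _ v hv => ?_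
      · refine ⟨LinearMap.range (hw C), ⟨c, rfl⟩, inferInstance, ?_⟩
        rintro x hx _ ⟨c, rfl⟩
        exact ⟨_, (ρ_borel_hw C hx c).symm⟩
      · obtain ⟨N, hvN, h1, h2⟩ := hv
        obtain ⟨N', h3, h4⟩ := locallyFinite_ρ h1 h2
        exact ⟨N', h3 x v hvN, h4⟩
    exact (hW ▸ Submodule.mem_top : v ∈ W)

/-- Proper submodules lie in the proper subspace `rest`, so two of them never span the module. -/
lemma isIndecomposable (hC : wtSpace C μ = ⊤) (hs : C.IsSimple) : (verma C).IsIndecomposable := by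
  constructor
  · have := hs.1
    exact (hw_injective C).nontrivial
  · intro N N' hN hN' h
    rcases le_rest_or_eq_top hC hs hN with h1 | h1
    · rcases le_rest_or_eq_top hC hs hN' with h2 | h2
      · exact (rest_ne_top hC hs (top_le_iff.1 (h.sup_eq_top ▸ sup_le h1 h2))).elim
      · left
        have := h.inf_eq_bot
        rwa [h2, inf_top_eq] at this
    · right
      have := h.inf_eq_bot
      rwa [h1, top_inf_eq] at this

/-- Simple highest weight modules are quotients of Verma modules. -/
lemma isSubquotient_of_isSimpleHighestWeight {C : FinRep (cartan n)} (hC : IsSimpleOfWeight μ C)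
    {X : SuperRep (Q n)} (hX : IsSimpleHighestWeight μ C X) : (verma C.rep).IsSubquotient X := by
  obtain ⟨hXs, hX0, hXi⟩ := hX
  obtain ⟨f, hf, hfb⟩ := hXi.symm
  have hf' : IsHom C.rep (resCartan X) ((wtSpace (resCartan X) μ).subtype ∘ₗ f) :=
    (sub_subtype_isHom _ _ (wtSpace_isSub (resCartan X) μ)).comp hf
  obtain ⟨φ, hφ, hφ1⟩ := exists_hom C.rep X ((wtSpace (resCartan X) μ).subtype ∘ₗ f) hf'
    fun x hx c => hX0 x hx _ (f c).2
  refine ⟨⊤, isSub_top _, φ ∘ₗ Submodule.subtype ⊤, hφ.comp (sub_subtype_isHom _ _ _), ?_⟩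
  have hr : LinearMap.range φ = ⊤ := by
    refine (hXs.2 _ hφ.range).resolve_left fun h => ?_
    have := hC.1.1
    obtain ⟨c, hc⟩ := exists_ne (0 : C.rep.carrier)
    have h1 : φ (hw C.rep c) = 0 := (Submodule.mem_bot ℂ).1 (h ▸ LinearMap.mem_range_self _ _)
    rw [hφ1] at h1
    exact hc (hfb.1 ((Subtype.ext h1 : f c = 0).trans (map_zero f).symm))
  intro v
  obtain ⟨w, hw⟩ := LinearMap.range_eq_top.1 hr v
  exact ⟨⟨w, trivial⟩, hw⟩

lemma _root_.Queer.SuperRep.IsHom.exists_factor {L : Type} [AddCommGroup L] [Module ℂ L]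
    [LieSuperalgebra L] {M N P : SuperRep L} {φ : M.carrier →ₗ[ℂ] N.carrier}
    {q : M.carrier →ₗ[ℂ] P.carrier} (hφ : IsHom M N φ) (hq : IsHom M P q)
    (h : ∀ v, φ v = 0 → q v = 0) (hs : Function.Surjective q) : N.IsSubquotient P := by
  have hle : LinearMap.ker φ ≤ LinearMap.ker q := h
  let g : LinearMap.range φ →ₗ[ℂ] P.carrier :=
    (LinearMap.ker φ).liftQ q hle ∘ₗ φ.quotKerEquivRange.symm.toLinearMap
  have hg : ∀ v (w : LinearMap.range φ), φ v = w.1 → g w = q v := by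
    intro v w hvw
    have : w = φ.quotKerEquivRange ((LinearMap.ker φ).mkQ v) := Subtype.ext hvw.symm
    rw [this]
    simp [g]
  refine ⟨LinearMap.range φ, hφ.range, g, ⟨?_, ?_⟩, fun p => ?_⟩
  · rintro ⟨_, v, rfl⟩
    refine (hg (M.δ v) _ (hφ.1 v)).trans ((hq.1 v).trans (congrArg P.δ ?_))
    exact (hg v _ rfl).symm
  · rintro x ⟨_, v, rfl⟩
    refine (hg (M.ρ x v) _ (hφ.2 x v)).trans ((hq.2 x v).trans (congrArg (P.ρ x) ?_))
    exact (hg v _ rfl).symm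
  · obtain ⟨v, rfl⟩ := hs p
    exact ⟨⟨φ v, v, rfl⟩, hg v _ rfl⟩

/-- Simple modules given by singular vectors are subquotients of Verma modules. -/
lemma isSubquotient_of_singular {D : SuperRep (Q n)} {C : SuperRep (cartan n)}
    (hC : wtSpace C μ = ⊤) (hs : C.IsSimple) {f : C.carrier →ₗ[ℂ] D.carrier}
    (hf : IsHom C (resCartan D) f) (h0 : ∀ x ∈ upper n, ∀ c, D.ρ x (f c) = 0) (hne : f ≠ 0) :
    D.IsSubquotient (simple C μ) := by
  obtain ⟨φ, hφ, hφ1⟩ := exists_hom C D f hf h0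
  obtain ⟨q, hq, hq0, hqs⟩ := exists_proj C μ
  refine hφ.exists_factor hq (fun v hv => (hq0 v).2 ?_) hqs
  -- The kernel is proper because `f ≠ 0`, so it is contained in the radical, and the projection to
  -- the simple quotient factors through the image.
  rcases le_rest_or_eq_top hC hs hφ.ker with h | h
  · exact (le_sSup ⟨hφ.ker, h⟩ : LinearMap.ker φ ≤ rad C μ) hv
  · refine (hne (LinearMap.ext fun c => ?_)).elim
    rw [← hφ1]
    exact (h ▸ Submodule.mem_top : hw C c ∈ LinearMap.ker φ)

end verma

lemma linked_of_isSimpleHighestWeight {μ : Fin n → ℂ} {C : FinRep (cartan n)}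
    (hC : IsSimpleOfWeight μ C) {X Y : SuperRep (Q n)} (hX : IsSimpleHighestWeight μ C X)
    (hY : IsSimpleHighestWeight μ C Y) : Linked X Y :=
  ⟨hX.1, hY.1, verma C.rep, verma.inCatO hC.2 C.fin, verma.isIndecomposable hC.2 hC.1,
    verma.isSubquotient_of_isSimpleHighestWeight hC hX,
    verma.isSubquotient_of_isSimpleHighestWeight hC hY⟩

/-! ### Parity shifts and singular vectors -/

section Shift

lemma IsSub.shift {L : Type} [AddCommGroup L] [Module ℂ L] [LieSuperalgebra L] {M : SuperRep L}
    {N : Submodule ℂ M.carrier} (h : IsSub M N) : IsSub M.shift N :=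
  ⟨fun v hv => neg_mem (h.1 v hv), h.2⟩

lemma IsSub.of_shift {L : Type} [AddCommGroup L] [Module ℂ L] [LieSuperalgebra L] {M : SuperRep L}
    {N : Submodule ℂ M.carrier} (h : IsSub M.shift N) : IsSub M N :=
  ⟨fun v hv => neg_mem_iff.1 (h.1 v hv), h.2⟩

lemma IsHom.shift {L : Type} [AddCommGroup L] [Module ℂ L] [LieSuperalgebra L] {M N : SuperRep L}
    {f : M.carrier →ₗ[ℂ] N.carrier} (h : IsHom M N f) : IsHom M.shift N.shift f :=
  ⟨fun v => (map_neg f (M.δ v)).trans (congrArg Neg.neg (h.1 v)), h.2⟩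

lemma Linked.shift {X Y : SuperRep (Q n)} (h : Linked X Y) : Linked X.shift Y.shift := by
  obtain ⟨hX, hY, E, hE, hEi, ⟨N, hN, p, hp, hps⟩, ⟨N', hN', p', hp', hps'⟩⟩ := h
  refine ⟨isSimple_shift hX, isSimple_shift hY, E.shift, hE, ⟨hEi.1, fun A B hA hB => ?_⟩,
    ⟨N, IsSub.shift hN, p, ⟨(IsHom.shift hp).1, (IsHom.shift hp).2⟩, hps⟩,
    ⟨N', IsSub.shift hN', p', ⟨(IsHom.shift hp').1, (IsHom.shift hp').2⟩, hps'⟩⟩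
  exact hEi.2 A B (IsSub.of_shift hA) (IsSub.of_shift hB)

lemma SameBlock.shift {X Y : SuperRep (Q n)} (h : SameBlock X Y) : SameBlock X.shift Y.shift := by
  induction h with
  | rel _ _ h => exact .rel _ _ h.shift
  | refl _ => exact .refl _
  | symm _ _ _ h => exact .symm _ _ h
  | trans _ _ _ _ _ h h' => exact .trans _ _ _ h h'

lemma Iso.shift {L : Type} [AddCommGroup L] [Module ℂ L] [LieSuperalgebra L] {M N : SuperRep L}
    (h : Iso M N) : Iso M.shift N.shift := by
  obtain ⟨f, hf, hb⟩ := h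
  exact ⟨f, IsHom.shift hf, hb⟩

lemma shift_shift_iso {L : Type} [AddCommGroup L] [Module ℂ L] [LieSuperalgebra L] (M : SuperRep L) :
    Iso M.shift.shift M :=
  ⟨LinearMap.id, ⟨fun v => neg_neg (M.δ v), fun _ _ => rfl⟩, Function.bijective_id⟩

lemma IsSimpleHighestWeight.shift {μ : Fin n → ℂ} {C : FinRep (cartan n)} {X : SuperRep (Q n)}
    (h : IsSimpleHighestWeight μ C X) : IsSimpleHighestWeight μ C.shift X.shift := by
  refine ⟨isSimple_shift h.1, h.2.1, ?_⟩
  obtain ⟨f, hf, hb⟩ := h.2.2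
  exact ⟨f, IsHom.shift hf, hb⟩

lemma IsSimpleHighestWeight.of_iso {μ : Fin n → ℂ} {C D : FinRep (cartan n)} {X : SuperRep (Q n)}
    (h : IsSimpleHighestWeight μ C X) (e : Iso C.rep D.rep) : IsSimpleHighestWeight μ D X :=
  ⟨h.1, h.2.1, h.2.2.trans e⟩

lemma IsSimpleOfWeight.shift {μ : Fin n → ℂ} {C : FinRep (cartan n)} (h : IsSimpleOfWeight μ C) :
    IsSimpleOfWeight μ C.shift := ⟨isSimple_shift h.1, h.2⟩

end Shift

lemma isSub_resCartan {M : SuperRep (Q n)} {N : Submodule ℂ M.carrier}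
    (h1 : ∀ v ∈ N, M.δ v ∈ N) (h2 : ∀ x ∈ cartan n, ∀ v ∈ N, M.ρ x v ∈ N) :
    IsSub (resCartan M) N := ⟨h1, fun x => h2 x.1 x.2⟩

/-- The singular vectors of a given weight are a submodule over `𝔥`. -/
lemma singular_isSub (M : SuperRep (Q n)) : ∃ N : Submodule ℂ M.carrier, IsSub (resCartan M) N ∧
    ∀ v, v ∈ N ↔ ∀ x ∈ upper n, M.ρ x v = 0 := by
  refine ⟨⨅ x ∈ upper n, LinearMap.ker (M.ρ x), ?_, fun v => by simp⟩
  have hm : ∀ v, v ∈ (⨅ x ∈ upper n, LinearMap.ker (M.ρ x)) ↔ ∀ x ∈ upper n, M.ρ x v = 0 :=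
    fun v => by simp
  refine isSub_resCartan ?_ ?_
  · intro v hv
    rw [hm] at hv
    refine (hm _).2 fun x hx => ?_
    have h := M.δ_ρ (par x) v
    rw [hv _ (patternSub_par hx), map_zero, par_par] at h
    exact h.symm
  · intro x hx v hv
    rw [hm] at hv
    refine (hm _).2 fun y hy => ?_
    have hb := cartan_le_borel hx
    have hpar : ∀ {r : Fin n → Fin n → Prop}, ∀ x ∈ patternSub n r,
        ev x ∈ patternSub n r ∧ od x ∈ patternSub n r := fun x hx =>
      ⟨Submodule.smul_mem _ _ (add_mem hx (patternSub_par hx)),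
        Submodule.smul_mem _ _ (sub_mem hx (patternSub_par hx))⟩
    have key : ∀ (s t : ℕ) (x y : Q n), par x = (-1 : ℂ) ^ s • x → par y = (-1 : ℂ) ^ t • y →
        x ∈ borel n → y ∈ upper n → M.ρ y (M.ρ x v) = 0 := by
      intro s t x y hs ht hx hy
      have h := ρ_br_apply M ht hs v
      rw [hv _ (br_upper_borel hy hx), hv y hy, map_zero, smul_zero, sub_zero] at h
      exact h.symm
    have e : M.ρ y (M.ρ x v) = M.ρ (ev y) (M.ρ (ev x) v) + M.ρ (ev y) (M.ρ (od x) v)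
        + (M.ρ (od y) (M.ρ (ev x) v) + M.ρ (od y) (M.ρ (od x) v)) := by
      rw [← map_add (M.ρ (ev y)), ← map_add (M.ρ (od y)), ← LinearMap.add_apply, ← map_add,
        ev_add_od, ← LinearMap.add_apply, ← map_add, ev_add_od]
    rw [e, key 0 0 _ _ (par_ev _) (par_ev _) (hpar _ hb).1 (hpar _ hy).1,
      key 1 0 _ _ (par_od _) (par_ev _) (hpar _ hb).2 (hpar _ hy).1,
      key 0 1 _ _ (par_ev _) (par_od _) (hpar _ hb).1 (hpar _ hy).2,
      key 1 1 _ _ (par_od _) (par_od _) (hpar _ hb).2 (hpar _ hy).2]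
    simp

/-- The singular vectors of weight `ν` are intersected with a finite-dimensional `𝔟`-stable subspace
around `w`. This gives a finite-dimensional `𝔥`-module, in which a simple one can be found. -/
lemma exists_finite_singular {M : SuperRep (Q n)} (hM : InCatO M) {ν : Fin n → ℂ} {w : M.carrier}
    (hwt : w ∈ wtSpace (resCartan M) ν) (hsing : ∀ x ∈ upper n, M.ρ x w = 0) :
    ∃ X : Submodule ℂ M.carrier, Module.Finite ℂ X ∧ w ∈ X ∧ IsSub (resCartan M) X ∧
      X ≤ wtSpace (resCartan M) ν ∧ ∀ v ∈ X, ∀ x ∈ upper n, M.ρ x v = 0 := by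
  obtain ⟨N, hwN, hNfin, hN⟩ := hM.2.2 w
  obtain ⟨S, hS, hSm⟩ := singular_isSub M
  -- The subspace from category `𝒪` need not be graded; adding its image under the parity makes it
  -- so.
  have hN' : IsSub (resCartan M) (N ⊔ N.map M.δ) := by
    have h1 : ∀ v ∈ N ⊔ N.map M.δ, M.δ v ∈ N ⊔ N.map M.δ := by
      intro v hv
      obtain ⟨a, ha, _, ⟨b, hb, rfl⟩, rfl⟩ := Submodule.mem_sup.1 hv
      rw [map_add, M.δ_δ, add_comm]
      exact add_mem (Submodule.mem_sup_left hb) (Submodule.mem_sup_right ⟨a, ha, rfl⟩)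
    have h2 : ∀ x ∈ cartan n, ∀ v ∈ N ⊔ N.map M.δ, M.ρ x v ∈ N ⊔ N.map M.δ := by
      intro x hx v hv
      obtain ⟨a, ha, _, ⟨b, hb, rfl⟩, rfl⟩ := Submodule.mem_sup.1 hv
      have h := M.δ_ρ (par x) b
      rw [par_par] at h
      rw [map_add, ← h]
      exact add_mem (Submodule.mem_sup_left (hN _ (cartan_le_borel hx) _ ha))
        (Submodule.mem_sup_right ⟨_, hN _ (patternSub_par (cartan_le_borel hx)) _ hb, rfl⟩)
    exact isSub_resCartan h1 h2
  refine ⟨(S ⊓ wtSpace (resCartan M) ν) ⊓ (N ⊔ N.map M.δ), ?_,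
    ⟨⟨(hSm w).2 hsing, hwt⟩, Submodule.mem_sup_left hwN⟩,
    (hS.inf (wtSpace_isSub (resCartan M) ν)).inf hN',
    fun v hv => hv.1.2, fun v hv => (hSm v).1 hv.1.1⟩
  have h2 : Module.Finite ℂ (N ⊔ N.map M.δ : Submodule ℂ M.carrier) := inferInstance
  exact Submodule.finiteDimensional_of_le (inf_le_right)

/-! ### Connected weights -/

/-- Some simple modules of the highest weights `μ` and `ν` lie in the same block. -/
def Conn (μ ν : Fin n → ℂ) : Prop :=
  ∃ (C D : FinRep (cartan n)) (X Y : SuperRep (Q n)), IsSimpleOfWeight μ C ∧ IsSimpleOfWeight ν D ∧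
    IsSimpleHighestWeight μ C X ∧ IsSimpleHighestWeight ν D Y ∧ SameBlock X Y

namespace Conn

variable {μ ν ξ : Fin n → ℂ}

lemma symm (h : Conn μ ν) : Conn ν μ := by
  obtain ⟨C, D, X, Y, h1, h2, h3, h4, h5⟩ := h
  exact ⟨D, C, Y, X, h2, h1, h4, h3, h5.symm⟩

/-- Both parities of the second module occur, up to the parity of the first one. -/
lemma exists_right (h : Conn μ ν) {D : FinRep (cartan n)} (hD : IsSimpleOfWeight ν D)
    {Y : SuperRep (Q n)} (hY : IsSimpleHighestWeight ν D Y) :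
    ∃ (C : FinRep (cartan n)) (X : SuperRep (Q n)), IsSimpleOfWeight μ C ∧
      IsSimpleHighestWeight μ C X ∧ SameBlock X Y := by
  obtain ⟨C, D', X, Y', h1, h2, h3, h4, h5⟩ := h
  rcases simple_unique h2.2 hD.2 h2.1 hD.1 with e | e
  · exact ⟨C, X, h1, h3, h5.trans _ _ _ (.rel _ _ (linked_of_isSimpleHighestWeight hD (h4.of_iso e) hY))⟩
  · have h4' : IsSimpleHighestWeight ν D Y'.shift :=
      h4.shift.of_iso ((Iso.shift e).trans (shift_shift_iso _))
    exact ⟨C.shift, X.shift, h1.shift, h3.shift,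
      h5.shift.trans _ _ _ (.rel _ _ (linked_of_isSimpleHighestWeight hD h4' hY))⟩

lemma trans (h : Conn μ ν) (h' : Conn ν ξ) : Conn μ ξ := by
  obtain ⟨D, E, Y, Z, h1, h2, h3, h4, h5⟩ := h'
  obtain ⟨C, X, h6, h7, h8⟩ := h.exists_right h1 h3
  exact ⟨C, E, X, Z, h6, h2, h7, h4, h8.trans _ _ _ h5⟩

lemma refl {C : FinRep (cartan n)} (hC : IsSimpleOfWeight μ C) : Conn μ μ :=
  ⟨C, C, _, _, hC, hC, verma.simple_isSimpleHighestWeight hC, verma.simple_isSimpleHighestWeight hC,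
    .refl _⟩

/-- Singular vectors connect weights. -/
lemma of_singular {C : FinRep (cartan n)} (hC : IsSimpleOfWeight μ C)
    {w : (verma C.rep).carrier} (hw0 : w ≠ 0) (hwt : w ∈ wtSpace (resCartan (verma C.rep)) ν)
    (hsing : ∀ x ∈ upper n, (verma C.rep).ρ x w = 0) : Conn μ ν := by
  have hO := verma.inCatO hC.2 C.fin
  obtain ⟨X, hXfin, hwX, hX, hXw, hX0⟩ := exists_finite_singular hO hwt hsing
  -- A simple `𝔥`-module `Y` of singular vectors gives a nonzero map from another Verma module.
  -- Hence the simple module with highest weight space `Y` is a subquotient of this indecomposable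
  -- Verma module.
  obtain ⟨Y, hY, hYX, hYs⟩ := exists_simple_sub (resCartan (verma C.rep)) X hX
    (fun h => hw0 ((Submodule.mem_bot ℂ).1 (h ▸ hwX))) (hfin := hXfin)
  have hYfin : Module.Finite ℂ Y :=
    @Submodule.finiteDimensional_of_le ℂ (verma C.rep).carrier _ _ _ Y X hXfin hYX
  let D : FinRep (cartan n) := ⟨(resCartan (verma C.rep)).sub Y hY, hYfin⟩
  have hD : IsSimpleOfWeight ν D := by
    refine ⟨hYs, (Submodule.eq_top_iff').2 fun v => mem_wtSpace.2 fun i => Subtype.ext ?_⟩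
    exact (mem_wtSpace (M := resCartan (verma C.rep))).1 (hXw (hYX v.2)) i
  have hsub := verma.isSubquotient_of_singular (D := verma C.rep) (f := Y.subtype) hD.2 hD.1
    (sub_subtype_isHom _ _ hY) (fun x hx c => hX0 _ (hYX c.2) x hx) fun h => by
      have := hYs.1
      obtain ⟨c, hc⟩ := exists_ne (0 : ((resCartan (verma C.rep)).sub Y hY).carrier)
      exact hc (Subtype.ext (LinearMap.congr_fun h c))
  have hC' := verma.simple_isSimpleHighestWeight hC
  have hD' := verma.simple_isSimpleHighestWeight hD
  exact ⟨C, D, _, _, hC, hD, hC', hD', .rel _ _ ⟨hC'.1, hD'.1, verma C.rep, hO,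
    verma.isIndecomposable hC.2 hC.1, verma.isSubquotient_of_isSimpleHighestWeight hC hC', hsub⟩⟩

end Conn

end

end Queer

namespace Queer

noncomputable section

open LieSuperalgebra SuperRep TensorProduct

variable {n : ℕ}

/-! ### Singular vectors for 𝔮₂ -/

/-- The relations of `𝔮₂`, for operators on a vector space. -/
structure QTwoRel {V : Type} [AddCommGroup V] [Module ℂ V] (e E f F h H : Module.End ℂ V) : Prop where
  ef : ∀ v, e (f v) = f (e v) + h v
  Ef : ∀ v, E (f v) = f (E v) + H v
  eF : ∀ v, e (F v) = F (e v) + H v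
  EF : ∀ v, E (F v) = -F (E v) + H (H v)
  hf : ∀ v, h (f v) = f (h v) - (2 : ℂ) • f v
  Hf : ∀ v, H (f v) = f (H v) - (2 : ℂ) • F v
  HF : ∀ v, H (F v) = -F (H v)
  Ff : ∀ v, F (f v) = f (F v)
  FF : ∀ v, F (F v) = 0

lemma pow_succ_apply' {V : Type} [AddCommGroup V] [Module ℂ V] (f : Module.End ℂ V) (m : ℕ) (v : V) :
    f ((f ^ m) v) = (f ^ (m + 1)) v := by
  rw [pow_succ']; rfl

namespace QTwoRel

variable {V : Type} [AddCommGroup V] [Module ℂ V] {e E f F h H : Module.End ℂ V}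
  (R : QTwoRel e E f F h H)
include R

lemma h_pow {κ : ℂ} {v : V} (hv : h v = κ • v) (m : ℕ) :
    h ((f ^ m) v) = (κ - 2 * m) • (f ^ m) v := by
  induction m with
  | zero => simp [hv]
  | succ m ih =>
    rw [← pow_succ_apply', R.hf, ih, map_smul]
    push_cast
    module

lemma e_pow {κ : ℂ} {v : V} (hv : h v = κ • v) (he : e v = 0) (m : ℕ) :
    e ((f ^ (m + 1)) v) = ((m + 1) * (κ - m)) • (f ^ m) v := by
  induction m with
  | zero => rw [← pow_succ_apply', R.ef]; simp [he, hv]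
  | succ m ih =>
    rw [← pow_succ_apply', R.ef, ih, h_pow R hv, map_smul, pow_succ_apply']
    push_cast
    module

lemma F_pow (m : ℕ) (v : V) : F ((f ^ m) v) = (f ^ m) (F v) := by
  induction m with
  | zero => rfl
  | succ m ih => rw [← pow_succ_apply', R.Ff, ih, pow_succ_apply']

lemma H_pow (m : ℕ) (v : V) :
    H ((f ^ (m + 1)) v) = (f ^ (m + 1)) (H v) - (2 * (m + 1 : ℂ)) • (f ^ m) (F v) := by
  induction m with
  | zero => rw [← pow_succ_apply', R.Hf]; simp
  | succ m ih =>
    rw [← pow_succ_apply', R.Hf, ih, map_sub, map_smul, pow_succ_apply', pow_succ_apply', F_pow R]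
    push_cast
    module

lemma E_pow {v : V} (hE : E v = 0) (m : ℕ) : E ((f ^ (m + 2)) v) =
    (m + 2 : ℂ) • (f ^ (m + 1)) (H v) - ((m + 1) * (m + 2) : ℂ) • (f ^ m) (F v) := by
  induction m with
  | zero =>
    rw [← pow_succ_apply', R.Ef, zero_add, H_pow R 0, ← pow_succ_apply', R.Ef]
    simp only [pow_zero, Module.End.one_apply, hE, map_zero, zero_add, pow_one, Nat.cast_zero]
    module
  | succ m ih =>
    rw [← pow_succ_apply', R.Ef, ih, map_sub, map_smul, map_smul, pow_succ_apply', pow_succ_apply', H_pow R (m + 1)]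
    push_cast
    module

lemma HH_pow (m : ℕ) (v : V) : H (H ((f ^ m) v)) = (f ^ m) (H (H v)) := by
  induction m with
  | zero => rfl
  | succ m ih =>
    rw [← pow_succ_apply', R.Hf, map_sub, map_smul, R.Hf, R.HF, ih, pow_succ_apply']
    module

/-- The singular vector that belongs to the reflection of a dominant integral weight. -/
lemma reflection {m : ℕ} {v : V} (hv : h v = (m + 1 : ℂ) • v) (hHv : h (H v) = (m + 1 : ℂ) • H v)
    (he : e v = 0) (hE : E v = 0) (heH : e (H v) = 0) (hEH : E (H v) = 0) :
    e (F ((f ^ m) v) + (f ^ (m + 1)) ((-1 / (m + 1) : ℂ) • H v)) = 0 ∧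
      E (F ((f ^ m) v) + (f ^ (m + 1)) ((-1 / (m + 1) : ℂ) • H v)) = 0 := by
  -- For the weight `m + 1`, `e` maps `F f^m v` to `f^m H v`, because the two terms with `F v`
  -- cancel, and it maps `f^(m+1) H v` to `m + 1` times the same vector; hence the coefficient `-1 /
  -- (m + 1)`.
  have hm : ((m : ℂ) + 1) ≠ 0 := Nat.cast_add_one_ne_zero m
  cases m with
  | zero =>
    rw [Nat.cast_zero, zero_add, one_smul] at hHv
    rw [Nat.cast_zero, zero_add, pow_zero, zero_add, pow_one, Module.End.one_apply, map_add, map_add,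
      R.eF, R.EF, map_smul, map_smul, map_smul, R.ef, R.Ef, he, hE, heH, hEH, map_zero, map_zero, hHv]
    constructor <;> module
  | succ p =>
    have h5 : E ((f ^ (p + 1)) v) = (p + 1 : ℂ) • (f ^ p) (H v) - ((p * (p + 1) : ℂ)) • (f ^ (p - 1)) (F v) := by
      cases p with
      | zero => rw [← pow_succ_apply', R.Ef]; simp [hE]
      | succ p =>
        rw [E_pow R hE p]
        push_cast
        module
    push_cast at hm hv hHv ⊢
    constructor
    · rw [map_add, R.eF, map_smul, map_smul, e_pow R hv he p, e_pow R hHv heH (p + 1), map_smul,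
        F_pow R, H_pow R]
      push_cast
      match_scalars <;> field_simp <;> ring
    · rw [map_add, R.EF, map_smul, map_smul, h5, HH_pow R, E_pow R hEH p, map_sub, map_smul,
        map_smul, F_pow R, F_pow R, R.FF, map_zero]
      match_scalars <;> field_simp <;> ring

end QTwoRel

/-- The operators of a simple root satisfy the relations of `𝔮₂`. -/
lemma qTwoRel (M : SuperRep (Q n)) {a b : Fin n} (hab : a ≠ b) :
    QTwoRel (M.ρ (eQ a b)) (M.ρ (oQ a b)) (M.ρ (eQ b a)) (M.ρ (oQ b a))
      (M.ρ (eQ a a - eQ b b)) (M.ρ (oQ a a - oQ b b)) := by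
  have hba := hab.symm
  have ee := fun (i j k l : Fin n) v => ρ_br_apply M (par_eQ i j) (par_eQ k l) v
  have eo := fun (i j k l : Fin n) v => ρ_br_apply M (par_eQ i j) (par_oQ k l) v
  have oe := fun (i j k l : Fin n) v => ρ_br_apply M (par_oQ i j) (par_eQ k l) v
  have oo := fun (i j k l : Fin n) v => ρ_br_apply M (par_oQ i j) (par_oQ k l) v
  simp only [mul_zero, zero_mul, mul_one, pow_zero, pow_one, one_smul, neg_smul, sub_neg_eq_add,
    br_eQ_eQ, br_eQ_oQ, br_oQ_eQ, br_oQ_oQ, map_sub, map_add, LinearMap.sub_apply,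
    LinearMap.add_apply] at ee eo oe oo
  constructor
  · intro v
    have := ee a b b a v
    simp only [if_true] at this
    rw [map_sub, LinearMap.sub_apply, this]; abel
  · intro v
    have := oe a b b a v
    simp only [if_true] at this
    rw [map_sub, LinearMap.sub_apply, this]; abel
  · intro v
    have := eo a b b a v
    simp only [if_true] at this
    rw [map_sub, LinearMap.sub_apply, this]; abel
  · intro v
    have h1 := oo a b b a v
    have h2 := oo a a a a v
    have h3 := oo b b b b v
    have h4 := oo a a b b v
    simp only [if_true, hab, hba, if_false, map_zero, LinearMap.zero_apply, add_zero] at h1 h2 h3 h4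
    simp only [map_sub, LinearMap.sub_apply]
    have h2' : M.ρ (oQ a a) (M.ρ (oQ a a) v) = M.ρ (eQ a a) v := by
      have : (2 : ℂ) • M.ρ (oQ a a) (M.ρ (oQ a a) v) = (2 : ℂ) • M.ρ (eQ a a) v := by
        rw [two_smul, two_smul]; exact h2.symm
      exact smul_right_injective _ (two_ne_zero) this
    have h3' : M.ρ (oQ b b) (M.ρ (oQ b b) v) = M.ρ (eQ b b) v := by
      have : (2 : ℂ) • M.ρ (oQ b b) (M.ρ (oQ b b) v) = (2 : ℂ) • M.ρ (eQ b b) v := by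
        rw [two_smul, two_smul]; exact h3.symm
      exact smul_right_injective _ (two_ne_zero) this
    have h4' := eq_neg_of_add_eq_zero_left h4.symm
    rw [h2', h3', h4', eq_neg_add_iff_add_eq, add_comm, ← h1]
    abel
  · intro v
    have h1 := ee a a b a v
    have h2 := ee b b b a v
    simp only [if_true, hab, hba, if_false, map_zero, LinearMap.zero_apply, sub_zero, zero_sub] at h1 h2
    simp only [map_sub, LinearMap.sub_apply]
    have h1' := sub_eq_iff_eq_add.1 h1.symm
    have h2' := sub_eq_iff_eq_add.1 h2.symm
    rw [h1', h2']; module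
  · intro v
    have h1 := oe a a b a v
    have h2 := oe b b b a v
    simp only [if_true, hab, hba, if_false, map_zero, LinearMap.zero_apply, sub_zero, zero_sub] at h1 h2
    simp only [map_sub, LinearMap.sub_apply]
    have h1' := sub_eq_iff_eq_add.1 h1.symm
    have h2' := sub_eq_iff_eq_add.1 h2.symm
    rw [h1', h2']; module
  · intro v
    have h1 := oo a a b a v
    have h2 := oo b b b a v
    simp only [if_true, hab, hba, if_false, map_zero, LinearMap.zero_apply, add_zero, zero_add] at h1 h2
    simp only [map_sub, LinearMap.sub_apply]
    rw [eq_sub_of_add_eq h1.symm, eq_sub_of_add_eq h2.symm]; abel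
  · intro v
    have h1 := oe b a b a v
    simp only [hab, hba, if_false, map_zero, LinearMap.zero_apply, sub_zero] at h1
    exact sub_eq_zero.1 h1.symm
  · intro v
    have h1 := oo b a b a v
    simp only [hab, hba, if_false, map_zero, LinearMap.zero_apply, add_zero] at h1
    rw [← two_smul ℂ] at h1
    exact (smul_eq_zero.1 h1.symm).resolve_left two_ne_zero

/-! ### Reduction to a simple root -/

section Singular

variable {a b : Fin n}

/-- The upper triangular matrices with vanishing entry at `(a, b)`. -/
def nilrad (a b : Fin n) : Submodule ℂ (Q n) := patternSub n fun i j => j ≤ i ∨ (i = a ∧ j = b)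

/-- As `a` and `b` are adjacent, `nilrad a b` is the nilradical of a minimal parabolic subalgebra,
so the negative root vectors normalize it. Consequently, a vector made from the highest weight space
with these root vectors only has to be tested against the two positive simple root vectors. -/
lemma br_nilrad (hab : (b : ℕ) = a + 1) {x y : Q n} (hx : x ∈ nilrad a b)
    (hy : y ∈ patternSub n fun i j => ¬(i = b ∧ j = a)) : br x y ∈ nilrad a b := by
  refine patternSub_br (r₁ := fun i j => j ≤ i ∨ (i = a ∧ j = b))
    (r₂ := fun i j => ¬(i = b ∧ j = a)) (fun i j k h => ?_) hx hy
  simp only [Fin.le_def, Fin.ext_iff] at *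
  omega

/-- The vectors that are killed by the nilradical are stable under the operators of the simple
negative root. -/
lemma nilrad_stable (hab : (b : ℕ) = a + 1) {M : SuperRep (Q n)} {v : M.carrier}
    (hv : ∀ x ∈ nilrad a b, M.ρ x v = 0) {y : Q n} {t : ℕ} (hyt : par y = (-1 : ℂ) ^ t • y)
    (hy : y ∈ patternSub n fun i j => ¬(i = b ∧ j = a)) : ∀ x ∈ nilrad a b, M.ρ x (M.ρ y v) = 0 := by
  have key : ∀ (s : ℕ) x, par x = (-1 : ℂ) ^ s • x → x ∈ nilrad a b → M.ρ x (M.ρ y v) = 0 := by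
    intro s x hs hx
    have h := ρ_br_apply M hs hyt v
    rw [hv _ (br_nilrad hab hx hy), hv x hx, map_zero, smul_zero, sub_zero] at h
    exact h.symm
  intro x hx
  have h1 : ev x ∈ nilrad a b := Submodule.smul_mem _ _ (add_mem hx (patternSub_par hx))
  have h2 : od x ∈ nilrad a b := Submodule.smul_mem _ _ (sub_mem hx (patternSub_par hx))
  rw [← ev_add_od x, map_add, LinearMap.add_apply, key 0 _ (par_ev x) h1, key 1 _ (par_od x) h2,
    add_zero]

lemma singular_of_nilrad {M : SuperRep (Q n)} {v : M.carrier}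
    (hv : ∀ x ∈ nilrad a b, M.ρ x v = 0) (he : M.ρ (eQ a b) v = 0) (ho : M.ρ (oQ a b) v = 0) :
    ∀ x ∈ upper n, M.ρ x v = 0 := by
  intro x hx
  refine pattern_induction (P := fun x => M.ρ x v = 0) (by simp) ?_ ?_ ?_ ?_ hx
  · intro x y hx hy; rw [map_add, LinearMap.add_apply, hx, hy, add_zero]
  · intro c x hx; rw [map_smul, LinearMap.smul_apply, hx, smul_zero]
  · intro i j hij
    by_cases h : i = a ∧ j = b
    · rw [h.1, h.2, he]
    · exact hv _ (single_mem (not_or.2 ⟨hij, h⟩)).1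
  · intro i j hij
    by_cases h : i = a ∧ j = b
    · rw [h.1, h.2, ho]
    · exact hv _ (single_mem (not_or.2 ⟨hij, h⟩)).2

lemma nilrad_le : nilrad a b ≤ upper n := fun _ hx i j h => hx i j (Or.inl h)

end Singular

end

end Queer

namespace Queer

noncomputable section

open LieSuperalgebra SuperRep TensorProduct

variable {n : ℕ}

/-- The algebra homomorphism to the dual numbers given by the entries at a simple negative root. -/
lemma exists_dualNumber {a b : Fin n} (hab : (b : ℕ) = a + 1) :
    ∃ χ : Env (nMinusBr n) →ₐ[ℂ] DualNumber ℂ, ∀ x : lower n,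
      χ (Env.ι (nMinusBr n) x) = TrivSqZeroExt.inl ((x : Q n).1 b a) + TrivSqZeroExt.inr ((x : Q n).2 b a) := by
  let f : lower n →ₗ[ℂ] DualNumber ℂ :=
    { toFun := fun x => TrivSqZeroExt.inl ((x : Q n).1 b a) + TrivSqZeroExt.inr ((x : Q n).2 b a)
      map_add' := fun x y => by ext <;> simp
      map_smul' := fun c x => by ext <;> simp }
  have hodd : ∀ (i : ℕ) (x : lower n), Odd i → par (x : Q n) = (-1 : ℂ) ^ i • (x : Q n) →
      (x : Q n).1 b a = 0 := by
    intro i x hi hx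
    rw [hi.neg_one_pow] at hx
    have h3 := congrArg (fun z : Q n => z.1 b a) hx
    simp only [par_apply, Prod.smul_fst, Matrix.smul_apply, smul_eq_mul, neg_one_mul] at h3
    exact self_eq_neg.1 h3
  have hf : ∀ (i k : ℕ) (x y : lower n), par (x : Q n) = (-1 : ℂ) ^ i • (x : Q n) →
      par (y : Q n) = (-1 : ℂ) ^ k • (y : Q n) →
      f x * f y = (-1 : ℂ) ^ (i * k) • (f y * f x) + f (lowerBr n x y) := by
    intro i k x y hx hy
    have h0 : br (x : Q n) (y : Q n) ∈ patternSub n fun i j => i = b ∧ j = a :=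
      -- Brackets of strictly lower triangular matrices have no entry next to the diagonal.
      patternSub_br (r₁ := fun i j => i ≤ j) (r₂ := fun i j => i ≤ j) (fun i j k h => by
        simp only [Fin.le_def, Fin.ext_iff] at *; omega) x.2 y.2
    have h1 : f (lowerBr n x y) = 0 := by
      change TrivSqZeroExt.inl ((br (x : Q n) (y : Q n)).1 b a)
        + TrivSqZeroExt.inr ((br (x : Q n) (y : Q n)).2 b a) = (0 : DualNumber ℂ)
      rw [(h0 b a ⟨rfl, rfl⟩).1, (h0 b a ⟨rfl, rfl⟩).2]
      simp
    rw [h1, add_zero]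
    -- The dual numbers are commutative in the ordinary sense. For two odd elements the sign does no
    -- harm, because their images are multiples of `ε` and `ε² = 0`.
    rcases Nat.even_or_odd (i * k) with h | h
    · rw [h.neg_one_pow, one_smul, mul_comm]
    · obtain ⟨hi, hk⟩ := Nat.odd_mul.1 h
      have h2 := hodd i x hi hx
      have h3 := hodd k y hk hy
      change (TrivSqZeroExt.inl ((x : Q n).1 b a) + TrivSqZeroExt.inr ((x : Q n).2 b a)) *
        (TrivSqZeroExt.inl ((y : Q n).1 b a) + TrivSqZeroExt.inr ((y : Q n).2 b a)) = _ •
        ((TrivSqZeroExt.inl ((y : Q n).1 b a) + TrivSqZeroExt.inr ((y : Q n).2 b a)) *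
        (TrivSqZeroExt.inl ((x : Q n).1 b a) + TrivSqZeroExt.inr ((x : Q n).2 b a)))
      rw [h2, h3]
      simp
  exact ⟨Env.lift (nMinusBr n) f fun i k x y hx hy =>
    hf i k x y (congrArg Subtype.val hx) (congrArg Subtype.val hy), fun x => Env.lift_ι _ _ _ _⟩

/-- A functional that detects singular vectors. -/
lemma verma.exists_detect (C : SuperRep (cartan n)) {a b : Fin n} (hab : (b : ℕ) = a + 1) (m : ℕ) :
    ∃ G : (verma C).carrier →ₗ[ℂ] C.carrier, ∀ c d,
      G ((verma C).ρ (oQ b a) (((verma C).ρ (eQ b a) ^ m) (verma.hw C c)) +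
        ((verma C).ρ (eQ b a) ^ (m + 1)) (verma.hw C d)) = c := by
  obtain ⟨χ, hχ⟩ := exists_dualNumber hab
  have hlt : ¬b ≤ a := by rw [Fin.le_def]; omega
  let e : lower n := ⟨eQ b a, (single_mem hlt).1⟩
  let o : lower n := ⟨oQ b a, (single_mem hlt).2⟩
  have he : χ (Env.ι (nMinusBr n) e) = 1 := by
    rw [hχ]; simp [e, eQ]
  have ho : χ (Env.ι (nMinusBr n) o) = TrivSqZeroExt.inr 1 := by
    rw [hχ]; simp [o, oQ]
  have hact : ∀ (x : lower n) (u : Env (nMinusBr n)) (c : C.carrier),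
      (verma C).ρ x.1 (u ⊗ₜ[ℂ] c) = (Env.ι (nMinusBr n) x * u) ⊗ₜ[ℂ] c := by
    intro x u c
    have h1 := LinearMap.congr_fun (Splitting.gact_j (inflate C) x) (u ⊗ₜ[ℂ] c)
    exact h1.trans (Splitting.lact_tmul (inflate C) _ _ _)
  have hpow : ∀ (m : ℕ) (c : C.carrier), ((verma C).ρ (eQ b a) ^ m) (verma.hw C c) =
      (Env.ι (nMinusBr n) e ^ m) ⊗ₜ[ℂ] c := by
    intro m c
    induction m with
    | zero => rw [pow_zero, pow_zero]; rfl
    | succ m ih =>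
      rw [← pow_succ_apply', ih, pow_succ' (Env.ι (nMinusBr n) e)]
      exact hact e _ c
  -- The coefficient of `ε`: the element `F f^m` is mapped to `ε` and `f^(m+1)` to `1`, so only `c`
  -- is left.
  let G : Env (nMinusBr n) ⊗[ℂ] C.carrier →ₗ[ℂ] C.carrier :=
    (TensorProduct.lid ℂ C.carrier).toLinearMap ∘ₗ
      TensorProduct.map (TrivSqZeroExt.sndHom ℂ ℂ ∘ₗ χ.toLinearMap) LinearMap.id
  have hG : ∀ u c, G (u ⊗ₜ c) = (χ u).snd • c := fun u c => by simp [G]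
  refine ⟨G, fun c d => ?_⟩
  rw [hpow, hpow]
  refine (congrArg (fun y => G (y + _)) (hact o _ c)).trans ?_
  refine (map_add G _ _).trans ?_
  rw [hG, hG, map_mul, map_pow, map_pow, he, ho]
  simp

/-! ### Links between weights for a simple root -/

namespace Conn

variable {μ ν : Fin n → ℂ} {a b : Fin n}

lemma hw_ρ_cartan {C : SuperRep (cartan n)} (x : cartan n) (c : C.carrier) :
    (verma C).ρ (x : Q n) (verma.hw C c) = verma.hw C (C.ρ x c) :=
  ((verma.hw_isHom C).2 x c).symm

lemma hw_ρ_e {C : FinRep (cartan n)} (hC : IsSimpleOfWeight μ C) (i j : Fin n) (c : C.rep.carrier) :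
    (verma C.rep).ρ (eQ i i - eQ j j) (verma.hw C.rep c) = (μ i - μ j) • verma.hw C.rep c := by
  rw [← tor_eq_eQ, ← tor_eq_eQ, map_sub, LinearMap.sub_apply, hw_ρ_cartan, hw_ρ_cartan,
    tor_of_wt hC.2, tor_of_wt hC.2, map_smul, map_smul, sub_smul]

lemma hw_ρ_o {C : FinRep (cartan n)} (i j : Fin n) (c : C.rep.carrier) :
    (verma C.rep).ρ (oQ i i - oQ j j) (verma.hw C.rep c) =
      verma.hw C.rep (C.rep.ρ (clf i - clf j) c) := by
  rw [← clf_eq_oQ, ← clf_eq_oQ, ← hw_ρ_cartan]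
  rfl

/-- If `F f^m c + f^(m+1) d` is killed by the positive simple root vectors, then it is singular, and
it is nonzero for `c ≠ 0`. -/
lemma of_rankOne_singular {C : FinRep (cartan n)} (hC : IsSimpleOfWeight μ C) (hab : (b : ℕ) = a + 1) (m : ℕ)
    (c d : C.rep.carrier) (hc : c ≠ 0)
    (he : (verma C.rep).ρ (eQ a b) ((verma C.rep).ρ (oQ b a)
      (((verma C.rep).ρ (eQ b a) ^ m) (verma.hw C.rep c)) +
        ((verma C.rep).ρ (eQ b a) ^ (m + 1)) (verma.hw C.rep d)) = 0)
    (ho : (verma C.rep).ρ (oQ a b) ((verma C.rep).ρ (oQ b a)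
      (((verma C.rep).ρ (eQ b a) ^ m) (verma.hw C.rep c)) +
        ((verma C.rep).ρ (eQ b a) ^ (m + 1)) (verma.hw C.rep d)) = 0) :
    Conn μ (μ + (m + 1) • dwt b a) := by
  set V := verma C.rep with hV
  have hpat := single_mem (r := fun i j => ¬(i = b ∧ j = a)) (i := b) (j := a) (by simp)
  have hnil : ∀ (m : ℕ) (c : C.rep.carrier), ∀ x ∈ nilrad a b,
      V.ρ x ((V.ρ (eQ b a) ^ m) (verma.hw C.rep c)) = 0 := by
    intro m c
    induction m with
    | zero => exact fun x hx => verma.ρ_upper_hw C.rep (nilrad_le hx) c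
    | succ m ih =>
      intro x hx
      rw [← pow_succ_apply']
      exact nilrad_stable hab ih (par_eQ b a) hpat.1 x hx
  have hwt : ∀ (m : ℕ) (c : C.rep.carrier),
      (V.ρ (eQ b a) ^ m) (verma.hw C.rep c) ∈ wtSpace (resCartan V) (μ + m • dwt b a) := by
    intro m c
    induction m with
    | zero => rw [zero_smul, add_zero]; exact verma.hw_mem_wtSpace hC.2 c
    | succ m ih =>
      rw [← pow_succ_apply', succ_nsmul, ← add_assoc]
      exact eQ_mem_wtSpace b a ih
  refine of_singular hC (w := V.ρ (oQ b a) ((V.ρ (eQ b a) ^ m) (verma.hw C.rep c)) +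
        (V.ρ (eQ b a) ^ (m + 1)) (verma.hw C.rep d)) (fun h0 => ?_) ?_ ?_
  · obtain ⟨G, hG⟩ := verma.exists_detect C.rep hab m
    exact hc ((hG c d).symm.trans ((congrArg G h0).trans (map_zero G)))
  · refine add_mem ?_ (hwt (m + 1) d)
    rw [succ_nsmul, ← add_assoc]
    exact oQ_mem_wtSpace b a (hwt m c)
  · refine singular_of_nilrad (a := a) (b := b) (fun x hx => ?_) he ho
    rw [map_add, hnil _ _ x hx, add_zero]
    exact nilrad_stable hab (hnil m c) (par_oQ b a) hpat.2 x hx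

lemma eQ_oQ_hw {C : SuperRep (cartan n)} (hab : (b : ℕ) = a + 1) (c : C.carrier) :
    (verma C).ρ (eQ a b) (verma.hw C c) = 0 ∧ (verma C).ρ (oQ a b) (verma.hw C c) = 0 := by
  have hlt : ¬b ≤ a := by rw [Fin.le_def]; omega
  have h := single_mem (r := fun i j : Fin n => j ≤ i) hlt
  exact ⟨verma.ρ_upper_hw C h.1 c, verma.ρ_upper_hw C h.2 c⟩

/-- Reflection of a weight with positive integral difference. -/
lemma reflection {C : FinRep (cartan n)} (hC : IsSimpleOfWeight μ C) (hab : (b : ℕ) = a + 1) {m : ℕ}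
    (hm : μ a - μ b = m + 1) : Conn μ (μ + (m + 1) • dwt b a) := by
  have hne : a ≠ b := fun h => by rw [h] at hab; omega
  have := hC.1.1
  obtain ⟨c, hc⟩ := exists_ne (0 : C.rep.carrier)
  have hH := hw_ρ_o (C := C) a b c
  have h := (qTwoRel (verma C.rep) hne).reflection (m := m) (v := verma.hw C.rep c)
    (by rw [hw_ρ_e hC, hm]) (by rw [hH, hw_ρ_e hC, hm]) (eQ_oQ_hw hab c).1 (eQ_oQ_hw hab c).2
    (by rw [hH]; exact (eQ_oQ_hw hab _).1) (by rw [hH]; exact (eQ_oQ_hw hab _).2)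
  rw [hH, ← map_smul (verma.hw C.rep)] at h
  exact of_rankOne_singular hC hab m c _ hc h.1 h.2

/-- Subtraction of an atypical root. -/
lemma atypical {C : FinRep (cartan n)} (hC : IsSimpleOfWeight μ C) (hab : (b : ℕ) = a + 1)
    (h0 : μ a + μ b = 0) : Conn μ (μ + dwt b a) := by
  have hne : a ≠ b := fun h => by rw [h] at hab; omega
  have := hC.1.1
  obtain ⟨c, hc⟩ := exists_ne (0 : C.rep.carrier)
  have R := qTwoRel (verma C.rep) hne
  have hH := fun c => hw_ρ_o (C := C) a b c
  -- The square of `clf a - clf b` is the scalar `μ a + μ b`, which vanishes.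
  have hHH : C.rep.ρ (clf a - clf b) (C.rep.ρ (clf a - clf b) c) = 0 := by
    simp only [map_sub, LinearMap.sub_apply, clf_sq_of_wt hC.2]
    rw [clf_anti C.rep hne.symm, eq_neg_of_add_eq_zero_left h0]
    module
  -- The coefficient that makes `e` kill the vector. If `μ a - μ b = 0`, both entries vanish, and
  -- then the odd generators already kill the simple module.
  obtain ⟨r, hr⟩ : ∃ r : ℂ, (μ a - μ b) • (r • C.rep.ρ (clf a - clf b) c)
      + C.rep.ρ (clf a - clf b) c = 0 := by
    by_cases hk : μ a - μ b = 0
    · have ha : μ a = 0 := by linear_combination (1 / 2 : ℂ) * h0 + (1 / 2 : ℂ) * hk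
      have hb : μ b = 0 := by linear_combination (1 / 2 : ℂ) * h0 - (1 / 2 : ℂ) * hk
      refine ⟨0, ?_⟩
      simp [clf_eq_zero hC.2 hC.1 ha, clf_eq_zero hC.2 hC.1 hb]
    · refine ⟨-(μ a - μ b)⁻¹, ?_⟩
      rw [smul_smul, mul_neg, mul_inv_cancel₀ hk]
      module
  have h := of_rankOne_singular hC hab 0 c (r • C.rep.ρ (clf a - clf b) c) hc
  simp only [zero_add, one_smul, pow_one, pow_zero, Module.End.one_apply] at h
  apply h
  · rw [map_add, R.eF, R.ef, (eQ_oQ_hw hab _).1, (eQ_oQ_hw hab _).1, map_zero, map_zero, hH,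
      hw_ρ_e hC, ← map_smul (verma.hw C.rep), zero_add, zero_add, ← map_add, add_comm, hr, map_zero]
  · rw [map_add, R.EF, R.Ef, (eQ_oQ_hw hab _).2, (eQ_oQ_hw hab _).2, map_zero, map_zero, hH, hH, hH,
      hHH, map_smul (C.rep.ρ _), hHH]
    simp

end Conn

end

end Queer

namespace Queer

noncomputable section

open LieSuperalgebra SuperRep TensorProduct

variable {n : ℕ}

/-! ### Weights connected with zero -/

/-- Integral weights. -/
def IsIntegral (μ : Fin n → ℂ) : Prop := ∀ i, ∃ z : ℤ, μ i = z

lemma IsIntegral.add {μ ν : Fin n → ℂ} (hμ : IsIntegral μ) (hν : IsIntegral ν) :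
    IsIntegral (μ + ν) := fun i => by
  obtain ⟨x, hx⟩ := hμ i
  obtain ⟨y, hy⟩ := hν i
  exact ⟨x + y, by rw [Pi.add_apply, hx, hy]; push_cast; rfl⟩

lemma isIntegral_dwt (i j : Fin n) : IsIntegral (dwt i j) := fun t => by
  refine ⟨(if t = i then 1 else 0) - (if t = j then 1 else 0), ?_⟩
  rw [dwt, Pi.sub_apply, Pi.single_apply, Pi.single_apply]
  push_cast
  rfl

lemma IsIntegral.nsmul {μ : Fin n → ℂ} (hμ : IsIntegral μ) (k : ℕ) : IsIntegral (k • μ) := fun i => by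
  obtain ⟨x, hx⟩ := hμ i
  exact ⟨k * x, by rw [Pi.smul_apply, hx, nsmul_eq_mul]; push_cast; rfl⟩

lemma dwt_comp (σ : Equiv.Perm (Fin n)) (i j : Fin n) : dwt (σ i) (σ j) ∘ σ = dwt i j := by
  ext t
  simp [dwt, Pi.single_apply, σ.injective.eq_iff]

namespace Conn

variable (hex : ∀ μ : Fin n → ℂ, ∃ C : FinRep (cartan n), IsSimpleOfWeight μ C)
include hex

/-- If the difference of the two entries is positive, the reflection subtracts exactly this
difference times the simple root, which exchanges the entries. If it is negative, the argument is
applied to the exchanged weight. -/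
lemma swap {μ : Fin n → ℂ} (hμ : IsIntegral μ) {a b : Fin n} (hab : (b : ℕ) = a + 1) :
    Conn μ (μ ∘ Equiv.swap a b) := by
  have hne : a ≠ b := fun h => by rw [h] at hab; omega
  have key : ∀ (μ : Fin n → ℂ) (m : ℕ), μ a - μ b = m + 1 → Conn μ (μ ∘ Equiv.swap a b) := by
    intro μ m hm
    obtain ⟨C, hC⟩ := hex μ
    have h := reflection hC hab hm
    have e : μ + (m + 1) • dwt b a = μ ∘ Equiv.swap a b := by
      ext t
      rw [Pi.add_apply, Pi.smul_apply, Function.comp_apply, dwt, Pi.sub_apply, Pi.single_apply,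
        Pi.single_apply, nsmul_eq_mul]
      push_cast
      rw [← hm]
      by_cases h1 : t = a
      · rw [h1, Equiv.swap_apply_left]; simp [hne]
      · by_cases h2 : t = b
        · rw [h2, Equiv.swap_apply_right]; simp [hne.symm]
        · rw [Equiv.swap_apply_of_ne_of_ne h1 h2]; simp [h1, h2]
    rwa [e] at h
  obtain ⟨x, hx⟩ := hμ a
  obtain ⟨y, hy⟩ := hμ b
  rcases lt_trichotomy x y with h | h | h
  · obtain ⟨m, hm⟩ := Int.eq_ofNat_of_zero_le (sub_nonneg.2 (Int.add_one_le_of_lt h))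
    have h1 := key (μ ∘ Equiv.swap a b) m (by
      rw [Function.comp_apply, Function.comp_apply, Equiv.swap_apply_left, Equiv.swap_apply_right, hx,
        hy, ← Int.cast_natCast, ← hm]
      push_cast
      ring)
    have e : (μ ∘ Equiv.swap a b) ∘ Equiv.swap a b = μ := by ext t; simp
    rw [e] at h1
    exact h1.symm
  · have e : μ ∘ Equiv.swap a b = μ := by
      ext t
      by_cases h1 : t = a
      · rw [h1, Function.comp_apply, Equiv.swap_apply_left, hx, hy, h]
      · by_cases h2 : t = b
        · rw [h2, Function.comp_apply, Equiv.swap_apply_right, hx, hy, h]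
        · rw [Function.comp_apply, Equiv.swap_apply_of_ne_of_ne h1 h2]
    rw [e]
    obtain ⟨C, hC⟩ := hex μ
    exact refl hC
  · obtain ⟨m, hm⟩ := Int.eq_ofNat_of_zero_le (sub_nonneg.2 (Int.add_one_le_of_lt h))
    refine key μ m ?_
    rw [hx, hy, ← Int.cast_natCast, ← hm]
    push_cast
    ring

/-- Integral weights are connected with their permutations. -/
lemma perm {μ : Fin n → ℂ} (hμ : IsIntegral μ) (σ : Equiv.Perm (Fin n)) : Conn μ (μ ∘ σ) := by
  cases n with
  | zero =>
    obtain ⟨C, hC⟩ := hex μ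
    have e : μ ∘ σ = μ := Subsingleton.elim _ _
    rw [e]; exact refl hC
  | succ n =>
    have hσ : σ ∈ Submonoid.closure (Set.range fun i : Fin n => Equiv.swap i.castSucc i.succ) := by
      rw [Equiv.Perm.mclosure_swap_castSucc_succ]; trivial
    induction hσ using Submonoid.closure_induction generalizing μ with
    | mem σ hσ =>
      obtain ⟨i, rfl⟩ := hσ
      exact swap hex hμ (by simp)
    | one =>
      obtain ⟨C, hC⟩ := hex μ
      exact refl hC
    | mul σ τ _ _ h h' => exact (h hμ).trans (h' (μ := μ ∘ σ) fun i => hμ (σ i))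

/-- Integral weights are connected with their shifts by atypical roots. -/
lemma add_dwt {μ : Fin n → ℂ} (hμ : IsIntegral μ) {i j : Fin n} (hij : i ≠ j) (h0 : μ i + μ j = 0) :
    Conn μ (μ + dwt j i) := by
  have hn : 2 ≤ n := by
    have := Fin.val_ne_of_ne hij
    have := i.2
    have := j.2
    omega
  -- A permutation moves `i` and `j` to the first two positions, where the root is simple; the shift
  -- is made there and the permutation undone.
  let a : Fin n := ⟨0, by omega⟩
  let b : Fin n := ⟨1, by omega⟩
  have hab : a ≠ b := by simp [a, b]
  let x := Equiv.swap a i j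
  have hx : a ≠ x := fun h => hij (by
    have := congrArg (Equiv.swap a i) h
    simpa [x] using this)
  let σ : Equiv.Perm (Fin n) := Equiv.swap a i * Equiv.swap b x
  have hσa : σ a = i := by
    rw [Equiv.Perm.mul_apply, Equiv.swap_apply_of_ne_of_ne hab hx, Equiv.swap_apply_left]
  have hσb : σ b = j := by
    rw [Equiv.Perm.mul_apply, Equiv.swap_apply_left]
    simp [x]
  obtain ⟨C, hC⟩ := hex (μ ∘ σ)
  have h1 := atypical hC (a := a) (b := b) rfl (by
    rw [Function.comp_apply, Function.comp_apply, hσa, hσb, h0])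
  have e : μ ∘ σ + dwt b a = (μ + dwt j i) ∘ σ := by
    rw [← dwt_comp σ b a, hσa, hσb]; rfl
  rw [e] at h1
  exact ((perm hex hμ σ).trans h1).trans (perm hex (hμ.add (isIntegral_dwt j i)) σ).symm

/-- The entries at `i` and `j` are `k` and `-k`, with sum zero at every stage, so the root can be
subtracted one copy at a time. -/
lemma nsmul_dwt {ξ : Fin n → ℂ} (hξ : IsIntegral ξ) {i j : Fin n} (hij : i ≠ j) (hi : ξ i = 0)
    (hj : ξ j = 0) (k : ℕ) : Conn (k • dwt i j + ξ) ξ := by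
  induction k with
  | zero =>
    obtain ⟨C, hC⟩ := hex ξ
    rw [zero_smul, zero_add]
    exact refl hC
  | succ k ih =>
    have h := add_dwt hex (((isIntegral_dwt i j).nsmul (k + 1)).add hξ) hij (by
      rw [Pi.add_apply, Pi.add_apply, hi, hj, Pi.smul_apply, Pi.smul_apply, add_zero, add_zero,
        ← smul_add]
      simp [dwt, hij, hij.symm])
    have e : (k + 1) • dwt i j + ξ + dwt j i = k • dwt i j + ξ := by
      have e1 : dwt j i = -dwt i j := (neg_sub _ _).symm
      rw [e1, succ_nsmul]
      abel
    rw [e] at h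
    exact h.trans ih

/-- A weight with a matching is connected with zero. -/
lemma of_isMatching {ν : Fin n → ℂ} {k : Root n → ℕ} (h : IsMatching ν k) : Conn ν 0 := by
  -- The edges are removed one by one. The remaining ones vanish at the ends of the removed edge,
  -- because the edges of a matching are disjoint.
  have key : ∀ S : Finset (Root n), (∀ α ∈ S, k α ≠ 0) →
      IsIntegral (∑ α ∈ S, k α • α.wt) ∧ Conn (∑ α ∈ S, k α • α.wt) 0 := by
    classical
    intro S
    induction S using Finset.induction_on with
    | empty =>
      intro _
      obtain ⟨C, hC⟩ := hex 0
      exact ⟨fun i => ⟨0, by simp⟩, by simpa using refl hC⟩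
    | insert α S hα ih =>
      intro hS
      have h1 := ih fun β hβ => hS β (Finset.mem_insert_of_mem hβ)
      have h2 : k α ≠ 0 := hS α (Finset.mem_insert_self _ _)
      have h3 : ∀ v, v = α.j ∨ v = α.i → (∑ β ∈ S, k β • β.wt) v = 0 := by
        intro v hv
        rw [Finset.sum_apply]
        refine Finset.sum_eq_zero fun β hβ => ?_
        have h4 : ∀ h : v = β.j ∨ v = β.i, False := fun h5 =>
          hα (h.eq_of_vertex h2 (hS β (Finset.mem_insert_of_mem hβ)) hv h5 ▸ hβ)
        rw [Pi.smul_apply, Root.wt_of_ne (fun e => h4 (.inr e)) (fun e => h4 (.inl e)), smul_zero]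
      rw [Finset.sum_insert hα]
      exact ⟨((isIntegral_dwt α.i α.j).nsmul (k α)).add h1.1,
        (nsmul_dwt hex h1.1 α.ne (h3 _ (.inr rfl)) (h3 _ (.inl rfl)) (k α)).trans h1.2⟩
  have h5 := (key (edges k) fun α hα => mem_edges.1 hα).2
  have h6 : ∑ α ∈ edges k, k α • α.wt = ν := by
    rw [← h.mem.2, edges, Finset.sum_filter]
    refine Finset.sum_congr rfl fun α _ => ?_
    split_ifs with hα
    · rfl
    · rw [not_not.1 hα, zero_smul]
  rwa [h6] at h5

end Conn

/-! ### The trivial module and its parity shift -/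

section Parity

/-- The indecomposable extension of the trivial module by its parity shift. -/
def oddExt (n : ℕ) : SuperRep (Q n) where
  carrier := ℂ × ℂ
  δ := LinearMap.prodMap LinearMap.id (-LinearMap.id)
  δ_δ v := by ext <;> simp
  ρ :=
    { toFun := fun x => x.2.trace • (LinearMap.inr ℂ ℂ ℂ ∘ₗ LinearMap.fst ℂ ℂ ℂ)
      map_add' := fun x y => by rw [Prod.snd_add, Matrix.trace_add, add_smul]
      map_smul' := fun c x => by rw [Prod.smul_snd, Matrix.trace_smul, smul_assoc]; rfl }
  δ_ρ x v := by ext <;> simp [par_apply, Matrix.trace_neg]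
  ρ_br i j x y _ _ := by
    -- The trace of the odd block vanishes on brackets, and the operator it multiplies has square
    -- zero; so both sides of the relation are zero.
    have h : (br x y).2.trace = 0 := by
      rw [br_apply]
      simp only [Matrix.trace_add, Matrix.trace_sub]
      rw [Matrix.trace_mul_comm x.1 y.2, Matrix.trace_mul_comm x.2 y.1]
      ring
    have h0 : (LinearMap.inr ℂ ℂ ℂ ∘ₗ LinearMap.fst ℂ ℂ ℂ) ∘ₗ (LinearMap.inr ℂ ℂ ℂ ∘ₗ LinearMap.fst ℂ ℂ ℂ) = 0 := by
      ext <;> simp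
    simp only [LinearMap.coe_mk, AddHom.coe_mk, h, zero_smul, smul_mul_smul_comm,
      Module.End.mul_eq_comp, h0, smul_zero, sub_zero]

lemma oddExt_ρ (x : Q n) (v : ℂ × ℂ) :
    (oddExt n).ρ x v = ((0, x.2.trace * v.1) : ℂ × ℂ) := by
  change x.2.trace • ((0 : ℂ), v.1) = _
  simp

lemma oddExt_inCatO : InCatO (oddExt n) := by
  classical
  refine ⟨?_, ?_, fun v => ⟨⊤, trivial, inferInstanceAs (Module.Finite ℂ (⊤ : Submodule ℂ (ℂ × ℂ))),
    fun _ _ _ _ => trivial⟩⟩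
  · refine ⟨({((1 : ℂ), (0 : ℂ)), ((0 : ℂ), (1 : ℂ))} : Finset (ℂ × ℂ)), fun N _ hS => ?_⟩
    have h1 : ((1 : ℂ), (0 : ℂ)) ∈ N := hS _ (Finset.mem_insert_self (α := ℂ × ℂ) _ _)
    have h2 : ((0 : ℂ), (1 : ℂ)) ∈ N :=
      hS _ (Finset.mem_insert_of_mem (α := ℂ × ℂ) (Finset.mem_singleton_self _))
    refine (Submodule.eq_top_iff').2 fun v => ?_
    have h3 := add_mem (N.smul_mem v.1 h1) (N.smul_mem v.2 h2)
    have e : v.1 • ((1 : ℂ), (0 : ℂ)) + v.2 • ((0 : ℂ), (1 : ℂ)) = v := by ext <;> simp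
    exact e ▸ h3
  · refine top_le_iff.1 fun v _ => (le_iSup (wtSpace (resCartan (oddExt n))) 0) ?_
    refine (mem_wtSpace (M := resCartan (oddExt n))).2 fun i => ?_
    have h : (oddExt n).ρ (tor i : Q n) v = 0 := by
      refine (oddExt_ρ _ _).trans ?_
      have : (tor i : Q n).2.trace = 0 := Matrix.trace_zero _ _
      rw [this, zero_mul]
      rfl
    exact h.trans (zero_smul ℂ v).symm

/-- A submodule that contains a vector with nonzero first coordinate is everything, because an odd
matrix unit on the diagonal moves that coordinate into the second one; such a matrix unit exists
since `n > 0`. So two proper submodules both lie in the second line. -/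
lemma oddExt_isIndecomposable (hn : 0 < n) : (oddExt n).IsIndecomposable := by
  refine ⟨inferInstanceAs (Nontrivial (ℂ × ℂ)), fun N N' hN hN' h => ?_⟩
  have key : ∀ N : Submodule ℂ (oddExt n).carrier, IsSub (oddExt n) N →
      (∀ v : ℂ × ℂ, v ∈ N → v.1 = 0) ∨ N = ⊤ := by
    intro N hN
    by_contra! hc
    obtain ⟨⟨v, hv, hv0⟩, hne⟩ := hc
    apply hne
    have h1 : ((0 : ℂ), v.1) ∈ N := by
      have h2 := hN.2 (oQ ⟨0, hn⟩ ⟨0, hn⟩) v hv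
      rw [oddExt_ρ] at h2
      have h3 : (oQ (⟨0, hn⟩ : Fin n) ⟨0, hn⟩).2.trace = 1 := by simp [oQ]
      rwa [h3, one_mul] at h2
    refine (Submodule.eq_top_iff').2 fun w => ?_
    have h3 := add_mem (N.smul_mem (w.1 / v.1) hv)
      (N.smul_mem ((w.2 - w.1 / v.1 * v.2) / v.1) h1)
    have e : (w.1 / v.1) • v + ((w.2 - w.1 / v.1 * v.2) / v.1) • ((0 : ℂ), v.1) = w := by
      ext
      · simp [hv0]
      · simp [hv0]
    exact e ▸ h3
  rcases key N hN with h1 | h1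
  · rcases key N' hN' with h2 | h2
    · have h3 : ((1 : ℂ), (0 : ℂ)) ∈ N ⊔ N' := h.sup_eq_top ▸ trivial
      have h4 : N ⊔ N' ≤ LinearMap.ker (LinearMap.fst ℂ ℂ ℂ) :=
        sup_le (fun v hv => h1 v hv) fun v hv => h2 v hv
      exact (one_ne_zero (h4 h3 : (1 : ℂ) = 0)).elim
    · left
      have := h.inf_eq_bot
      rwa [h2, inf_top_eq] at this
  · right
    have := h.inf_eq_bot
    rwa [h1, top_inf_eq] at this

lemma triv_isSimple {L : Type} [AddCommGroup L] [Module ℂ L] [LieSuperalgebra L] :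
    (SuperRep.triv L).IsSimple :=
  ⟨inferInstanceAs (Nontrivial ℂ), fun N _ => eq_bot_or_eq_top (α := Ideal ℂ) N⟩

lemma wtSpace_triv : wtSpace (SuperRep.triv (cartan n)) 0 = ⊤ :=
  (Submodule.eq_top_iff').2 fun v => mem_wtSpace.2 fun _ => (zero_smul ℂ v).symm

lemma triv_isSimpleOfWeight : IsSimpleOfWeight 0 (FinRep.triv (cartan n)) :=
  ⟨triv_isSimple, wtSpace_triv⟩

lemma triv_isSimpleHighestWeight :
    IsSimpleHighestWeight 0 (FinRep.triv (cartan n)) (SuperRep.triv (Q n)) := by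
  refine ⟨triv_isSimple, fun _ _ _ _ => rfl, ?_⟩
  have h : wtSpace (resCartan (SuperRep.triv (Q n))) 0 = ⊤ :=
    (Submodule.eq_top_iff').2 fun v =>
      (mem_wtSpace (M := resCartan (SuperRep.triv (Q n)))).2 fun _ => (zero_smul ℂ v).symm
  refine ⟨(wtSpace (resCartan (SuperRep.triv (Q n))) 0).subtype, ⟨fun _ => rfl, fun _ _ => rfl⟩,
    Submodule.subtype_injective _, fun v => ⟨⟨v, h ▸ trivial⟩, rfl⟩⟩

lemma linked_triv_shift (hn : 0 < n) : Linked (SuperRep.triv (Q n)) (SuperRep.triv (Q n)).shift := by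
  refine ⟨triv_isSimple, isSimple_shift triv_isSimple, oddExt n, oddExt_inCatO,
    oddExt_isIndecomposable hn, ?_, ?_⟩
  · refine ⟨⊤, isSub_top _, LinearMap.fst ℂ ℂ ℂ ∘ₗ Submodule.subtype ⊤, ⟨fun _ => rfl, fun x v => ?_⟩,
      fun c => ⟨⟨(c, 0), trivial⟩, rfl⟩⟩
    exact congrArg Prod.fst (oddExt_ρ x v.1)
  · have hs : ∀ v ∈ LinearMap.ker (LinearMap.fst ℂ ℂ ℂ), ∀ x, (oddExt n).ρ x v = ((0, 0) : ℂ × ℂ) := by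
      intro v hv x
      have h0 : v.1 = 0 := hv
      rw [oddExt_ρ, h0, mul_zero]
    refine ⟨LinearMap.ker (LinearMap.fst ℂ ℂ ℂ), ⟨fun v hv => hv, fun x v hv => ?_⟩,
      LinearMap.snd ℂ ℂ ℂ ∘ₗ Submodule.subtype _, ⟨fun v => rfl, fun x v => ?_⟩,
      fun c => ⟨⟨(0, c), rfl⟩, rfl⟩⟩
    · exact congrArg Prod.fst (hs v hv x)
    · exact congrArg Prod.snd (hs v.1 v.2 x)

/-- For nonzero weights a parity mismatch is repaired by shifting a whole chain of links. At the end
of the chain, in weight zero, the shifted and the unshifted module have to be joined themselves,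
through the trivial module and its shift. -/
lemma sameBlock_shift (hn : 0 < n) {D : FinRep (cartan n)} (hD : IsSimpleOfWeight 0 D)
    {X : SuperRep (Q n)} (hX : IsSimpleHighestWeight 0 D X) : SameBlock X X.shift := by
  have ht := triv_isSimpleOfWeight (n := n)
  have ht' := triv_isSimpleHighestWeight (n := n)
  have key : ∀ X : SuperRep (Q n), IsSimpleHighestWeight 0 (FinRep.triv (cartan n)) X →
      SameBlock X X.shift := by
    intro X hX
    have h1 := linked_of_isSimpleHighestWeight ht hX ht'
    exact (Relation.EqvGen.rel _ _ h1).trans _ _ _ ((Relation.EqvGen.rel _ _ (linked_triv_shift hn)).trans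
      _ _ _ (Relation.EqvGen.rel _ _ h1.shift).symm)
  rcases simple_unique hD.2 ht.2 hD.1 ht.1 with e | e
  · exact key X (hX.of_iso e)
  · have h1 : IsSimpleHighestWeight 0 (FinRep.triv (cartan n)) X.shift :=
      hX.shift.of_iso ((Iso.shift e).trans (shift_shift_iso _))
    have h2 := linked_of_isSimpleHighestWeight ht.shift (h1.shift) ht'.shift
    have h3 := linked_of_isSimpleHighestWeight ht.shift (hX.of_iso e) ht'.shift
    have h4 := linked_of_isSimpleHighestWeight ht h1 ht'
    exact (Relation.EqvGen.rel _ _ h3).trans _ _ _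
      (((Relation.EqvGen.rel _ _ (linked_triv_shift hn)).symm).trans _ _ _
        (Relation.EqvGen.rel _ _ h4).symm)

end Parity

/-- Connection with the weight zero determines the block of a simple module. -/
lemma Conn.blockEquiv {C : (Fin n → ℂ) → FinRep (cartan n)} (hC : ∀ ν, IsSimpleOfWeight ν (C ν))
    {ν : Fin n → ℂ} (h : Conn ν 0) : BlockEquiv C ν 0 := by
  -- For `n = 0` the extension splits, but zero is the only weight, so nothing has to be joined.
  rcases Nat.eq_zero_or_pos n with rfl | hn
  · have e : ν = 0 := Subsingleton.elim _ _
    subst e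
    exact ⟨_, _, verma.simple_isSimpleHighestWeight (hC 0), verma.simple_isSimpleHighestWeight (hC 0),
      .refl _⟩
  · have hν := verma.simple_isSimpleHighestWeight (hC ν)
    obtain ⟨D, X, h1, h2, h3⟩ := h.symm.exists_right (hC ν) hν
    rcases simple_unique h1.2 (hC 0).2 h1.1 (hC 0).1 with e | e
    · exact ⟨_, X, hν, h2.of_iso e, h3.symm⟩
    · exact ⟨_, X.shift, hν, h2.shift.of_iso ((Iso.shift e).trans (shift_shift_iso _)),
        h3.symm.trans _ _ _ (sameBlock_shift hn h1 h2)⟩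

end

end Queer

open Queer
theorem mainTheorem10 (n : ℕ) (C : (Fin n → ℂ) → FinRep (cartan n))
    (hC : ∀ ν, IsSimpleOfWeight ν (C ν)) :
    InCatM (UnMinus n) ∧
    ∃ m : (Fin n → ℂ) → ℤ,
      (∀ ν, m ν = 0 ∨ m ν = 1 ∨ m ν = -1) ∧
      (∀ ν, m ν ≠ 0 → BlockEquiv C ν 0) ∧
      (∀ ν, sch (UnMinus n) ν = m ν • Gr.cls (C ν)) ∧
      ∀ ν, m ν ≠ 0 →
        ∃ D : Finset (ℕ × List (Root n)),
          IsPresentation ν D ∧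
          (∀ D', IsPresentation ν D' → D' = D) ∧
          (∀ b ∈ D, ∀ α ∈ b.2, α.IsNeg) ∧
          m ν • Gr.cls (C ν) =
            ∏ b ∈ D, (b.2.map fun α => Gr.cls (symPow b.1 α.space)).prod := by
  choose m hm hsch hmatch using fun ν => exists_coeff (hC ν)
  refine ⟨inCatM_UnMinus n, m, hm, fun ν hν => ?_, hsch, fun ν hν => ?_⟩
  · obtain ⟨k, hk, _⟩ := hmatch ν hν
    exact (Conn.of_isMatching (fun μ => ⟨C μ, hC μ⟩) hk).blockEquiv hC
  · obtain ⟨k, hk, hb, hterm⟩ := hmatch ν hν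
    obtain ⟨D, h1, h2, h3, h4⟩ := exists_presentation hk hb
    exact ⟨D, h1, h2, h3, hterm.trans h4⟩
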